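/- **Setting.** Let $\Gamma$ be a Coxeter graph with Coxeter matrix $M=(m_{s,t})_{s,t\in S}$ ($S$ finite or infinite, $m_{s,t}=\infty$ allowed), let $(W,S)$ be its Coxeter system with length function $\lg$, and let $V=\bigoplus_{s\in S}\mathbb R\alpha_s$. A *symmetry* of $\Gamma$ is a permutation $g$ of $S$ with $m_{g(s),g(t)}=m_{s,t}$ for all $s,t$; let $G$ be a group of symmetries of $\Gamma$. It acts on $W$, and on $V$ by $g(\alpha_s)=\alpha_{g(s)}$. A *root prebasis* $\mathbb B$ of $\Gamma$ is a family of linear reflections $\sigma_s$ ($s\in S$) of $V$ with $\sigma_s(\alpha_s)=-\alpha_s$ such that $\sigma_s\sigma_t$ has order $m_{s,t}$ for all $s,t$. Then $W$ acts on $V$ through $s\mapsto\sigma_s$. Let $\Phi=\{w(\alpha_s)\mid w\in W,\ s\in S\}$, and let $\Phi^+$ (resp. $\Phi^-$) be the set of elements of $\Phi$ all of whose coordinates are $\ge 0$ (resp. $\le 0$). $\mathbb B$ is a *reduced root basis* if $\Phi=\Phi^+\sqcup\Phi^-$ and $\mathbb R\alpha_s\cap\Phi=\{\pm\alpha_s\}$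 for all $s$; it is *symmetric* with respect to $G$ if $\sigma_{g(s)}=g\sigma_sg^{-1}$ for all $g\in G$, $s\in S$. The *canonical root basis* of $\Gamma$ is given by $\sigma_s(x)=x-\langle\alpha_s,x\rangle\alpha_s$, where $\langle\alpha_s,\alpha_t\rangle=-2\cos(\pi/m_{s,t})$, read as $-2$ if $m_{s,t}=\infty$. Let $\mathcal S$ be the set of finite $G$-orbits $X\subset S$ such that $W_X=\langle X\rangle$ is finite. For $X\in\mathcal S$ let $u_X$ be the longest element of $W_X$, $\hat\alpha_X=\sum_{s\in X}\alpha_s$ and $\omega_X=\{\alpha_s\mid s\in X\}$. Let $\hat\Phi^+$ be the set of vectors $w(\hat\alpha_X)$, with $X\in\mathcal S$ and $w\in\langle u_Y\mid Y\in\mathcal S\rangle$, that are linear combinations of the $\hat\alpha_Y$ ($Y\in\mathcal S$) with coefficients $\ge0$. For $\hat\alpha\in\hat\Phi^+$ put $F(\hat\alpha)=w(\omega_X)$, where $X\in\mathcal S$ and $w\in W^G$ are such that $\hat\alpha=w(\hat\alpha_X)$ (for a reduced root basis symmetric with respect to $G$ this does not depend on the choices, and $F(\hat\alpha)$ is a finite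 $G$-orbit in $\Phi^+$). Let $\mathbb K$ be a field, let $E$ be the $\mathbb K$-vector space with basis $\{e_\beta\mid\beta\in\Phi^+\}$, on which $G$ acts by $g(e_\beta)=e_{g(\beta)}$, and let $E^G$ be its subspace of fixed vectors. The pair $(\Gamma,G)$ has the *$\hat\Phi^+$-basis property* if $$\hat{\mathcal B}=\Big\{\sum_{\alpha\in F(\hat\alpha)}e_\alpha\ \Big|\ \hat\alpha\in\hat\Phi^+\Big\}$$ is a basis of $E^G$, where all this is formed with the canonical root basis of $\Gamma$. The same property may be considered for any reduced root basis of $\Gamma$ that is symmetric with respect to $G$. **Theorem 2.12.** Suppose that $\Gamma$ is connected, $G$ is non-trivial and all the orbits of $G$ on $S$ are finite. Let $\mathbb K$ be any field. Then $(\Gamma,G)$ has the $\hat\Phi^+$-basis property if and only if it is, up to isomorphism, one of the pairs (i)–(x) below; and the same equivalence holds when the property is formed with any reduced root basis of $\Gamma$ that is symmetric with respect to $G$. All graphs below are simply laced (all labels $m_{s,t}$ with $s\ne t$ are $2$ or $3$), with vertices $s_i$; $i-j$ stands for an edge between $s_i$ and $s_j$. Vertices not mentioned in the description of a symmetry are fixed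 by it. * (i) $\Gamma=A_{2m+1}$ ($m\ge1$), the path $1-2-\cdots-(2m+1)$, and $G=\langle g\rangle$, $g(s_i)=s_{2m+2-i}$ for $1\le i\le 2m+1$. * (ii) $\Gamma=D_m$ ($m\ge4$), the path $1-2-\cdots-(m-1)$ with the additional edge $(m-2)-m$, and $G=\langle g\rangle$, where $g$ exchanges $s_{m-1}$ and $s_m$. * (iii) $\Gamma=D_4$ and $\langle g_1\rangle\subseteq G\subseteq\langle g_1,g_2\rangle$, where $g_1(s_1)=s_3$, $g_1(s_3)=s_4$, $g_1(s_4)=s_1$, and $g_2$ exchanges $s_3$ and $s_4$. * (iv) $\Gamma=E_6$, the path $1-3-4-5-6$ with the additional edge $2-4$, and $G=\langle g\rangle$, where $g$ exchanges $s_1,s_6$ and exchanges $s_3,s_5$. * (v) $\Gamma=\tilde A_{2m+1}$ ($m\ge1$), the cycle $0-1-\cdots-(2m+1)-0$, and $G=\langle g\rangle$, $g(s_0)=s_0$, $g(s_i)=s_{2m+2-i}$ for $1\le i\le 2m+1$. * (vi) $\Gamma=\tilde D_m$ ($m\ge4$), obtained from $D_m$ by adding a vertex $0$ and the edge $0-2$,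 and $G=\langle g\rangle$, where $g$ exchanges $s_{m-1}$ and $s_m$. * (vii) $\Gamma=\tilde D_4$ and $\langle g_1\rangle\subseteq G\subseteq\langle g_1,g_2\rangle$, where $g_1,g_2$ act as in (iii) and fix $s_0$. * (viii) $\Gamma=\tilde E_6$, obtained from $E_6$ by adding a vertex $0$ and the edge $0-2$, and $G=\langle g\rangle$, where $g$ exchanges $s_1,s_6$ and exchanges $s_3,s_5$. * (ix) $\Gamma={}_\infty A_\infty$, the two-sided infinite path with vertices $s_i$ ($i\in\mathbb Z$) and edges $i-(i+1)$, and $G=\langle g\rangle$, $g(s_i)=s_{-i}$. * (x) $\Gamma=D_\infty$, the infinite path $2-3-4-\cdots$ with the additional edge $1-3$, and $G=\langle g\rangle$, where $g$ exchanges $s_1$ and $s_2$. Here $(\Gamma,G)$ is isomorphic to $(\Gamma',G')$ if there is a bijection between the vertex sets that carries the Coxeter matrix of $\Gamma$ to that of $\Gamma'$ and, by conjugation, $G$ to $G'$. -/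

import Mathlib

noncomputable section

/-! ### Coxeter graphs and their symmetries

As in Mathlib, the entry `0` of a Coxeter matrix stands for `∞`. -/

namespace CoxeterMatrix

/-- The underlying graph of the Coxeter graph `Γ` of `M`: distinct vertices `s`, `t` are joined
if `m_{s,t} ≥ 3`, that is, if `m_{s,t} ≠ 2` (the value `0` meaning `∞`). -/
def coxeterGraph {S : Type*} (M : CoxeterMatrix S) : SimpleGraph S where
  Adj s t := s ≠ t ∧ M s t ≠ 2
  symm := ⟨fun s t h => ⟨h.1.symm, by rw [M.symmetric]; exact h.2⟩⟩
  loopless := ⟨fun _ h => h.1 rfl⟩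

/-- `Sym(Γ)`: the permutations `g` of `S` with `m_{g(s),g(t)} = m_{s,t}` for all `s, t`. -/
def symmetryGroup {S : Type*} (M : CoxeterMatrix S) : Subgroup (Equiv.Perm S) where
  carrier := {g | ∀ s t, M (g s) (g t) = M s t}
  one_mem' := fun _ _ => rfl
  mul_mem' := fun {g h} hg hh s t => by
    rw [Equiv.Perm.mul_apply, Equiv.Perm.mul_apply, hg, hh]
  inv_mem' := fun {g} hg s t => by
    rw [← hg (g⁻¹ s) (g⁻¹ t)]; simp

/-- The generator `s` of the Coxeter group `W = M.Group`. -/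
abbrev gen {S : Type*} (M : CoxeterMatrix S) (s : S) : M.Group := M.toCoxeterSystem.simple s

/-- The endomorphism of `W` induced by a symmetry `g` of `Γ`: it sends `s` to `g(s)`. -/
def symmHom {S : Type*} (M : CoxeterMatrix S) (g : M.symmetryGroup) : M.Group →* M.Group :=
  M.toCoxeterSystem.lift ⟨fun s => M.gen ((g : Equiv.Perm S) s), fun s t => by
    rw [← g.2 s t]; exact M.toCoxeterSystem.simple_mul_simple_pow _ _⟩

/-- `W^G`: the elements of `W` fixed by the group of symmetries `G`. -/
def fixedSubgroup {S : Type*} (M : CoxeterMatrix S) (G : Subgroup M.symmetryGroup) :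
    Subgroup M.Group where
  carrier := {w | ∀ g ∈ G, M.symmHom g w = w}
  one_mem' := fun _ _ => map_one _
  mul_mem' := fun {v w} hv hw g hg => by rw [map_mul, hv g hg, hw g hg]
  inv_mem' := fun {w} hw g hg => by rw [map_inv, hw g hg]

/-- The standard parabolic subgroup `W_X` generated by `X ⊆ S`. -/
def parabolic {S : Type*} (M : CoxeterMatrix S) (X : Set S) : Subgroup M.Group :=
  Subgroup.closure (M.gen '' X)

/-- `u` is the longest element of `W_X`: `u ∈ W_X` and `lg(su) < lg(u)` for all `s ∈ X`. -/
def IsLongest {S : Type*} (M : CoxeterMatrix S) (X : Set S) (u : M.Group) : Prop :=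
  u ∈ M.parabolic X ∧
    ∀ s ∈ X, M.toCoxeterSystem.length (M.gen s * u) < M.toCoxeterSystem.length u

/-- The set `𝒮` of the finite orbits `X` of `G` on `S` such that `W_X` is finite. -/
def sphericalOrbits {S : Type*} (M : CoxeterMatrix S) (G : Subgroup M.symmetryGroup) :
    Set (Set S) :=
  {X | (∃ s : S, X = MulAction.orbit G s) ∧ X.Finite ∧ (M.parabolic X : Set M.Group).Finite}

/-- The subgroup of `W` generated by the longest elements `u_X` of the `W_X`, `X ∈ 𝒮`
(the Coxeter group of `Γ̂`, realised inside `W`). -/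
def hatGroup {S : Type*} (M : CoxeterMatrix S) (G : Subgroup M.symmetryGroup) :
    Subgroup M.Group :=
  Subgroup.closure {u | ∃ X ∈ M.sphericalOrbits G, M.IsLongest X u}

end CoxeterMatrix

/-! ### Root bases

The space `V = ⊕ ℝ α_s` is `S →₀ ℝ`, with `α_s = Finsupp.single s 1`. -/

/-- The action of a permutation of `S` on `V`, with `g(α_s) = α_{g(s)}`. -/
def permOnV {S : Type*} (g : Equiv.Perm S) : (S →₀ ℝ) ≃ₗ[ℝ] (S →₀ ℝ) :=
  Finsupp.domLCongr g

/-- A root prebasis `(S, V, Π, ℛ)` whose Coxeter group `W(𝔹)` is that of `M`: a family of linear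
reflections `σ_s(x) = x - φ_s(x) α_s` of `V`, with `φ_s(α_s) = 2` (equivalently
`σ_s(α_s) = -α_s`), such that `σ_s σ_t` has order `m_{s,t}` for all `s, t`
(`orderOf` is `0` for elements of infinite order). -/
structure RootPrebasis {S : Type*} (M : CoxeterMatrix S) where
  /-- the linear form `φ_s` of the reflection `σ_s` -/
  form : S → Module.Dual ℝ (S →₀ ℝ)
  form_self : ∀ s, form s (Finsupp.single s 1) = 2
  order_eq : ∀ s t,
    orderOf (Module.reflection (form_self s) * Module.reflection (form_self t)) = M s t

namespace RootPrebasis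

/-- The reflection `σ_s`. -/
def refl {S : Type*} {M : CoxeterMatrix S} (B : RootPrebasis M) (s : S) :
    (S →₀ ℝ) ≃ₗ[ℝ] (S →₀ ℝ) :=
  Module.reflection (B.form_self s)

/-- The linear representation `f : W → GL(V)`, `s ↦ σ_s`. -/
def rep {S : Type*} {M : CoxeterMatrix S} (B : RootPrebasis M) :
    M.Group →* ((S →₀ ℝ) ≃ₗ[ℝ] (S →₀ ℝ)) :=
  M.toCoxeterSystem.lift ⟨B.refl, fun s t => by
    rw [← B.order_eq s t]; exact pow_orderOf_eq_one _⟩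

/-- `Φ = {w(α_s) | w ∈ W, s ∈ S}`. -/
def roots {S : Type*} {M : CoxeterMatrix S} (B : RootPrebasis M) : Set (S →₀ ℝ) :=
  {v | ∃ (w : M.Group) (s : S), v = B.rep w (Finsupp.single s 1)}

/-- `Φ⁺`. -/
def posRoots {S : Type*} {M : CoxeterMatrix S} (B : RootPrebasis M) : Set (S →₀ ℝ) :=
  {v | v ∈ B.roots ∧ ∀ s, 0 ≤ v s}

/-- `Φ⁻`. -/
def negRoots {S : Type*} {M : CoxeterMatrix S} (B : RootPrebasis M) : Set (S →₀ ℝ) :=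
  {v | v ∈ B.roots ∧ ∀ s, v s ≤ 0}

/-- `𝔹` is a reduced root basis: `Φ` is the disjoint union of `Φ⁺` and `Φ⁻`, and
`ℝα_s ∩ Φ = {α_s, -α_s}` for all `s ∈ S`. -/
structure IsReducedRootBasis {S : Type*} {M : CoxeterMatrix S} (B : RootPrebasis M) : Prop where
  union : B.roots = B.posRoots ∪ B.negRoots
  disjoint : Disjoint B.posRoots B.negRoots
  reduced : ∀ s : S, {v | ∃ c : ℝ, v = c • Finsupp.single s 1} ∩ B.roots =
    {Finsupp.single s 1, -Finsupp.single s 1}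

/-- `𝔹` is symmetric with respect to `G`: `σ_{g(s)} = g σ_s g⁻¹`. -/
def IsSymmetric {S : Type*} {M : CoxeterMatrix S} (B : RootPrebasis M)
    (G : Subgroup M.symmetryGroup) : Prop :=
  ∀ g ∈ G, ∀ s : S, B.refl ((g : Equiv.Perm S) s) =
    permOnV (g : Equiv.Perm S) * B.refl s * (permOnV (g : Equiv.Perm S))⁻¹

end RootPrebasis

/-! ### The canonical root basis -/

namespace CoxeterMatrix

/-- The value `⟨α_s, α_t⟩` of the canonical bilinear form. -/
def canonicalEntry {S : Type*} (M : CoxeterMatrix S) (s t : S) : ℝ :=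
  if M s t = 0 then -2 else -2 * Real.cos (Real.pi / M s t)

/-- The linear form `x ↦ ⟨α_s, x⟩` of the canonical bilinear form. -/
def canonicalForm {S : Type*} (M : CoxeterMatrix S) (s : S) : Module.Dual ℝ (S →₀ ℝ) :=
  Finsupp.linearCombination ℝ (M.canonicalEntry s)

theorem canonicalForm_single {S : Type*} (M : CoxeterMatrix S) (s t : S) :
    M.canonicalForm s (Finsupp.single t 1) = M.canonicalEntry s t := by
  simp [canonicalForm]

theorem canonicalForm_self {S : Type*} (M : CoxeterMatrix S) (s : S) :
    M.canonicalForm s (Finsupp.single s 1) = 2 := by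
  rw [canonicalForm_single]; simp [canonicalEntry]

/-- The canonical reflections satisfy: `σ_s σ_t` has order exactly `m_{s,t}`. -/
theorem canonical_order {S : Type*} (M : CoxeterMatrix S) (s t : S) :
    orderOf (Module.reflection (M.canonicalForm_self s) *
      Module.reflection (M.canonicalForm_self t)) = M s t := by
  by_cases hst : s = t
  · subst hst
    rw [M.diagonal, orderOf_eq_one_iff]
    ext1 x
    exact Module.involutive_reflection (M.canonicalForm_self s) x
  have hts : M.canonicalEntry t s = M.canonicalEntry s t := by
    simp only [canonicalEntry, M.symmetric t s]
  have hm1 : M s t ≠ 1 := M.off_diagonal s t hst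
  -- the action of the powers on `α_s`
  have key : ∀ k : ℕ, ((Module.reflection (M.canonicalForm_self s) *
      Module.reflection (M.canonicalForm_self t)) ^ k) (Finsupp.single s 1) =
      ((Polynomial.Chebyshev.S ℝ k).eval (M.canonicalEntry s t ^ 2 - 2) +
        (Polynomial.Chebyshev.S ℝ (k - 1)).eval (M.canonicalEntry s t ^ 2 - 2)) • Finsupp.single s 1 +
      ((Polynomial.Chebyshev.S ℝ (k - 1)).eval (M.canonicalEntry s t ^ 2 - 2) * -M.canonicalEntry s t) •
        Finsupp.single t 1 := by
    intro k
    have := Module.reflection_mul_reflection_pow_apply_self (M.canonicalForm_self s)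
      (M.canonicalForm_self t) k (M.canonicalEntry s t ^ 2 - 2)
      (by rw [canonicalForm_single, canonicalForm_single, hts]; ring)
    rw [this, M.canonicalForm_single t s, hts]
  have coords : ∀ k : ℕ, (Module.reflection (M.canonicalForm_self s) *
      Module.reflection (M.canonicalForm_self t)) ^ k = 1 →
      (Polynomial.Chebyshev.S ℝ k).eval (M.canonicalEntry s t ^ 2 - 2) +
        (Polynomial.Chebyshev.S ℝ (k - 1)).eval (M.canonicalEntry s t ^ 2 - 2) = 1 ∧
      (Polynomial.Chebyshev.S ℝ (k - 1)).eval (M.canonicalEntry s t ^ 2 - 2) * M.canonicalEntry s t = 0 := by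
    intro k hk
    have h := key k
    rw [hk, LinearEquiv.coe_one, id] at h
    have h1 := DFunLike.congr_fun h s
    have h2 := DFunLike.congr_fun h t
    simp [hst, Ne.symm hst] at h1 h2
    exact ⟨h1.symm, mul_eq_zero.mpr h2⟩
  rcases Nat.lt_or_ge (M s t) 3 with hlt | hge
  · have h02 : M s t = 0 ∨ M s t = 2 := by omega
    rcases h02 with h0 | h2
    · rw [h0, orderOf_eq_zero_iff']
      intro k hk h
      have h2 := (coords k h).2
      have ha : M.canonicalEntry s t = -2 := by simp [canonicalEntry, h0]
      rw [ha, show ((-2 : ℝ) ^ 2 - 2) = 2 by norm_num, Polynomial.Chebyshev.S_eval_two] at h2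
      push_cast at h2
      have : (k : ℝ) ≠ 0 := by exact_mod_cast hk.ne'
      apply this; linarith
    · have ha : M.canonicalEntry s t = 0 := by simp [canonicalEntry, h2]
      rw [h2]
      refine orderOf_eq_prime ?_ ?_
      · ext1 x
        have h1 : M.canonicalForm s (Finsupp.single t 1) = 0 := by rw [canonicalForm_single, ha]
        have h2 : M.canonicalForm t (Finsupp.single s 1) = 0 := by
          rw [canonicalForm_single, hts, ha]
        simp only [pow_two, LinearEquiv.mul_apply, Module.reflection_apply, map_sub, map_smul,
          h1, h2, M.canonicalForm_self, LinearEquiv.coe_one, id]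
        module
      · intro h
        have := (coords 1 (by rw [pow_one]; exact h)).1
        rw [ha] at this
        norm_num at this
  · set m := M s t with hm
    have hmpos : (0 : ℝ) < m := by exact_mod_cast (by omega : 0 < m)
    have hm3 : (3 : ℝ) ≤ m := by exact_mod_cast hge
    have hpi := Real.pi_pos
    set φ : ℝ := 2 * (Real.pi / m) with hφ
    have hmφ : m * φ = 2 * Real.pi := by rw [hφ]; field_simp
    have ha : M.canonicalEntry s t = -2 * Real.cos (Real.pi / m) := by
      simp only [canonicalEntry, ← hm]; rw [if_neg (by omega)]
    have hc : 0 < Real.cos (Real.pi / m) := by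
      apply Real.cos_pos_of_mem_Ioo
      constructor
      · have : 0 < Real.pi / m := by positivity
        linarith
      · rw [div_lt_div_iff₀ hmpos (by norm_num)]; nlinarith
    have hφpos : 0 < φ := by positivity
    have hφlt : φ < Real.pi := by
      rw [hφ, ← mul_div_assoc, div_lt_iff₀ hmpos]; nlinarith
    have hs : 0 < Real.sin φ := Real.sin_pos_of_pos_of_lt_pi hφpos hφlt
    have ht : M.canonicalEntry s t ^ 2 - 2 = 2 * Real.cos φ := by
      rw [ha, hφ, Real.cos_two_mul]; ring
    have hS : ∀ n : ℤ, (Polynomial.Chebyshev.S ℝ n).eval (M.canonicalEntry s t ^ 2 - 2) =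
        Real.sin ((n + 1) * φ) / Real.sin φ := by
      intro n
      rw [eq_div_iff hs.ne', ht, Polynomial.Chebyshev.S_two_mul_real_cos]
    rw [orderOf_eq_iff (by omega)]
    constructor
    · ext1 x
      rw [Module.reflection_mul_reflection_pow_apply (M.canonicalForm_self s)
        (M.canonicalForm_self t) m x (M.canonicalEntry s t ^ 2 - 2)
        (by rw [canonicalForm_single, canonicalForm_single, hts]; ring)]
      rcases Nat.even_or_odd' m with ⟨k, hk | hk⟩
      · have e1 : ((m : ℤ) - 2) / 2 = k - 1 := by omega
        have e2 : ((m : ℤ) - 1) / 2 = k - 1 := by omega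
        have z : (Polynomial.Chebyshev.S ℝ ((k : ℤ) - 1)).eval (M.canonicalEntry s t ^ 2 - 2) = 0 := by
          rw [hS]
          have : ((((k : ℤ) - 1 : ℤ) : ℝ) + 1) * φ = Real.pi := by
            have hk' : (m : ℝ) = 2 * k := by exact_mod_cast hk
            rw [hk'] at hmφ
            push_cast; linarith
          rw [this, Real.sin_pi, zero_div]
        rw [e1, e2, z]
        simp
      · have e1 : ((m : ℤ) - 2) / 2 = k - 1 := by omega
        have e2 : ((m : ℤ) - 1) / 2 = k := by omega
        have e3 : ((m : ℤ) - 3) / 2 = k - 1 := by omega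
        have e4 : (m : ℤ) / 2 = k := by omega
        have z : (Polynomial.Chebyshev.S ℝ (k : ℤ)).eval (M.canonicalEntry s t ^ 2 - 2) +
            (Polynomial.Chebyshev.S ℝ ((k : ℤ) - 1)).eval (M.canonicalEntry s t ^ 2 - 2) = 0 := by
          rw [hS, hS]
          have : (((k : ℤ) : ℝ) + 1) * φ = 2 * Real.pi - ((((k : ℤ) - 1 : ℤ) : ℝ) + 1) * φ := by
            have hk' : (m : ℝ) = 2 * k + 1 := by exact_mod_cast hk
            rw [hk'] at hmφ
            push_cast; linarith
          rw [this, Real.sin_two_pi_sub]; ring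
        rw [e1, e2, e3, e4, z]
        simp
    · intro k hkm hk h
      obtain ⟨h1, h2⟩ := coords k h
      have hkS : (Polynomial.Chebyshev.S ℝ ((k : ℤ) - 1)).eval (M.canonicalEntry s t ^ 2 - 2) = 0 := by
        rcases mul_eq_zero.mp h2 with h2 | h2
        · exact h2
        · rw [ha] at h2; nlinarith
      rw [hkS, add_zero, hS] at h1
      rw [hS, div_eq_zero_iff, or_iff_left hs.ne'] at hkS
      have e : ((((k : ℤ) - 1 : ℤ) : ℝ) + 1) * φ = k * φ := by push_cast; ring
      rw [e] at hkS
      have e' : (((k : ℤ) : ℝ) + 1) * φ = k * φ + φ := by push_cast; ring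
      rw [e', Real.sin_add, hkS, zero_mul, zero_add, mul_div_assoc, div_self hs.ne', mul_one]
        at h1
      have hlt : (k : ℝ) * φ < 2 * Real.pi := by
        rw [← hmφ]; exact mul_lt_mul_of_pos_right (by exact_mod_cast hkm) hφpos
      have hpos : 0 < (k : ℝ) * φ := by positivity
      have := (Real.cos_eq_one_iff_of_lt_of_lt (by linarith) hlt).mp h1
      linarith

/-- The canonical root basis of `Γ`, with `σ_s(x) = x - ⟨α_s, x⟩ α_s`. -/
def canonicalRootBasis {S : Type*} (M : CoxeterMatrix S) : RootPrebasis M where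
  form := M.canonicalForm
  form_self := M.canonicalForm_self
  order_eq := M.canonical_order

end CoxeterMatrix

/-! ### The basis property -/

/-- `α̂_X = ∑_{s ∈ X} α_s`. -/
def hatSimple {S : Type*} (X : Set S) : S →₀ ℝ := ∑ᶠ s ∈ X, Finsupp.single s 1

/-- `ω_X = {α_s | s ∈ X}`. -/
def simpleSet {S : Type*} (X : Set S) : Set (S →₀ ℝ) := (fun s => Finsupp.single s 1) '' X

namespace RootPrebasis

/-- `Φ̂`, the root system of the equivariant root basis `𝔹̂ = (𝒮, V̂, Π̂, ℛ̂)`, realised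
in `V̂ ⊆ V`: the vectors `w(α̂_X)`, with `X ∈ 𝒮` and `w` in the group generated by the `u_X`. -/
def hatRoots {S : Type*} {M : CoxeterMatrix S} (B : RootPrebasis M)
    (G : Subgroup M.symmetryGroup) : Set (S →₀ ℝ) :=
  {v | ∃ w ∈ M.hatGroup G, ∃ X ∈ M.sphericalOrbits G, v = B.rep w (hatSimple X)}

/-- `Φ̂⁺`: the elements of `Φ̂` of the form `∑ λ_X α̂_X` with all `λ_X ≥ 0`. -/
def hatPosRoots {S : Type*} {M : CoxeterMatrix S} (B : RootPrebasis M)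
    (G : Subgroup M.symmetryGroup) : Set (S →₀ ℝ) :=
  {v | v ∈ B.hatRoots G ∧ ∃ c : M.sphericalOrbits G →₀ ℝ,
    (∀ X, 0 ≤ c X) ∧ v = c.sum fun X r => r • hatSimple (X : Set S)}

/-- `F(v) = ω`: we have `v = w(α̂_X)` and `ω = w(ω_X)` for some `X ∈ 𝒮` and `w ∈ W^G`.
For reduced symmetric root bases, `ω` is determined by `v`. -/
def IsF {S : Type*} {M : CoxeterMatrix S} (B : RootPrebasis M)
    (G : Subgroup M.symmetryGroup) (v : S →₀ ℝ) (ω : Set (S →₀ ℝ)) : Prop :=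
  ∃ w ∈ M.fixedSubgroup G, ∃ X ∈ M.sphericalOrbits G,
    v = B.rep w (hatSimple X) ∧ ω = B.rep w '' simpleSet X

/-- The `K`-vector space `E` with basis `e_β = Finsupp.single β 1`, `β ∈ Φ⁺`, as a subspace of
the free vector space on `V`. -/
def E {S : Type*} {M : CoxeterMatrix S} (B : RootPrebasis M) (K : Type*) [Field K] :
    Submodule K ((S →₀ ℝ) →₀ K) :=
  Finsupp.supported K K B.posRoots

/-- `E^G`: the elements of `E` fixed by `G`, where `g(e_β) = e_{g(β)}`. -/
def EG {S : Type*} {M : CoxeterMatrix S} (B : RootPrebasis M) (G : Subgroup M.symmetryGroup)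
    (K : Type*) [Field K] : Submodule K ((S →₀ ℝ) →₀ K) where
  carrier := {x | x ∈ B.E K ∧
    ∀ g ∈ G, Finsupp.mapDomain (permOnV (g : Equiv.Perm S)) x = x}
  zero_mem' := ⟨Submodule.zero_mem _, fun _ _ => Finsupp.mapDomain_zero⟩
  add_mem' := fun hx hy => ⟨Submodule.add_mem _ hx.1 hy.1, fun g hg => by
    rw [Finsupp.mapDomain_add, hx.2 g hg, hy.2 g hg]⟩
  smul_mem' := fun c x hx => ⟨Submodule.smul_mem _ c hx.1, fun g hg => by
    rw [Finsupp.mapDomain_smul, hx.2 g hg]⟩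

/-- `ℬ̂ = {ê_{F(v)} | v ∈ Φ̂⁺}`, where `ê_ω = ∑_{α ∈ ω} e_α`. -/
def hatFamily {S : Type*} {M : CoxeterMatrix S} (B : RootPrebasis M)
    (G : Subgroup M.symmetryGroup) (K : Type*) [Field K] : Set ((S →₀ ℝ) →₀ K) :=
  {x | ∃ v ∈ B.hatPosRoots G, ∃ ω, B.IsF G v ω ∧ x = ∑ᶠ α ∈ ω, Finsupp.single α 1}

/-- The set `ℬ̂` formed with the root basis `𝔹` is a basis of `E^G`. -/
def HasBasisProperty {S : Type*} {M : CoxeterMatrix S} (B : RootPrebasis M)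
    (G : Subgroup M.symmetryGroup) (K : Type*) [Field K] : Prop :=
  LinearIndepOn K id (B.hatFamily G K) ∧ Submodule.span K (B.hatFamily G K) = B.EG G K

end RootPrebasis

/-! ### The pairs of the classification

The vertices `s_i` of the graphs are labelled by integers `i`; for spherical and affine types the
numbering is that of Bourbaki, with `0` for the additional vertex of the affine graphs. -/

namespace CoxeterMatrix

open Classical in
/-- The simply laced Coxeter matrix with a given underlying graph. -/
def simplyLaced {I : Type*} (Γ : SimpleGraph I) : CoxeterMatrix I where
  M := Matrix.of fun i j => if i = j then 1 else if Γ.Adj i j then 3 else 2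
  isSymm := by
    ext i j
    simp only [Matrix.transpose_apply, Matrix.of_apply, eq_comm (a := j), Γ.adj_comm j i]
  diagonal := by simp
  off_diagonal i j h := by
    simp only [Matrix.of_apply, if_neg h]
    split_ifs <;> decide

/-- `(Γ, G)` is isomorphic to `(Γ', H)`, where `Γ'` is the simply laced Coxeter graph with
underlying graph `A` and `H` is a group of permutations of its vertices. -/
def IsoPair {S I : Type*} (M : CoxeterMatrix S) (G : Subgroup M.symmetryGroup)
    (A : SimpleGraph I) (H : Subgroup (Equiv.Perm I)) : Prop :=
  ∃ e : S ≃ I, (∀ s t, simplyLaced A (e s) (e t) = M s t) ∧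
    (G.map M.symmetryGroup.subtype).map e.permCongrHom.toMonoidHom = H

end CoxeterMatrix

namespace CoxeterPairs

open Set

/-- The permutation of the vertices labelled `a, …, b` given on labels by `f`, with inverse
`f'`. -/
def labelPerm (a b : ℕ) (f f' : ℕ → ℕ)
    (h : ∀ i, a ≤ i → i ≤ b → (a ≤ f i ∧ f i ≤ b) ∧ f' (f i) = i)
    (h' : ∀ i, a ≤ i → i ≤ b → (a ≤ f' i ∧ f' i ≤ b) ∧ f (f' i) = i) :
    Equiv.Perm (Icc a b) where
  toFun i := ⟨f i, (h i i.2.1 i.2.2).1⟩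
  invFun i := ⟨f' i, (h' i i.2.1 i.2.2).1⟩
  left_inv i := Subtype.ext (h i i.2.1 i.2.2).2
  right_inv i := Subtype.ext (h' i i.2.1 i.2.2).2

/-- `A_n`: the path `1 - 2 - ⋯ - n`. -/
def graphA (n : ℕ) : SimpleGraph (Icc 1 n) :=
  SimpleGraph.fromRel fun i j => (i : ℕ) + 1 = j

/-- `D_m`: the path `1 - 2 - ⋯ - (m-1)`, together with the edge `(m-2) - m`. -/
def graphD (m : ℕ) : SimpleGraph (Icc 1 m) :=
  SimpleGraph.fromRel fun i j => ((i : ℕ) + 1 = j ∧ (j : ℕ) + 1 ≤ m) ∨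
    ((i : ℕ) + 2 = m ∧ (j : ℕ) = m)

/-- `E_6`: the path `1 - 3 - 4 - 5 - 6`, together with the edge `2 - 4`. -/
def graphE6 : SimpleGraph (Icc 1 6) :=
  SimpleGraph.fromRel fun i j => ((i : ℕ) = 1 ∧ (j : ℕ) = 3) ∨ ((i : ℕ) = 3 ∧ (j : ℕ) = 4) ∨
    ((i : ℕ) = 4 ∧ (j : ℕ) = 5) ∨ ((i : ℕ) = 5 ∧ (j : ℕ) = 6) ∨ ((i : ℕ) = 2 ∧ (j : ℕ) = 4)

/-- `Ã_n` (`n ≥ 2`): the cycle `0 - 1 - ⋯ - n - 0`. -/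
def graphAffA (n : ℕ) : SimpleGraph (Icc 0 n) :=
  SimpleGraph.fromRel fun i j => (i : ℕ) + 1 = j ∨ ((i : ℕ) = 0 ∧ (j : ℕ) = n)

/-- `D̃_m`: the graph `D_m` with a further vertex `0` and the edge `0 - 2`. -/
def graphAffD (m : ℕ) : SimpleGraph (Icc 0 m) :=
  SimpleGraph.fromRel fun i j => (1 ≤ (i : ℕ) ∧ (i : ℕ) + 1 = j ∧ (j : ℕ) + 1 ≤ m) ∨
    ((i : ℕ) + 2 = m ∧ (j : ℕ) = m) ∨ ((i : ℕ) = 0 ∧ (j : ℕ) = 2)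

/-- `Ẽ_6`: the graph `E_6` with a further vertex `0` and the edge `0 - 2`. -/
def graphAffE6 : SimpleGraph (Icc 0 6) :=
  SimpleGraph.fromRel fun i j => ((i : ℕ) = 1 ∧ (j : ℕ) = 3) ∨ ((i : ℕ) = 3 ∧ (j : ℕ) = 4) ∨
    ((i : ℕ) = 4 ∧ (j : ℕ) = 5) ∨ ((i : ℕ) = 5 ∧ (j : ℕ) = 6) ∨
    ((i : ℕ) = 2 ∧ (j : ℕ) = 4) ∨ ((i : ℕ) = 0 ∧ (j : ℕ) = 2)

/-- `∞A∞`: the two-sided infinite path, with vertices labelled by `ℤ`. -/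
def graphInfAInf : SimpleGraph ℤ := SimpleGraph.fromRel fun i j => i + 1 = j

/-- `D_∞`: the infinite path `2 - 3 - 4 - ⋯`, together with the edge `1 - 3`. -/
def graphDInf : SimpleGraph (Ici (1 : ℕ)) :=
  SimpleGraph.fromRel fun i j => (2 ≤ (i : ℕ) ∧ (i : ℕ) + 1 = j) ∨ ((i : ℕ) = 1 ∧ (j : ℕ) = 3)

/-- `i ↦ 2m+2-i` on `1, …, 2m+1`. -/
def flipA (m : ℕ) : Equiv.Perm (Icc 1 (2 * m + 1)) :=
  labelPerm 1 (2 * m + 1) (fun i => 2 * m + 2 - i) (fun i => 2 * m + 2 - i)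
    (fun i _ _ => by omega) (fun i _ _ => by omega)

/-- `0 ↦ 0` and `i ↦ 2m+2-i` for `1 ≤ i ≤ 2m+1`. -/
def flipAffA (m : ℕ) : Equiv.Perm (Icc 0 (2 * m + 1)) :=
  labelPerm 0 (2 * m + 1) (fun i => if i = 0 then 0 else 2 * m + 2 - i)
    (fun i => if i = 0 then 0 else 2 * m + 2 - i)
    (fun i _ _ => by split_ifs <;> omega)
    (fun i _ _ => by split_ifs <;> omega)

/-- The exchange of `m-1` and `m`, on the labels `a, …, m`. -/
def swapD (a m : ℕ) (h : a + 1 ≤ m) : Equiv.Perm (Icc a m) :=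
  Equiv.swap ⟨m - 1, by simp only [mem_Icc]; omega⟩ ⟨m, by simp only [mem_Icc]; omega⟩

/-- `1 ↦ 3 ↦ 4 ↦ 1`, the other labels being fixed, on the labels `a, …, 4`, where `a ≤ 1`. -/
def trialityD4 (a : ℕ) (ha : a ≤ 1) : Equiv.Perm (Icc a 4) :=
  labelPerm a 4
    (fun i => if i = 1 then 3 else if i = 3 then 4 else if i = 4 then 1 else i)
    (fun i => if i = 3 then 1 else if i = 4 then 3 else if i = 1 then 4 else i)
    (fun i _ _ => by split_ifs <;> omega)
    (fun i _ _ => by split_ifs <;> omega)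

/-- `1 ↔ 6`, `3 ↔ 5`, the other labels being fixed, on the labels `a, …, 6`, where `a ≤ 1`. -/
def flipE6 (a : ℕ) (ha : a ≤ 1) : Equiv.Perm (Icc a 6) :=
  labelPerm a 6
    (fun i => if i = 1 then 6 else if i = 6 then 1 else if i = 3 then 5 else
      if i = 5 then 3 else i)
    (fun i => if i = 1 then 6 else if i = 6 then 1 else if i = 3 then 5 else
      if i = 5 then 3 else i)
    (fun i _ _ => by split_ifs <;> omega)
    (fun i _ _ => by split_ifs <;> omega)

/-- The exchange of `1` and `2` on the labels `1, 2, 3, …`. -/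
def swapDInf : Equiv.Perm (Ici (1 : ℕ)) := Equiv.swap ⟨1, by simp⟩ ⟨2, by simp⟩

open Subgroup

/-- `(Γ, G)` is, up to isomorphism, one of the pairs of the classification. -/
def IsListed {S : Type*} (M : CoxeterMatrix S) (G : Subgroup M.symmetryGroup) : Prop :=
  (∃ m : ℕ, 1 ≤ m ∧ M.IsoPair G (graphA (2 * m + 1)) (zpowers (flipA m))) ∨
  (∃ (m : ℕ) (hm : 4 ≤ m), M.IsoPair G (graphD m) (zpowers (swapD 1 m (by omega)))) ∨
  (∃ H : Subgroup (Equiv.Perm (Icc 1 4)), zpowers (trialityD4 1 le_rfl) ≤ H ∧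
    H ≤ closure {trialityD4 1 le_rfl, swapD 1 4 (by omega)} ∧ M.IsoPair G (graphD 4) H) ∨
  M.IsoPair G graphE6 (zpowers (flipE6 1 le_rfl)) ∨
  (∃ m : ℕ, 1 ≤ m ∧ M.IsoPair G (graphAffA (2 * m + 1)) (zpowers (flipAffA m))) ∨
  (∃ (m : ℕ) (hm : 4 ≤ m), M.IsoPair G (graphAffD m) (zpowers (swapD 0 m (by omega)))) ∨
  (∃ H : Subgroup (Equiv.Perm (Icc 0 4)), zpowers (trialityD4 0 zero_le_one) ≤ H ∧
    H ≤ closure {trialityD4 0 zero_le_one, swapD 0 4 (by omega)} ∧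
    M.IsoPair G (graphAffD 4) H) ∨
  M.IsoPair G graphAffE6 (zpowers (flipE6 0 zero_le_one)) ∨
  M.IsoPair G graphInfAInf (zpowers (Equiv.neg ℤ)) ∨
  M.IsoPair G graphDInf (zpowers swapDInf)

end CoxeterPairs

end

/-!
Why the theorem is true. The link between the two sides is the condition that *roots have
orthogonal orbits*: for a root `β` and `g ∈ G`, either `g β = β` or the coroot of `β` vanishes on
`g β`.

*The basis property implies orthogonal orbits.* The orbit sum of a positive root `β` lies in `E^G`,
so `β` occurs in an element of `ℬ̂`; hence every positive root has the form `w(α_s)` with `w ∈ W^G`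
(`HasBasisProperty.rootsFromFixed`). For `s` and `t` in one orbit, `σ_s(α_t)` can only be of this
form if `s` and `t` are not adjacent; transporting this by `W^G` gives the condition
(`RootsFromFixed.orthogonalOrbits`). This does not involve the field.

*Orthogonal orbits imply the classification.* If some `g ∈ G` had no fixed vertex, a root supported
on a shortest path from a vertex `y` towards `g(y)` would violate the condition
(`OrthogonalOrbits.exists_fixed`). If some label were not `3`, roots fixed by `g` could be grown
from the corresponding edge until their pairing with a moved vertex is too negative
(`OrthogonalOrbits.isSimplyLaced`). A reduced root basis of a simply laced graph is the canonical
one (`eq_canonical_of_isSimplyLaced`), so what remains concerns the integral form of a graph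
(`IsOrthogonalPair`). The basic restriction is `IsOrthogonalPair.neg_one_le_bil`: a root fixed by
`g` has inner product at least `-1` with every simple root moved by `g`. A fixed vertex with a moved
neighbour is then extended as far as possible: an orbit of size three gives `D₄` and `D̃₄`; a path
reversed by `g` gives the types `A`, `Ã`, `∞A∞`, or, with a fixed vertex attached to its middle, `E₆`
and `Ẽ₆`; two exchanged leaves at the origin of a fixed path give the types `D`, `D̃`, `D_∞`. Every
other way of attaching a vertex produces a root that contradicts the restriction or the condition.
The outcome is `IsOrthogonalPair.listedPair`.

*The listed pairs have the basis property.* A positive function on the vertices that is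
superharmonic shows that the form of a listed graph is positive semidefinite, and determines its
isotropic vectors (`IsSemidefinitePair`). A root `β` and its image satisfy `|⟨β, g β⟩| ≤ 2`; a
parity count along the orbits of vertices excludes `±1`. The value `2` makes `β - g β` isotropic,
hence zero. The value `-2` makes `β + g β` isotropic: if `g` is an involution, then `β` minus half
this vector has norm `2` and is negated by `g`, but such vectors have norm divisible by `4`; if
`g³ = 1`, then `β + g β + g² β` has negative norm (`IsSemidefinitePair.ortho`). Thus the orbit of a positive root is orthogonal, and
induction on the height, reflecting in whole orbits of vertices by the elements `u_X`, writes the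
root as `w(α_s)` with `w` a product of such elements (`IsSemidefinite.exists_rep`). Consequently
`ℬ̂` consists of the sums over the orbits of positive roots (`mem_hatFamily_iff`), which form a basis
of `E^G` (`IsSemidefinite.hasBasisProperty`).
-/

noncomputable section

/-! ### Root bases: the representation, positivity and the canonical root basis -/

open CoxeterSystem

namespace RootPrebasis

variable {S : Type*} {M : CoxeterMatrix S} (B : RootPrebasis M)

theorem refl_apply (s : S) (v : S →₀ ℝ) :
    B.refl s v = v - B.form s v • Finsupp.single s 1 :=
  Module.reflection_apply _ _

theorem rep_gen (s : S) : B.rep (M.gen s) = B.refl s :=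
  M.toCoxeterSystem.lift_apply_simple _ s

theorem rep_mul_apply (v w : M.Group) (x : S →₀ ℝ) : B.rep (v * w) x = B.rep v (B.rep w x) := by
  rw [map_mul]; rfl

theorem rep_one_apply (x : S →₀ ℝ) : B.rep 1 x = x := by
  rw [map_one]; rfl

theorem rep_inv_rep (w : M.Group) (x : S →₀ ℝ) : B.rep w⁻¹ (B.rep w x) = x := by
  rw [← rep_mul_apply, inv_mul_cancel, rep_one_apply]

theorem rep_rep_inv (w : M.Group) (x : S →₀ ℝ) : B.rep w (B.rep w⁻¹ x) = x := by
  rw [← rep_mul_apply, mul_inv_cancel, rep_one_apply]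

theorem rep_gen_self (s : S) :
    B.rep (M.gen s) (Finsupp.single s 1) = -Finsupp.single s 1 := by
  rw [rep_gen, refl_apply, B.form_self]; module

end RootPrebasis

namespace CoxeterMatrix

variable {S : Type*} (M : CoxeterMatrix S)

theorem canonicalEntry_symm (s t : S) : M.canonicalEntry s t = M.canonicalEntry t s := by
  simp only [canonicalEntry, M.symmetric t s]

/-- The values `U_{k-1}(c / 2)` of the Chebyshev polynomials of the second kind; they are the
coordinates of the roots of a dihedral group. -/
def dihedralCoeff (c : ℝ) : ℕ → ℝ
  | 0 => 0
  | 1 => 1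
  | k + 2 => c * dihedralCoeff c (k + 1) - dihedralCoeff c k

theorem dihedralCoeff_two (k : ℕ) : dihedralCoeff 2 k = k := by
  induction k using Nat.twoStepInduction with
  | zero => simp [dihedralCoeff]
  | one => simp [dihedralCoeff]
  | more k h1 h2 => rw [dihedralCoeff, h1, h2]; push_cast; ring

theorem sin_mul_dihedralCoeff (x : ℝ) (k : ℕ) :
    Real.sin x * dihedralCoeff (2 * Real.cos x) k = Real.sin (k * x) := by
  induction k using Nat.twoStepInduction with
  | zero => simp [dihedralCoeff]
  | one => simp [dihedralCoeff]
  | more k h1 h2 =>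
    rw [dihedralCoeff, mul_sub, h1, mul_left_comm, h2]
    have e : ((k + 2 : ℕ) : ℝ) * x = (k + 1 : ℕ) * x + x := by push_cast; ring
    have e' : (k : ℝ) * x = (k + 1 : ℕ) * x - x := by push_cast; ring
    rw [e, e', Real.sin_add, Real.sin_sub]; ring

theorem dihedralCoeff_nonneg {s t : S} (hst : s ≠ t) {k : ℕ} (hk : M s t = 0 ∨ k ≤ M s t) :
    0 ≤ dihedralCoeff (-M.canonicalEntry s t) k := by
  by_cases h0 : M s t = 0
  · rw [show -M.canonicalEntry s t = 2 by simp [canonicalEntry, h0], dihedralCoeff_two]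
    positivity
  have hk := hk.resolve_left h0
  have h1 := M.off_diagonal s t hst
  have h2 : (2 : ℝ) ≤ M s t := by exact_mod_cast (by omega : 2 ≤ M s t)
  rw [show -M.canonicalEntry s t = 2 * Real.cos (Real.pi / M s t) by simp [canonicalEntry, h0]]
  have hpi := Real.pi_pos
  have hs : 0 < Real.sin (Real.pi / M s t) := by
    apply Real.sin_pos_of_pos_of_lt_pi (by positivity)
    rw [div_lt_iff₀ (by linarith)]; nlinarith
  refine nonneg_of_mul_nonneg_right ?_ hs
  rw [sin_mul_dihedralCoeff]
  apply Real.sin_nonneg_of_nonneg_of_le_pi (by positivity)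
  rw [mul_div_assoc', div_le_iff₀ (by linarith), mul_comm]
  have : (k : ℝ) ≤ M s t := by exact_mod_cast hk
  gcongr

/-- The action of an alternating word in `s`, `t` on `α_s`. -/
theorem canonical_rep_alternatingWord (s t : S) (k : ℕ) :
    M.canonicalRootBasis.rep (M.toCoxeterSystem.wordProd (alternatingWord s t k))
      (Finsupp.single s 1) =
      dihedralCoeff (-M.canonicalEntry s t) (if Even k then k + 1 else k) • Finsupp.single s 1 +
      dihedralCoeff (-M.canonicalEntry s t) (if Even k then k else k + 1) • Finsupp.single t 1 := by
  set c := -M.canonicalEntry s t with hc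
  have hst : M.canonicalForm s (Finsupp.single t 1) = -c := by
    rw [canonicalForm_single, hc, neg_neg]
  have hts : M.canonicalForm t (Finsupp.single s 1) = -c := by
    rw [canonicalForm_single, canonicalEntry_symm, hc, neg_neg]
  have hss := M.canonicalForm_self s
  have htt := M.canonicalForm_self t
  induction k with
  | zero => simp [alternatingWord, dihedralCoeff]
  | succ k ih =>
    rw [alternatingWord_succ', CoxeterSystem.wordProd_cons, RootPrebasis.rep_mul_apply, ih]
    by_cases hk : Even k
    · have hk' : ¬ Even (k + 1) := by simpa [Nat.even_add_one] using hk
      rw [if_pos hk, if_pos hk, if_neg hk', if_neg hk', if_pos hk]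
      change M.canonicalRootBasis.rep (M.gen t) _ = _
      rw [RootPrebasis.rep_gen, RootPrebasis.refl_apply]
      change _ - M.canonicalForm t _ • _ = _
      simp only [map_add, map_smul, hts, htt, smul_eq_mul, dihedralCoeff]
      module
    · have hk' : Even (k + 1) := by simpa [Nat.even_add_one] using hk
      rw [if_neg hk, if_neg hk, if_pos hk', if_pos hk', if_neg hk]
      change M.canonicalRootBasis.rep (M.gen s) _ = _
      rw [RootPrebasis.rep_gen, RootPrebasis.refl_apply]
      change _ - M.canonicalForm s _ • _ = _
      simp only [map_add, map_smul, hst, hss, smul_eq_mul, dihedralCoeff]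
      module

/-- If `lg(ws) > lg(w)`, then `w(α_s)` is positive: write `w = va` with `a` the longest possible
alternating right factor in `s` and a right descent `t` of `w`; then `v` is increasing on both
`s` and `t`, and `a(α_s)` is a nonnegative combination of `α_s` and `α_t`. -/
theorem canonical_nonneg_of_not_isRightDescent (w : M.Group) (s : S)
    (hs : ¬ M.toCoxeterSystem.IsRightDescent w s) (r : S) :
    0 ≤ M.canonicalRootBasis.rep w (Finsupp.single s 1) r := by
  set cs := M.toCoxeterSystem with hcs
  induction hn : cs.length w using Nat.strong_induction_on generalizing w s r with
  | _ n ih =>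
  by_cases hw : w = 1
  · subst hw
    rw [RootPrebasis.rep_one_apply]
    classical
    rw [Finsupp.single_apply]; split_ifs <;> norm_num
  obtain ⟨t, ht⟩ := cs.exists_rightDescent_of_ne_one hw
  have hst : s ≠ t := by rintro rfl; exact hs ht
  have hsl := cs.not_isRightDescent_iff.mp hs
  have htl := cs.isRightDescent_iff.mp ht
  classical
  let P : ℕ → Prop := fun k => ∃ v, w = v * cs.wordProd (alternatingWord s t k) ∧
    cs.length v + k = cs.length w
  have hP1 : P 1 := ⟨w * cs.simple t, by
    simp [alternatingWord], htl⟩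
  set k := Nat.findGreatest P (cs.length w) with hk
  have hk1 : 1 ≤ k := Nat.le_findGreatest (by omega) hP1
  obtain ⟨v, hv, hvl⟩ : P k := Nat.findGreatest_spec (m := 1) (by omega) hP1
  have hmax : ¬ P (k + 1) := by
    intro h
    by_cases hle : k + 1 ≤ cs.length w
    · exact Nat.findGreatest_is_greatest (Nat.lt_succ_self k) hle h
    · obtain ⟨v', _, h⟩ := h
      omega
  -- `v` is increasing on the letter that would prolong the alternating word
  have hq : ¬ cs.IsRightDescent v (if Even k then t else s) := by
    intro h
    have h := cs.isRightDescent_iff.mp h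
    refine hmax ⟨v * cs.simple (if Even k then t else s), ?_, by omega⟩
    rw [alternatingWord_succ', CoxeterSystem.wordProd_cons, mul_assoc,
      cs.simple_mul_simple_cancel_left]
    exact hv
  obtain ⟨k', hk'⟩ : ∃ k', k = k' + 1 := ⟨k - 1, by omega⟩
  have hp : ¬ cs.IsRightDescent v (if Even k' then t else s) := by
    intro h
    have h := cs.isRightDescent_iff.mp h
    have e : w = v * cs.simple (if Even k' then t else s) *
        cs.wordProd (alternatingWord s t k') := by
      rw [hv, hk', alternatingWord_succ', CoxeterSystem.wordProd_cons, mul_assoc]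
    have h1 := cs.length_mul_le (v * cs.simple (if Even k' then t else s))
      (cs.wordProd (alternatingWord s t k'))
    have h2 := cs.length_wordProd_le (alternatingWord s t k')
    rw [length_alternatingWord] at h2
    rw [← e] at h1
    omega
  have hboth : ¬ cs.IsRightDescent v s ∧ ¬ cs.IsRightDescent v t := by
    rw [hk'] at hq
    by_cases he : Even k'
    · rw [if_pos he] at hp
      rw [if_neg (by simpa [Nat.even_add_one] using he)] at hq
      exact ⟨hq, hp⟩
    · rw [if_neg he] at hp
      rw [if_pos (by simpa [Nat.even_add_one] using he)] at hq
      exact ⟨hp, hq⟩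
  have hkm : M s t = 0 ∨ k + 1 ≤ M s t := by
    by_contra hcon
    push Not at hcon
    have hnr := cs.not_isReduced_alternatingWord t s (m := k + 1)
      (by rw [M.symmetric]; exact hcon.1) (by rw [M.symmetric]; omega)
    have h1 := cs.length_wordProd_le (alternatingWord t s (k + 1))
    rw [length_alternatingWord] at h1
    have h2 : cs.length (cs.wordProd (alternatingWord t s (k + 1))) ≠ k + 1 := by
      intro h; apply hnr; rw [CoxeterSystem.IsReduced, h, length_alternatingWord]
    have e : w * cs.simple s = v * cs.wordProd (alternatingWord t s (k + 1)) := by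
      rw [alternatingWord_succ, CoxeterSystem.wordProd_concat, ← mul_assoc, ← hv]
    have h3 := cs.length_mul_le v (cs.wordProd (alternatingWord t s (k + 1)))
    rw [← e] at h3
    omega
  have hlt : cs.length v < n := by omega
  rw [hv, RootPrebasis.rep_mul_apply, canonical_rep_alternatingWord, map_add, map_smul, map_smul,
    Finsupp.add_apply, Finsupp.smul_apply, Finsupp.smul_apply, smul_eq_mul, smul_eq_mul]
  refine add_nonneg (mul_nonneg ?_ (ih _ hlt v s r hboth.1 rfl))
    (mul_nonneg ?_ (ih _ hlt v t r hboth.2 rfl))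
  · apply M.dihedralCoeff_nonneg hst
    split_ifs <;> omega
  · apply M.dihedralCoeff_nonneg hst
    split_ifs <;> omega

theorem canonical_nonpos_of_isRightDescent (w : M.Group) (s : S)
    (hs : M.toCoxeterSystem.IsRightDescent w s) (r : S) :
    M.canonicalRootBasis.rep w (Finsupp.single s 1) r ≤ 0 := by
  have h := (M.toCoxeterSystem.isRightDescent_iff_not_isRightDescent_mul).mp hs
  have h2 := M.canonical_nonneg_of_not_isRightDescent _ s h r
  have e := RootPrebasis.rep_gen_self M.canonicalRootBasis s
  rw [RootPrebasis.rep_mul_apply] at h2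
  change 0 ≤ (M.canonicalRootBasis.rep w) ((M.canonicalRootBasis.rep (M.gen s)) _) r at h2
  rw [e, map_neg, Finsupp.neg_apply] at h2
  linarith

/-- The geometric representation is faithful. -/
theorem canonical_rep_injective : Function.Injective M.canonicalRootBasis.rep := by
  rw [injective_iff_map_eq_one]
  intro w hw
  by_contra hne
  obtain ⟨s, hs⟩ := M.toCoxeterSystem.exists_rightDescent_of_ne_one hne
  have h := M.canonical_nonpos_of_isRightDescent w s hs s
  rw [hw] at h
  simp at h
  linarith

/-- The canonical bilinear form. -/
def canonicalBilin : (S →₀ ℝ) →ₗ[ℝ] (S →₀ ℝ) →ₗ[ℝ] ℝ :=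
  Finsupp.linearCombination ℝ M.canonicalForm

theorem canonicalBilin_single (s : S) (v : S →₀ ℝ) :
    M.canonicalBilin (Finsupp.single s 1) v = M.canonicalForm s v := by
  simp [canonicalBilin]

theorem canonicalBilin_symm (v w : S →₀ ℝ) : M.canonicalBilin v w = M.canonicalBilin w v := by
  induction v using Finsupp.induction_linear with
  | zero => simp
  | add v v' h h' => simp [h, h']
  | single s a =>
    induction w using Finsupp.induction_linear with
    | zero => simp
    | add w w' h h' => simp [h, h']
    | single t b =>
      simp [canonicalBilin, canonicalForm, M.canonicalEntry_symm s t]; ring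

theorem canonicalBilin_rep (u : M.Group) (v w : S →₀ ℝ) :
    M.canonicalBilin (M.canonicalRootBasis.rep u v) (M.canonicalRootBasis.rep u w) =
      M.canonicalBilin v w := by
  induction u using M.toCoxeterSystem.simple_induction_left generalizing v w with
  | one => simp
  | mul_simple_left u s ih =>
    rw [RootPrebasis.rep_mul_apply, RootPrebasis.rep_mul_apply, ← ih v w]
    generalize M.canonicalRootBasis.rep u v = v
    generalize M.canonicalRootBasis.rep u w = w
    have e : M.canonicalRootBasis.rep (M.toCoxeterSystem.simple s) =
      M.canonicalRootBasis.refl s := M.canonicalRootBasis.rep_gen s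
    rw [e, RootPrebasis.refl_apply, RootPrebasis.refl_apply]
    change M.canonicalBilin (v - M.canonicalForm s v • _) (w - M.canonicalForm s w • _) = _
    have h1 : M.canonicalBilin v (Finsupp.single s 1) = M.canonicalForm s v := by
      rw [canonicalBilin_symm, canonicalBilin_single]
    simp only [map_sub, map_smul, LinearMap.sub_apply, LinearMap.smul_apply, canonicalBilin_single,
      h1, canonicalForm_self, smul_eq_mul]
    ring

theorem canonical_isReducedRootBasis : M.canonicalRootBasis.IsReducedRootBasis where
  union := by
    apply Set.Subset.antisymm
    · rintro v ⟨w, s, rfl⟩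
      by_cases h : M.toCoxeterSystem.IsRightDescent w s
      · exact Or.inr ⟨⟨w, s, rfl⟩, M.canonical_nonpos_of_isRightDescent w s h⟩
      · exact Or.inl ⟨⟨w, s, rfl⟩, M.canonical_nonneg_of_not_isRightDescent w s h⟩
    · rintro v (h | h) <;> exact h.1
  disjoint := by
    rw [Set.disjoint_left]
    rintro v ⟨⟨w, s, rfl⟩, h1⟩ ⟨-, h2⟩
    have h0 : M.canonicalRootBasis.rep w (Finsupp.single s 1) = 0 := by
      ext r; exact le_antisymm (h2 r) (h1 r)
    rw [LinearEquiv.map_eq_zero_iff] at h0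
    simp at h0
  reduced s := by
    ext v
    constructor
    · rintro ⟨⟨c, rfl⟩, w, t, h⟩
      have h2 := M.canonicalBilin_rep w (Finsupp.single t 1) (Finsupp.single t 1)
      rw [← h] at h2
      simp only [map_smul, LinearMap.smul_apply, canonicalBilin_single, canonicalForm_self,
        smul_eq_mul] at h2
      have h3 : (c - 1) * (c + 1) = 0 := by linarith
      rcases mul_eq_zero.mp h3 with h3 | h3
      · left; rw [show c = 1 by linarith, one_smul]
      · right; rw [Set.mem_singleton_iff, show c = -1 by linarith, neg_one_smul]
    · rintro (rfl | rfl)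
      · exact ⟨⟨1, by simp⟩, 1, s, by simp⟩
      · exact ⟨⟨-1, by simp⟩, M.gen s, s, by rw [RootPrebasis.rep_gen_self]⟩

theorem canonical_isSymmetric (G : Subgroup M.symmetryGroup) :
    M.canonicalRootBasis.IsSymmetric G := by
  intro g _ s
  ext1 v
  have h : ∀ v : S →₀ ℝ, M.canonicalForm ((g : Equiv.Perm S) s) (permOnV (g : Equiv.Perm S) v) =
      M.canonicalForm s v := by
    intro v
    induction v using Finsupp.induction_linear with
    | zero => simp
    | add v v' h h' => simp [h, h']
    | single t b =>
      simp [permOnV, canonicalForm, canonicalEntry, g.2 s t]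
  obtain ⟨u, rfl⟩ := (permOnV (g : Equiv.Perm S)).surjective v
  have e : (permOnV (g : Equiv.Perm S))⁻¹ (permOnV (g : Equiv.Perm S) u) = u :=
    (permOnV (g : Equiv.Perm S)).symm_apply_apply u
  rw [LinearEquiv.mul_apply, LinearEquiv.mul_apply, e, RootPrebasis.refl_apply,
    RootPrebasis.refl_apply, map_sub, map_smul]
  change _ - M.canonicalForm _ _ • _ = _ - M.canonicalForm _ _ • _
  rw [h]
  simp [permOnV]

end CoxeterMatrix

end

noncomputable section

/-! ### Symmetric root bases: roots, coroots and the action of the symmetries -/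

open CoxeterSystem

theorem permOnV_single {S : Type*} (g : Equiv.Perm S) (s : S) (a : ℝ) :
    permOnV g (Finsupp.single s a) = Finsupp.single (g s) a := by
  simp [permOnV]

theorem permOnV_apply {S : Type*} (g : Equiv.Perm S) (v : S →₀ ℝ) (s : S) :
    permOnV g v (g s) = v s := by
  simp [permOnV]

theorem permOnV_one {S : Type*} (v : S →₀ ℝ) : permOnV (1 : Equiv.Perm S) v = v := by
  ext s; exact permOnV_apply 1 v s

theorem permOnV_mul {S : Type*} (g h : Equiv.Perm S) (v : S →₀ ℝ) :
    permOnV (g * h) v = permOnV g (permOnV h v) := by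
  induction v using Finsupp.induction_linear with
  | zero => simp
  | add v v' e e' => simp [e, e']
  | single s a => simp [permOnV_single]

/-- The sum of the basis vectors over a finite set is its indicator function. -/
theorem finsum_single_apply {I R : Type*} [Semiring R] {X : Set I} (hX : X.Finite) (i : I)
    [Decidable (i ∈ X)] :
    (∑ᶠ x ∈ X, Finsupp.single x (1 : R)) i = if i ∈ X then 1 else 0 := by
  classical
  rw [finsum_mem_eq_finite_toFinset_sum _ hX, Finsupp.finsetSum_apply]
  simp [Finsupp.single_apply]

namespace RootPrebasis

variable {S : Type*} {M : CoxeterMatrix S} (B : RootPrebasis M)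

/-- `(β, φ)` is a root together with its coroot: the image of some `(α_s, φ_s)` under `W`. -/
def IsRootPair (β : S →₀ ℝ) (φ : Module.Dual ℝ (S →₀ ℝ)) : Prop :=
  ∃ (w : M.Group) (s : S), β = B.rep w (Finsupp.single s 1) ∧ ∀ v, φ v = B.form s (B.rep w⁻¹ v)

variable {B}

theorem isRootPair_simple (s : S) : B.IsRootPair (Finsupp.single s 1) (B.form s) :=
  ⟨1, s, by simp, by simp⟩

theorem IsRootPair.mem_roots {β : S →₀ ℝ} {φ : Module.Dual ℝ (S →₀ ℝ)} (h : B.IsRootPair β φ) :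
    β ∈ B.roots := by
  obtain ⟨w, s, rfl, -⟩ := h
  exact ⟨w, s, rfl⟩

theorem IsRootPair.apply_self {β : S →₀ ℝ} {φ : Module.Dual ℝ (S →₀ ℝ)} (h : B.IsRootPair β φ) :
    φ β = 2 := by
  obtain ⟨w, s, rfl, hφ⟩ := h
  rw [hφ, rep_inv_rep, B.form_self]

theorem IsRootPair.rep {β : S →₀ ℝ} {φ : Module.Dual ℝ (S →₀ ℝ)} (h : B.IsRootPair β φ)
    (u : M.Group) : B.IsRootPair (B.rep u β) (φ ∘ₗ (B.rep u⁻¹ : (S →₀ ℝ) →ₗ[ℝ] (S →₀ ℝ))) := by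
  obtain ⟨w, s, rfl, hφ⟩ := h
  refine ⟨u * w, s, (B.rep_mul_apply _ _ _).symm, fun v => ?_⟩
  rw [mul_inv_rev, rep_mul_apply, ← hφ]; rfl

theorem gen_inv (s : S) : (M.gen s)⁻¹ = M.gen s := M.toCoxeterSystem.inv_simple s

theorem IsRootPair.refl {β : S →₀ ℝ} {φ : Module.Dual ℝ (S →₀ ℝ)} (h : B.IsRootPair β φ)
    (s : S) : B.IsRootPair (β - B.form s β • Finsupp.single s 1)
      (φ - φ (Finsupp.single s 1) • B.form s) := by
  have h := h.rep (M.gen s)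
  rw [rep_gen, refl_apply] at h
  convert h using 1
  refine LinearMap.ext fun v => ?_
  change φ v - φ (Finsupp.single s 1) * B.form s v = φ (B.rep (M.gen s)⁻¹ v)
  rw [gen_inv, rep_gen, refl_apply, map_sub, map_smul, smul_eq_mul, mul_comm]

theorem IsRootPair.neg {β : S →₀ ℝ} {φ : Module.Dual ℝ (S →₀ ℝ)} (h : B.IsRootPair β φ) :
    B.IsRootPair (-β) (-φ) := by
  obtain ⟨w, s, rfl, hφ⟩ := h
  refine ⟨w * M.gen s, s, ?_, fun v => ?_⟩
  · rw [rep_mul_apply, rep_gen_self, map_neg]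
  · rw [mul_inv_rev, rep_mul_apply, gen_inv, rep_gen, refl_apply, map_sub, map_smul, B.form_self,
      LinearMap.neg_apply, hφ]
    simp; ring

theorem rep_mem_roots {β : S →₀ ℝ} (h : β ∈ B.roots) (w : M.Group) : B.rep w β ∈ B.roots := by
  obtain ⟨u, s, rfl⟩ := h
  exact ⟨w * u, s, by rw [rep_mul_apply]⟩

theorem simple_mem_roots (s : S) : Finsupp.single s 1 ∈ B.roots := ⟨1, s, by simp⟩

theorem ne_zero_of_mem_roots {β : S →₀ ℝ} (h : β ∈ B.roots) : β ≠ 0 := by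
  obtain ⟨u, s, rfl⟩ := h
  simp

namespace IsReducedRootBasis

variable (hB : B.IsReducedRootBasis)
include hB

theorem nonneg_or_nonpos {β : S →₀ ℝ} (h : β ∈ B.roots) : (∀ t, 0 ≤ β t) ∨ ∀ t, β t ≤ 0 := by
  rw [hB.union] at h
  exact h.imp (fun h => h.2) fun h => h.2

theorem nonneg_of_pos {β : S →₀ ℝ} (h : β ∈ B.roots) {r : S} (hr : 0 < β r) (t : S) : 0 ≤ β t :=
  (hB.nonneg_or_nonpos h).elim (fun h => h t) fun h => absurd (h r) (not_le.mpr hr)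

/-- The coroot of a simple root is unique: if `σ_s` and `σ'` are reflections in `W` with the same
root `α_s`, then `σ_s σ'` and its inverse map a simple root `α_r ≠ α_s` to `α_r ± c α_s`. -/
theorem coroot_simple {s : S} {φ : Module.Dual ℝ (S →₀ ℝ)}
    (h : B.IsRootPair (Finsupp.single s 1) φ) : φ = B.form s := by
  have hs := h.apply_self
  obtain ⟨w, t, hw, hφ⟩ := h
  have key : ∀ v, B.rep (w * M.gen t * w⁻¹) v = v - φ v • Finsupp.single s 1 := by
    intro v
    rw [rep_mul_apply, rep_mul_apply, rep_gen, refl_apply, map_sub, map_smul, rep_rep_inv, ← hw,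
      hφ]
  classical
  refine Finsupp.lhom_ext' fun r => LinearMap.ext_ring ?_
  change φ (Finsupp.single r 1) = B.form s (Finsupp.single r 1)
  by_cases hr : r = s
  · subst hr; rw [hs, B.form_self]
  have e1 := rep_mem_roots (rep_mem_roots (simple_mem_roots r) (w * M.gen t * w⁻¹)) (M.gen s)
    (B := B)
  have e2 := rep_mem_roots (rep_mem_roots (simple_mem_roots r) (M.gen s)) (w * M.gen t * w⁻¹)
    (B := B)
  have p1 := hB.nonneg_of_pos e1 (r := r)
    (by rw [key, rep_gen, refl_apply]; simp [Ne.symm hr]) s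
  have p2 := hB.nonneg_of_pos e2 (r := r)
    (by rw [key, rep_gen, refl_apply]; simp [Ne.symm hr]) s
  have hrs : (Finsupp.single r (1 : ℝ)) s = 0 := Finsupp.single_eq_of_ne (Ne.symm hr)
  rw [key, rep_gen, refl_apply] at p1 p2
  simp only [map_sub, map_smul, Finsupp.sub_apply, Finsupp.smul_apply, B.form_self, hs,
    Finsupp.single_eq_same, hrs, smul_eq_mul] at p1 p2
  linarith

/-- A root determines its coroot. -/
theorem coroot_unique {β : S →₀ ℝ} {φ φ' : Module.Dual ℝ (S →₀ ℝ)} (h : B.IsRootPair β φ)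
    (h' : B.IsRootPair β φ') : φ = φ' := by
  obtain ⟨w, s, rfl, hφ⟩ := h
  have h1 := h'.rep w⁻¹
  rw [rep_inv_rep] at h1
  have h2 := hB.coroot_simple h1
  refine LinearMap.ext fun v => ?_
  have h3 : φ' (B.rep w⁻¹⁻¹ (B.rep w⁻¹ v)) = _ := LinearMap.congr_fun h2 (B.rep w⁻¹ v)
  rw [inv_inv, rep_rep_inv] at h3
  rw [hφ, h3]

theorem form_nonpos {s t : S} (hst : s ≠ t) : B.form s (Finsupp.single t 1) ≤ 0 := by
  classical
  have h := ((isRootPair_simple t).refl s (B := B)).mem_roots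
  have h2 := hB.nonneg_of_pos h (r := t) (by simp [hst]) s
  simp [Ne.symm hst] at h2
  exact h2

theorem form_eq_zero_symm {s t : S} (h : B.form s (Finsupp.single t 1) = 0) :
    B.form t (Finsupp.single s 1) = 0 := by
  have h1 := (isRootPair_simple t).refl s (B := B)
  rw [h, zero_smul, sub_zero] at h1
  have h2 := LinearMap.congr_fun (hB.coroot_simple h1) (Finsupp.single s 1)
  simp [B.form_self] at h2
  linarith

end IsReducedRootBasis

theorem IsSymmetric.form_apply {G : Subgroup M.symmetryGroup} (hG : B.IsSymmetric G)
    {g : M.symmetryGroup} (hg : g ∈ G) (s : S) (v : S →₀ ℝ) :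
    B.form (g.1 s) (permOnV g.1 v) = B.form s v := by
  have h := LinearEquiv.congr_fun (hG g hg s) (permOnV g.1 v)
  have e : (permOnV g.1)⁻¹ (permOnV g.1 v) = v := (permOnV g.1).symm_apply_apply v
  rw [LinearEquiv.mul_apply, LinearEquiv.mul_apply, e, refl_apply, refl_apply, map_sub, map_smul,
    permOnV_single, sub_right_inj] at h
  have h2 := DFunLike.congr_fun h (g.1 s)
  simpa using h2

theorem _root_.CoxeterMatrix.symmHom_gen (g : M.symmetryGroup) (s : S) :
    M.symmHom g (M.gen s) = M.gen (g.1 s) :=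
  M.toCoxeterSystem.lift_apply_simple _ s

theorem IsSymmetric.rep_symmHom {G : Subgroup M.symmetryGroup} (hG : B.IsSymmetric G)
    {g : M.symmetryGroup} (hg : g ∈ G) (w : M.Group) (v : S →₀ ℝ) :
    B.rep (M.symmHom g w) (permOnV g.1 v) = permOnV g.1 (B.rep w v) := by
  induction w using M.toCoxeterSystem.simple_induction_left generalizing v with
  | one => simp
  | mul_simple_left w s ih =>
    rw [map_mul, rep_mul_apply, rep_mul_apply, ih]
    change B.rep (M.symmHom g (M.gen s)) _ = permOnV _ (B.rep (M.gen s) _)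
    rw [CoxeterMatrix.symmHom_gen, rep_gen, rep_gen, refl_apply, refl_apply, hG.form_apply hg,
      map_sub, map_smul, permOnV_single]

theorem IsSymmetric.rep_fixed {G : Subgroup M.symmetryGroup} (hG : B.IsSymmetric G)
    {g : M.symmetryGroup} (hg : g ∈ G) {w : M.Group} (hw : w ∈ M.fixedSubgroup G)
    (v : S →₀ ℝ) : B.rep w (permOnV g.1 v) = permOnV g.1 (B.rep w v) := by
  rw [← hG.rep_symmHom hg, hw g hg]

theorem IsRootPair.perm {G : Subgroup M.symmetryGroup} (hG : B.IsSymmetric G)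
    {g : M.symmetryGroup} (hg : g ∈ G) {β : S →₀ ℝ} {φ : Module.Dual ℝ (S →₀ ℝ)}
    (h : B.IsRootPair β φ) : B.IsRootPair (permOnV g.1 β)
      (φ ∘ₗ ((permOnV g.1).symm : (S →₀ ℝ) →ₗ[ℝ] (S →₀ ℝ))) := by
  obtain ⟨w, s, rfl, hφ⟩ := h
  refine ⟨M.symmHom g w, g.1 s, ?_, fun v => ?_⟩
  · rw [← permOnV_single, hG.rep_symmHom hg]
  · obtain ⟨u, rfl⟩ := (permOnV g.1).surjective v
    rw [← map_inv, hG.rep_symmHom hg, hG.form_apply hg, ← hφ]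
    simp

/-! ### The basis property in terms of roots -/

theorem mem_EG_iff {G : Subgroup M.symmetryGroup} {K : Type*} [Field K] {x : (S →₀ ℝ) →₀ K} :
    x ∈ B.EG G K ↔ (∀ β, x β ≠ 0 → β ∈ B.posRoots) ∧
      ∀ g ∈ G, ∀ β, x (permOnV (g : Equiv.Perm S) β) = x β := by
  change (x ∈ B.E K ∧ _) ↔ _
  refine and_congr ?_ (forall₂_congr fun g _ => ?_)
  · rw [E, Finsupp.mem_supported]
    simp [Set.subset_def]
  · constructor
    · intro h β
      conv_lhs => rw [← h]
      exact Finsupp.mapDomain_apply (permOnV (g : Equiv.Perm S)).injective _ _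
    · intro h
      ext β
      obtain ⟨γ, rfl⟩ := (permOnV (g : Equiv.Perm S)).surjective β
      rw [Finsupp.mapDomain_apply (permOnV (g : Equiv.Perm S)).injective, h]

/-- The `G`-orbit of a vector of `V`. -/
def vecOrbit (G : Subgroup M.symmetryGroup) (v : S →₀ ℝ) : Set (S →₀ ℝ) :=
  {u | ∃ g ∈ G, u = permOnV (g : Equiv.Perm S) v}

theorem mem_vecOrbit_self (G : Subgroup M.symmetryGroup) (v : S →₀ ℝ) : v ∈ vecOrbit G v :=
  ⟨1, one_mem _, (permOnV_one v).symm⟩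

theorem perm_mem_vecOrbit_iff {G : Subgroup M.symmetryGroup} {v u : S →₀ ℝ}
    {g : M.symmetryGroup} (hg : g ∈ G) :
    permOnV (g : Equiv.Perm S) u ∈ vecOrbit G v ↔ u ∈ vecOrbit G v := by
  constructor
  · rintro ⟨h, hh, e⟩
    refine ⟨g⁻¹ * h, mul_mem (inv_mem hg) hh, ?_⟩
    rw [Subgroup.coe_mul, permOnV_mul, ← e, ← permOnV_mul, Subgroup.coe_inv, inv_mul_cancel,
      permOnV_one]
  · rintro ⟨h, hh, rfl⟩
    exact ⟨g * h, mul_mem hg hh, by rw [Subgroup.coe_mul, permOnV_mul]⟩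

theorem vecOrbit_finite {G : Subgroup M.symmetryGroup}
    (hfin : ∀ s : S, (MulAction.orbit G s).Finite) (v : S →₀ ℝ) : (vecOrbit G v).Finite := by
  classical
  have h : {f : v.support → S | ∀ i : v.support, f i ∈ MulAction.orbit G (i : S)}.Finite :=
    Set.Finite.pi' fun i => hfin i
  refine (h.image fun f => ∑ i : v.support, Finsupp.single (f i) (v i)).subset ?_
  rintro _ ⟨g, hg, rfl⟩
  refine ⟨fun i => g.1 i, fun i => ⟨⟨g, hg⟩, rfl⟩, ?_⟩
  change ∑ i : v.support, Finsupp.single (g.1 i) (v i) = permOnV g.1 v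
  conv_rhs => rw [← Finsupp.sum_single v, Finsupp.sum, map_sum]
  rw [← Finset.sum_coe_sort v.support]
  simp [permOnV_single]

theorem permOnV_mem_posRoots {G : Subgroup M.symmetryGroup} (hG : B.IsSymmetric G)
    {g : M.symmetryGroup} (hg : g ∈ G) {β : S →₀ ℝ} (h : β ∈ B.posRoots) :
    permOnV (g : Equiv.Perm S) β ∈ B.posRoots := by
  obtain ⟨⟨w, s, hw⟩, hp⟩ := h
  refine ⟨⟨M.symmHom g w, g.1 s, ?_⟩, fun s => ?_⟩
  · rw [← permOnV_single, hG.rep_symmHom hg, hw]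
  · obtain ⟨t, rfl⟩ := g.1.surjective s
    rw [permOnV_apply]; exact hp t

theorem orbitSum_mem_EG {G : Subgroup M.symmetryGroup} (hG : B.IsSymmetric G)
    (hfin : ∀ s : S, (MulAction.orbit G s).Finite) (K : Type*) [Field K]
    {β : S →₀ ℝ} (hβ : β ∈ B.posRoots) :
    (∑ᶠ α ∈ vecOrbit G β, Finsupp.single α (1 : K)) ∈ B.EG G K := by
  classical
  rw [mem_EG_iff]
  refine ⟨fun γ hγ => ?_, fun g hg γ => ?_⟩
  · rw [finsum_single_apply (vecOrbit_finite hfin β)] at hγ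
    obtain ⟨g, hg, rfl⟩ : γ ∈ vecOrbit G β := by by_contra h; simp [h] at hγ
    exact permOnV_mem_posRoots hG hg hβ
  · rw [finsum_single_apply (vecOrbit_finite hfin β), finsum_single_apply (vecOrbit_finite hfin β)]
    simp only [perm_mem_vecOrbit_iff hg]

/-- Every positive root is the image of a simple root under an element of `W^G`. -/
def RootsFromFixed (B : RootPrebasis M) (G : Subgroup M.symmetryGroup) : Prop :=
  ∀ β ∈ B.posRoots, ∃ w ∈ M.fixedSubgroup G, ∃ s, β = B.rep w (Finsupp.single s 1)

theorem HasBasisProperty.rootsFromFixed {G : Subgroup M.symmetryGroup} (hG : B.IsSymmetric G)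
    (hfin : ∀ s : S, (MulAction.orbit G s).Finite) {K : Type*} [Field K]
    (h : B.HasBasisProperty G K) : B.RootsFromFixed G := by
  classical
  intro β hβ
  have h1 := orbitSum_mem_EG hG hfin K hβ
  rw [← h.2] at h1
  have h2 : ∀ x ∈ Submodule.span K (B.hatFamily G K), x β ≠ 0 →
      ∃ y ∈ B.hatFamily G K, y β ≠ 0 := by
    intro x hx
    induction hx using Submodule.span_induction with
    | mem x hx => exact fun h => ⟨x, hx, h⟩
    | zero => simp
    | add x y _ _ hx hy =>
      intro hxy
      by_cases hx0 : x β = 0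
      · exact hy fun hy0 => hxy (by simp [hx0, hy0])
      · exact hx hx0
    | smul a x _ hx =>
      intro hax
      exact hx fun hx0 => hax (by simp [hx0])
  obtain ⟨y, ⟨v, -, ω, ⟨w, hw, X, hX, -, hω⟩, rfl⟩, hy⟩ := h2 _ h1 (by
    rw [finsum_single_apply (vecOrbit_finite hfin β), if_pos (mem_vecOrbit_self G β)]
    exact one_ne_zero)
  have hfinω : ω.Finite := by
    rw [hω]; exact (hX.2.1.image _).image _
  rw [finsum_single_apply hfinω] at hy
  have hmem : β ∈ ω := by by_contra h; simp [h] at hy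
  rw [hω] at hmem
  obtain ⟨_, ⟨s, -, rfl⟩, rfl⟩ := hmem
  exact ⟨w, hw, s, rfl⟩

end RootPrebasis

end

noncomputable section

/-! ### Consequences of the basis property: orthogonal orbits and simply laced graphs -/

open CoxeterSystem

namespace RootPrebasis

variable {S : Type*} {M : CoxeterMatrix S} {B : RootPrebasis M} {G : Subgroup M.symmetryGroup}

/-- Distinct vertices of an orbit are not adjacent: if `α_t + c α_s = w(α_u)` with `w ∈ W^G` and
`s`, `t` in one orbit, then `w⁻¹(α_s)` and `w⁻¹(α_t)` have the same sign, so both are multiples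
of `α_u`. -/
theorem RootsFromFixed.form_orbit_eq_zero (hP : B.RootsFromFixed G) (hB : B.IsReducedRootBasis)
    (hG : B.IsSymmetric G) {g : M.symmetryGroup} (hg : g ∈ G) {s : S} (hs : g.1 s ≠ s) :
    B.form s (Finsupp.single (g.1 s) 1) = 0 := by
  classical
  by_contra hne
  set t := g.1 s with ht
  set c := B.form s (Finsupp.single t 1) with hc
  have hc0 : c < 0 := lt_of_le_of_ne (hB.form_nonpos (Ne.symm hs)) hne
  have hroot := ((isRootPair_simple t).refl s (B := B)).mem_roots
  rw [← hc] at hroot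
  have hpos : Finsupp.single t 1 - c • Finsupp.single s 1 ∈ B.posRoots :=
    ⟨hroot, hB.nonneg_of_pos hroot (r := t) (by simp [hs])⟩
  obtain ⟨w, hw, u, hu⟩ := hP _ hpos
  have hw' := inv_mem hw
  set a := B.rep w⁻¹ (Finsupp.single s 1) with ha
  set b := B.rep w⁻¹ (Finsupp.single t 1) with hb
  have hab : b = permOnV g.1 a := by
    rw [hb, ht, ← permOnV_single, hG.rep_fixed hg hw']
  have hsum : ∀ r, b r - c * a r = (Finsupp.single u (1 : ℝ)) r := by
    intro r
    rw [← B.rep_inv_rep w (Finsupp.single u 1), ← hu, map_sub, map_smul, ← ha, ← hb]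
    simp
  have haR : a ∈ B.roots := rep_mem_roots (simple_mem_roots s) _
  rcases hB.nonneg_or_nonpos haR with h | h
  · have hb0 : ∀ r, 0 ≤ b r := by
      intro r
      obtain ⟨r', rfl⟩ := g.1.surjective r
      rw [hab, permOnV_apply]; exact h r'
    have hz : ∀ r, r ≠ u → a r = 0 ∧ b r = 0 := by
      intro r hr
      have h1 := hsum r
      rw [Finsupp.single_eq_of_ne hr] at h1
      have h2 := hb0 r
      have h3 := h r
      have h4 : 0 ≤ -c * a r := mul_nonneg (by linarith) h3
      constructor
      · have : c * a r = 0 := by linarith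
        exact (mul_eq_zero.mp this).resolve_left hne
      · linarith
    have hlin : b u • a = a u • b := by
      ext r
      by_cases hr : r = u
      · subst hr; simp [mul_comm]
      · simp [hz r hr]
    rw [ha, hb, ← map_smul, ← map_smul] at hlin
    have h2 := (B.rep w⁻¹).injective hlin
    have h3 := DFunLike.congr_fun h2 t
    simp [hs] at h3
    have : a = 0 := by
      ext r
      by_cases hr : r = u
      · subst hr; simpa [ha] using h3.symm
      · simp [hz r hr]
    exact ne_zero_of_mem_roots haR this
  · have hb0 : ∀ r, b r ≤ 0 := by
      intro r
      obtain ⟨r', rfl⟩ := g.1.surjective r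
      rw [hab, permOnV_apply]; exact h r'
    have h1 := hsum u
    rw [Finsupp.single_eq_same] at h1
    have h2 := hb0 u
    have h3 := h u
    nlinarith

/-- Roots have orthogonal `G`-orbits. -/
def OrthogonalOrbits (B : RootPrebasis M) (G : Subgroup M.symmetryGroup) : Prop :=
  ∀ β φ, B.IsRootPair β φ → ∀ g ∈ G,
    permOnV (g : Equiv.Perm S) β = β ∨ φ (permOnV (g : Equiv.Perm S) β) = 0

theorem RootsFromFixed.orthogonalOrbits (hP : B.RootsFromFixed G) (hB : B.IsReducedRootBasis)
    (hG : B.IsSymmetric G) : B.OrthogonalOrbits G := by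
  have key : ∀ β φ, B.IsRootPair β φ → (∀ r, 0 ≤ β r) → ∀ g ∈ G,
      permOnV (g : Equiv.Perm S) β = β ∨ φ (permOnV (g : Equiv.Perm S) β) = 0 := by
    intro β φ h hpos g hg
    obtain ⟨w, hw, u, rfl⟩ := hP β ⟨h.mem_roots, hpos⟩
    have e : φ = B.form u ∘ₗ (B.rep w⁻¹ : (S →₀ ℝ) →ₗ[ℝ] (S →₀ ℝ)) :=
      hB.coroot_unique h ((isRootPair_simple u).rep w)
    rw [← hG.rep_fixed hg hw, permOnV_single]
    by_cases hu : g.1 u = u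
    · left; rw [hu]
    · right
      rw [e]
      change B.form u (B.rep w⁻¹ (B.rep w _)) = 0
      rw [rep_inv_rep]
      exact hP.form_orbit_eq_zero hB hG hg hu
  intro β φ h g hg
  rcases hB.nonneg_or_nonpos h.mem_roots with hp | hp
  · exact key β φ h hp g hg
  · have := key _ _ h.neg (fun r => by simpa using hp r) g hg
    simpa using this

/-- If `φ_s(α_t) φ_t(α_s) = 1`, then `σ_s` and `σ_t` satisfy the braid relation of length three. -/
theorem eq_three_of_form_mul_eq_one {s t : S} (hst : s ≠ t)
    (h : B.form s (Finsupp.single t 1) * B.form t (Finsupp.single s 1) = 1) : M s t = 3 := by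
  set a := B.form s (Finsupp.single t 1) with ha
  set b := B.form t (Finsupp.single s 1) with hb
  have braid : ∀ v, B.refl s (B.refl t (B.refl s v)) = B.refl t (B.refl s (B.refl t v)) := by
    intro v
    simp only [refl_apply, map_sub, map_smul, ← ha, ← hb, B.form_self]
    match_scalars
    · ring
    · linear_combination -B.form s v * h
    · linear_combination B.form t v * h
  have inv : ∀ s v, B.refl s (B.refl s v) = v := fun s v =>
    Module.involutive_reflection (B.form_self s) v
  have hd : M s t ∣ 3 := by
    rw [← B.order_eq s t]
    apply orderOf_dvd_of_pow_eq_one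
    ext1 v
    change B.refl s (B.refl t (B.refl s (B.refl t (B.refl s (B.refl t v))))) = v
    rw [braid, inv, inv, inv]
  have := M.off_diagonal s t hst
  rcases (Nat.dvd_prime Nat.prime_three).mp hd with h | h
  · exact absurd h this
  · exact h

section Rank2

variable (hB : B.IsReducedRootBasis) {s t : S} (hst : s ≠ t)
include hB hst

theorem form_eq_zero_of_eq_two (h2 : M s t = 2) : B.form s (Finsupp.single t 1) = 0 := by
  by_contra hne
  set a := B.form s (Finsupp.single t 1) with ha
  set b := B.form t (Finsupp.single s 1) with hb
  have ho := B.order_eq s t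
  rw [h2] at ho
  have h := pow_orderOf_eq_one (Module.reflection (B.form_self s) * Module.reflection (B.form_self t))
  rw [ho, pow_two] at h
  have h3 := LinearEquiv.congr_fun h (Finsupp.single s 1)
  simp only [LinearEquiv.mul_apply, Module.reflection_apply, map_sub, map_smul, ← ha, ← hb,
    B.form_self, LinearEquiv.coe_one, id] at h3
  have h4 := DFunLike.congr_fun h3 t
  have h5 := DFunLike.congr_fun h3 s
  simp [hst, Ne.symm hst] at h4 h5
  have hb0 : b ≠ 0 := fun h => hne (hB.form_eq_zero_symm h)
  have hab : a * b ≠ 0 := mul_ne_zero hne hb0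
  have h6 : b * (a * b - 2) = 0 := by linarith
  have h7 := (mul_eq_zero.mp h6).resolve_left hb0
  nlinarith

theorem eq_two_of_form_eq_zero (h : B.form s (Finsupp.single t 1) = 0) : M s t = 2 := by
  have h' := hB.form_eq_zero_symm h
  have hd : M s t ∣ 2 := by
    rw [← B.order_eq s t]
    apply orderOf_dvd_of_pow_eq_one
    ext1 v
    simp only [pow_two, LinearEquiv.mul_apply, Module.reflection_apply, map_sub, map_smul, h, h',
      B.form_self, LinearEquiv.coe_one, id]
    module
  have := M.off_diagonal s t hst
  rcases (Nat.dvd_prime Nat.prime_two).mp hd with h | h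
  · exact absurd h this
  · exact h

/-- If `φ_s(α_t) φ_t(α_s) = 1`, then both factors are `-1`, because `σ_t σ_s(α_t)` is a multiple of
`α_s` and the root basis is reduced. -/
theorem form_eq_neg_one_of_mul_eq_one
    (h : B.form s (Finsupp.single t 1) * B.form t (Finsupp.single s 1) = 1) :
    B.form s (Finsupp.single t 1) = -1 := by
  have h1 := rep_mem_roots (rep_mem_roots (simple_mem_roots t) (M.gen s)) (M.gen t) (B := B)
  have e : B.rep (M.gen t) (B.rep (M.gen s) (Finsupp.single t 1)) =
      (-B.form s (Finsupp.single t 1)) • Finsupp.single s 1 := by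
    simp only [rep_gen, refl_apply, map_sub, map_smul, B.form_self]
    match_scalars
    · linear_combination h
    · ring
  rw [e] at h1
  have h2 := (hB.reduced s).subset ⟨⟨_, rfl⟩, h1⟩
  have h3 := hB.form_nonpos hst
  rcases h2 with h2 | h2
  · have := DFunLike.congr_fun h2 s
    simp at this; linarith
  · have := DFunLike.congr_fun h2 s
    simp at this; linarith

/-- The root `σ_s σ_t(α_s)` has a positive coordinate at `t`, so that its coordinate
`φ_s(α_t) φ_t(α_s) - 1` at `s` is nonnegative. -/
theorem one_le_form_mul (h : B.form s (Finsupp.single t 1) ≠ 0) :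
    1 ≤ B.form s (Finsupp.single t 1) * B.form t (Finsupp.single s 1) := by
  have h1 := rep_mem_roots (rep_mem_roots (simple_mem_roots s) (M.gen t)) (M.gen s) (B := B)
  have hb : B.form t (Finsupp.single s 1) ≠ 0 := fun h' => h (hB.form_eq_zero_symm h')
  have hb' : B.form t (Finsupp.single s 1) < 0 := lt_of_le_of_ne (hB.form_nonpos hst.symm) hb
  set a := B.form s (Finsupp.single t 1)
  set b := B.form t (Finsupp.single s 1)
  have e : B.rep (M.gen s) (B.rep (M.gen t) (Finsupp.single s 1)) =
      (a * b - 1) • Finsupp.single s 1 - b • Finsupp.single t 1 := by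
    simp only [rep_gen, refl_apply, map_sub, map_smul, B.form_self]
    module
  rw [e] at h1
  have h2 := hB.nonneg_of_pos h1 (r := t) (by simp [hst.symm, hb']) s
  simp [hst] at h2
  linarith

/-- The root `σ_t σ_s σ_t(α_s)` has the positive coordinate `φ_s(α_t) φ_t(α_s) - 1` at `s`, so that
its coordinate at `t`, a positive multiple of `φ_s(α_t) φ_t(α_s) - 2`, is nonnegative. -/
theorem two_le_form_mul (h : B.form s (Finsupp.single t 1) ≠ 0)
    (h1 : B.form s (Finsupp.single t 1) * B.form t (Finsupp.single s 1) ≠ 1) :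
    2 ≤ B.form s (Finsupp.single t 1) * B.form t (Finsupp.single s 1) := by
  have h0 := one_le_form_mul hB hst h
  have hr := rep_mem_roots (rep_mem_roots (rep_mem_roots (simple_mem_roots s) (M.gen t))
    (M.gen s)) (M.gen t) (B := B)
  have hb : B.form t (Finsupp.single s 1) ≠ 0 := fun h' => h (hB.form_eq_zero_symm h')
  have hb' : B.form t (Finsupp.single s 1) < 0 := lt_of_le_of_ne (hB.form_nonpos hst.symm) hb
  set a := B.form s (Finsupp.single t 1)
  set b := B.form t (Finsupp.single s 1)
  have h0' : 1 < a * b := lt_of_le_of_ne h0 (Ne.symm h1)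
  have e : B.rep (M.gen t) (B.rep (M.gen s) (B.rep (M.gen t) (Finsupp.single s 1))) =
      (a * b - 1) • Finsupp.single s 1 + (-b * (a * b - 2)) • Finsupp.single t 1 := by
    simp only [rep_gen, refl_apply, map_sub, map_smul, B.form_self]
    module
  rw [e] at hr
  have h2 := hB.nonneg_of_pos hr (r := s) (by simp [hst]; linarith) t
  simp [hst.symm] at h2
  nlinarith

end Rank2

end RootPrebasis

end

noncomputable section

/-! ### The graph is simply laced -/

open CoxeterSystem

namespace RootPrebasis

variable {S : Type*} {M : CoxeterMatrix S} {B : RootPrebasis M} {G : Subgroup M.symmetryGroup}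

theorem form_eq_sum (y : S) (θ : S →₀ ℝ) :
    B.form y θ = θ.sum fun v c => c * B.form y (Finsupp.single v 1) := by
  conv_lhs => rw [← Finsupp.sum_single θ]
  rw [Finsupp.sum, map_sum, Finsupp.sum]
  refine Finset.sum_congr rfl fun v _ => ?_
  rw [← mul_one (θ v), ← smul_eq_mul, ← Finsupp.smul_single, map_smul]
  simp

/-- A root and its coroot, with nonnegative coordinates `θ` with respect to the `α_s` and `θ'`
with respect to the `φ_s`. -/
structure IsPosPair (B : RootPrebasis M) (θ θ' : S →₀ ℝ) : Prop where
  pair : B.IsRootPair θ (Finsupp.linearCombination ℝ B.form θ')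
  nonneg : ∀ s, 0 ≤ θ s
  nonneg' : ∀ s, 0 ≤ θ' s

theorem isPosPair_simple (s : S) :
    B.IsPosPair (Finsupp.single s 1) (Finsupp.single s 1) where
  pair := by simpa using isRootPair_simple s
  nonneg t := by classical rw [Finsupp.single_apply]; split_ifs <;> norm_num
  nonneg' t := by classical rw [Finsupp.single_apply]; split_ifs <;> norm_num

theorem linearCombination_form_apply (θ' : S →₀ ℝ) (y : S) :
    Finsupp.linearCombination ℝ B.form θ' (Finsupp.single y 1) =
      θ'.sum fun v c => c * B.form v (Finsupp.single y 1) := by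
  rw [Finsupp.linearCombination_apply, Finsupp.sum, LinearMap.sum_apply]
  rfl

namespace IsReducedRootBasis

variable (hB : B.IsReducedRootBasis)
include hB

/-- Outside the support of a nonnegative vector `θ`, the value `φ_y(θ)` is a sum of nonpositive
terms, hence at most the term at `p`. -/
theorem form_le {θ : S →₀ ℝ} (hθ : ∀ s, 0 ≤ θ s) {y : S} (hy : θ y = 0) (p : S) :
    B.form y θ ≤ θ p * B.form y (Finsupp.single p 1) := by
  classical
  rw [form_eq_sum]
  have h : ∀ v, θ v * B.form y (Finsupp.single v 1) ≤ 0 := by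
    intro v
    by_cases hv : y = v
    · subst hv; simp [hy]
    · exact mul_nonpos_of_nonneg_of_nonpos (hθ v) (hB.form_nonpos hv)
  by_cases hp : p ∈ θ.support
  · rw [Finsupp.sum, ← Finset.add_sum_erase _ _ hp]
    have := Finset.sum_nonpos fun v (_ : v ∈ θ.support.erase p) => h v
    linarith
  · rw [Finsupp.notMem_support_iff.mp hp, zero_mul]
    exact Finset.sum_nonpos fun v _ => h v

theorem coform_le {θ' : S →₀ ℝ} (hθ : ∀ s, 0 ≤ θ' s) {y : S} (hy : θ' y = 0) (p : S) :
    Finsupp.linearCombination ℝ B.form θ' (Finsupp.single y 1) ≤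
      θ' p * B.form p (Finsupp.single y 1) := by
  classical
  rw [linearCombination_form_apply]
  have h : ∀ v, θ' v * B.form v (Finsupp.single y 1) ≤ 0 := by
    intro v
    by_cases hv : v = y
    · subst hv; simp [hy]
    · exact mul_nonpos_of_nonneg_of_nonpos (hθ v) (hB.form_nonpos hv)
  by_cases hp : p ∈ θ'.support
  · rw [Finsupp.sum, ← Finset.add_sum_erase _ _ hp]
    have := Finset.sum_nonpos fun v (_ : v ∈ θ'.support.erase p) => h v
    linarith
  · rw [Finsupp.notMem_support_iff.mp hp, zero_mul]
    exact Finset.sum_nonpos fun v _ => h v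

/-- Reflecting a positive root in commuting simple roots outside its support. -/
theorem isPosPair_extend {θ θ' : S →₀ ℝ} (h : B.IsPosPair θ θ') (P : Finset S)
    (hP : ∀ q ∈ P, ∀ r ∈ P, q ≠ r → B.form q (Finsupp.single r 1) = 0)
    (h1 : ∀ q ∈ P, θ q = 0) (h2 : ∀ q ∈ P, θ' q = 0) :
    B.IsPosPair (θ - ∑ q ∈ P, B.form q θ • Finsupp.single q 1)
      (θ' - ∑ q ∈ P, Finsupp.linearCombination ℝ B.form θ' (Finsupp.single q 1) •
        Finsupp.single q 1) := by
  classical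
  induction P using Finset.induction_on with
  | empty => simpa using h
  | insert q P hq ih =>
    have ih := ih (fun a ha b hb => hP a (by simp [ha]) b (by simp [hb]))
      (fun a ha => h1 a (by simp [ha])) (fun a ha => h2 a (by simp [ha]))
    have e1 : B.form q (θ - ∑ r ∈ P, B.form r θ • Finsupp.single r 1) = B.form q θ := by
      rw [map_sub, map_sum, Finset.sum_eq_zero, sub_zero]
      intro r hr
      rw [map_smul, hP q (by simp) r (by simp [hr]) (by rintro rfl; exact hq hr), smul_zero]
    have e2 : Finsupp.linearCombination ℝ B.form (θ' - ∑ r ∈ P,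
        Finsupp.linearCombination ℝ B.form θ' (Finsupp.single r 1) • Finsupp.single r 1)
        (Finsupp.single q 1) = Finsupp.linearCombination ℝ B.form θ' (Finsupp.single q 1) := by
      rw [map_sub, map_sum, LinearMap.sub_apply, LinearMap.sum_apply, Finset.sum_eq_zero, sub_zero]
      intro r hr
      rw [map_smul, Finsupp.linearCombination_single, one_smul, LinearMap.smul_apply,
        hP r (by simp [hr]) q (by simp) (by rintro rfl; exact hq hr), smul_zero]
    have hr := ih.pair.refl q
    rw [e1, e2] at hr
    refine ⟨?_, fun t => ?_, fun t => ?_⟩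
    · convert hr using 1
      · rw [Finset.sum_insert hq]; abel
      · rw [Finset.sum_insert hq, ← sub_sub, sub_right_comm, map_sub, map_smul,
          Finsupp.linearCombination_single, one_smul]
    · rw [Finset.sum_insert hq, add_comm, ← sub_sub, Finsupp.sub_apply, Finsupp.smul_apply,
        Finsupp.single_apply, smul_eq_mul]
      have h3 := ih.nonneg t
      split_ifs
      · have := hB.form_le h.nonneg (h1 q (by simp)) q
        rw [h1 q (by simp), zero_mul] at this
        linarith
      · linarith
    · rw [Finset.sum_insert hq, add_comm, ← sub_sub, Finsupp.sub_apply, Finsupp.smul_apply,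
        Finsupp.single_apply, smul_eq_mul]
      have h3 := ih.nonneg' t
      split_ifs
      · have := hB.coform_le h.nonneg' (h2 q (by simp)) q
        rw [h2 q (by simp), zero_mul] at this
        linarith
      · linarith

end IsReducedRootBasis

theorem OrthogonalOrbits.form_eq_zero (hQ : B.OrthogonalOrbits G) {g : M.symmetryGroup}
    (hg : g ∈ G) {s : S} (hs : g.1 s ≠ s) : B.form s (Finsupp.single (g.1 s) 1) = 0 := by
  have h := hQ _ _ (isRootPair_simple s) g hg
  rw [permOnV_single] at h
  refine h.resolve_left fun h => hs ?_
  exact Finsupp.single_left_injective one_ne_zero h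

/-- If `θ` is a root fixed by `g` and `y` is a vertex moved by `g`, then the root `σ_y(θ)` is
orthogonal to its image under `g` (or fixed), which bounds `φ_y(θ) ϑ(α_y)`. -/
theorem OrthogonalOrbits.fixed_mul (hQ : B.OrthogonalOrbits G) (hB : B.IsReducedRootBasis)
    (hG : B.IsSymmetric G) {g : M.symmetryGroup} (hg : g ∈ G) {θ : S →₀ ℝ}
    {φ : Module.Dual ℝ (S →₀ ℝ)} (h : B.IsRootPair θ φ) (hθ : permOnV g.1 θ = θ) {y : S}
    (hy : g.1 y ≠ y) :
    B.form y θ * φ (Finsupp.single y 1) = 0 ∨ B.form y θ * φ (Finsupp.single y 1) = 1 := by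
  have e1 : B.form (g.1 y) θ = B.form y θ := by
    conv_lhs => rw [← hθ]
    exact hG.form_apply hg y θ
  have e2 : φ (Finsupp.single (g.1 y) 1) = φ (Finsupp.single y 1) := by
    have h' := h.perm hG hg
    rw [hθ] at h'
    have := LinearMap.congr_fun (hB.coroot_unique h h') (Finsupp.single (g.1 y) 1)
    rw [this, ← permOnV_single]
    change φ ((permOnV g.1).symm (permOnV g.1 _)) = _
    rw [LinearEquiv.symm_apply_apply]
  have e3 := hQ.form_eq_zero hg hy
  rcases hQ _ _ (h.refl y) g hg with h1 | h1
  · left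
    rw [map_sub, map_smul, permOnV_single, hθ, sub_right_inj] at h1
    have := DFunLike.congr_fun h1 y
    simp [hy] at this
    rw [← this, zero_mul]
  · right
    rw [map_sub, map_smul, permOnV_single, hθ] at h1
    simp only [map_sub, map_smul, LinearMap.sub_apply, LinearMap.smul_apply, h.apply_self, e2, e3,
      smul_eq_mul] at h1
    linarith

/-- `s` and `t` are adjacent exactly if `φ_s(α_t) ≠ 0`. -/
theorem IsReducedRootBasis.adj_iff (hB : B.IsReducedRootBasis) {s t : S} :
    M.coxeterGraph.Adj s t ↔ s ≠ t ∧ B.form s (Finsupp.single t 1) ≠ 0 := by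
  constructor
  · exact fun h => ⟨h.1, fun h' => h.2 (eq_two_of_form_eq_zero hB h.1 h')⟩
  · exact fun h => ⟨h.1, fun h' => h.2 (form_eq_zero_of_eq_two hB h.1 h')⟩

theorem adj_symm_iff (g : M.symmetryGroup) (s t : S) :
    M.coxeterGraph.Adj (g.1 s) (g.1 t) ↔ M.coxeterGraph.Adj s t := by
  change (_ ∧ _) ↔ (_ ∧ _)
  rw [g.2 s t, g.1.injective.ne_iff]

/-- A symmetry as an automorphism of the underlying graph. -/
def symmIso (g : M.symmetryGroup) : M.coxeterGraph ≃g M.coxeterGraph :=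
  ⟨g.1, adj_symm_iff g _ _⟩

theorem dist_symm (hconn : M.coxeterGraph.Connected) (g : M.symmetryGroup) (s t : S) :
    M.coxeterGraph.dist (g.1 s) (g.1 t) = M.coxeterGraph.dist s t := by
  have key : ∀ (g : M.symmetryGroup) s t,
      M.coxeterGraph.dist (g.1 s) (g.1 t) ≤ M.coxeterGraph.dist s t := by
    intro g s t
    obtain ⟨p, hp⟩ := hconn.exists_walk_length_eq_dist s t
    rw [← hp, ← SimpleGraph.Walk.length_map (symmIso g).toHom p]
    exact SimpleGraph.dist_le _
  refine le_antisymm (key g s t) ?_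
  have := key g⁻¹ (g.1 s) (g.1 t)
  simpa using this

theorem exists_adj_dist (hconn : M.coxeterGraph.Connected) {s p : S} {k : ℕ}
    (h : M.coxeterGraph.dist s p = k + 1) :
    ∃ q, M.coxeterGraph.Adj q p ∧ M.coxeterGraph.dist s q = k := by
  obtain ⟨w, hw⟩ := hconn.exists_walk_length_eq_dist p s
  rw [SimpleGraph.dist_comm, h] at hw
  cases w with
  | nil => simp at hw
  | cons hadj w' =>
    rename_i q
    refine ⟨q, hadj.symm, ?_⟩
    have h1 : M.coxeterGraph.dist s q ≤ k := by
      rw [SimpleGraph.dist_comm]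
      refine (SimpleGraph.dist_le w').trans ?_
      simpa using hw.le
    have h2 := hconn.dist_triangle (u := s) (v := q) (w := p)
    have h3 : M.coxeterGraph.dist q p = 1 := SimpleGraph.dist_eq_one_iff_adj.mpr hadj.symm
    omega

/-- A positive root whose support consists of vertices on geodesics from `s` to `p`, and contains
both ends. -/
theorem exists_geodesic_root (hB : B.IsReducedRootBasis) (hconn : M.coxeterGraph.Connected)
    (s : S) (k : ℕ) (p : S) (hp : M.coxeterGraph.dist s p = k) :
    ∃ θ θ', B.IsPosPair θ θ' ∧ 0 < θ s ∧ 0 < θ' p ∧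
      ∀ v, θ v ≠ 0 ∨ θ' v ≠ 0 → M.coxeterGraph.dist s v + M.coxeterGraph.dist v p ≤ k := by
  classical
  induction k generalizing p with
  | zero =>
    obtain rfl : s = p := hconn.dist_eq_zero_iff.mp hp
    refine ⟨_, _, isPosPair_simple s, by simp, by simp, fun v hv => ?_⟩
    obtain rfl : v = s := by
      by_contra h; simp [h] at hv
    simp
  | succ k ih =>
    obtain ⟨q, hqp, hq⟩ := exists_adj_dist hconn hp
    obtain ⟨θ, θ', h, hs, hq', hsupp⟩ := ih q hq
    have hps : p ≠ s := by rintro rfl; simp at hp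
    have hp0 : θ p = 0 ∧ θ' p = 0 := by
      constructor
      · by_contra h0
        have := hsupp p (Or.inl h0)
        omega
      · by_contra h0
        have := hsupp p (Or.inr h0)
        omega
    have hext := hB.isPosPair_extend h {p} (by simp) (by simp [hp0]) (by simp [hp0])
    rw [Finset.sum_singleton, Finset.sum_singleton] at hext
    have hlt : Finsupp.linearCombination ℝ B.form θ' (Finsupp.single p 1) < 0 := by
      have h1 := hB.coform_le h.nonneg' hp0.2 q
      have h2 := hB.adj_iff.mp hqp
      have h3 := lt_of_le_of_ne (hB.form_nonpos h2.1) h2.2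
      nlinarith
    refine ⟨_, _, hext, ?_, ?_, fun v hv => ?_⟩
    · simpa [hps.symm] using hs
    · simpa [hp0] using hlt
    · by_cases hvp : v = p
      · subst hvp; simp [hp]
      · have := hsupp v (by simpa [hvp] using hv)
        have h1 := hconn.dist_triangle (u := v) (v := q) (w := p)
        have h3 : M.coxeterGraph.dist q p = 1 := SimpleGraph.dist_eq_one_iff_adj.mpr hqp
        omega

/-- Every symmetry in `G` has a fixed vertex: otherwise take `y` with `d(y, g(y))` minimal and a
root `β` supported on a geodesic from `y` to the vertex before `g(y)`; then `β` and `g(β)` have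
disjoint supports joined by an edge. -/
theorem OrthogonalOrbits.exists_fixed (hQ : B.OrthogonalOrbits G) (hB : B.IsReducedRootBasis)
    (hconn : M.coxeterGraph.Connected) {g : M.symmetryGroup}
    (hg : g ∈ G) : ∃ x, g.1 x = x := by
  classical
  by_contra! hne
  have hnon : Nonempty S := hconn.nonempty
  obtain ⟨y, hy⟩ : ∃ y, ∀ v, M.coxeterGraph.dist y (g.1 y) ≤ M.coxeterGraph.dist v (g.1 v) :=
    ⟨Function.argmin (fun v => M.coxeterGraph.dist v (g.1 v)),
      fun v => Function.argmin_le (fun v => M.coxeterGraph.dist v (g.1 v)) v⟩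
  obtain ⟨k, hk⟩ : ∃ k, M.coxeterGraph.dist y (g.1 y) = k + 1 := by
    have := hconn.pos_dist_of_ne (Ne.symm (hne y))
    exact ⟨_, (Nat.succ_pred_eq_of_pos this).symm⟩
  obtain ⟨q, hqy, hq⟩ := exists_adj_dist hconn hk
  obtain ⟨θ, θ', h, hs, hq', hsupp⟩ := exists_geodesic_root hB hconn y k q hq
  have hdisj : ∀ u v, (θ u ≠ 0 ∨ θ' u ≠ 0) → (θ v ≠ 0 ∨ θ' v ≠ 0) → v ≠ g.1 u := by
    rintro u v hu hv rfl
    have h1 := hsupp _ hu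
    have h2 := hsupp _ hv
    have h3 := hy u
    have h4 := hconn.dist_triangle (u := u) (v := y) (w := g.1 u)
    have h5 := hconn.dist_triangle (u := u) (v := q) (w := g.1 u)
    rw [M.coxeterGraph.dist_comm (u := u) (v := y)] at h4
    rw [M.coxeterGraph.dist_comm (u := q)] at h5
    omega
  rcases hQ _ _ h.pair g hg with h1 | h1
  · have h2 := DFunLike.congr_fun h1 (g.1 y)
    rw [permOnV_apply] at h2
    exact hdisj y (g.1 y) (Or.inl hs.ne') (Or.inl (h2 ▸ hs.ne')) rfl
  · have hlt : Finsupp.linearCombination ℝ B.form θ' (permOnV g.1 θ) < 0 := by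
      rw [Finsupp.linearCombination_apply, Finsupp.sum, LinearMap.sum_apply]
      have hnn : ∀ v, 0 ≤ permOnV g.1 θ v := by
        intro v
        obtain ⟨u, rfl⟩ := g.1.surjective v
        rw [permOnV_apply]; exact h.nonneg u
      have hz : ∀ v ∈ θ'.support, permOnV g.1 θ v = 0 := by
        intro v hv
        by_contra h0
        obtain ⟨u, rfl⟩ := g.1.surjective v
        rw [permOnV_apply] at h0
        exact hdisj u (g.1 u) (Or.inl h0) (Or.inr (Finsupp.mem_support_iff.mp hv)) rfl
      refine Finset.sum_neg' (fun v hv => ?_) ⟨q, Finsupp.mem_support_iff.mpr hq'.ne', ?_⟩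
      · have := hB.form_le hnn (hz v hv) v
        rw [hz v hv, zero_mul] at this
        exact mul_nonpos_of_nonneg_of_nonpos (h.nonneg' v) this
      · have := hB.form_le hnn (hz q (Finsupp.mem_support_iff.mpr hq'.ne')) (g.1 y)
        rw [permOnV_apply] at this
        have h2 := hB.adj_iff.mp hqy
        have h3 := lt_of_le_of_ne (hB.form_nonpos h2.1) h2.2
        exact mul_neg_of_pos_of_neg hq' (this.trans_lt (mul_neg_of_pos_of_neg hs h3))
    exact hlt.ne h1

end RootPrebasis

end

noncomputable section

open CoxeterSystem

namespace RootPrebasis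

variable {S : Type*} {M : CoxeterMatrix S} {B : RootPrebasis M} {G : Subgroup M.symmetryGroup}

theorem zpow_orbit_finite (hfin : ∀ s : S, (MulAction.orbit G s).Finite) {g : M.symmetryGroup}
    (hg : g ∈ G) (p : S) : {v : S | ∃ i : ℤ, v = (g ^ i).1 p}.Finite := by
  refine (hfin p).subset ?_
  rintro _ ⟨i, rfl⟩
  exact ⟨⟨g ^ i, zpow_mem hg i⟩, rfl⟩

/-- Starting from a root supported on two fixed vertices `s`, `t`, the orbits of `g` on the
vertices of a geodesic issuing from `s` can be added one after the other; this gives roots fixed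
by `g` such that the product of a coordinate with the dual coordinate does not decrease. -/
theorem exists_layered_root (hQ : B.OrthogonalOrbits G) (hB : B.IsReducedRootBasis)
    (hG : B.IsSymmetric G) (hconn : M.coxeterGraph.Connected)
    (hfin : ∀ s : S, (MulAction.orbit G s).Finite) {g : M.symmetryGroup} (hg : g ∈ G)
    {s t : S} (hs : g.1 s = s) (ht : g.1 t = t) {θ₀ θ₀' : S →₀ ℝ} (h₀ : B.IsPosPair θ₀ θ₀')
    (hfix : permOnV g.1 θ₀ = θ₀) (hsupp₀ : ∀ v, θ₀ v ≠ 0 ∨ θ₀' v ≠ 0 → v = s ∨ v = t)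
    {N : ℝ} (hN₀ : N ≤ θ₀ s * θ₀' s) (k : ℕ) (p : S)
    (hp : M.coxeterGraph.dist s p = k) (hp' : k ≤ M.coxeterGraph.dist t p) :
    ∃ θ θ', B.IsPosPair θ θ' ∧ permOnV g.1 θ = θ ∧ N ≤ θ p * θ' p ∧
      ∀ v, θ v ≠ 0 ∨ θ' v ≠ 0 → v = s ∨ v = t ∨ M.coxeterGraph.dist s v < k ∨
        M.coxeterGraph.dist t v < k ∨ ∃ i : ℤ, v = (g ^ i).1 p := by
  classical
  induction k generalizing p with
  | zero =>
    obtain rfl : s = p := hconn.dist_eq_zero_iff.mp hp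
    exact ⟨θ₀, θ₀', h₀, hfix, hN₀, fun v hv => (hsupp₀ v hv).imp id Or.inl⟩
  | succ k ih =>
    obtain ⟨q, hqp, hq⟩ := exists_adj_dist hconn hp
    have hqp1 : M.coxeterGraph.dist q p = 1 := SimpleGraph.dist_eq_one_iff_adj.mpr hqp
    have hq' : k ≤ M.coxeterGraph.dist t q := by
      have := hconn.dist_triangle (u := t) (v := q) (w := p)
      omega
    obtain ⟨θ, θ', h, hθ, hNq, hsupp⟩ := ih q hq hq'
    have hzs : ∀ i : ℤ, (g ^ i).1 s = s := fun i => by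
      rw [Subgroup.coe_zpow, Equiv.Perm.zpow_apply_eq_self_of_apply_eq_self hs]
    have hzt : ∀ i : ℤ, (g ^ i).1 t = t := fun i => by
      rw [Subgroup.coe_zpow, Equiv.Perm.zpow_apply_eq_self_of_apply_eq_self ht]
    have hds : ∀ (i : ℤ) v, M.coxeterGraph.dist s ((g ^ i).1 v) = M.coxeterGraph.dist s v := by
      intro i v
      conv_lhs => rw [← hzs i]
      exact dist_symm hconn _ _ _
    have hdt : ∀ (i : ℤ) v, M.coxeterGraph.dist t ((g ^ i).1 v) = M.coxeterGraph.dist t v := by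
      intro i v
      conv_lhs => rw [← hzt i]
      exact dist_symm hconn _ _ _
    set P := (zpow_orbit_finite hfin hg p).toFinset with hPdef
    have hP : ∀ r, r ∈ P ↔ ∃ i : ℤ, r = (g ^ i).1 p := fun r => by simp [hPdef]
    have hpP : p ∈ P := (hP p).mpr ⟨0, by simp⟩
    have hP0 : ∀ r ∈ P, ¬ (θ r ≠ 0 ∨ θ' r ≠ 0) := by
      intro r hr hne
      obtain ⟨i, rfl⟩ := (hP r).mp hr
      have e1 := hds i p
      have e2 := hdt i p
      rcases hsupp _ hne with h | h | h | h | ⟨j, h⟩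
      · rw [h] at e1; simp at e1; omega
      · rw [h] at e2; simp at e2; omega
      · omega
      · omega
      · rw [h, hds] at e1
        omega
    have hPorth : ∀ a ∈ P, ∀ b ∈ P, a ≠ b → B.form a (Finsupp.single b 1) = 0 := by
      intro a ha b hb hab
      obtain ⟨i, rfl⟩ := (hP a).mp ha
      obtain ⟨j, rfl⟩ := (hP b).mp hb
      have e : (g ^ j).1 p = (g ^ (j - i)).1 ((g ^ i).1 p) := by
        rw [← Equiv.Perm.mul_apply, ← Subgroup.coe_mul, ← zpow_add, sub_add_cancel]
      rw [e] at hab ⊢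
      exact hQ.form_eq_zero (zpow_mem hg _) hab.symm
    have hPθ : ∀ r ∈ P, θ r = 0 := fun r hr => by
      by_contra h0; exact hP0 r hr (Or.inl h0)
    have hPθ' : ∀ r ∈ P, θ' r = 0 := fun r hr => by
      by_contra h0; exact hP0 r hr (Or.inr h0)
    have hext := hB.isPosPair_extend h P hPorth hPθ hPθ'
    have hval : ∀ (c : S → ℝ) v, (∑ r ∈ P, c r • Finsupp.single r (1 : ℝ)) v =
        if v ∈ P then c v else 0 := by
      intro c v
      rw [Finsupp.finsetSum_apply]
      simp [Finsupp.single_apply]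
    refine ⟨_, _, hext, ?_, ?_, fun v hv => ?_⟩
    · rw [map_sub, hθ, map_sum]
      congr 1
      refine Finset.sum_equiv g.1 (fun r => ?_) fun r hr => ?_
      · rw [hP, hP]
        constructor
        · rintro ⟨i, rfl⟩
          exact ⟨1 + i, by rw [zpow_add, zpow_one]; rfl⟩
        · rintro ⟨i, hi⟩
          refine ⟨-1 + i, ?_⟩
          rw [zpow_add, zpow_neg, zpow_one]
          change r = (g⁻¹).1 ((g ^ i).1 p)
          rw [← hi]; simp
      · rw [map_smul, permOnV_single]
        congr 1
        conv_rhs => rw [← hθ]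
        rw [hG.form_apply hg]
    · rw [Finsupp.sub_apply, Finsupp.sub_apply, hval, hval, if_pos hpP, if_pos hpP,
        hPθ p hpP, hPθ' p hpP, zero_sub, zero_sub]
      have h1 := hB.form_le h.nonneg (hPθ p hpP) q
      have h2 := hB.coform_le h.nonneg' (hPθ' p hpP) q
      have h3 := hB.adj_iff.mp hqp
      have h4 := one_le_form_mul hB h3.1 h3.2
      have h5 := hB.form_nonpos h3.1
      have h6 := hB.form_nonpos h3.1.symm
      have h7 := h.nonneg q
      have h8 := h.nonneg' q
      calc N ≤ θ q * θ' q := hNq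
        _ ≤ (θ q * θ' q) * (B.form q (Finsupp.single p 1) * B.form p (Finsupp.single q 1)) :=
          le_mul_of_one_le_right (mul_nonneg h7 h8) h4
        _ = (-(θ q * B.form p (Finsupp.single q 1))) * (-(θ' q * B.form q (Finsupp.single p 1))) := by
          ring
        _ ≤ _ := mul_le_mul (by linarith) (by linarith)
          (by have := mul_nonpos_of_nonneg_of_nonpos h8 h5; linarith)
          (by have := mul_nonpos_of_nonneg_of_nonpos h7 h6; linarith)
    · rw [Finsupp.sub_apply, Finsupp.sub_apply, hval, hval] at hv
      by_cases hvP : v ∈ P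
      · exact Or.inr (Or.inr (Or.inr (Or.inr ((hP v).mp hvP))))
      · rw [if_neg hvP, if_neg hvP, sub_zero, sub_zero] at hv
        rcases hsupp v hv with h | h | h | h | ⟨j, rfl⟩
        · exact Or.inl h
        · exact Or.inr (Or.inl h)
        · exact Or.inr (Or.inr (Or.inl (by omega)))
        · exact Or.inr (Or.inr (Or.inr (Or.inl (by omega))))
        · exact Or.inr (Or.inr (Or.inl (by rw [hds]; omega)))

/-- The bound on the label of an edge between a vertex at the end of a layered root and a moved
vertex. -/
theorem layered_bound (hQ : B.OrthogonalOrbits G) (hB : B.IsReducedRootBasis)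
    (hG : B.IsSymmetric G) (hconn : M.coxeterGraph.Connected)
    (hfin : ∀ s : S, (MulAction.orbit G s).Finite) {g : M.symmetryGroup} (hg : g ∈ G)
    {s t : S} (hs : g.1 s = s) (ht : g.1 t = t) {θ₀ θ₀' : S →₀ ℝ} (h₀ : B.IsPosPair θ₀ θ₀')
    (hfix : permOnV g.1 θ₀ = θ₀) (hsupp₀ : ∀ v, θ₀ v ≠ 0 ∨ θ₀' v ≠ 0 → v = s ∨ v = t)
    {N : ℝ} (hN₀ : N ≤ θ₀ s * θ₀' s) {p y : S}
    (hp : M.coxeterGraph.dist s p ≤ M.coxeterGraph.dist t p)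
    (hy : M.coxeterGraph.dist s p ≤ M.coxeterGraph.dist s y)
    (hy' : M.coxeterGraph.dist s p ≤ M.coxeterGraph.dist t y)
    (hadj : M.coxeterGraph.Adj p y) (hmov : g.1 y ≠ y) :
    N * (B.form p (Finsupp.single y 1) * B.form y (Finsupp.single p 1)) ≤ 1 := by
  obtain ⟨θ, θ', h, hθ, hNp, hsupp⟩ := exists_layered_root hQ hB hG hconn hfin hg hs ht h₀ hfix
    hsupp₀ hN₀ _ p rfl hp
  have h3 := hB.adj_iff.mp hadj
  have hy0 : ¬ (θ y ≠ 0 ∨ θ' y ≠ 0) := by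
    intro hne
    rcases hsupp y hne with h | h | h | h | ⟨j, h⟩
    · exact hmov (h ▸ hs)
    · exact hmov (h ▸ ht)
    · omega
    · omega
    · rw [h] at h3
      exact h3.2 (hQ.form_eq_zero (zpow_mem hg j) h3.1.symm)
  push Not at hy0
  have h1 := hB.form_le h.nonneg hy0.1 p
  have h2 := hB.coform_le h.nonneg' hy0.2 p
  have h5 := hB.form_nonpos h3.1
  have h6 := hB.form_nonpos h3.1.symm
  have h7 := h.nonneg p
  have h8 := h.nonneg' p
  have h4 := one_le_form_mul hB h3.1 h3.2
  have hle : N * (B.form p (Finsupp.single y 1) * B.form y (Finsupp.single p 1)) ≤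
      B.form y θ * Finsupp.linearCombination ℝ B.form θ' (Finsupp.single y 1) := by
    calc _ ≤ (θ p * θ' p) * (B.form p (Finsupp.single y 1) * B.form y (Finsupp.single p 1)) :=
          mul_le_mul_of_nonneg_right hNp (by linarith)
      _ = (-(θ p * B.form y (Finsupp.single p 1))) * (-(θ' p * B.form p (Finsupp.single y 1))) := by
          ring
      _ ≤ (-(B.form y θ)) * (-(Finsupp.linearCombination ℝ B.form θ' (Finsupp.single y 1))) :=
          mul_le_mul (by linarith) (by linarith)
          (by have := mul_nonpos_of_nonneg_of_nonpos h8 h5; linarith)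
          (by have := mul_nonpos_of_nonneg_of_nonpos h7 h6; linarith)
      _ = _ := by ring
  rcases hQ.fixed_mul hB hG hg h.pair hθ hmov with h0 | h0 <;> linarith

/-- All edges are simple. -/
theorem OrthogonalOrbits.form_mul_eq_one (hQ : B.OrthogonalOrbits G) (hB : B.IsReducedRootBasis)
    (hG : B.IsSymmetric G) (hconn : M.coxeterGraph.Connected) (hGne : G ≠ ⊥)
    (hfin : ∀ s : S, (MulAction.orbit G s).Finite) {u v : S} (huv : M.coxeterGraph.Adj u v) :
    B.form u (Finsupp.single v 1) * B.form v (Finsupp.single u 1) = 1 := by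
  classical
  by_contra hne
  have h3 := hB.adj_iff.mp huv
  have h2 := two_le_form_mul hB h3.1 h3.2 hne
  obtain ⟨⟨g, hg⟩, hg1⟩ := Subgroup.ne_bot_iff_exists_ne_one.mp hGne
  have hsimple : ∀ x : S, g.1 x = x →
      permOnV g.1 (Finsupp.single x (1 : ℝ)) = Finsupp.single x 1 :=
    fun x hx => by rw [permOnV_single, hx]
  have hsupp : ∀ x v : S, (Finsupp.single x (1 : ℝ)) v ≠ 0 ∨ (Finsupp.single x (1 : ℝ)) v ≠ 0 →
      v = x ∨ v = x := by
    intro x v h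
    left
    by_contra hv
    simp [hv] at h
  -- an edge with a moved end at the greater distance from a fixed vertex
  have one : ∀ x p y : S, g.1 x = x → M.coxeterGraph.dist x p ≤
      M.coxeterGraph.dist x y → M.coxeterGraph.Adj p y → g.1 y ≠ y →
      B.form p (Finsupp.single y 1) * B.form y (Finsupp.single p 1) ≤ 1 := by
    intro x p y hx hd hadj hy
    have := layered_bound hQ hB hG hconn hfin hg hx hx (isPosPair_simple x) (hsimple x hx)
      (hsupp x) (N := 1) (by simp) le_rfl hd hd hadj hy
    linarith
  by_cases hu : g.1 u = u
  · by_cases hv : g.1 v = v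
    · -- both ends are fixed
      have key : ∀ s t y : S, M.coxeterGraph.Adj s t → g.1 s = s →
          g.1 t = t →
          2 ≤ B.form s (Finsupp.single t 1) * B.form t (Finsupp.single s 1) →
          g.1 y ≠ y → M.coxeterGraph.dist s y ≤ M.coxeterGraph.dist t y →
          False := by
        intro s t y hst hs ht h2 hy hle
        obtain ⟨k, hk⟩ : ∃ k, M.coxeterGraph.dist s y = k + 1 := by
          have hsy : s ≠ y := by rintro rfl; exact hy hs
          have := hconn.pos_dist_of_ne hsy
          exact ⟨_, (Nat.succ_pred_eq_of_pos this).symm⟩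
        obtain ⟨p, hpy, hp⟩ := exists_adj_dist hconn hk
        have hpy1 : M.coxeterGraph.dist p y = 1 := SimpleGraph.dist_eq_one_iff_adj.mpr hpy
        have htri := hconn.dist_triangle (u := t) (v := p) (w := y)
        have hne : t ≠ s := hst.symm.1
        have h₀ := hB.isPosPair_extend (isPosPair_simple t) {s} (by simp) (by simp [hne.symm])
          (by simp [hne.symm])
        simp only [Finset.sum_singleton, Finsupp.linearCombination_single, one_smul] at h₀
        have hb := layered_bound hQ hB hG hconn hfin hg hs ht h₀
          (by rw [map_sub, map_smul, hsimple s hs, hsimple t ht])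
          (by
            intro v hv
            by_contra! hcon
            simp [hcon] at hv)
          (N := 2)
          (by simp [hne.symm]; linarith)
          (p := p) (y := y) (by omega) (by omega) (by omega) hpy hy
        have h5 := hB.adj_iff.mp hpy
        have := one_le_form_mul hB h5.1 h5.2
        linarith
      obtain ⟨y, hy⟩ : ∃ y, g.1 y ≠ y := by
        by_contra! h
        exact hg1 (Subtype.ext (Subtype.ext (Equiv.ext h)))
      rcases le_total (M.coxeterGraph.dist u y) (M.coxeterGraph.dist v y) with h | h
      · exact key u v y huv hu hv h2 hy h
      · exact key v u y huv.symm hv hu (by linarith) hy h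
    · have := one u u v hu (by simp) huv hv
      linarith
  · by_cases hv : g.1 v = v
    · have := one v v u hv (by simp) huv.symm hu
      linarith
    · obtain ⟨x, hx⟩ := hQ.exists_fixed hB hconn hg
      rcases le_total (M.coxeterGraph.dist x u) (M.coxeterGraph.dist x v) with h | h
      · have := one x u v hx h huv hv
        linarith
      · have := one x v u hx h huv.symm hu
        linarith

/-- `M` is simply laced, that is, all labels of its graph are `3`. -/
def _root_.CoxeterMatrix.IsSimplyLaced (M : CoxeterMatrix S) : Prop :=
  ∀ s t, M.coxeterGraph.Adj s t → M s t = 3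

theorem OrthogonalOrbits.isSimplyLaced (hQ : B.OrthogonalOrbits G) (hB : B.IsReducedRootBasis)
    (hG : B.IsSymmetric G) (hconn : M.coxeterGraph.Connected) (hGne : G ≠ ⊥)
    (hfin : ∀ s : S, (MulAction.orbit G s).Finite) : M.IsSimplyLaced := fun _ _ h =>
  eq_three_of_form_mul_eq_one h.1 (hQ.form_mul_eq_one hB hG hconn hGne hfin h)

/-- The order of `σ_s σ_t` being `3` forces `φ_s(α_t) φ_t(α_s) = 1`. -/
theorem form_mul_eq_one_of_eq_three (hB : B.IsReducedRootBasis) {s t : S} (hst : s ≠ t)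
    (h3 : M s t = 3) : B.form s (Finsupp.single t 1) * B.form t (Finsupp.single s 1) = 1 := by
  by_contra hne
  have h0 : B.form s (Finsupp.single t 1) ≠ 0 := fun h0 => by
    have := eq_two_of_form_eq_zero hB hst h0
    omega
  have h2 := two_le_form_mul hB hst h0 hne
  have hb0 : B.form t (Finsupp.single s 1) ≠ 0 := fun h => h0 (hB.form_eq_zero_symm h)
  set a := B.form s (Finsupp.single t 1) with ha
  set b := B.form t (Finsupp.single s 1) with hb
  have ho := B.order_eq s t
  rw [h3] at ho
  have h := pow_orderOf_eq_one (Module.reflection (B.form_self s) * Module.reflection (B.form_self t))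
  rw [ho, pow_three] at h
  have h3 := LinearEquiv.congr_fun h (Finsupp.single s 1)
  simp only [LinearEquiv.mul_apply, Module.reflection_apply, map_sub, map_smul, ← ha, ← hb,
    B.form_self, LinearEquiv.coe_one, id] at h3
  have h4 := DFunLike.congr_fun h3 t
  simp [Ne.symm hst] at h4
  have h6 : b * ((a * b - 1) * (a * b - 3)) = 0 := by linarith
  have h5 := DFunLike.congr_fun h3 s
  simp [hst] at h5
  have h7 := (mul_eq_zero.mp h6).resolve_left hb0
  have h8 : a * b = 3 := by
    rcases mul_eq_zero.mp h7 with h8 | h8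
    · exact absurd (by linarith) hne
    · linarith
  have h9 : a * b * (a * b * (a * b)) = 27 := by rw [h8]; norm_num
  nlinarith

/-- A reduced root basis of a simply laced graph is the canonical one. -/
theorem eq_canonical_of_isSimplyLaced (hB : B.IsReducedRootBasis) (hM : M.IsSimplyLaced) :
    B = M.canonicalRootBasis := by
  have hf : B.form = M.canonicalForm := by
    funext s
    refine Finsupp.lhom_ext' fun t => LinearMap.ext_ring ?_
    change B.form s (Finsupp.single t 1) = M.canonicalForm s (Finsupp.single t 1)
    by_cases hst : s = t
    · subst hst; rw [B.form_self, M.canonicalForm_self]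
    rw [CoxeterMatrix.canonicalForm_single, CoxeterMatrix.canonicalEntry]
    by_cases h2 : M s t = 2
    · rw [form_eq_zero_of_eq_two hB hst h2, h2]
      simp
    · have h3 := hM s t ⟨hst, h2⟩
      rw [form_eq_neg_one_of_mul_eq_one hB hst (form_mul_eq_one_of_eq_three hB hst h3), h3]
      norm_num
  cases B
  simp only at hf
  subst hf
  rfl

end RootPrebasis

end

noncomputable section

/-! ### The root lattice of a simply laced graph -/

/-- The simple root of the vertex `s`, in the root lattice `S →₀ ℤ`. -/
def vert {S : Type*} (s : S) : S →₀ ℤ := Finsupp.single s 1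

/-- The action of a permutation of the vertices on the root lattice. -/
def latPerm {S : Type*} (g : Equiv.Perm S) : (S →₀ ℤ) ≃ₗ[ℤ] (S →₀ ℤ) := Finsupp.domLCongr g

theorem latPerm_vert {S : Type*} (g : Equiv.Perm S) (s : S) :
    latPerm g (vert s) = vert (g s) := by
  simp [latPerm, vert]

theorem latPerm_apply {S : Type*} (g : Equiv.Perm S) (v : S →₀ ℤ) (s : S) :
    latPerm g v (g s) = v s := by
  simp [latPerm]

theorem vert_induction {S : Type*} {p : (S →₀ ℤ) → Prop} (v : S →₀ ℤ) (zero : p 0)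
    (add : ∀ u v, p u → p v → p (u + v)) (smul : ∀ (n : ℤ) s, p (n • vert s)) : p v := by
  induction v using Finsupp.induction_linear with
  | zero => exact zero
  | add u v hu hv => exact add u v hu hv
  | single s n => simpa [vert] using smul n s

theorem vert_apply_self {S : Type*} (s : S) : vert s s = 1 := by simp [vert]

theorem vert_apply_ne {S : Type*} {s t : S} (h : t ≠ s) : vert s t = 0 := by simp [vert, h]

namespace SimpleGraph

variable {S : Type*} (Γ : SimpleGraph S)

open Classical in
/-- The entries of the symmetric Cartan matrix of a simply laced graph. -/
def cart (s t : S) : ℤ := if s = t then 2 else if Γ.Adj s t then -1 else 0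

/-- The symmetric bilinear form of a simply laced graph on its root lattice. -/
def bil : (S →₀ ℤ) →ₗ[ℤ] (S →₀ ℤ) →ₗ[ℤ] ℤ :=
  Finsupp.linearCombination ℤ fun s => Finsupp.linearCombination ℤ (Γ.cart s)

theorem cart_symm (s t : S) : Γ.cart s t = Γ.cart t s := by
  unfold cart
  split_ifs <;> simp_all [Γ.adj_comm]

theorem cart_self (s : S) : Γ.cart s s = 2 := by simp [cart]

variable {Γ}

theorem Adj.cart_eq {s t : S} (h : Γ.Adj s t) : Γ.cart s t = -1 := by simp [cart, h, h.ne]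

theorem cart_eq_zero {s t : S} (h : s ≠ t) (h' : ¬ Γ.Adj s t) : Γ.cart s t = 0 := by
  simp [cart, h, h']

theorem cart_nonpos {s t : S} (h : s ≠ t) : Γ.cart s t ≤ 0 := by
  simp only [cart, if_neg h]; split_ifs <;> norm_num

variable (Γ)

theorem bil_vert_vert (s t : S) : Γ.bil (vert s) (vert t) = Γ.cart s t := by
  simp [bil, vert]

theorem bil_symm (u v : S →₀ ℤ) : Γ.bil u v = Γ.bil v u := by
  induction u using vert_induction with
  | zero => simp
  | add u u' h h' => simp [h, h']
  | smul n s =>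
    induction v using vert_induction with
    | zero => simp
    | add v v' h h' => rw [map_add, h, h', map_add, LinearMap.add_apply]
    | smul m t =>
      simp only [map_smul, LinearMap.smul_apply, bil_vert_vert, smul_eq_mul, Γ.cart_symm s t]
      ring

/-- The reflection in the simple root of `s`. -/
def latRefl (s : S) (β : S →₀ ℤ) : S →₀ ℤ := β - Γ.bil β (vert s) • vert s

/-- The (real) roots in the root lattice. -/
inductive LatRoot : (S →₀ ℤ) → Prop
  | simple (s : S) : LatRoot (vert s)
  | refl (s : S) (β : S →₀ ℤ) : LatRoot β → LatRoot (Γ.latRefl s β)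

theorem bil_vert_self (s : S) : Γ.bil (vert s) (vert s) = 2 := by
  rw [bil_vert_vert, cart_self]

theorem bil_latRefl (s : S) (u v : S →₀ ℤ) :
    Γ.bil (Γ.latRefl s u) (Γ.latRefl s v) = Γ.bil u v := by
  simp only [latRefl, map_sub, map_smul, LinearMap.sub_apply, LinearMap.smul_apply,
    bil_vert_self, smul_eq_mul, Γ.bil_symm (vert s) v]
  ring

theorem latRefl_latRefl (s : S) (u : S →₀ ℤ) : Γ.latRefl s (Γ.latRefl s u) = u := by
  have h : Γ.bil (Γ.latRefl s u) (vert s) = -Γ.bil u (vert s) := by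
    simp only [latRefl, map_sub, map_smul, LinearMap.sub_apply, LinearMap.smul_apply,
      bil_vert_self, smul_eq_mul]
    ring
  rw [latRefl, h, latRefl]
  module

variable {Γ}

theorem LatRoot.bil_self {β : S →₀ ℤ} (h : Γ.LatRoot β) : Γ.bil β β = 2 := by
  induction h with
  | simple s => exact Γ.bil_vert_self s
  | refl s β _ ih => rw [bil_latRefl, ih]

theorem LatRoot.reflect {η θ : S →₀ ℤ} (hη : Γ.LatRoot η) (hθ : Γ.LatRoot θ) :
    Γ.LatRoot (θ - Γ.bil θ η • η) := by
  induction hη generalizing θ with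
  | simple s => exact .refl s θ hθ
  | refl s η _ ih =>
    have h := LatRoot.refl s _ (ih (LatRoot.refl s θ hθ))
    have e : Γ.bil (Γ.latRefl s θ) η = Γ.bil θ (Γ.latRefl s η) := by
      rw [← Γ.bil_latRefl s, latRefl_latRefl]
    rw [e] at h
    convert h using 1
    have hlin : ∀ (u v : S →₀ ℤ) (n : ℤ), Γ.latRefl s (u - n • v) =
        Γ.latRefl s u - n • Γ.latRefl s v := by
      intro u v n
      simp only [latRefl, map_sub, map_smul, LinearMap.sub_apply, LinearMap.smul_apply,
        smul_eq_mul]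
      module
    rw [hlin, latRefl_latRefl]

theorem LatRoot.add_smul {η θ : S →₀ ℤ} (hη : Γ.LatRoot η) (hθ : Γ.LatRoot θ) {n : ℤ}
    (h : Γ.bil θ η = -n) : Γ.LatRoot (θ + n • η) := by
  have := hη.reflect hθ
  rwa [h, neg_smul, sub_neg_eq_add] at this

theorem bil_latPerm {g : Equiv.Perm S} (hg : ∀ s t, Γ.Adj (g s) (g t) ↔ Γ.Adj s t)
    (u v : S →₀ ℤ) : Γ.bil (latPerm g u) (latPerm g v) = Γ.bil u v := by
  induction u using vert_induction with
  | zero => simp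
  | add u u' h h' => simp [h, h']
  | smul n s =>
    induction v using vert_induction with
    | zero => simp
    | add v v' h h' => rw [map_add (latPerm g), map_add, h, h', map_add]
    | smul m t =>
      simp only [map_smul, LinearMap.smul_apply, bil_vert_vert, latPerm_vert]
      have e : Γ.cart (g s) (g t) = Γ.cart s t := by
        by_cases h : s = t
        · rw [h, cart_self, cart_self]
        by_cases h' : Γ.Adj s t
        · rw [h'.cart_eq, ((hg s t).mpr h').cart_eq]
        · rw [cart_eq_zero h h', cart_eq_zero (g.injective.ne h) (mt (hg s t).mp h')]
      rw [e]

end SimpleGraph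

/-! ### Transfer between the root lattice and the canonical root basis -/

namespace CoxeterMatrix

variable {S : Type*} {M : CoxeterMatrix S}

/-- The embedding of the root lattice into `V`. -/
def latEmb (S : Type*) : (S →₀ ℤ) →+ (S →₀ ℝ) :=
  Finsupp.mapRange.addMonoidHom (Int.castAddHom ℝ)

theorem latEmb_apply (v : S →₀ ℤ) (s : S) : latEmb S v s = (v s : ℝ) := by
  simp [latEmb]

theorem latEmb_vert (s : S) : latEmb S (vert s) = Finsupp.single s 1 := by
  simp [latEmb, vert]

theorem latEmb_injective : Function.Injective (latEmb S) := by
  intro u v h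
  ext s
  have := DFunLike.congr_fun h s
  rw [latEmb_apply, latEmb_apply] at this
  exact_mod_cast this

theorem latEmb_latPerm (g : Equiv.Perm S) (v : S →₀ ℤ) :
    latEmb S (latPerm g v) = permOnV g (latEmb S v) := by
  ext s
  obtain ⟨t, rfl⟩ := g.surjective s
  rw [latEmb_apply, latPerm_apply, permOnV_apply, latEmb_apply]

theorem canonicalEntry_eq_cart (hM : M.IsSimplyLaced) (s t : S) :
    M.canonicalEntry s t = (M.coxeterGraph.cart s t : ℝ) := by
  by_cases hst : s = t
  · subst hst
    rw [← canonicalForm_single, canonicalForm_self, SimpleGraph.cart_self]; norm_num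
  by_cases h2 : M s t = 2
  · rw [SimpleGraph.cart_eq_zero hst (fun h : M.coxeterGraph.Adj s t => h.2 h2), canonicalEntry, h2]
    simp
  · have h : M.coxeterGraph.Adj s t := ⟨hst, h2⟩
    rw [h.cart_eq, canonicalEntry, hM s t h]
    norm_num

theorem canonicalForm_latEmb (hM : M.IsSimplyLaced) (s : S) (v : S →₀ ℤ) :
    M.canonicalForm s (latEmb S v) = (M.coxeterGraph.bil (vert s) v : ℝ) := by
  induction v using vert_induction with
  | zero => simp
  | add u v hu hv => simp [hu, hv]
  | smul n t =>
    rw [map_zsmul, map_zsmul, latEmb_vert, canonicalForm_single, canonicalEntry_eq_cart hM,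
      map_smul, SimpleGraph.bil_vert_vert]
    simp

theorem refl_latEmb (hM : M.IsSimplyLaced) (s : S) (v : S →₀ ℤ) :
    M.canonicalRootBasis.refl s (latEmb S v) = latEmb S (M.coxeterGraph.latRefl s v) := by
  rw [RootPrebasis.refl_apply]
  change _ - M.canonicalForm s _ • _ = _
  rw [canonicalForm_latEmb hM, SimpleGraph.latRefl, map_sub, map_zsmul, latEmb_vert,
    M.coxeterGraph.bil_symm, Int.cast_smul_eq_zsmul]

theorem latRoot_iff (hM : M.IsSimplyLaced) (v : S →₀ ℝ) :
    v ∈ M.canonicalRootBasis.roots ↔ ∃ β, M.coxeterGraph.LatRoot β ∧ v = latEmb S β := by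
  constructor
  · rintro ⟨w, s, rfl⟩
    induction w using M.toCoxeterSystem.simple_induction_left with
    | one => exact ⟨vert s, .simple s, by rw [latEmb_vert, RootPrebasis.rep_one_apply]⟩
    | mul_simple_left w t ih =>
      obtain ⟨β, hβ, e⟩ := ih
      refine ⟨_, .refl t β hβ, ?_⟩
      rw [RootPrebasis.rep_mul_apply, e]
      change M.canonicalRootBasis.rep (M.gen t) _ = _
      rw [RootPrebasis.rep_gen, refl_latEmb hM]
  · rintro ⟨β, hβ, rfl⟩
    induction hβ with
    | simple s => rw [latEmb_vert]; exact RootPrebasis.simple_mem_roots s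
    | refl s β _ ih =>
      rw [← refl_latEmb hM, ← RootPrebasis.rep_gen]
      exact RootPrebasis.rep_mem_roots ih _

theorem exists_isRootPair_latEmb (hM : M.IsSimplyLaced) {β : S →₀ ℤ}
    (hβ : M.coxeterGraph.LatRoot β) : ∃ φ, M.canonicalRootBasis.IsRootPair (latEmb S β) φ ∧
      ∀ v, φ (latEmb S v) = (M.coxeterGraph.bil β v : ℝ) := by
  induction hβ with
  | simple s =>
    refine ⟨M.canonicalForm s, ?_, canonicalForm_latEmb hM s⟩
    rw [latEmb_vert]
    exact RootPrebasis.isRootPair_simple s (B := M.canonicalRootBasis)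
  | refl s β _ ih =>
    obtain ⟨φ, hφ, e⟩ := ih
    refine ⟨_, by rw [← refl_latEmb hM, ← RootPrebasis.rep_gen]; exact hφ.rep (M.gen s), ?_⟩
    intro v
    change φ (M.canonicalRootBasis.rep (M.gen s)⁻¹ (latEmb S v)) = _
    rw [RootPrebasis.gen_inv, RootPrebasis.rep_gen, refl_latEmb hM, e,
      ← M.coxeterGraph.bil_latRefl s, SimpleGraph.latRefl_latRefl]

end CoxeterMatrix

/-- The situation to be classified: a connected simply laced graph with a group `G` of
automorphisms, each having a fixed vertex, such that the `G`-orbits of roots are orthogonal. -/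
structure IsOrthogonalPair {S : Type*} (Γ : SimpleGraph S) (G : Subgroup (Equiv.Perm S)) :
    Prop where
  conn : Γ.Connected
  adj : ∀ g ∈ G, ∀ s t, Γ.Adj (g s) (g t) ↔ Γ.Adj s t
  ortho : ∀ β, Γ.LatRoot β → ∀ g ∈ G, latPerm g β = β ∨ Γ.bil β (latPerm g β) = 0
  fixed : ∀ g ∈ G, ∃ x, g x = x

theorem RootPrebasis.OrthogonalOrbits.isOrthogonalPair {S : Type*} {M : CoxeterMatrix S}
    {G : Subgroup M.symmetryGroup} (hQ : M.canonicalRootBasis.OrthogonalOrbits G)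
    (hM : M.IsSimplyLaced) (hconn : M.coxeterGraph.Connected) :
    IsOrthogonalPair M.coxeterGraph (G.map M.symmetryGroup.subtype) where
  conn := hconn
  adj := by
    rintro _ ⟨g, hg, rfl⟩ s t
    exact RootPrebasis.adj_symm_iff g s t
  ortho := by
    rintro β hβ _ ⟨g, hg, rfl⟩
    obtain ⟨φ, hφ, e⟩ := CoxeterMatrix.exists_isRootPair_latEmb hM hβ
    have h := hQ _ _ hφ g hg
    rw [← CoxeterMatrix.latEmb_latPerm, e] at h
    exact h.imp (fun h => CoxeterMatrix.latEmb_injective h) fun h => by exact_mod_cast h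
  fixed := by
    rintro _ ⟨g, hg, rfl⟩
    exact hQ.exists_fixed M.canonical_isReducedRootBasis hconn hg

end

noncomputable section

/-! ### Roots fixed by a symmetry -/

open SimpleGraph

variable {S : Type*} {Γ : SimpleGraph S} {G : Subgroup (Equiv.Perm S)}

/-- The roots fixed by `g`. -/
structure FixedRoot (Γ : SimpleGraph S) (g : Equiv.Perm S) (θ : S →₀ ℤ) : Prop where
  root : Γ.LatRoot θ
  fix : latPerm g θ = θ

theorem fixedRoot_vert {g : Equiv.Perm S} {x : S} (hx : g x = x) : FixedRoot Γ g (vert x) :=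
  ⟨.simple x, by rw [latPerm_vert, hx]⟩

theorem FixedRoot.add_smul {g : Equiv.Perm S} {θ η : S →₀ ℤ} (hθ : FixedRoot Γ g θ)
    (hη : FixedRoot Γ g η) {n : ℤ} (h : Γ.bil θ η = -n) : FixedRoot Γ g (θ + n • η) :=
  ⟨hη.root.add_smul hθ.root h, by rw [map_add, map_smul, hθ.fix, hη.fix]⟩

theorem FixedRoot.add {g : Equiv.Perm S} {θ η : S →₀ ℤ} (hθ : FixedRoot Γ g θ)
    (hη : FixedRoot Γ g η) (h : Γ.bil θ η = -1) : FixedRoot Γ g (θ + η) := by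
  simpa using hθ.add_smul hη h

theorem FixedRoot.bil_self {g : Equiv.Perm S} {θ : S →₀ ℤ} (hθ : FixedRoot Γ g θ) :
    Γ.bil θ θ = 2 := hθ.root.bil_self

namespace IsOrthogonalPair

variable (P : IsOrthogonalPair Γ G) {g : Equiv.Perm S} (hg : g ∈ G)
include P hg

theorem bil_perm {β : S →₀ ℤ} (hβ : Γ.LatRoot β) :
    Γ.bil β (latPerm g β) = 0 ∨ Γ.bil β (latPerm g β) = 2 := by
  rcases P.ortho β hβ g hg with h | h
  · right; rw [h, hβ.bil_self]
  · exact Or.inl h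

theorem not_adj {y : S} : ¬ Γ.Adj y (g y) := by
  intro h
  have := P.bil_perm hg (.simple y)
  rw [latPerm_vert, bil_vert_vert, h.cart_eq] at this
  omega

theorem cart_moved {y : S} (hy : g y ≠ y) : Γ.cart y (g y) = 0 :=
  cart_eq_zero hy.symm (P.not_adj hg)

theorem bil_fixed {θ : S →₀ ℤ} (hθ : FixedRoot Γ g θ) (v : S →₀ ℤ) :
    Γ.bil θ (latPerm g v) = Γ.bil θ v := by
  conv_lhs => rw [← hθ.fix]
  exact bil_latPerm (P.adj g hg) _ _

theorem bil_fixed_vert {θ : S →₀ ℤ} (hθ : FixedRoot Γ g θ) (y : S) :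
    Γ.bil θ (vert (g y)) = Γ.bil θ (vert y) := by
  rw [← latPerm_vert, P.bil_fixed hg hθ]

/-- A fixed root has inner product at least `-1` with the simple root of a moved vertex. -/
theorem neg_one_le_bil {θ : S →₀ ℤ} (hθ : FixedRoot Γ g θ) {y : S} (hy : g y ≠ y) :
    -1 ≤ Γ.bil θ (vert y) := by
  have h := P.bil_perm hg (.refl y θ hθ.root)
  have e1 := P.cart_moved hg hy
  have e2 := P.bil_fixed_vert hg hθ y
  simp only [latRefl, map_sub, map_smul, latPerm_vert, hθ.fix, LinearMap.sub_apply,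
    LinearMap.smul_apply, e2, bil_vert_vert, e1, smul_eq_mul, hθ.bil_self,
    Γ.bil_symm (vert y) θ] at h
  by_contra! hlt
  rcases h with h | h <;> nlinarith

/-- The moved vertices with inner product `-1` with a fixed root form one orbit. -/
theorem eq_of_bil_eq_neg_one {θ : S →₀ ℤ} (hθ : FixedRoot Γ g θ) {y z : S} (hy : g y ≠ y)
    (hz : g z ≠ z) (hθy : Γ.bil θ (vert y) = -1) (hθz : Γ.bil θ (vert z) = -1) :
    z = y ∨ z = g y ∨ y = g z := by
  by_contra! hcon
  obtain ⟨h1, h2, h3⟩ := hcon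
  have h := P.bil_perm hg (.refl z _ (.refl y θ hθ.root))
  have ey := P.cart_moved hg hy
  have ez := P.cart_moved hg hz
  have fy := P.bil_fixed_vert hg hθ y
  have fz := P.bil_fixed_vert hg hθ z
  have a0 := cart_nonpos (Γ := Γ) h1
  have b0 := cart_nonpos (Γ := Γ) h2
  have c0 := cart_nonpos (Γ := Γ) h3
  have e : Γ.bil (latRefl Γ z (latRefl Γ y θ)) (latPerm g (latRefl Γ z (latRefl Γ y θ))) =
      2 - 2 * (2 - Γ.cart z y) + (1 - Γ.cart z y) * (Γ.cart z (g y) + Γ.cart y (g z)) := by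
    simp only [latRefl, map_sub, map_smul, latPerm_vert, hθ.fix, LinearMap.sub_apply,
      LinearMap.smul_apply, fy, fz, hθy, hθz, bil_vert_vert, ey, ez, smul_eq_mul, hθ.bil_self,
      Γ.bil_symm (vert _) θ, Γ.cart_symm y z]
    ring
  rw [e] at h
  rcases h with h | h <;> nlinarith

/-- The orbit under `g` of a moved vertex attached to a fixed root has two or three elements. -/
theorem pow_of_bil_eq_neg_one {θ : S →₀ ℤ} (hθ : FixedRoot Γ g θ) {y : S} (hy : g y ≠ y)
    (hθy : Γ.bil θ (vert y) = -1) : g (g y) = y ∨ g (g (g y)) = y := by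
  have hy' : g (g (g y)) ≠ g (g y) := fun h => hy (g.injective (g.injective h))
  have := P.eq_of_bil_eq_neg_one hg hθ hy hy' hθy
    (by rw [P.bil_fixed_vert hg hθ, P.bil_fixed_vert hg hθ, hθy])
  rcases this with h | h | h
  · exact Or.inl h
  · exact absurd (g.injective h) hy
  · exact Or.inr h.symm

/-- If the fixed roots `θ`, `θ'` have the isotropic sum `δ`, then no vertex is attached to `δ`:
otherwise inner products with the roots `kδ + θ` would be unbounded. -/
theorem bil_eq_zero_of_isotropic {θ θ' : S →₀ ℤ} (hθ : FixedRoot Γ g θ) (hθ' : FixedRoot Γ g θ')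
    (h : Γ.bil θ θ' = -2) {y : S} (hy : g y ≠ y) (hθy : Γ.bil θ (vert y) = -1)
    (hθ'y : Γ.bil θ' (vert y) = 1) {v : S} (hvy : v ≠ y) (h1 : Γ.bil θ (vert v) ≤ 0)
    (h2 : Γ.bil θ' (vert v) ≤ 0) : Γ.bil θ (vert v) = 0 ∧ Γ.bil θ' (vert v) = 0 := by
  have r1 : FixedRoot Γ g (θ + (2 : ℤ) • θ') := hθ.add_smul hθ' h
  have r2 : FixedRoot Γ g (θ + (2 : ℤ) • θ' + (2 : ℤ) • θ) := r1.add_smul hθ (by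
    simp only [map_add, map_smul, LinearMap.add_apply, LinearMap.smul_apply, hθ.bil_self,
      Γ.bil_symm θ' θ, h]
    norm_num)
  have e : ∀ u, Γ.bil (θ + (2 : ℤ) • θ' + (2 : ℤ) • θ) u = 3 * Γ.bil θ u + 2 * Γ.bil θ' u := by
    intro u
    simp only [map_add, map_smul, LinearMap.add_apply, LinearMap.smul_apply, smul_eq_mul]
    ring
  by_cases hv : g v = v
  · have r3 := (fixedRoot_vert (Γ := Γ) hv).add_smul r2 (n := -Γ.bil (vert v) _) (neg_neg _).symm
    have h3 := P.neg_one_le_bil hg r3 hy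
    rw [map_add, map_smul, LinearMap.add_apply, LinearMap.smul_apply, e, Γ.bil_symm (vert v) (_ + _), e,
      hθy, hθ'y, bil_vert_vert, smul_eq_mul] at h3
    have := cart_nonpos (Γ := Γ) hvy
    constructor <;> linarith
  · have h3 := P.neg_one_le_bil hg r2 hv
    rw [e] at h3
    omega

/-- A fixed vertex attached to a fixed root is not adjacent to a moved vertex attached to it. -/
theorem not_adj_of_attached {θ : S →₀ ℤ} (hθ : FixedRoot Γ g θ) {y z : S} (hy : g y ≠ y)
    (hz : g z = z) (hθy : Γ.bil θ (vert y) < 0) (hθz : Γ.bil θ (vert z) < 0) :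
    ¬ Γ.Adj z y := by
  intro hadj
  have r := hθ.add_smul (fixedRoot_vert (Γ := Γ) hz) (n := -Γ.bil θ (vert z)) (neg_neg _).symm
  have := P.neg_one_le_bil hg r hy
  rw [map_add, map_smul, LinearMap.add_apply, LinearMap.smul_apply, bil_vert_vert, hadj.cart_eq,
    smul_eq_mul] at this
  linarith

/-- Two fixed vertices attached to a fixed root `η` with an attached moved vertex are not
adjacent. -/
theorem not_adj_of_fixed {η : S →₀ ℤ} (hη : FixedRoot Γ g η) {y z z' : S} (hy : g y ≠ y)
    (hz : g z = z) (hz' : g z' = z') (hηy : Γ.bil η (vert y) = -1)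
    (hηz : Γ.bil η (vert z) = -1) (hηz' : Γ.bil η (vert z') = -1) : ¬ Γ.Adj z z' := by
  intro hadj
  have r1 := hη.add (fixedRoot_vert hz) hηz
  have r2 : FixedRoot Γ g (η + vert z + (2 : ℤ) • vert z') := r1.add_smul (fixedRoot_vert hz') (by
    rw [map_add, LinearMap.add_apply, hηz', bil_vert_vert, hadj.cart_eq]; norm_num)
  -- the fixed root `2 η + z + 2 z'` has inner product at most `-2` with `y`
  have r3 : FixedRoot Γ g (η + vert z + (2 : ℤ) • vert z' + η) := r2.add hη (by
    simp only [map_add, map_smul, LinearMap.add_apply, LinearMap.smul_apply, hη.bil_self,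
      Γ.bil_symm (vert _) η, hηz, hηz']
    norm_num)
  have := P.neg_one_le_bil hg r3 hy
  simp only [map_add, map_smul, LinearMap.add_apply, LinearMap.smul_apply, hηy, bil_vert_vert,
    smul_eq_mul] at this
  have h1 : z ≠ y := by rintro rfl; exact hy hz
  have h2 : z' ≠ y := by rintro rfl; exact hy hz'
  have h3 := cart_nonpos (Γ := Γ) h1
  have h4 := cart_nonpos (Γ := Γ) h2
  linarith

/-- Reflecting a fixed root in both vertices of an orbit of size two. -/
theorem fixedRoot_add_pair {θ : S →₀ ℤ} (hθ : FixedRoot Γ g θ) {y : S} (hy : g y ≠ y)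
    (hyy : g (g y) = y) {n : ℤ} (h : Γ.bil θ (vert y) = -n) :
    FixedRoot Γ g (θ + n • vert y + n • vert (g y)) := by
  refine ⟨(LatRoot.simple (g y)).add_smul ((LatRoot.simple y).add_smul hθ.root h) ?_, ?_⟩
  · rw [map_add, map_smul, LinearMap.add_apply, LinearMap.smul_apply, bil_vert_vert,
      P.cart_moved hg hy, P.bil_fixed_vert hg hθ, h]
    simp
  · rw [map_add, map_add, map_smul, map_smul, hθ.fix, latPerm_vert, latPerm_vert, hyy]
    abel

/-- Reflecting a fixed root in the vertices of an orbit of size three. -/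
theorem fixedRoot_add_triple {θ : S →₀ ℤ} (hθ : FixedRoot Γ g θ) {y : S} (hy : g y ≠ y)
    (hyy : g (g (g y)) = y) {n : ℤ} (h : Γ.bil θ (vert y) = -n) :
    FixedRoot Γ g (θ + n • vert y + n • vert (g y) + n • vert (g (g y))) := by
  have hy1 : g (g y) ≠ g y := fun h => hy (g.injective h)
  have hy2 : g (g (g y)) ≠ g (g y) := fun h => hy1 (g.injective h)
  have e2 : Γ.cart y (g (g y)) = 0 := by
    have := P.cart_moved hg hy2
    rw [hyy] at this
    rw [Γ.cart_symm, this]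
  refine ⟨(LatRoot.simple _).add_smul ((LatRoot.simple (g y)).add_smul
    ((LatRoot.simple y).add_smul hθ.root h) ?_) ?_, ?_⟩
  · rw [map_add, map_smul, LinearMap.add_apply, LinearMap.smul_apply, bil_vert_vert,
      P.cart_moved hg hy, P.bil_fixed_vert hg hθ, h]
    simp
  · simp only [map_add, map_smul, LinearMap.add_apply, LinearMap.smul_apply, bil_vert_vert,
      P.cart_moved hg hy1, P.bil_fixed_vert hg hθ, h, e2]
    simp
  · rw [map_add, map_add, map_add, map_smul, map_smul, map_smul, hθ.fix, latPerm_vert,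
      latPerm_vert, latPerm_vert, hyy]
    abel

end IsOrthogonalPair

/-- A set of vertices of a connected graph that contains a vertex and is closed under adjacency
is everything. -/
theorem SimpleGraph.Connected.mem_of_closed (hΓ : Γ.Connected) {T : Set S} {x : S} (hx : x ∈ T)
    (hT : ∀ u ∈ T, ∀ v, Γ.Adj u v → v ∈ T) (v : S) : v ∈ T := by
  obtain ⟨w⟩ := hΓ.preconnected x v
  induction w with
  | nil => exact hx
  | cons h _ ih => exact ih (hT _ hx _ h)

theorem IsOrthogonalPair.exists_fixed_adj_moved (P : IsOrthogonalPair Γ G) {g : Equiv.Perm S}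
    (hg : g ∈ G) (hg1 : g ≠ 1) : ∃ x y, g x = x ∧ g y ≠ y ∧ Γ.Adj x y := by
  by_contra! hcon
  obtain ⟨x, hx⟩ := P.fixed g hg
  refine hg1 (Equiv.ext fun v => ?_)
  exact P.conn.mem_of_closed (T := {v | g v = v}) hx
    (fun u hu v huv => by by_contra hv; exact hcon u v hu hv huv) v

end

noncomputable section

/-! ### Isomorphisms of pairs -/

open SimpleGraph

/-- `(Γ, G)` is isomorphic to `(A, H)`. -/
def PairIso {S I : Type*} (Γ : SimpleGraph S) (G : Subgroup (Equiv.Perm S)) (A : SimpleGraph I)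
    (H : Subgroup (Equiv.Perm I)) : Prop :=
  ∃ e : S ≃ I, (∀ s t, A.Adj (e s) (e t) ↔ Γ.Adj s t) ∧
    G.map e.permCongrHom.toMonoidHom = H

theorem PairIso.isoPair {S I : Type*} {M : CoxeterMatrix S} (hM : M.IsSimplyLaced)
    {G : Subgroup M.symmetryGroup} {A : SimpleGraph I} {H : Subgroup (Equiv.Perm I)}
    (h : PairIso M.coxeterGraph (G.map M.symmetryGroup.subtype) A H) : M.IsoPair G A H := by
  obtain ⟨e, he, hH⟩ := h
  refine ⟨e, fun s t => ?_, hH⟩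
  classical
  have hval : CoxeterMatrix.simplyLaced A (e s) (e t) =
      if e s = e t then 1 else if A.Adj (e s) (e t) then 3 else 2 := by
    change Matrix.of _ _ _ = _
    rw [Matrix.of_apply]
  rw [hval]
  by_cases hst : s = t
  · rw [hst, if_pos rfl, M.diagonal]
  rw [if_neg (e.injective.ne hst)]
  by_cases hadj : M.coxeterGraph.Adj s t
  · rw [if_pos ((he s t).mpr hadj), hM s t hadj]
  · rw [if_neg (mt (he s t).mp hadj)]
    by_contra hne
    exact hadj ⟨hst, fun h => hne h.symm⟩

section

variable {S I : Type*} {Γ : SimpleGraph S} {G : Subgroup (Equiv.Perm S)} {A : SimpleGraph I}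

theorem pairIso_zpowers {f : I → S} (hf : Function.Bijective f)
    (hadj : ∀ i j, A.Adj i j ↔ Γ.Adj (f i) (f j)) {g : Equiv.Perm S} (hg : g ∈ G)
    (hG : ∀ h ∈ G, h = 1 ∨ h = g) {h₀ : Equiv.Perm I} (hgh : ∀ i, g (f i) = f (h₀ i)) :
    PairIso Γ G A (Subgroup.zpowers h₀) := by
  have hGz : G = Subgroup.zpowers g := by
    refine le_antisymm (fun h hh => ?_) (by rwa [Subgroup.zpowers_le])
    rcases hG h hh with rfl | rfl
    · exact one_mem _
    · exact Subgroup.mem_zpowers _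
  let e := (Equiv.ofBijective f hf).symm
  have he : ∀ i, e (f i) = i := fun i => (Equiv.ofBijective f hf).symm_apply_apply i
  refine ⟨e, fun s t => ?_, ?_⟩
  · obtain ⟨i, rfl⟩ := hf.2 s
    obtain ⟨j, rfl⟩ := hf.2 t
    rw [he, he, hadj]
  · rw [hGz, MonoidHom.map_zpowers]
    congr 1
    ext1 i
    change e (g (f i)) = _
    rw [hgh, he]

theorem pairIso_between {f : I → S} (hf : Function.Bijective f)
    (hadj : ∀ i j, A.Adj i j ↔ Γ.Adj (f i) (f j)) {g : Equiv.Perm S} (hg : g ∈ G)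
    {h₀ : Equiv.Perm I} (hgh : ∀ i, g (f i) = f (h₀ i)) {H : Subgroup (Equiv.Perm I)}
    (hH : ∀ h ∈ G, ∀ π : Equiv.Perm I, (∀ i, h (f i) = f (π i)) → π ∈ H) :
    ∃ H', Subgroup.zpowers h₀ ≤ H' ∧ H' ≤ H ∧ PairIso Γ G A H' := by
  let e := (Equiv.ofBijective f hf).symm
  have he : ∀ i, e (f i) = i := fun i => (Equiv.ofBijective f hf).symm_apply_apply i
  have he' : ∀ s, f (e s) = s := fun s => (Equiv.ofBijective f hf).apply_symm_apply s
  refine ⟨G.map e.permCongrHom.toMonoidHom, ?_, ?_, e, fun s t => ?_, rfl⟩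
  · rw [Subgroup.zpowers_le]
    refine ⟨g, hg, ?_⟩
    ext1 i
    change e (g (f i)) = _
    rw [hgh, he]
  · rintro _ ⟨h, hh, rfl⟩
    refine hH h hh _ fun i => ?_
    change _ = f (e (h (f i)))
    rw [he']
  · obtain ⟨i, rfl⟩ := hf.2 s
    obtain ⟨j, rfl⟩ := hf.2 t
    rw [he, he, hadj]

end

namespace CoxeterPairs

open Set

/-- The permutations of the three leaves of `D_4` fixing the other vertices. -/
theorem leafPerm_cases (a : ℕ) (ha : a ≤ 1) (π : Equiv.Perm (Icc a 4))
    (h : ∀ i : Icc a 4, (i : ℕ) = 0 ∨ (i : ℕ) = 2 → π i = i) {t s : Equiv.Perm (Icc a 4)}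
    (ht : t = trialityD4 a ha) (hs : s = swapD a 4 (by omega)) :
    π = 1 ∨ π = t ∨ π = t * t ∨ π = s ∨ π = t * s ∨ π = t * t * s := by
  let i1 : Icc a 4 := ⟨1, by simp; omega⟩
  let i2 : Icc a 4 := ⟨2, by simp; omega⟩
  let i3 : Icc a 4 := ⟨3, by simp; omega⟩
  let i4 : Icc a 4 := ⟨4, by simp; omega⟩
  have t1 : t i1 = i3 := by rw [ht]; rfl
  have t3 : t i3 = i4 := by rw [ht]; rfl
  have t4 : t i4 = i1 := by rw [ht]; rfl
  have s3 : s i3 = i4 := by rw [hs]; exact Equiv.swap_apply_left _ _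
  have s4 : s i4 = i3 := by rw [hs]; exact Equiv.swap_apply_right _ _
  have s1 : s i1 = i1 := by
    rw [hs]; exact Equiv.swap_apply_of_ne_of_ne (by simp [i1]) (by simp [i1])
  have hfix : ∀ i : Icc a 4, (i : ℕ) = 0 ∨ (i : ℕ) = 2 → t i = i ∧ s i = i := by
    rintro ⟨i, hi⟩ hi2
    simp only at hi2
    constructor
    · rw [ht]; rcases hi2 with rfl | rfl <;> rfl
    · rw [hs]; exact Equiv.swap_apply_of_ne_of_ne (by simp; omega) (by simp; omega)
  have hcases : ∀ i : Icc a 4, ((i : ℕ) = 0 ∨ (i : ℕ) = 2) ∨ i = i1 ∨ i = i3 ∨ i = i4 := by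
    rintro ⟨i, hi⟩
    have := hi.2
    simp only [i1, i3, i4, Subtype.mk.injEq]
    omega
  have hext : ∀ ρ : Equiv.Perm (Icc a 4), (∀ i : Icc a 4, (i : ℕ) = 0 ∨ (i : ℕ) = 2 → ρ i = i) →
      π i1 = ρ i1 → π i3 = ρ i3 → π i4 = ρ i4 → π = ρ := by
    intro ρ h0 h1 h3 h4
    ext1 i
    rcases hcases i with hi | rfl | rfl | rfl
    · rw [h i hi, h0 i hi]
    · exact h1
    · exact h3
    · exact h4
  have hval : ∀ i, (i = i1 ∨ i = i3 ∨ i = i4) → π i = i1 ∨ π i = i3 ∨ π i = i4 := by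
    intro i hi
    rcases hcases (π i) with h' | h'
    · have := π.injective (h _ h')
      rw [this] at h'
      rcases hi with rfl | rfl | rfl <;> simp [i1, i3, i4] at h'
    · exact h'
  have n13 : i1 ≠ i3 := by simp [i1, i3]
  have n14 : i1 ≠ i4 := by simp [i1, i4]
  have n34 : i3 ≠ i4 := by simp [i3, i4]
  have v1 := hval i1 (by simp)
  have v3 := hval i3 (by simp)
  have v4 := hval i4 (by simp)
  have d13 := π.injective.ne n13
  have d14 := π.injective.ne n14
  have d34 := π.injective.ne n34
  have w1 : ∀ ρ : Equiv.Perm (Icc a 4), (ρ = 1 ∨ ρ = t ∨ ρ = t * t ∨ ρ = s ∨ ρ = t * s ∨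
      ρ = t * t * s) → ∀ i : Icc a 4, (i : ℕ) = 0 ∨ (i : ℕ) = 2 → ρ i = i := by
    rintro ρ (rfl | rfl | rfl | rfl | rfl | rfl) i hi <;> simp [hfix i hi]
  rcases v1 with v1 | v1 | v1 <;> rcases v3 with v3 | v3 | v3 <;>
    rcases v4 with v4 | v4 | v4 <;>
    first
    | exact absurd (v1.trans v3.symm) d13
    | exact absurd (v1.trans v4.symm) d14
    | exact absurd (v3.trans v4.symm) d34
    | skip
  · exact Or.inl (hext _ (w1 _ (by simp)) v1 v3 v4)
  · refine Or.inr (Or.inr (Or.inr (Or.inl (hext _ (w1 _ (by simp)) ?_ ?_ ?_))))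
    · rw [v1, s1]
    · rw [v3, s3]
    · rw [v4, s4]
  · refine Or.inr (Or.inr (Or.inr (Or.inr (Or.inl (hext _ (w1 _ (by simp)) ?_ ?_ ?_)))))
    · simp [v1, s1, t1]
    · simp [v3, s3, t4]
    · simp [v4, s4, t3]
  · exact Or.inr (Or.inl (hext _ (w1 _ (by simp)) (v1.trans t1.symm) (v3.trans t3.symm)
      (v4.trans t4.symm)))
  · refine Or.inr (Or.inr (Or.inl (hext _ (w1 _ (by simp)) ?_ ?_ ?_)))
    · simp [v1, t1, t3]
    · simp [v3, t3, t4]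
    · simp [v4, t4, t1]
  · refine Or.inr (Or.inr (Or.inr (Or.inr (Or.inr (hext _ (w1 _ (by simp)) ?_ ?_ ?_)))))
    · simp [v1, s1, t1, t3]
    · simp [v3, s3, t4, t1]
    · simp [v4, s4, t4, t3]

theorem mem_closure_triality (a : ℕ) (ha : a ≤ 1) (π : Equiv.Perm (Icc a 4))
    (h : ∀ i : Icc a 4, (i : ℕ) = 0 ∨ (i : ℕ) = 2 → π i = i) :
    π ∈ Subgroup.closure {trialityD4 a ha, swapD a 4 (by omega)} := by
  obtain ⟨t, ht⟩ : ∃ t, t = trialityD4 a ha := ⟨_, rfl⟩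
  obtain ⟨s, hs⟩ : ∃ s, s = swapD a 4 (by omega) := ⟨_, rfl⟩
  rw [← ht, ← hs]
  have htm : t ∈ Subgroup.closure {t, s} := Subgroup.subset_closure (by simp)
  have hsm : s ∈ Subgroup.closure {t, s} := Subgroup.subset_closure (by simp)
  rcases leafPerm_cases a ha π h ht hs with rfl | rfl | rfl | rfl | rfl | rfl
  · exact one_mem _
  · exact htm
  · exact mul_mem htm htm
  · exact hsm
  · exact mul_mem htm hsm
  · exact mul_mem (mul_mem htm htm) hsm

end CoxeterPairs

end

noncomputable section

/-! ### Orbits of size three -/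

open SimpleGraph

variable {S : Type*} {Γ : SimpleGraph S} {G : Subgroup (Equiv.Perm S)}

namespace IsOrthogonalPair

variable (P : IsOrthogonalPair Γ G) {g : Equiv.Perm S} (hg : g ∈ G)
include P hg

/-- A moved vertex attached to a fixed vertex `x`, in an orbit of size three, is a leaf. -/
theorem eq_of_adj_triple {x y z : S} (hx : g x = x) (hy : g y ≠ y) (hxy : Γ.Adj x y)
    (hyy : g (g y) ≠ y) (hyz : Γ.Adj y z) : z = x := by
  have fx := fixedRoot_vert (Γ := Γ) hx
  have exy : Γ.cart x y = -1 := hxy.cart_eq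
  have h3 : g (g (g y)) = y :=
    (P.pow_of_bil_eq_neg_one hg fx hy (by rw [bil_vert_vert, exy])).resolve_left hyy
  have hy1 : g (g y) ≠ g y := fun h => hy (g.injective h)
  have exy1 : Γ.cart x (g y) = -1 := Adj.cart_eq (by rw [← P.adj g hg, hx] at hxy; exact hxy)
  have exy2 : Γ.cart x (g (g y)) = -1 := by
    refine Adj.cart_eq ?_
    rw [← P.adj g hg, hx, ← P.adj g hg, hx] at hxy; exact hxy
  have e01 := P.cart_moved hg hy
  have e12 := P.cart_moved hg hy1
  have e20 : Γ.cart y (g (g y)) = 0 := by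
    have := P.cart_moved hg (y := g (g y)) (by rw [h3]; exact hyy.symm)
    rwa [h3, Γ.cart_symm] at this
  have e10 := Γ.cart_symm y (g y) ▸ e01
  have e02 := Γ.cart_symm y (g (g y)) ▸ e20
  have e21 := Γ.cart_symm (g y) (g (g y)) ▸ e12
  have fθ := P.fixedRoot_add_triple hg fx hy h3 (n := 1) (by rw [bil_vert_vert, exy])
  simp only [one_smul] at fθ
  by_contra hzx
  have eyz := hyz.cart_eq
  have exz0 := cart_nonpos (Γ := Γ) (Ne.symm hzx)
  by_cases hz : g z = z
  · by_cases hxz : Γ.Adj x z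
    · exact P.not_adj_of_attached hg fx hy hz (by rw [bil_vert_vert, exy]; norm_num)
        (by rw [bil_vert_vert, hxz.cart_eq]; norm_num) hyz.symm
    have e1 : Γ.cart (g y) z = -1 := Adj.cart_eq (by rw [← P.adj g hg, hz] at hyz; exact hyz)
    have e2 : Γ.cart (g (g y)) z = -1 := by
      refine Adj.cart_eq ?_
      rw [← P.adj g hg, hz, ← P.adj g hg, hz] at hyz; exact hyz
    have exz := cart_eq_zero (Ne.symm hzx) hxz
    -- the fixed root `x + y + g y + g² y + 3 z` has inner product `-2` with `y`
    have r := fθ.add_smul (fixedRoot_vert hz) (n := 3) (by simp [bil_vert_vert, *])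
    have := P.neg_one_le_bil hg r hy
    rw [map_add, map_smul, LinearMap.add_apply, LinearMap.smul_apply, bil_vert_vert,
      Γ.cart_symm z y, eyz] at this
    simp [bil_vert_vert, cart_self, *] at this
  · have exz : Γ.cart x z = 0 := by
      refine cart_eq_zero (Ne.symm hzx) fun hxz => ?_
      rcases P.eq_of_bil_eq_neg_one hg fx hy hz (by rw [bil_vert_vert, exy])
        (by rw [bil_vert_vert, hxz.cart_eq]) with rfl | rfl | h
      · exact hyz.ne rfl
      · exact P.not_adj hg hyz
      · exact P.not_adj hg (h ▸ hyz.symm)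
    -- the fixed root `2 x + y + g y + g² y` shows that `z` is not adjacent to `g y` and `g² y`
    have r := fθ.add fx (by simp [bil_vert_vert, cart_self, Γ.cart_symm _ x, *])
    have h1 := P.neg_one_le_bil hg r hz
    simp [bil_vert_vert, *] at h1
    have c1 : Γ.cart (g y) z ≤ 0 :=
      cart_nonpos (by rintro rfl; exact P.not_adj hg hyz)
    have c2 : Γ.cart (g (g y)) z ≤ 0 :=
      cart_nonpos (by rintro rfl; rw [← P.adj g hg, h3] at hyz; exact P.not_adj hg hyz.symm)
    have c1' : Γ.cart (g y) z = 0 := by linarith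
    have c2' : Γ.cart (g (g y)) z = 0 := by linarith
    -- the root `x + y + g y + z` has inner product `-1` with its image
    have b : Γ.LatRoot (vert x + (1 : ℤ) • vert y + (1 : ℤ) • vert (g y) + (1 : ℤ) • vert z) :=
      (LatRoot.simple z).add_smul ((LatRoot.simple (g y)).add_smul ((LatRoot.simple y).add_smul
        (.simple x) (by simp [bil_vert_vert, *])) (by simp [bil_vert_vert, *]))
        (by simp [bil_vert_vert, *])
    have tr : ∀ u v, Γ.cart (g u) (g v) = Γ.cart u v := fun u v => by
      have := bil_latPerm (P.adj g hg) (vert u) (vert v)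
      rwa [latPerm_vert, latPerm_vert, bil_vert_vert, bil_vert_vert] at this
    have d1 : Γ.cart x (g z) = 0 := by rw [← exz, ← tr x z, hx]
    have d2 : Γ.cart (g y) (g z) = -1 := by rw [tr, eyz]
    have d3 : Γ.cart y (g z) = 0 := by rw [← c2', ← tr _ z, h3]
    have d4 := P.cart_moved hg hz
    have := P.bil_perm hg b
    simp only [map_add, latPerm_vert, LinearMap.add_apply, one_smul, bil_vert_vert, hx, exy1,
      exy2, d1, d2, d3, d4, Γ.cart_symm y x, exy, e01, e20, Γ.cart_symm (g y) x, cart_self, e12,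
      Γ.cart_symm z, exz, c1', c2'] at this
    omega

omit hg in
/-- A symmetry fixing a vertex `x` does not move four of its neighbours. -/
theorem not_four_moved {h : Equiv.Perm S} (hh : h ∈ G) {θ : S →₀ ℤ} (hθ : FixedRoot Γ h θ)
    {a b c d : S}
    (ha : Γ.bil θ (vert a) = -1) (hb : Γ.bil θ (vert b) = -1) (hc : Γ.bil θ (vert c) = -1)
    (hd : Γ.bil θ (vert d) = -1) (hab : a ≠ b) (hac : a ≠ c) (had : a ≠ d) (hbc : b ≠ c)
    (hbd : b ≠ d) (hcd : c ≠ d)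
    (ma : h a ≠ a) (mb : h b ≠ b) (mc : h c ≠ c) (md : h d ≠ d) : False := by
  have hb' := P.eq_of_bil_eq_neg_one hh hθ ma mb ha hb
  have hc' := P.eq_of_bil_eq_neg_one hh hθ ma mc ha hc
  have hd' := P.eq_of_bil_eq_neg_one hh hθ ma md ha hd
  have key : ∀ u v, h u = a → h v = a → u = v := fun u v hu hv => h.injective (hu.trans hv.symm)
  grind

end IsOrthogonalPair

/-- If `g` permutes `a`, `b`, `c` cyclically and fixes `d`, and `h` permutes the four points without
fixing `d`, then one of `h`, `g h`, `g² h` moves all four points. -/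
theorem exists_derangement {g h : Equiv.Perm S} {a b c d : S} (hab : g a = b) (hbc : g b = c)
    (hca : g c = a) (hd : g d = d) (nab : a ≠ b) (nac : a ≠ c) (nbc : b ≠ c) (nad : a ≠ d)
    (nbd : b ≠ d) (ncd : c ≠ d)
    (ha : h a = a ∨ h a = b ∨ h a = c ∨ h a = d) (hb : h b = a ∨ h b = b ∨ h b = c ∨ h b = d)
    (hc : h c = a ∨ h c = b ∨ h c = c ∨ h c = d) (hd' : h d = a ∨ h d = b ∨ h d = c) :
    ∃ k : Equiv.Perm S, (k = h ∨ k = g * h ∨ k = g * (g * h)) ∧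
      k a ≠ a ∧ k b ≠ b ∧ k c ≠ c ∧ k d ≠ d := by
  have i1 := h.injective.ne nab
  have i2 := h.injective.ne nac
  have i3 := h.injective.ne nbc
  have i4 := h.injective.ne nad
  have i5 := h.injective.ne nbd
  have i6 := h.injective.ne ncd
  by_contra! hcon
  have h1 := hcon h (Or.inl rfl)
  have h2 := hcon (g * h) (Or.inr (Or.inl rfl))
  have h3 := hcon (g * (g * h)) (Or.inr (Or.inr rfl))
  simp only [Equiv.Perm.mul_apply] at h2 h3
  clear hcon
  rcases hd' with hd' | hd' | hd' <;> rcases ha with ha | ha | ha | ha <;>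
    first
    | (exfalso; exact i4 (ha.trans hd'.symm))
    | (rcases hb with hb | hb | hb | hb <;>
        first
        | (exfalso; exact i5 (hb.trans hd'.symm))
        | (exfalso; exact i1 (ha.trans hb.symm))
        | (rcases hc with hc | hc | hc | hc <;>
            first
            | (exfalso; exact i6 (hc.trans hd'.symm))
            | (exfalso; exact i2 (ha.trans hc.symm))
            | (exfalso; exact i3 (hb.trans hc.symm))
            | (rw [ha, hb, hc, hd'] at h1 h2 h3; grind)))

end

noncomputable section

open SimpleGraph CoxeterPairs Set

variable {S : Type*} {Γ : SimpleGraph S} {G : Subgroup (Equiv.Perm S)}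

namespace IsOrthogonalPair

variable (P : IsOrthogonalPair Γ G) {g : Equiv.Perm S} (hg : g ∈ G)
include P hg

/-- The pairs with an orbit of size three are those of types `D₄` and `D̃₄`. -/
theorem pairIso_triality {x y : S} (hx : g x = x) (hy : g y ≠ y) (hxy : Γ.Adj x y)
    (hyy : g (g y) ≠ y) :
    (∃ H, Subgroup.zpowers (trialityD4 1 le_rfl) ≤ H ∧
      H ≤ Subgroup.closure {trialityD4 1 le_rfl, swapD 1 4 (by omega)} ∧
      PairIso Γ G (graphD 4) H) ∨
    (∃ H, Subgroup.zpowers (trialityD4 0 zero_le_one) ≤ H ∧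
      H ≤ Subgroup.closure {trialityD4 0 zero_le_one, swapD 0 4 (by omega)} ∧
      PairIso Γ G (graphAffD 4) H) := by
  have fx := fixedRoot_vert (Γ := Γ) hx
  have exy : Γ.cart x y = -1 := hxy.cart_eq
  have h3 : g (g (g y)) = y :=
    (P.pow_of_bil_eq_neg_one hg fx hy (by rw [bil_vert_vert, exy])).resolve_left hyy
  have hxy1 : Γ.Adj x (g y) := by rw [← P.adj g hg, hx] at hxy; exact hxy
  have hxy2 : Γ.Adj x (g (g y)) := by rw [← P.adj g hg, hx] at hxy1; exact hxy1
  have n01 : y ≠ g y := Ne.symm hy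
  have n02 : y ≠ g (g y) := Ne.symm hyy
  have n12 : g y ≠ g (g y) := g.injective.ne n01
  have m1 : g (g y) ≠ g y := n12.symm
  have m2 : g (g (g y)) ≠ g (g y) := g.injective.ne m1
  have l0 : ∀ v, Γ.Adj y v ↔ v = x :=
    fun v => ⟨P.eq_of_adj_triple hg hx hy hxy hyy, by rintro rfl; exact hxy.symm⟩
  have l1 : ∀ v, Γ.Adj (g y) v ↔ v = x := fun v =>
    ⟨P.eq_of_adj_triple hg hx m1 hxy1 (by rw [h3]; exact n01), by rintro rfl; exact hxy1.symm⟩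
  have l2 : ∀ v, Γ.Adj (g (g y)) v ↔ v = x := fun v =>
    ⟨P.eq_of_adj_triple hg hx m2 hxy2 (by rw [h3]; exact n12), by rintro rfl; exact hxy2.symm⟩
  have l0' := fun v => (Γ.adj_comm v y).trans (l0 v)
  have l1' := fun v => (Γ.adj_comm v (g y)).trans (l1 v)
  have l2' := fun v => (Γ.adj_comm v (g (g y))).trans (l2 v)
  have nbr : ∀ v, Γ.Adj x v → v = y ∨ v = g y ∨ v = g (g y) ∨ g v = v := by
    intro v hv
    by_cases hgv : g v = v
    · simp [hgv]
    rcases P.eq_of_bil_eq_neg_one hg fx hy hgv (by rw [bil_vert_vert, exy])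
        (by rw [bil_vert_vert, hv.cart_eq]) with h | h | h
    · exact Or.inl h
    · exact Or.inr (Or.inl h)
    · exact Or.inr (Or.inr (Or.inl (g.injective (by rw [h3, ← h]))))
  -- `x` is the only vertex with two neighbours
  have fixx : (∀ v, v ≠ x → ∀ a b, Γ.Adj v a → Γ.Adj v b → a = b) → ∀ h ∈ G, h x = x := by
    intro hl h hh
    by_contra hhx
    refine n01 (h.injective (hl _ hhx _ _ ?_ ?_))
    · rwa [P.adj h hh]
    · rwa [P.adj h hh]
  by_cases hz : ∃ z, Γ.Adj x z ∧ g z = z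
  · right
    obtain ⟨z, hxz, hgz⟩ := hz
    have nzx : z ≠ x := hxz.ne'
    have nz0 : z ≠ y := by rintro rfl; exact hy hgz
    have nz1 : z ≠ g y := by rintro rfl; exact m1 hgz
    have nz2 : z ≠ g (g y) := by rintro rfl; exact m2 hgz
    have ezx := hxz.symm.cart_eq
    have e10 : Γ.cart (g y) y = 0 := by rw [Γ.cart_symm, P.cart_moved hg hy]
    have e20 : Γ.cart (g (g y)) y = 0 := by
      have := P.cart_moved hg m2
      rwa [h3] at this
    have ez0 : Γ.cart z y = 0 := cart_eq_zero nz0 (by rw [l0']; exact nzx)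
    have e0z := Γ.cart_symm _ _ ▸ ez0
    have e1z : Γ.cart (g y) z = 0 := cart_eq_zero nz1.symm (by rw [l1]; exact nzx)
    have e2z : Γ.cart (g (g y)) z = 0 := cart_eq_zero nz2.symm (by rw [l2]; exact nzx)
    have exz := hxz.cart_eq
    have ex1 := hxy1.cart_eq
    have ex2 := hxy2.cart_eq
    have fθ := P.fixedRoot_add_triple hg fx hy h3 (n := 1) (by rw [bil_vert_vert, exy])
    simp only [one_smul] at fθ
    have fδ := fθ.add (fixedRoot_vert hgz) (by simp [bil_vert_vert, *])
    -- by the isotropy of the sum of the two roots, nothing else is attached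
    have hT : ∀ v, v = x ∨ v = y ∨ v = g y ∨ v = g (g y) ∨ v = z := by
      refine P.conn.mem_of_closed (T := {v | v = x ∨ v = y ∨ v = g y ∨ v = g (g y) ∨ v = z})
        (Or.inl rfl) ?_
      intro u hu v huv
      by_contra hv
      change ¬ (_ ∨ _ ∨ _ ∨ _ ∨ _) at hv
      simp only [not_or] at hv
      obtain ⟨v1, v2, v3, v4, v5⟩ := hv
      have c1 := cart_nonpos (Γ := Γ) (Ne.symm v1)
      have c2 := cart_nonpos (Γ := Γ) (Ne.symm v2)
      have c3 := cart_nonpos (Γ := Γ) (Ne.symm v3)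
      have c4 := cart_nonpos (Γ := Γ) (Ne.symm v4)
      have c5 := cart_nonpos (Γ := Γ) (Ne.symm v5)
      have := P.bil_eq_zero_of_isotropic hg fx fδ (by simp [bil_vert_vert, cart_self, *]) hy
        (by rw [bil_vert_vert, exy]) (by simp [bil_vert_vert, cart_self, *]) v2
        (by rw [bil_vert_vert]; exact c1) (by simp [bil_vert_vert]; linarith)
      simp only [map_add, LinearMap.add_apply, bil_vert_vert] at this
      rcases hu with rfl | rfl | rfl | rfl | rfl <;> have := huv.cart_eq <;> omega
    have lz : ∀ v, Γ.Adj z v ↔ v = x := by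
      intro v
      refine ⟨fun h => ?_, by rintro rfl; exact hxz.symm⟩
      rcases hT v with rfl | rfl | rfl | rfl | rfl
      · rfl
      · exact (nzx ((l0 _).mp h.symm)).elim
      · exact (nzx ((l1 _).mp h.symm)).elim
      · exact (nzx ((l2 _).mp h.symm)).elim
      · exact (h.ne rfl).elim
    have lz' := fun v => (Γ.adj_comm v z).trans (lz v)
    have fixx' := fixx (by
      intro v hv a b ha hb
      rcases hT v with rfl | rfl | rfl | rfl | rfl
      · exact (hv rfl).elim
      all_goals simp_all)
    have hleaf : ∀ h ∈ G, ∀ v, v = y ∨ v = g y ∨ v = g (g y) ∨ v = z →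
        h v = y ∨ h v = g y ∨ h v = g (g y) ∨ h v = z := by
      intro h hh v hv
      refine (hT (h v)).resolve_left fun hv' => ?_
      have := h.injective (hv'.trans (fixx' h hh).symm)
      subst this
      rcases hv with hv | hv | hv | hv
      · exact hxy.ne hv
      · exact hxy1.ne hv
      · exact hxy2.ne hv
      · exact hxz.ne hv
    have fixz : ∀ h ∈ G, h z = z := by
      intro h hh
      by_contra hhz
      obtain ⟨k, hk, k1, k2, k3, k4⟩ := exists_derangement (g := g) (h := h) rfl rfl h3 hgz n01 n02
        n12 nz0.symm nz1.symm nz2.symm (hleaf h hh y (by simp)) (hleaf h hh _ (by simp))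
        (hleaf h hh _ (by simp)) (by have := hleaf h hh z (by simp); tauto)
      have hkG : k ∈ G := by
        rcases hk with rfl | rfl | rfl
        · exact hh
        · exact mul_mem hg hh
        · exact mul_mem hg (mul_mem hg hh)
      exact P.not_four_moved hkG (fixedRoot_vert (Γ := Γ) (fixx' k hkG))
        (by rw [bil_vert_vert, exy]) (by rw [bil_vert_vert, ex1])
        (by rw [bil_vert_vert, ex2]) (by rw [bil_vert_vert, exz]) n01 n02 nz0.symm n12
        nz1.symm nz2.symm k1 k2 k3 k4
    let f : Icc 0 4 → S := fun i => if (i : ℕ) = 0 then z else if (i : ℕ) = 1 then y else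
      if (i : ℕ) = 2 then x else if (i : ℕ) = 3 then g y else g (g y)
    have hf : Function.Bijective f := by
      constructor
      · rintro ⟨i, hi⟩ ⟨j, hj⟩ hij
        simp only [mem_Icc] at hi hj
        have := hi.2; have := hj.2
        interval_cases i <;> interval_cases j <;>
          simp [f, hxy.ne, hxy.ne', hxy1.ne, hxy1.ne', hxy2.ne, hxy2.ne', nzx, nzx.symm, nz0,
            nz0.symm, nz1, nz1.symm, nz2, nz2.symm, n01, n01.symm, n02, n02.symm, n12,
            n12.symm] at hij ⊢
      · intro v
        rcases hT v with rfl | rfl | rfl | rfl | rfl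
        · exact ⟨⟨2, by simp⟩, rfl⟩
        · exact ⟨⟨1, by simp⟩, rfl⟩
        · exact ⟨⟨3, by simp⟩, rfl⟩
        · exact ⟨⟨4, by simp⟩, rfl⟩
        · exact ⟨⟨0, by simp⟩, rfl⟩
    refine pairIso_between hf ?_ hg ?_ ?_
    · rintro ⟨i, hi⟩ ⟨j, hj⟩
      have := hi.2; have := hj.2
      interval_cases i <;> interval_cases j <;>
        simp [f, graphAffD, l0, l0', l1, l1', l2, l2', lz, lz', hxy1.ne', hxy2.ne', nzx]
    · rintro ⟨i, hi⟩
      have := hi.2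
      interval_cases i <;> simp [f, trialityD4, labelPerm, hx, h3, hgz]
    · intro h hh π hπ
      refine mem_closure_triality 0 zero_le_one π fun i hi => hf.1 ?_
      rw [← hπ]
      rcases hi with hi | hi
      · simp [f, hi, fixz h hh]
      · simp [f, hi, fixx' h hh]
  · left
    push Not at hz
    have hT : ∀ v, v = x ∨ v = y ∨ v = g y ∨ v = g (g y) := by
      refine P.conn.mem_of_closed (T := {v | v = x ∨ v = y ∨ v = g y ∨ v = g (g y)})
        (Or.inl rfl) ?_
      intro u hu v huv
      rcases hu with rfl | rfl | rfl | rfl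
      · rcases nbr v huv with h | h | h | h
        · exact Or.inr (Or.inl h)
        · exact Or.inr (Or.inr (Or.inl h))
        · exact Or.inr (Or.inr (Or.inr h))
        · exact (hz v huv h).elim
      · exact Or.inl ((l0 _).mp huv)
      · exact Or.inl ((l1 _).mp huv)
      · exact Or.inl ((l2 _).mp huv)
    have fixx' := fixx (by
      intro v hv a b ha hb
      rcases hT v with rfl | rfl | rfl | rfl
      · exact (hv rfl).elim
      all_goals simp_all)
    let f : Icc 1 4 → S := fun i => if (i : ℕ) = 1 then y else
      if (i : ℕ) = 2 then x else if (i : ℕ) = 3 then g y else g (g y)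
    have hf : Function.Bijective f := by
      constructor
      · rintro ⟨i, hi⟩ ⟨j, hj⟩ hij
        simp only [mem_Icc] at hi hj
        obtain ⟨_, _⟩ := hi; obtain ⟨_, _⟩ := hj
        interval_cases i <;> interval_cases j <;>
          simp [f, hxy.ne, hxy.ne', hxy1.ne, hxy1.ne', hxy2.ne, hxy2.ne', n01, n01.symm, n02,
            n02.symm, n12, n12.symm] at hij ⊢
      · intro v
        rcases hT v with rfl | rfl | rfl | rfl
        · exact ⟨⟨2, by simp⟩, rfl⟩
        · exact ⟨⟨1, by simp⟩, rfl⟩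
        · exact ⟨⟨3, by simp⟩, rfl⟩
        · exact ⟨⟨4, by simp⟩, rfl⟩
    refine pairIso_between hf ?_ hg ?_ ?_
    · rintro ⟨i, hi⟩ ⟨j, hj⟩
      obtain ⟨_, _⟩ := id hi; obtain ⟨_, _⟩ := id hj
      interval_cases i <;> interval_cases j <;>
        simp [f, graphD, l0, l0', l1, l1', l2, l2', hxy1.ne', hxy2.ne']
    · rintro ⟨i, hi⟩
      obtain ⟨_, _⟩ := id hi
      interval_cases i <;> simp [f, trialityD4, labelPerm, hx, h3]
    · intro h hh π hπ
      refine mem_closure_triality 1 le_rfl π fun i hi => hf.1 ?_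
      rw [← hπ]
      have := i.2.1
      simp [f, hi.resolve_left (by omega), fixx' h hh]

end IsOrthogonalPair

end

noncomputable section

/-! ### Symmetric paths -/

open SimpleGraph

variable {S : Type*} {Γ : SimpleGraph S} {G : Subgroup (Equiv.Perm S)}

theorem sum_cart_le {ι : Type*} {s : Finset ι} {c : ι → S} {v : S} (hv : ∀ i ∈ s, v ≠ c i)
    {i : ι} (hi : i ∈ s) : ∑ i ∈ s, Γ.cart (c i) v ≤ Γ.cart (c i) v := by
  classical
  rw [← Finset.add_sum_erase s _ hi]
  have : ∑ j ∈ s.erase i, Γ.cart (c j) v ≤ 0 :=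
    Finset.sum_nonpos fun j hj => cart_nonpos (hv j (Finset.mem_of_mem_erase hj)).symm
  linarith

/-- If `v` is adjacent to two of the vertices `c i`, then its inner product with their sum is at
most `-2`. -/
theorem sum_cart_le_neg_two {ι : Type*} {s : Finset ι} {c : ι → S} {v : S}
    (hv : ∀ i ∈ s, v ≠ c i) {i j : ι} (hi : i ∈ s) (hj : j ∈ s) (hij : i ≠ j)
    (hiv : Γ.Adj (c i) v) (hjv : Γ.Adj (c j) v) : ∑ i ∈ s, Γ.cart (c i) v ≤ -2 := by
  classical
  rw [← Finset.add_sum_erase s _ hi, hiv.cart_eq]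
  have := sum_cart_le (Γ := Γ) (s := s.erase i) (c := c) (v := v)
    (fun k hk => hv k (Finset.mem_of_mem_erase hk)) (Finset.mem_erase.mpr ⟨hij.symm, hj⟩)
  rw [hjv.cart_eq] at this
  linarith

theorem bil_sum_vert {ι : Type*} (s : Finset ι) (c : ι → S) (v : S) :
    Γ.bil (∑ i ∈ s, vert (c i)) (vert v) = ∑ i ∈ s, Γ.cart (c i) v := by
  simp [bil_vert_vert]

/-- The vertices `c i`, `-n ≤ i ≤ n`, form an induced path that is reversed by `g`; its middle
vertex is fixed. The field `root` records that the sum of the vertices of a path is a root. -/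
structure SymPath (Γ : SimpleGraph S) (g : Equiv.Perm S) (c : ℤ → S) (n : ℕ) : Prop where
  perm : ∀ i : ℤ, -n ≤ i → i ≤ n → g (c i) = c (-i)
  inj : ∀ i j : ℤ, -n ≤ i → i ≤ n → -n ≤ j → j ≤ n → c i = c j → i = j
  adj : ∀ i j : ℤ, -n ≤ i → i ≤ n → -n ≤ j → j ≤ n → (Γ.Adj (c i) (c j) ↔ j = i + 1 ∨ i = j + 1)
  root : ∀ m : ℕ, m ≤ n → FixedRoot Γ g (∑ i ∈ Finset.Icc (-m : ℤ) m, vert (c i))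

namespace SymPath

variable {g : Equiv.Perm S} {c : ℤ → S} {n : ℕ}

theorem restrict (h : SymPath Γ g c n) {m : ℕ} (hm : m ≤ n) : SymPath Γ g c m where
  perm i h1 h2 := h.perm i (by omega) (by omega)
  inj i j h1 h2 h3 h4 := h.inj i j (by omega) (by omega) (by omega) (by omega)
  adj i j h1 h2 h3 h4 := h.adj i j (by omega) (by omega) (by omega) (by omega)
  root k hk := h.root k (by omega)

theorem fix_zero (h : SymPath Γ g c n) : g (c 0) = c 0 := by
  simpa using h.perm 0 (by omega) (by omega)

theorem moved (h : SymPath Γ g c n) {i : ℤ} (h1 : -n ≤ i) (h2 : i ≤ n) (h0 : i ≠ 0) :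
    g (c i) ≠ c i := by
  rw [h.perm i h1 h2]
  intro e
  have := h.inj _ _ (by omega) (by omega) h1 h2 e
  omega

theorem cart (h : SymPath Γ g c n) {i j : ℤ} (h1 : -n ≤ i) (h2 : i ≤ n) (h3 : -n ≤ j)
    (h4 : j ≤ n) : Γ.cart (c i) (c j) = if i = j then 2 else if j = i + 1 ∨ i = j + 1 then -1
      else 0 := by
  split_ifs with e e'
  · rw [e, cart_self]
  · exact Adj.cart_eq ((h.adj i j h1 h2 h3 h4).mpr e')
  · exact cart_eq_zero (fun h' => e (h.inj i j h1 h2 h3 h4 h')) (mt (h.adj i j h1 h2 h3 h4).mp e')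

theorem single {x : S} (hx : g x = x) : SymPath Γ g (fun _ => x) 0 where
  perm _ _ _ := hx
  inj i j h1 h2 h3 h4 _ := by simp only [Nat.cast_zero, neg_zero] at *; omega
  adj i j h1 h2 h3 h4 := by
    simp only [Nat.cast_zero, neg_zero] at *
    have h5 : ¬ (j = i + 1 ∨ i = j + 1) := by omega
    simp [h5]
  root m hm := by
    obtain rfl : m = 0 := by omega
    simpa using fixedRoot_vert (Γ := Γ) hx

/-- `v` is not on the path. -/
def Off (c : ℤ → S) (n : ℕ) (v : S) : Prop := ∀ i : ℤ, -n ≤ i → i ≤ n → v ≠ c i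

theorem Off.mem {v : S} (hv : Off c n v) {m : ℕ} (hm : m ≤ n) :
    ∀ i ∈ Finset.Icc (-m : ℤ) m, v ≠ c i := by
  intro i hi
  rw [Finset.mem_Icc] at hi
  exact hv i (by omega) (by omega)

theorem Off.perm {v : S} (hv : Off c n v) (h : SymPath Γ g c n) : Off c n (g v) := by
  intro i h1 h2 e
  have := h.perm (-i) (by omega) (by omega)
  rw [neg_neg, ← e] at this
  exact hv (-i) (by omega) (by omega) (g.injective this.symm)

section

variable (P : IsOrthogonalPair Γ G) (hg : g ∈ G)
include P hg

theorem not_adj_of_adj_end (h : SymPath Γ g c n) {v : S} (hv : Off c n v) (hgv : g v ≠ v)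
    (hadj : Γ.Adj (c n) v) {i : ℤ} (h1 : -n ≤ i) (h2 : i ≤ n) (hi : i ≠ n) :
    ¬ Γ.Adj (c i) v := by
  intro hiv
  have := P.neg_one_le_bil hg (h.root n le_rfl) hgv
  rw [bil_sum_vert] at this
  have := sum_cart_le_neg_two (hv.mem le_rfl) (Finset.mem_Icc.mpr ⟨h1, h2⟩)
    (j := (n : ℤ)) (by rw [Finset.mem_Icc]; omega) hi hiv hadj
  linarith

theorem bil_eq_of_adj (h : SymPath Γ g c n) {v : S} (hv : Off c n v) (hgv : g v ≠ v)
    {i : ℤ} (h1 : -n ≤ i) (h2 : i ≤ n) (hadj : Γ.Adj (c i) v) :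
    Γ.bil (∑ i ∈ Finset.Icc (-n : ℤ) n, vert (c i)) (vert v) = -1 := by
  have := P.neg_one_le_bil hg (h.root n le_rfl) hgv
  rw [bil_sum_vert] at this ⊢
  have := sum_cart_le (Γ := Γ) (hv.mem le_rfl) (Finset.mem_Icc.mpr ⟨h1, h2⟩)
  rw [hadj.cart_eq] at this
  linarith

/-- A moved neighbour `v` of the end `c n` is exchanged with its image: an orbit of size three would
make `v` adjacent to `c (-n)` as well. -/
theorem sq_eq_of_adj_end (h : SymPath Γ g c n) (hn : 1 ≤ n) {v : S} (hv : Off c n v)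
    (hgv : g v ≠ v) (hadj : Γ.Adj (c n) v) : g (g v) = v := by
  refine (P.pow_of_bil_eq_neg_one hg (h.root n le_rfl) hgv
    (h.bil_eq_of_adj P hg hv hgv (by omega) le_rfl hadj)).resolve_right fun h3 => ?_
  refine h.not_adj_of_adj_end P hg hv hgv hadj (i := -n) (by omega) (by omega) (by omega) ?_
  rw [← P.adj g hg, h.perm _ (by omega) (by omega), ← P.adj g hg, h.perm _ (by omega) (by omega),
    neg_neg, ← P.adj g hg, h.perm _ (by omega) (by omega), h3] at hadj
  exact hadj

/-- A symmetric path can be prolonged by `v` and `g v`, if `v` is a moved neighbour of its end. -/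
theorem extend (h : SymPath Γ g c n) {v : S} (hv : Off c n v) (hgv : g v ≠ v)
    (hgg : g (g v) = v) (hadj : Γ.Adj (c n) v) :
    ∃ c', SymPath Γ g c' (n + 1) ∧ (∀ i : ℤ, -n ≤ i → i ≤ n → c' i = c i) ∧ c' (n + 1) = v := by
  let c' : ℤ → S := fun i => if i = n + 1 then v else if i = -(n + 1) then g v else c i
  have e1 : c' (n + 1) = v := if_pos rfl
  have e2 : c' (-(n + 1)) = g v := (if_neg (by omega)).trans (if_pos rfl)
  have e3 : ∀ i : ℤ, -n ≤ i → i ≤ n → c' i = c i := fun i h1 h2 => by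
    simp only [c']; rw [if_neg (by omega), if_neg (by omega)]
  have hcases : ∀ i : ℤ, -(n + 1 : ℕ) ≤ i → i ≤ (n + 1 : ℕ) →
      (i = n + 1) ∨ (i = -(n + 1)) ∨ (-n ≤ i ∧ i ≤ n) := by
    intro i h1 h2; push_cast at h1 h2; omega
  have a1 : ∀ j : ℤ, -n ≤ j → j ≤ n → (Γ.Adj v (c j) ↔ j = n) := by
    intro j h1 h2
    constructor
    · intro h'
      by_contra hj
      exact h.not_adj_of_adj_end P hg hv hgv hadj h1 h2 hj h'.symm
    · rintro rfl; exact hadj.symm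
  have a2 : ∀ j : ℤ, -n ≤ j → j ≤ n → (Γ.Adj (g v) (c j) ↔ j = -n) := by
    intro j h1 h2
    have := h.perm (-j) (by omega) (by omega)
    rw [neg_neg] at this
    rw [← this, P.adj g hg, a1 _ (by omega) (by omega)]
    omega
  have n1 := P.not_adj hg (y := v)
  refine ⟨c', ⟨?_, ?_, ?_, ?_⟩, e3, e1⟩
  · intro i h1 h2
    rcases hcases i h1 h2 with rfl | rfl | ⟨h3, h4⟩
    · rw [e1, e2]
    · rw [e2, neg_neg, e1, hgg]
    · rw [e3 i h3 h4, e3 _ (by omega) (by omega), h.perm i h3 h4]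
  · intro i j h1 h2 h3 h4 hij
    have hv' := hv.perm h
    rcases hcases i h1 h2 with rfl | rfl | ⟨h1, h2⟩ <;>
      rcases hcases j h3 h4 with rfl | rfl | ⟨h3, h4⟩
    · rfl
    · rw [e1, e2] at hij; exact (hgv hij.symm).elim
    · rw [e1, e3 j h3 h4] at hij; exact (hv j h3 h4 hij).elim
    · rw [e1, e2] at hij; exact (hgv hij).elim
    · rfl
    · rw [e2, e3 j h3 h4] at hij; exact (hv' j h3 h4 hij).elim
    · rw [e1, e3 i h1 h2] at hij; exact (hv i h1 h2 hij.symm).elim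
    · rw [e2, e3 i h1 h2] at hij; exact (hv' i h1 h2 hij.symm).elim
    · rw [e3 i h1 h2, e3 j h3 h4] at hij; exact h.inj i j h1 h2 h3 h4 hij
  · intro i j h1 h2 h3 h4
    rcases hcases i h1 h2 with rfl | rfl | ⟨h1, h2⟩ <;>
      rcases hcases j h3 h4 with rfl | rfl | ⟨h3, h4⟩
    · simp
    · rw [e1, e2]; simp only [n1, false_iff]; omega
    · rw [e1, e3 j h3 h4, a1 j h3 h4]; omega
    · rw [e1, e2, Γ.adj_comm]; simp only [n1, false_iff]; omega
    · simp
    · rw [e2, e3 j h3 h4, a2 j h3 h4]; omega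
    · rw [e1, e3 i h1 h2, Γ.adj_comm, a1 i h1 h2]; omega
    · rw [e2, e3 i h1 h2, Γ.adj_comm, a2 i h1 h2]; omega
    · rw [e3 i h1 h2, e3 j h3 h4]; exact h.adj i j h1 h2 h3 h4
  · intro m hm
    have hsum : ∀ k : ℕ, k ≤ n → ∑ i ∈ Finset.Icc (-k : ℤ) k, vert (c' i) =
        ∑ i ∈ Finset.Icc (-k : ℤ) k, vert (c i) := by
      intro k hk
      refine Finset.sum_congr rfl fun i hi => ?_
      rw [Finset.mem_Icc] at hi
      rw [e3 i (by omega) (by omega)]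
    rcases Nat.lt_or_ge n m with hlt | hle
    · obtain rfl : m = n + 1 := by omega
      have hI : Finset.Icc (-(n + 1 : ℕ) : ℤ) (n + 1 : ℕ) =
          insert (n + 1 : ℤ) (insert (-(n + 1) : ℤ) (Finset.Icc (-n : ℤ) n)) := by
        ext i
        simp only [Finset.mem_Icc, Finset.mem_insert]
        push_cast
        omega
      rw [hI, Finset.sum_insert (by simp only [Finset.mem_insert, Finset.mem_Icc]; omega),
        Finset.sum_insert (by simp only [Finset.mem_Icc]; omega), e1, e2, hsum n le_rfl]
      have := P.fixedRoot_add_pair hg (h.root n le_rfl) hgv hgg (n := 1)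
        (h.bil_eq_of_adj P hg hv hgv (by omega) le_rfl hadj)
      convert this using 1
      module
    · rw [hsum m hle]; exact h.root m hle

/-- A symmetric path is determined by its vertices `c 0` and `c 1`: two continuations would both be
attached to the fixed root formed by the path, so that they lie in one orbit. -/
theorem unique {c' : ℤ → S} (h : SymPath Γ g c n) (h' : SymPath Γ g c' n) (h0 : c 0 = c' 0)
    (h1 : 1 ≤ n → c 1 = c' 1) : ∀ i : ℤ, -n ≤ i → i ≤ n → c i = c' i := by
  induction n with
  | zero =>
    intro i hi hi'
    obtain rfl : i = 0 := by push_cast at *; omega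
    exact h0
  | succ n ih =>
    have ih' := ih (h.restrict (Nat.le_succ n)) (h'.restrict (Nat.le_succ n))
      (fun _ => h1 (by omega))
    have key : c (n + 1) = c' (n + 1) := by
      rcases Nat.eq_zero_or_pos n with rfl | hn
      · simpa using h1 le_rfl
      have r := h.restrict (Nat.le_succ n)
      have r' := h'.restrict (Nat.le_succ n)
      have m := h.moved (i := n + 1) (by push_cast; omega) (by push_cast; omega) (by omega)
      have m' := h'.moved (i := n + 1) (by push_cast; omega) (by push_cast; omega) (by omega)
      have a : Γ.Adj (c n) (c (n + 1)) :=
        (h.adj _ _ (by push_cast; omega) (by push_cast; omega) (by push_cast; omega)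
          (by push_cast; omega)).mpr (Or.inl rfl)
      have a' : Γ.Adj (c' n) (c' (n + 1)) :=
        (h'.adj _ _ (by push_cast; omega) (by push_cast; omega) (by push_cast; omega)
          (by push_cast; omega)).mpr (Or.inl rfl)
      have b := r.bil_eq_of_adj P hg (fun i h1 h2 e => by
        have := h.inj _ _ (by push_cast; omega) (by push_cast; omega) (by push_cast; omega)
          (by push_cast; omega) e
        omega) m (by omega) le_rfl a
      have b' := r'.bil_eq_of_adj P hg (fun i h1 h2 e => by
        have := h'.inj _ _ (by push_cast; omega) (by push_cast; omega) (by push_cast; omega)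
          (by push_cast; omega) e
        omega) m' (by omega) le_rfl a'
      have hsum : ∑ i ∈ Finset.Icc (-n : ℤ) n, vert (c' i) =
          ∑ i ∈ Finset.Icc (-n : ℤ) n, vert (c i) := by
        refine Finset.sum_congr rfl fun i hi => ?_
        rw [Finset.mem_Icc] at hi
        rw [ih' i hi.1 hi.2]
      rw [hsum] at b'
      rcases P.eq_of_bil_eq_neg_one hg (r.root n le_rfl) m m' b b' with e | e | e
      · exact e.symm
      · rw [h.perm _ (by push_cast; omega) (by push_cast; omega)] at e
        rw [e, ← ih' n (by omega) le_rfl, h.adj _ _ (by push_cast; omega) (by push_cast; omega)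
          (by push_cast; omega) (by push_cast; omega)] at a'
        omega
      · rw [h'.perm _ (by push_cast; omega) (by push_cast; omega)] at e
        rw [e, ih' n (by omega) le_rfl, h'.adj _ _ (by push_cast; omega) (by push_cast; omega)
          (by push_cast; omega) (by push_cast; omega)] at a
        omega
    intro i hi hi'
    push_cast at hi hi'
    have : i = n + 1 ∨ i = -(n + 1) ∨ (-n ≤ i ∧ i ≤ n) := by omega
    rcases this with rfl | rfl | ⟨h3, h4⟩
    · exact key
    · rw [← h.perm _ (by push_cast; omega) (by push_cast; omega), key,
        h'.perm _ (by push_cast; omega) (by push_cast; omega)]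
    · exact ih' i h3 h4

/-- A moved neighbour of an inner vertex of a symmetric path is on the path. -/
theorem fixed_of_adj_inner (h : SymPath Γ g c n) {v : S} (hv : Off c n v) {i : ℤ} (h1 : -n < i)
    (h2 : i < n) (hadj : Γ.Adj (c i) v) : g v = v := by
  by_contra hgv
  have main : ∀ v, Off c n v → g v ≠ v → ∀ m : ℕ, m < n → ¬ Γ.Adj (c m) v := by
    intro v hv hgv m hm hadj
    have r := h.restrict hm.le
    have m1 := h.moved (i := m + 1) (by omega) (by omega) (by omega)
    have b := r.bil_eq_of_adj P hg (fun i h1 h2 e => by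
        have := h.inj _ _ (by omega) (by omega) (by omega) (by omega) e
        omega) m1 (by omega) le_rfl
        ((h.adj _ _ (by omega) (by omega) (by omega) (by omega)).mpr (Or.inl rfl))
    have b' := r.bil_eq_of_adj P hg (fun i h1 h2 => hv i (by omega) (by omega)) hgv (by omega)
      le_rfl hadj
    rcases P.eq_of_bil_eq_neg_one hg (r.root m le_rfl) m1 hgv b b' with e | e | e
    · exact hv _ (by omega) (by omega) e
    · rw [h.perm _ (by omega) (by omega)] at e
      exact hv _ (by omega) (by omega) e
    · exact hv.perm h _ (by omega) (by omega) e.symm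
  obtain ⟨m, rfl | rfl⟩ := i.eq_nat_or_neg
  · exact main v hv hgv m (by omega) hadj
  · rw [← P.adj g hg, h.perm _ (by omega) (by omega), neg_neg] at hadj
    exact main (g v) (hv.perm h) (fun e => hgv (g.injective e)) m (by omega) hadj

theorem not_adj_of_fixed_adj (h : SymPath Γ g c n) {z : S} (hz : g z = z) {j : ℕ}
    (hj : j ≤ n) (hadj : Γ.Adj z (c j)) {i : ℤ} (h1 : -j < i) (h2 : i < j) :
    ¬ Γ.Adj z (c i) := by
  intro hi
  obtain ⟨k, rfl⟩ : ∃ k, j = k + 1 := ⟨j - 1, by omega⟩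
  have r := h.restrict (m := k) (by omega)
  have m1 := h.moved (i := k + 1) (by omega) (by omega) (by omega)
  have a : Γ.Adj (c k) (c (k + 1)) :=
    (h.adj _ _ (by omega) (by omega) (by omega) (by omega)).mpr (Or.inl rfl)
  have b := r.bil_eq_of_adj P hg (fun i h1 h2 e => by
        have := h.inj _ _ (by omega) (by omega) (by omega) (by omega) e
        omega) m1 (by omega) le_rfl a
  push_cast at hadj h1 h2
  refine P.not_adj_of_attached hg (r.root k le_rfl) m1 hz (by rw [b]; norm_num) ?_ hadj
  by_cases hoff : Off c k z
  · rw [bil_sum_vert]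
    refine lt_of_le_of_lt (sum_cart_le (hoff.mem le_rfl)
      (Finset.mem_Icc.mpr (⟨?_, ?_⟩ : -(k : ℤ) ≤ i ∧ i ≤ k))) ?_
    · omega
    · omega
    · rw [hi.symm.cart_eq]; norm_num
  · -- the only fixed vertex of the path is its middle
    exfalso
    unfold Off at hoff
    push Not at hoff
    obtain ⟨l, l1, l2, rfl⟩ := hoff
    have l0 : l = 0 := by
      by_contra l0
      exact h.moved (by omega) (by omega) l0 hz
    subst l0
    rw [h.adj _ _ (by omega) (by omega) (by omega) (by omega)] at hadj hi
    omega

end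

end SymPath

end

noncomputable section

/-! ### Paths and cycles -/

open SimpleGraph CoxeterPairs Set

variable {S : Type*} {Γ : SimpleGraph S} {G : Subgroup (Equiv.Perm S)}

theorem eq_one_or_eq_of_fixes {g : Equiv.Perm S} (hg : g ∈ G) {y : S} (hgg : g (g y) = y)
    (hfix : ∀ h ∈ G, h y = y → h = 1) (hor : ∀ h ∈ G, h y = y ∨ h y = g y) :
    ∀ h ∈ G, h = 1 ∨ h = g := by
  intro h hh
  rcases hor h hh with e | e
  · exact Or.inl (hfix h hh e)
  · right
    have h1 := hfix (g * h) (mul_mem hg hh) (by rw [Equiv.Perm.mul_apply, e, hgg])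
    have h2 := hfix (g * g) (mul_mem hg hg) hgg
    exact mul_left_cancel (h1.trans h2.symm)

/-- `u` runs along a graph all of whose vertices have degree two, without turning back. -/
structure IsLine (Γ : SimpleGraph S) (u : ℤ → S) : Prop where
  adj : ∀ i v, Γ.Adj (u i) v ↔ v = u (i + 1) ∨ v = u (i - 1)
  ne : ∀ i, u (i + 2) ≠ u i

theorem IsLine.reverse {u : ℤ → S} (hu : IsLine Γ u) (a : ℤ) : IsLine Γ fun i => u (a - i) where
  adj i v := by
    rw [hu.adj, or_comm, show a - i - 1 = a - (i + 1) by ring,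
      show a - i + 1 = a - (i - 1) by ring]
  ne i h := hu.ne (a - (i + 2)) (by rw [show a - (i + 2) + 2 = a - i by ring]; exact h.symm)

theorem IsLine.shift {u : ℤ → S} (hu : IsLine Γ u) (a : ℤ) : IsLine Γ fun i => u (a + i) where
  adj i v := by rw [hu.adj, add_assoc, add_sub_assoc]
  ne i h := hu.ne (a + i) (by rw [add_assoc]; exact h)

theorem IsLine.eq {u w : ℤ → S} (hu : IsLine Γ u) (hw : IsLine Γ w) (h0 : u 0 = w 0)
    (h1 : u 1 = w 1) : u = w := by
  have key : ∀ u w : ℤ → S, IsLine Γ u → IsLine Γ w → u 0 = w 0 → u 1 = w 1 →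
      ∀ n : ℕ, u n = w n ∧ u (n + 1) = w (n + 1) := by
    intro u w hu hw h0 h1 n
    induction n with
    | zero => simpa using ⟨h0, h1⟩
    | succ n ih =>
      push_cast
      refine ⟨ih.2, ?_⟩
      have h := (hu.adj (n + 1) (u (n + 1 + 1))).mpr (Or.inl rfl)
      rw [ih.2, hw.adj] at h
      refine h.resolve_right fun h => ?_
      rw [add_sub_cancel_right, ← ih.1] at h
      exact hu.ne n (by rw [← h]; congr 1)
  funext i
  obtain ⟨n, rfl | rfl⟩ := i.eq_nat_or_neg
  · exact (key u w hu hw h0 h1 n).1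
  · have := (key _ _ (hu.reverse 1) (hw.reverse 1) (by simpa using h1) (by simpa using h0) n).2
    simpa using this

/-- A group of symmetries with fixed vertices of a line or a cycle is generated by a
reflection. -/
theorem IsOrthogonalPair.eq_one_or_eq_of_isLine (P : IsOrthogonalPair Γ G) {g : Equiv.Perm S}
    (hg : g ∈ G) {u : ℤ → S} (hu : IsLine Γ u) (hs : Function.Surjective u)
    (hper : ∀ i j, u i = u j → ∀ k, u (i + k) = u (j + k)) (hgu : ∀ i, g (u i) = u (-i)) :
    ∀ h ∈ G, h = 1 ∨ h = g := by
  have hshift : ∀ h ∈ G, ∀ c, (∀ i, h (u i) = u (c + i)) → h = 1 := by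
    intro h hh c hc
    obtain ⟨x, hx⟩ := P.fixed h hh
    obtain ⟨i, rfl⟩ := hs x
    ext1 v
    obtain ⟨j, rfl⟩ := hs v
    rw [hc] at hx
    have := hper _ _ hx (j - i)
    rw [hc, Equiv.Perm.one_apply]
    convert this using 2 <;> ring
  intro h hh
  obtain ⟨c, hc⟩ := hs (h (u 0))
  have hline : IsLine Γ fun i => h (u i) := by
    refine ⟨fun i v => ?_, fun i => h.injective.ne (hu.ne i)⟩
    obtain ⟨v, rfl⟩ := h.surjective v
    rw [P.adj h hh, hu.adj, h.injective.eq_iff, h.injective.eq_iff]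
  have h1 := (hline.adj 0 (h (u 1))).mpr (by simp)
  simp only [← hc] at h1
  rcases (hu.adj _ _).mp h1 with h1 | h1
  · left
    exact hshift h hh c fun i => congrFun (hline.eq (hu.shift c) (by simpa using hc.symm) h1) i
  · right
    have e : ∀ i, h (u i) = u (c - i) :=
      fun i => congrFun (hline.eq (hu.reverse c) (by simpa using hc.symm) h1) i
    have e1 := hshift (h * g) (mul_mem hh hg) c fun i => by
      rw [Equiv.Perm.mul_apply, hgu, e, sub_neg_eq_add]
    have e2 := hshift (g * g) (mul_mem hg hg) 0 fun i => by
      rw [Equiv.Perm.mul_apply, hgu, hgu, neg_neg, zero_add]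
    exact mul_right_cancel (e1.trans e2.symm)

namespace SymPath

variable (P : IsOrthogonalPair Γ G) {g : Equiv.Perm S} (hg : g ∈ G) {c : ℤ → S} {n : ℕ}
include P hg

theorem pairIso_graphA (h : SymPath Γ g c n) (hn : 1 ≤ n)
    (hT : ∀ v, ∃ i : ℤ, -n ≤ i ∧ i ≤ n ∧ v = c i) :
    PairIso Γ G (graphA (2 * n + 1)) (Subgroup.zpowers (flipA n)) := by
  have hgg : g (g (c n)) = c n := by
    rw [h.perm _ (by omega) (by omega), h.perm _ (by omega) (by omega), neg_neg]
  have hend : ∀ v, Γ.Adj (c n) v → v = c (n - 1) := by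
    intro v hv
    obtain ⟨i, h1, h2, rfl⟩ := hT v
    rw [h.adj _ _ (by omega) (by omega) h1 h2] at hv
    congr 1; omega
  have hgrp := eq_one_or_eq_of_fixes hg hgg (fun k hk hkn => by
      have key : ∀ m : ℕ, m < 2 * n → k (c (n - m)) = c (n - m) ∧
          k (c (n - m - 1)) = c (n - m - 1) := by
        intro m
        induction m with
        | zero =>
          intro _
          simp only [Nat.cast_zero, sub_zero]
          refine ⟨hkn, hend _ ?_⟩
          conv_lhs => rw [← hkn]
          rw [P.adj k hk, h.adj _ _ (by omega) (by omega) (by omega) (by omega)]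
          omega
        | succ m ih =>
          intro hm
          obtain ⟨h1, h2⟩ := ih (by omega)
          push_cast
          rw [show (n : ℤ) - (m + 1) = n - m - 1 by ring]
          refine ⟨h2, ?_⟩
          have ha : Γ.Adj (c (n - m - 1)) (c (n - m - 1 - 1)) := by
            rw [h.adj _ _ (by omega) (by omega) (by omega) (by omega)]; omega
          rw [← P.adj k hk, h2] at ha
          obtain ⟨i, i1, i2, e⟩ := hT (k (c (n - m - 1 - 1)))
          rw [e, h.adj _ _ (by omega) (by omega) i1 i2] at ha
          rcases ha with rfl | ha
          · rw [show (n : ℤ) - m - 1 + 1 = n - m by ring, ← h1] at e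
            have := h.inj _ _ (by omega) (by omega) (by omega) (by omega) (k.injective e)
            omega
          · rw [e]; congr 1; omega
      ext1 v
      obtain ⟨i, h1, h2, rfl⟩ := hT v
      rcases eq_or_lt_of_le h1 with rfl | h1
      · have := (key (2 * n - 1) (by omega)).2
        rwa [show ((n : ℤ) - (2 * n - 1 : ℕ) - 1) = -n by omega] at this
      · have := (key (n - i).toNat (by omega)).1
        rwa [show ((n : ℤ) - (n - i).toNat) = i by omega] at this) (fun k hk => by
      obtain ⟨i, h1, h2, e⟩ := hT (k (c n))
      rw [h.perm n (by omega) le_rfl]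
      by_cases hi : i = n ∨ i = -n
      · rcases hi with rfl | rfl
        · exact Or.inl e
        · exact Or.inr e
      exfalso
      -- an inner vertex has two neighbours
      have a1 : Γ.Adj (c i) (c (i + 1)) := by
        rw [h.adj _ _ (by omega) (by omega) (by omega) (by omega)]; omega
      have a2 : Γ.Adj (c i) (c (i - 1)) := by
        rw [h.adj _ _ (by omega) (by omega) (by omega) (by omega)]; omega
      obtain ⟨v, hv⟩ := k.surjective (c (i + 1))
      obtain ⟨w, hw⟩ := k.surjective (c (i - 1))
      rw [← e, ← hv, P.adj k hk] at a1
      rw [← e, ← hw, P.adj k hk] at a2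
      have hvw : c (i + 1) = c (i - 1) := by rw [← hv, ← hw, hend v a1, hend w a2]
      have := h.inj _ _ (by omega) (by omega) (by omega) (by omega) hvw
      omega)
  refine pairIso_zpowers (f := fun i : Icc 1 (2 * n + 1) => c ((i : ℕ) - (n + 1))) ⟨?_, fun v => ?_⟩ ?_ hg hgrp ?_
  · rintro ⟨i, i1, i2⟩ ⟨j, j1, j2⟩ hij
    have := h.inj _ _ (by simp only; omega) (by simp only; omega) (by simp only; omega)
      (by simp only; omega) hij
    simp only [Subtype.ext_iff] at this ⊢
    omega
  · obtain ⟨i, h1, h2, rfl⟩ := hT v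
    refine ⟨⟨(i + (n + 1)).toNat, by rw [mem_Icc]; omega⟩, ?_⟩
    simp only
    congr 1; omega
  · rintro ⟨i, i1, i2⟩ ⟨j, j1, j2⟩
    simp only [graphA, fromRel_adj, ne_eq, Subtype.ext_iff]
    rw [h.adj _ _ (by omega) (by omega) (by omega) (by omega)]
    omega
  · rintro ⟨i, i1, i2⟩
    simp only [flipA, labelPerm, Equiv.coe_fn_mk]
    rw [h.perm _ (by omega) (by omega)]
    congr 1; omega

theorem pairIso_graphAffA (h : SymPath Γ g c n) (hn : 1 ≤ n) {z : S} (hz : g z = z)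
    (hoff : Off c n z) (hadj : Γ.Adj z (c n)) :
    PairIso Γ G (graphAffA (2 * n + 1)) (Subgroup.zpowers (flipAffA n)) := by
  have hzc : ∀ i : ℤ, -n ≤ i → i ≤ n → (Γ.Adj z (c i) ↔ i = n ∨ i = -n) := by
    intro i h1 h2
    constructor
    · intro hi
      by_contra hcon
      exact h.not_adj_of_fixed_adj P hg hz le_rfl hadj (by omega) (by omega) hi
    · rintro (rfl | rfl)
      · exact hadj
      · rw [← P.adj g hg, hz, h.perm _ (by omega) (by omega)] at hadj
        exact hadj
  have mn := h.moved (i := n) (by omega) (by omega) (by omega)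
  have ezn := hadj.cart_eq
  have hsumz : Γ.bil (vert z) (∑ i ∈ Finset.Icc (-n : ℤ) n, vert (c i)) = -2 := by
    rw [bil_symm, bil_sum_vert, Finset.sum_eq_add_of_mem (n : ℤ) (-n) (by simp) (by simp)
      (by omega), Γ.cart_symm, ezn, Γ.cart_symm, ((hzc (-n) (by omega) (by omega)).mpr (by simp)).cart_eq]
    · norm_num
    · intro i hi hne
      rw [Finset.mem_Icc] at hi
      exact cart_eq_zero (hoff i hi.1 hi.2).symm fun hi' => by
        have := (hzc i hi.1 hi.2).mp hi'.symm
        tauto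
  have hsumn : Γ.bil (∑ i ∈ Finset.Icc (-n : ℤ) n, vert (c i)) (vert (c n)) = 1 := by
    rw [bil_sum_vert, Finset.sum_eq_add_of_mem (n : ℤ) (n - 1) (by simp)
      (by rw [Finset.mem_Icc]; omega) (by omega), cart_self,
      h.cart (by omega) (by omega) (by omega) (by omega)]
    · rw [if_neg (by omega), if_pos (by omega)]; norm_num
    · intro i hi hne
      rw [Finset.mem_Icc] at hi
      rw [h.cart (by omega) (by omega) (by omega) (by omega), if_neg (by omega),
        if_neg (by omega)]
  -- the sum of all these vertices is isotropic
  have hT : ∀ v, v = z ∨ ∃ i : ℤ, -n ≤ i ∧ i ≤ n ∧ v = c i := by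
    refine P.conn.mem_of_closed (T := {v | v = z ∨ ∃ i : ℤ, -n ≤ i ∧ i ≤ n ∧ v = c i})
      (Or.inl rfl) ?_
    intro u hu v huv
    by_contra hv
    change ¬ (_ ∨ _) at hv
    push Not at hv
    obtain ⟨v1, v2⟩ := hv
    have c1 := cart_nonpos (Γ := Γ) (Ne.symm v1)
    have c2 : ∀ i ∈ Finset.Icc (-n : ℤ) n, v ≠ c i := fun i hi => by
      rw [Finset.mem_Icc] at hi; exact v2 i hi.1 hi.2
    have c3 : ∑ i ∈ Finset.Icc (-n : ℤ) n, Γ.cart (c i) v ≤ 0 :=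
      Finset.sum_nonpos fun i hi => cart_nonpos (c2 i hi).symm
    have := P.bil_eq_zero_of_isotropic hg (fixedRoot_vert (Γ := Γ) hz) (h.root n le_rfl) hsumz mn
      (by rw [bil_vert_vert, ezn]) hsumn (v2 n (by omega) le_rfl)
      (by rw [bil_vert_vert]; exact c1) (by rw [bil_sum_vert]; exact c3)
    rw [bil_vert_vert, bil_sum_vert] at this
    rcases hu with rfl | ⟨i, i1, i2, rfl⟩
    · rw [huv.cart_eq] at this; omega
    · have := sum_cart_le (Γ := Γ) c2 (Finset.mem_Icc.mpr ⟨i1, i2⟩)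
      rw [huv.cart_eq] at this; omega
  obtain ⟨N, hN⟩ : ∃ N : ℤ, N = 2 * n + 2 := ⟨_, rfl⟩
  let F : ℤ → S := fun r => if r = 0 then z else c (r - (n + 1))
  have F0 : F 0 = z := if_pos rfl
  have F1 : ∀ r, r ≠ 0 → F r = c (r - (n + 1)) := fun r hr => if_neg hr
  have Finj : ∀ r s, 0 ≤ r → r < N → 0 ≤ s → s < N → (F r = F s ↔ r = s) := by
    intro r s r1 r2 s1 s2
    refine ⟨fun e => ?_, fun e => by rw [e]⟩
    by_cases hr : r = 0 <;> by_cases hs : s = 0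
    · omega
    · rw [hr, F0, F1 s hs] at e
      exact (hoff _ (by omega) (by omega) e).elim
    · rw [hs, F0, F1 r hr] at e
      exact (hoff _ (by omega) (by omega) e.symm).elim
    · rw [F1 r hr, F1 s hs] at e
      have := h.inj _ _ (by omega) (by omega) (by omega) (by omega) e
      omega
  have Fsurj : ∀ v, ∃ r, 0 ≤ r ∧ r < N ∧ v = F r := by
    intro v
    rcases hT v with rfl | ⟨i, h1, h2, rfl⟩
    · exact ⟨0, le_rfl, by omega, F0.symm⟩
    · refine ⟨i + (n + 1), by omega, by omega, ?_⟩
      rw [F1 _ (by omega), add_sub_cancel_right]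
  have Fadj : ∀ r s, 0 ≤ r → r < N → 0 ≤ s → s < N → (Γ.Adj (F r) (F s) ↔
      s = r + 1 ∨ r = s + 1 ∨ (r = 0 ∧ s = N - 1) ∨ (r = N - 1 ∧ s = 0)) := by
    intro r s r1 r2 s1 s2
    by_cases hr : r = 0 <;> by_cases hs : s = 0
    · rw [hr, hs]; simp; omega
    · rw [hr, F0, F1 s hs, hzc _ (by omega) (by omega)]; omega
    · rw [hs, F0, F1 r hr, Γ.adj_comm, hzc _ (by omega) (by omega)]; omega
    · rw [F1 r hr, F1 s hs, h.adj _ _ (by omega) (by omega) (by omega) (by omega)]; omega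
  have Fperm : ∀ r, 0 ≤ r → r < N → g (F r) = F (if r = 0 then 0 else N - r) := by
    intro r r1 r2
    split_ifs with hr
    · rw [hr, F0, hz]
    · rw [F1 r hr, F1 _ (by omega), h.perm _ (by omega) (by omega)]
      congr 1; omega
  -- the periodic walk around the cycle
  let ρ : ℤ → ℤ := fun i => (i + (n + 1)) % N
  have ρ0 : ∀ i, 0 ≤ ρ i := fun i => Int.emod_nonneg _ (by omega)
  have ρ1 : ∀ i, ρ i < N := fun i => Int.emod_lt_of_pos _ (by omega)
  have ρs : ∀ i, ρ (i + 1) = if ρ i + 1 = N then 0 else ρ i + 1 := by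
    intro i
    have hd := Int.emod_add_mul_ediv (i + (n + 1)) N
    have h0 := ρ0 i
    have h1 := ρ1 i
    change ρ i + _ = _ at hd
    split_ifs with hi
    · exact ((Int.ediv_emod_unique (q := (i + (n + 1)) / N + 1) (by omega)).mpr
        ⟨by rw [mul_add]; omega, by omega, by omega⟩).2
    · exact ((Int.ediv_emod_unique (q := (i + (n + 1)) / N) (by omega)).mpr
        ⟨by omega, by omega, by omega⟩).2
  have ρneg : ∀ i, ρ (-i) = if ρ i = 0 then 0 else N - ρ i := by
    intro i
    have hd := Int.emod_add_mul_ediv (i + (n + 1)) N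
    have h0 := ρ0 i
    have h1 := ρ1 i
    change ρ i + _ = _ at hd
    split_ifs with hi
    · exact ((Int.ediv_emod_unique (q := -((i + (n + 1)) / N) + 1) (by omega)).mpr
        ⟨by rw [mul_add, mul_neg]; omega, by omega, by omega⟩).2
    · exact ((Int.ediv_emod_unique (q := -((i + (n + 1)) / N)) (by omega)).mpr
        ⟨by rw [mul_neg]; omega, by omega, by omega⟩).2
  have hline : IsLine Γ fun i => F (ρ i) := by
    constructor
    · intro i v
      obtain ⟨s, s1, s2, rfl⟩ := Fsurj v
      rw [Fadj _ _ (ρ0 i) (ρ1 i) s1 s2, Finj _ _ s1 s2 (ρ0 _) (ρ1 _),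
        Finj _ _ s1 s2 (ρ0 _) (ρ1 _), ρs i]
      have h1 := ρs (i - 1)
      rw [sub_add_cancel] at h1
      have h2 := ρ0 (i - 1)
      have h3 := ρ1 (i - 1)
      have h4 := ρ0 i
      have h5 := ρ1 i
      split_ifs at h1 ⊢ <;> omega
    · intro i
      rw [Ne, Finj _ _ (ρ0 _) (ρ1 _) (ρ0 _) (ρ1 _), show i + 2 = i + 1 + 1 by ring, ρs, ρs]
      have h4 := ρ0 i
      have h5 := ρ1 i
      split_ifs <;> omega
  have hgrp := P.eq_one_or_eq_of_isLine hg hline (fun v => by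
      obtain ⟨r, r1, r2, rfl⟩ := Fsurj v
      refine ⟨r - (n + 1), ?_⟩
      simp only [ρ, sub_add_cancel, Int.emod_eq_of_lt r1 r2]) (fun i j e k => by
      have e' := (Finj _ _ (ρ0 _) (ρ1 _) (ρ0 _) (ρ1 _)).mp e
      have : (i + (n + 1)) + k ≡ (j + (n + 1)) + k [ZMOD N] := Int.ModEq.add_right k e'
      simp only [ρ]
      rw [show i + k + (n + 1) = i + (n + 1) + k by ring,
        show j + k + (n + 1) = j + (n + 1) + k by ring, this]) (fun i => by
      rw [Fperm _ (ρ0 _) (ρ1 _), ρneg])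
  refine pairIso_zpowers (f := fun i : Icc 0 (2 * n + 1) => F (i : ℕ)) ⟨?_, fun v => ?_⟩ ?_ hg
    hgrp ?_
  · rintro ⟨i, i1, i2⟩ ⟨j, j1, j2⟩ hij
    have := (Finj _ _ (by omega) (by simp only; omega) (by omega) (by simp only; omega)).mp hij
    simp only [Subtype.ext_iff] at this ⊢
    omega
  · obtain ⟨r, r1, r2, rfl⟩ := Fsurj v
    refine ⟨⟨r.toNat, by rw [mem_Icc]; omega⟩, ?_⟩
    simp only
    congr 1; omega
  · rintro ⟨i, i1, i2⟩ ⟨j, j1, j2⟩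
    simp only [graphAffA, fromRel_adj, ne_eq, Subtype.ext_iff]
    rw [Fadj _ _ (by omega) (by omega) (by omega) (by omega)]
    omega
  · rintro ⟨i, i1, i2⟩
    simp only [flipAffA, labelPerm, Equiv.coe_fn_mk]
    rw [Fperm _ (by omega) (by omega)]
    congr 1
    split_ifs <;> omega

end SymPath

/-- A two-sided infinite symmetric path without further neighbours. -/
theorem IsOrthogonalPair.pairIso_graphInfAInf (P : IsOrthogonalPair Γ G) {g : Equiv.Perm S}
    (hg : g ∈ G) {c : ℤ → S} (h : ∀ n, SymPath Γ g c n) (hT : Function.Surjective c) :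
    PairIso Γ G graphInfAInf (Subgroup.zpowers (Equiv.neg ℤ)) := by
  have hinj : Function.Injective c := fun i j =>
    (h (i.natAbs + j.natAbs)).inj i j (by omega) (by omega) (by omega) (by omega)
  have hadj : ∀ i j, Γ.Adj (c i) (c j) ↔ j = i + 1 ∨ i = j + 1 := fun i j =>
    (h (i.natAbs + j.natAbs)).adj i j (by omega) (by omega) (by omega) (by omega)
  have hperm : ∀ i, g (c i) = c (-i) := fun i => (h i.natAbs).perm i (by omega) (by omega)
  have hline : IsLine Γ c := by
    refine ⟨fun i v => ?_, fun i => hinj.ne (by omega)⟩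
    obtain ⟨j, rfl⟩ := hT v
    rw [hadj, hinj.eq_iff, hinj.eq_iff]; omega
  refine pairIso_zpowers ⟨hinj, hT⟩ (fun i j => ?_) hg
    (P.eq_one_or_eq_of_isLine hg hline hT (fun i j e k => by rw [hinj e]) hperm) (fun i => ?_)
  · rw [hadj, graphInfAInf, fromRel_adj]; omega
  · rw [hperm, Equiv.neg_apply]

end

noncomputable section

/-! ### Forks -/

open SimpleGraph CoxeterPairs Set

variable {S : Type*} {Γ : SimpleGraph S} {G : Subgroup (Equiv.Perm S)}

namespace IsOrthogonalPair

variable (P : IsOrthogonalPair Γ G) {g : Equiv.Perm S} (hg : g ∈ G)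
  (hinv : ∀ k ∈ G, ∀ x y, k x = x → Γ.Adj x y → k (k y) = y)

include hg hinv in
/-- The symmetries fixing a vertex `x` act on the neighbours of `x` by commuting involutions. -/
theorem perm_fixed_neighbour {x z : S} (hx : g x = x) (hz : g z = z) (hxz : Γ.Adj x z)
    {h : Equiv.Perm S} (hh : h ∈ G) (hhx : h x = x) : g (h z) = h z := by
  have h1 := hinv h hh x z hhx hxz
  have h2 := hinv (g * h) (mul_mem hg hh) x z (by rw [Equiv.Perm.mul_apply, hhx, hx]) hxz
  simp only [Equiv.Perm.mul_apply] at h2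
  refine h.injective (g.injective ?_)
  rw [h2, h1, hz]

include P hg hinv in
theorem eq_one_or_eq_of_fork {x y z : S} (hx : g x = x) (hy : g y ≠ y) (hz : g z = z)
    (hN : ∀ v, Γ.Adj x v ↔ v = y ∨ v = g y ∨ v = z)
    (hdeg : ∀ v, v ≠ x → ∀ p q r, Γ.Adj v p → Γ.Adj v q → Γ.Adj v r → p = q ∨ p = r ∨ q = r)
    (hfix : ∀ h ∈ G, h x = x → h y = y → h (g y) = g y → h z = z → h = 1) :
    ∀ h ∈ G, h = 1 ∨ h = g := by
  have hxy : Γ.Adj x y := (hN y).mpr (by simp)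
  have hxgy : Γ.Adj x (g y) := (hN _).mpr (by simp)
  have hxz : Γ.Adj x z := (hN z).mpr (by simp)
  have n1 : y ≠ z := by rintro rfl; exact hy hz
  have n2 : g y ≠ z := fun e => n1 (g.injective (e.trans hz.symm))
  have kx : ∀ h ∈ G, h x = x := by
    intro h hh
    by_contra hhx
    rcases hdeg _ hhx (h y) (h (g y)) (h z) ((P.adj h hh _ _).mpr hxy)
      ((P.adj h hh _ _).mpr hxgy) ((P.adj h hh _ _).mpr hxz) with e | e | e
    · exact hy (h.injective e).symm
    · exact n1 (h.injective e)
    · exact n2 (h.injective e)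
  have kN : ∀ h ∈ G, ∀ v, Γ.Adj x v → Γ.Adj x (h v) := by
    intro h hh v hv
    have := (P.adj h hh x v).mpr hv
    rwa [kx h hh] at this
  have kz : ∀ h ∈ G, h z = z := by
    intro h hh
    have := perm_fixed_neighbour hg hinv hx hz hxz hh (kx h hh)
    rcases (hN _).mp (kN h hh z hxz) with e | e | e
    · rw [e] at this; exact (hy this).elim
    · rw [e] at this; exact (hy (g.injective this)).elim
    · exact e
  refine eq_one_or_eq_of_fixes hg (hinv g hg x y hx hxy) (fun h hh hhy => ?_) (fun h hh => ?_)
  · refine hfix h hh (kx h hh) hhy ?_ (kz h hh)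
    rcases (hN _).mp (kN h hh _ hxgy) with e | e | e
    · exact (hy (h.injective (e.trans hhy.symm))).elim
    · exact e
    · exact (n2 (h.injective (e.trans (kz h hh).symm))).elim
  · rcases (hN _).mp (kN h hh y hxy) with e | e | e
    · exact Or.inl e
    · exact Or.inr e
    · exact (n1 (h.injective (e.trans (kz h hh).symm))).elim

end IsOrthogonalPair

namespace SymPath

variable (P : IsOrthogonalPair Γ G) {g : Equiv.Perm S} (hg : g ∈ G) {c : ℤ → S} {n : ℕ}
include P hg

theorem cart_of_adj_zero (h : SymPath Γ g c n) {z : S} (hz : g z = z) (hxz : Γ.Adj z (c 0))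
    {i : ℤ} (h1 : -n ≤ i) (h2 : i ≤ n) : Γ.cart z (c i) = if i = 0 then -1 else 0 := by
  split_ifs with h0
  · rw [h0]; exact hxz.cart_eq
  · refine cart_eq_zero (fun e => h.moved h1 h2 h0 (e ▸ hz)) fun hadj => ?_
    obtain ⟨m, rfl | rfl⟩ := i.eq_nat_or_neg
    · exact h.not_adj_of_fixed_adj P hg hz (j := m) (by omega) hadj (by omega) (by omega) hxz
    · rw [← P.adj g hg, hz, h.perm _ h1 h2, neg_neg] at hadj
      exact h.not_adj_of_fixed_adj P hg hz (j := m) (by omega) hadj (by omega) (by omega) hxz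

/-- The graph does not contain `Ẽ₇`, with the arms of length three exchanged. -/
theorem false_of_three (h : SymPath Γ g c 3) {z : S} (hz : g z = z) (hxz : Γ.Adj z (c 0)) :
    False := by
  have hc : ∀ i j : ℤ, -3 ≤ i → i ≤ 3 → -3 ≤ j → j ≤ 3 → Γ.cart (c i) (c j) =
      if i = j then 2 else if j = i + 1 ∨ i = j + 1 then -1 else 0 :=
    fun i j h1 h2 h3 h4 => h.cart h1 h2 h3 h4
  have hzc : ∀ i : ℤ, -3 ≤ i → i ≤ 3 → Γ.cart z (c i) = if i = 0 then -1 else 0 :=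
    fun i h1 h2 => h.cart_of_adj_zero P hg hz hxz h1 h2
  have hcz : ∀ i : ℤ, -3 ≤ i → i ≤ 3 → Γ.cart (c i) z = if i = 0 then -1 else 0 :=
    fun i h1 h2 => by rw [Γ.cart_symm, hzc i h1 h2]
  have hp : ∀ i : ℤ, -3 ≤ i → i ≤ 3 → g (c i) = c (-i) := h.perm
  -- `β = 2 c₀ + 2 c₁ + c₋₁ + c₂ + c₋₂ + c₃ + z` is a root, and its inner product with `g β`
  -- is `-2`, since `β - g β = c₁ - c₋₁ + c₃ - c₋₃` has norm `8`
  have r1 : Γ.LatRoot (vert (c 0) + (1 : ℤ) • vert (c 1) + (1 : ℤ) • vert (c (-1)) +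
      (1 : ℤ) • vert z) :=
    (LatRoot.simple z).add_smul ((LatRoot.simple (c (-1))).add_smul
      ((LatRoot.simple (c 1)).add_smul (.simple (c 0)) (by simp [bil_vert_vert, hc]))
      (by simp [bil_vert_vert, hc])) (by simp [bil_vert_vert, hcz])
  have r2 := (LatRoot.simple (c (-2))).add_smul ((LatRoot.simple (c 2)).add_smul
      ((LatRoot.simple (c 0)).add_smul r1 (n := 1) (by simp [bil_vert_vert, hc, hzc]))
      (n := 1) (by simp [bil_vert_vert, hc, hzc])) (n := 1) (by simp [bil_vert_vert, hc, hzc])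
  have r3 := (LatRoot.simple (c 1)).add_smul ((LatRoot.simple (c 3)).add_smul r2 (n := 1)
      (by simp [bil_vert_vert, hc, hzc])) (n := 1) (by simp [bil_vert_vert, hc, hzc])
  have := P.bil_perm hg r3
  simp [latPerm_vert, bil_vert_vert, hc, hzc, hcz, hp, hz, cart_self] at this

end SymPath

end

noncomputable section

/-! ### The types `E₆` and `Ẽ₆` -/

open SimpleGraph CoxeterPairs Set

variable {S : Type*} {Γ : SimpleGraph S} {G : Subgroup (Equiv.Perm S)}

namespace SymPath

variable (P : IsOrthogonalPair Γ G) {g : Equiv.Perm S} (hg : g ∈ G)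
  (hinv : ∀ k ∈ G, ∀ x y, k x = x → Γ.Adj x y → k (k y) = y) {c : ℤ → S}
include P hg hinv

set_option maxHeartbeats 1000000 in
/-- A symmetric path of length five with a fixed vertex `z` attached to its middle and no other
neighbours of its moved vertices is of type `Ẽ₆` if `z` has a further neighbour, and of type `E₆`
otherwise. -/
theorem pairIso_graphE6 (h : SymPath Γ g c 2) {z : S} (hz : g z = z) (hxz : Γ.Adj z (c 0))
    (hmax : ∀ v, Off c 2 v → ∀ i : ℤ, -2 ≤ i → i ≤ 2 → i ≠ 0 → ¬ Γ.Adj (c i) v) :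
    PairIso Γ G graphE6 (Subgroup.zpowers (flipE6 1 le_rfl)) ∨
      PairIso Γ G graphAffE6 (Subgroup.zpowers (flipE6 0 zero_le_one)) := by
  have hc : ∀ i j : ℤ, -2 ≤ i → i ≤ 2 → -2 ≤ j → j ≤ 2 → Γ.cart (c i) (c j) =
      if i = j then 2 else if j = i + 1 ∨ i = j + 1 then -1 else 0 :=
    fun i j h1 h2 h3 h4 => h.cart h1 h2 h3 h4
  have hzc : ∀ i : ℤ, -2 ≤ i → i ≤ 2 → Γ.cart z (c i) = if i = 0 then -1 else 0 :=
    fun i h1 h2 => h.cart_of_adj_zero P hg hz hxz h1 h2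
  have hcz : ∀ i : ℤ, -2 ≤ i → i ≤ 2 → Γ.cart (c i) z = if i = 0 then -1 else 0 :=
    fun i h1 h2 => by rw [Γ.cart_symm, hzc i h1 h2]
  have hp : ∀ i : ℤ, -2 ≤ i → i ≤ 2 → g (c i) = c (-i) := h.perm
  have hadj : ∀ i j : ℤ, -2 ≤ i → i ≤ 2 → -2 ≤ j → j ≤ 2 →
      (Γ.Adj (c i) (c j) ↔ j = i + 1 ∨ i = j + 1) := h.adj
  have hinj : ∀ i j : ℤ, -2 ≤ i → i ≤ 2 → -2 ≤ j → j ≤ 2 → (c i = c j ↔ i = j) :=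
    fun i j h1 h2 h3 h4 => ⟨h.inj i j h1 h2 h3 h4, fun e => by rw [e]⟩
  have hoffz : Off c 2 z := by
    rintro i h1 h2 e
    have := hcz i h1 h2
    rw [e, cart_self] at this
    split_ifs at this
    omega
  have m1 : g (c 1) ≠ c 1 := h.moved (by norm_num) (by norm_num) (by norm_num)
  have m2 : g (c 2) ≠ c 2 := h.moved (by norm_num) (by norm_num) (by norm_num)
  have mm : ∀ i : ℤ, -2 ≤ i → i ≤ 2 → i ≠ 0 → g (c i) ≠ c i :=
    fun i h1 h2 h0 => h.moved h1 h2 h0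
  have fx : g (c 0) = c 0 := h.fix_zero
  have fθ := fixedRoot_vert (Γ := Γ) fx
  have hzadj : ∀ i : ℤ, -2 ≤ i → i ≤ 2 → (Γ.Adj z (c i) ↔ i = 0) := fun i h1 h2 => by
    constructor
    · intro hi
      have := hzc i h1 h2
      rw [hi.cart_eq] at this
      by_contra h0
      rw [if_neg h0] at this
      omega
    · rintro rfl; exact hxz
  have fη := P.fixedRoot_add_pair hg fθ m1 (hinv g hg _ _ fx (by simp [hadj])) (n := 1)
    (by simp [bil_vert_vert, hc])
  rw [hp 1 (by norm_num) (by norm_num)] at fη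
  have hr := h.root 2 le_rfl
  have fη2 := P.fixedRoot_add_pair hg fη m2 (by simp [hp]) (n := 1)
    (by simp [bil_vert_vert, hc])
  rw [hp 2 (by norm_num) (by norm_num)] at fη2
  -- `z` is the only neighbour of the middle vertex off the path
  have huniq : ∀ v, Off c 2 v → Γ.Adj (c 0) v → v = z := by
    intro v hv hxv
    by_contra hvz
    have gv : g v = v := h.fixed_of_adj_inner P hg hv (by norm_num) (by norm_num) hxv
    have evz : Γ.cart z v = 0 := cart_eq_zero (Ne.symm hvz) (P.not_adj_of_fixed hg fθ m1 hz gv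
      (by simp [bil_vert_vert, hc]) (by simp [bil_vert_vert, hcz])
      (by rw [bil_vert_vert, hxv.cart_eq]))
    have evc : ∀ i : ℤ, -2 ≤ i → i ≤ 2 → Γ.cart (c i) v = if i = 0 then -1 else 0 :=
      fun i h1 h2 => by rw [Γ.cart_symm, h.cart_of_adj_zero P hg gv hxv.symm h1 h2]
    have evc' : ∀ i : ℤ, -2 ≤ i → i ≤ 2 → Γ.cart v (c i) = if i = 0 then -1 else 0 :=
      fun i h1 h2 => by rw [Γ.cart_symm, evc i h1 h2]
    have f1 := fη.add (fixedRoot_vert hz) (by simp [bil_vert_vert, hcz])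
    have f2 := f1.add (fixedRoot_vert gv) (by simp [bil_vert_vert, evc, evz])
    have := P.bil_eq_zero_of_isotropic hg fθ f2 (by simp [bil_vert_vert, hc, hcz, evc]) m1
      (by simp [bil_vert_vert, hc]) (by simp [bil_vert_vert, hc, hzc, evc'])
      (v := c 2) (by simp [hinj]) (by simp [bil_vert_vert, hc])
      (by simp [bil_vert_vert, hc, hzc, evc'])
    simp [bil_vert_vert, hc, hzc, evc'] at this
  have hN : ∀ v, Γ.Adj (c 0) v ↔ v = c 1 ∨ v = g (c 1) ∨ v = z := by
    intro v
    rw [hp 1 (by norm_num) (by norm_num)]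
    constructor
    · intro hv
      by_cases hoff : Off c 2 v
      · exact Or.inr (Or.inr (huniq v hoff hv))
      · unfold Off at hoff
        push Not at hoff
        obtain ⟨i, h1, h2, rfl⟩ := hoff
        rw [hadj 0 i (by norm_num) (by norm_num) h1 h2] at hv
        rcases hv with hv | hv
        · left; congr 1
        · right; left; congr 1; omega
    · rintro (rfl | rfl | rfl)
      · simp [hadj]
      · simp [hadj]
      · exact hxz.symm
  have hNc : ∀ i : ℤ, -2 ≤ i → i ≤ 2 → i ≠ 0 → ∀ v, Γ.Adj (c i) v →
      ∃ j : ℤ, -2 ≤ j ∧ j ≤ 2 ∧ (j = i + 1 ∨ i = j + 1) ∧ v = c j := by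
    intro i h1 h2 h0 v hv
    by_cases hoff : Off c 2 v
    · exact (hmax v hoff i h1 h2 h0 hv).elim
    · unfold Off at hoff
      push Not at hoff
      obtain ⟨j, j1, j2, rfl⟩ := hoff
      exact ⟨j, j1, j2, (hadj i j h1 h2 j1 j2).mp hv, rfl⟩
  have hdegc : ∀ i : ℤ, -2 ≤ i → i ≤ 2 → i ≠ 0 → ∀ p q r, Γ.Adj (c i) p → Γ.Adj (c i) q →
      Γ.Adj (c i) r → p = q ∨ p = r ∨ q = r := by
    intro i h1 h2 h0 p q r hp hq hr
    obtain ⟨j, -, -, hj, rfl⟩ := hNc i h1 h2 h0 p hp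
    obtain ⟨k, -, -, hk, rfl⟩ := hNc i h1 h2 h0 q hq
    obtain ⟨l, -, -, hl, rfl⟩ := hNc i h1 h2 h0 r hr
    have : j = k ∨ j = l ∨ k = l := by omega
    rcases this with rfl | rfl | rfl <;> simp
  -- a symmetry fixing the neighbours of the middle vertex fixes the path
  have hfixc : ∀ k ∈ G, k (c 0) = c 0 → k (c 1) = c 1 → k (g (c 1)) = g (c 1) →
      ∀ i : ℤ, -2 ≤ i → i ≤ 2 → k (c i) = c i := by
    intro k hk k0 k1 k2
    rw [hp 1 (by norm_num) (by norm_num)] at k2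
    have key : ∀ i j : ℤ, (i = 1 ∧ j = 2 ∨ i = -1 ∧ j = -2) → k (c i) = c i →
        k (c j) = c j := by
      intro i j hij ki
      have ha : Γ.Adj (c i) (c j) := by
        rw [hadj i j (by omega) (by omega) (by omega) (by omega)]; omega
      rw [← P.adj k hk, ki] at ha
      obtain ⟨l, l1, l2, hl, e⟩ := hNc i (by omega) (by omega) (by omega) _ ha
      have : l = 0 ∨ l = j := by omega
      rcases this with rfl | rfl
      · rw [← k0] at e
        have := (hinj j 0 (by omega) (by omega) (by omega) (by omega)).mp (k.injective e)
        omega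
      · exact e
    intro i h1 h2
    have : i = 0 ∨ i = 1 ∨ i = -1 ∨ i = 2 ∨ i = -2 := by omega
    rcases this with rfl | rfl | rfl | rfl | rfl
    · exact k0
    · exact k1
    · exact k2
    · exact key 1 2 (by omega) k1
    · exact key (-1) (-2) (by omega) k2
  by_cases hw : ∃ w, Off c 2 w ∧ w ≠ z ∧ Γ.Adj z w
  · right
    obtain ⟨w, hoffw, hwz, hzw⟩ := hw
    have hwadj : ∀ i : ℤ, -2 ≤ i → i ≤ 2 → ¬ Γ.Adj (c i) w := by
      intro i h1 h2 hadj'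
      by_cases h0 : i = 0
      · rw [h0] at hadj'
        exact hwz (huniq w hoffw hadj')
      · exact hmax w hoffw i h1 h2 h0 hadj'
    have hcw : ∀ i : ℤ, -2 ≤ i → i ≤ 2 → Γ.cart (c i) w = 0 :=
      fun i h1 h2 => cart_eq_zero (hoffw i h1 h2).symm (hwadj i h1 h2)
    have hwc : ∀ i : ℤ, -2 ≤ i → i ≤ 2 → Γ.cart w (c i) = 0 :=
      fun i h1 h2 => by rw [Γ.cart_symm, hcw i h1 h2]
    have ezw := hzw.cart_eq
    have ewz := hzw.symm.cart_eq
    have gw : g w = w := by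
      by_contra gw
      have f1 := fθ.add (fixedRoot_vert hz) (by simp [bil_vert_vert, hcz])
      rcases P.eq_of_bil_eq_neg_one hg f1 m1 gw (by simp [bil_vert_vert, hc, hzc])
        (by simp [bil_vert_vert, hcw, ezw]) with e | e | e
      · exact hoffw 1 (by norm_num) (by norm_num) e
      · rw [hp 1 (by norm_num) (by norm_num)] at e
        exact hoffw (-1) (by norm_num) (by norm_num) e
      · exact hoffw.perm h 1 (by norm_num) (by norm_num) e.symm
    -- the root `δ - x`, where `δ` is the isotropic root and `x` the middle vertex
    have f1 := fη2.add (fixedRoot_vert hz) (by simp [bil_vert_vert, hcz])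
    have f2 := f1.add fθ (by simp [bil_vert_vert, hc, hzc])
    have f3 := P.fixedRoot_add_pair hg f2 m1 (by simp [hp]) (n := 1)
      (by simp [bil_vert_vert, hc, hzc])
    rw [hp 1 (by norm_num) (by norm_num)] at f3
    have f4 := f3.add (fixedRoot_vert gw) (by simp [bil_vert_vert, hcw, ezw])
    have f5 := f4.add (fixedRoot_vert hz) (by simp [bil_vert_vert, hcz, ewz, cart_self])
    have hT : ∀ v, v = w ∨ v = z ∨ ∃ i : ℤ, -2 ≤ i ∧ i ≤ 2 ∧ v = c i := by
      refine P.conn.mem_of_closed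
        (T := {v | v = w ∨ v = z ∨ ∃ i : ℤ, -2 ≤ i ∧ i ≤ 2 ∧ v = c i}) (Or.inl rfl) ?_
      intro u hu v huv
      by_contra hv
      change ¬ (_ ∨ _ ∨ _) at hv
      push Not at hv
      obtain ⟨v1, v2, v3⟩ := hv
      have c1 := cart_nonpos (Γ := Γ) (Ne.symm v1)
      have c2 := cart_nonpos (Γ := Γ) (Ne.symm v2)
      have c3 : ∀ i : ℤ, -2 ≤ i → i ≤ 2 → Γ.cart (c i) v ≤ 0 :=
        fun i h1 h2 => cart_nonpos (v3 i h1 h2).symm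
      have d0 := c3 0 (by norm_num) (by norm_num)
      have d1 := c3 1 (by norm_num) (by norm_num)
      have d2 := c3 2 (by norm_num) (by norm_num)
      have d3 := c3 (-1) (by norm_num) (by norm_num)
      have d4 := c3 (-2) (by norm_num) (by norm_num)
      have := P.bil_eq_zero_of_isotropic hg fθ f5 (by simp [bil_vert_vert, hc, hcz, hcw]) m1
        (by simp [bil_vert_vert, hc]) (by simp [bil_vert_vert, hc, hzc, hwc]) (v := v)
        (v3 1 (by norm_num) (by norm_num)) (by rw [bil_vert_vert]; exact d0)
        (by simp [bil_vert_vert]; linarith)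
      simp only [map_add, LinearMap.add_apply, bil_vert_vert, one_smul] at this
      have hu' : u = w ∨ u = z ∨ u = c 0 ∨ u = c 1 ∨ u = c 2 ∨ u = c (-1) ∨ u = c (-2) := by
        rcases hu with hu | hu | ⟨i, h1, h2, hu⟩
        · simp [hu]
        · simp [hu]
        · have : i = 0 ∨ i = 1 ∨ i = 2 ∨ i = -1 ∨ i = -2 := by omega
          rcases this with rfl | rfl | rfl | rfl | rfl <;> simp [hu]
      rcases hu' with rfl | rfl | rfl | rfl | rfl | rfl | rfl <;> have := huv.cart_eq <;> omega
    have hwN : ∀ v, Γ.Adj w v → v = z := by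
      intro v hv
      rcases hT v with rfl | rfl | ⟨i, h1, h2, rfl⟩
      · exact (hv.ne rfl).elim
      · rfl
      · exact (hwadj i h1 h2 hv.symm).elim
    have hzN : ∀ v, Γ.Adj z v → v = w ∨ v = c 0 := by
      intro v hv
      rcases hT v with rfl | rfl | ⟨i, h1, h2, rfl⟩
      · exact Or.inl rfl
      · exact (hv.ne rfl).elim
      · right; rw [(hzadj i h1 h2).mp hv]
    have hgrp := P.eq_one_or_eq_of_fork hg hinv fx m1 hz hN (fun v hv p q r hp hq hr => by
        rcases hT v with rfl | rfl | ⟨i, h1, h2, rfl⟩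
        · exact Or.inl ((hwN p hp).trans (hwN q hq).symm)
        · rcases hzN p hp with rfl | rfl <;> rcases hzN q hq with rfl | rfl <;>
            rcases hzN r hr with rfl | rfl <;> simp
        · exact hdegc i h1 h2 (by rintro rfl; exact hv rfl) p q r hp hq hr)
      (fun k hk k0 k1 k2 kz => by
        have kw : k w = w := by
          have ha := hzw
          rw [← P.adj k hk, kz] at ha
          refine (hzN _ ha).resolve_right fun e => ?_
          exact hoffw 0 (by norm_num) (by norm_num) (k.injective (e.trans k0.symm))
        ext1 v
        rcases hT v with rfl | rfl | ⟨i, h1, h2, rfl⟩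
        · exact kw
        · exact kz
        · exact hfixc k hk k0 k1 k2 i h1 h2)
    let f : Icc 0 6 → S := fun i => if (i : ℕ) = 0 then w else if (i : ℕ) = 1 then c (-2) else
      if (i : ℕ) = 2 then z else if (i : ℕ) = 3 then c (-1) else if (i : ℕ) = 4 then c 0 else
      if (i : ℕ) = 5 then c 1 else c 2
    have e1 : ∀ i : ℤ, -2 ≤ i → i ≤ 2 → ¬ z = c i := hoffz
    have e2 : ∀ i : ℤ, -2 ≤ i → i ≤ 2 → ¬ w = c i := hoffw
    have e3 : ∀ i : ℤ, -2 ≤ i → i ≤ 2 → ¬ c i = z := fun i h1 h2 => Ne.symm (hoffz i h1 h2)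
    have e4 : ∀ i : ℤ, -2 ≤ i → i ≤ 2 → ¬ c i = w := fun i h1 h2 => Ne.symm (hoffw i h1 h2)
    refine pairIso_zpowers (f := f) ⟨?_, fun v => ?_⟩ ?_ hg hgrp ?_
    · rintro ⟨i, hi⟩ ⟨j, hj⟩ hij
      obtain ⟨_, _⟩ := id hi; obtain ⟨_, _⟩ := id hj
      interval_cases i <;> interval_cases j <;>
        first | rfl | (exfalso; simp [f, hinj, e1, e2, e3, e4, hwz, hwz.symm] at hij)
    · rcases hT v with rfl | rfl | ⟨i, h1, h2, rfl⟩
      · exact ⟨⟨0, by simp⟩, rfl⟩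
      · exact ⟨⟨2, by simp⟩, rfl⟩
      · have : i = 0 ∨ i = 1 ∨ i = 2 ∨ i = -1 ∨ i = -2 := by omega
        rcases this with rfl | rfl | rfl | rfl | rfl
        · exact ⟨⟨4, by simp⟩, rfl⟩
        · exact ⟨⟨5, by simp⟩, rfl⟩
        · exact ⟨⟨6, by simp⟩, rfl⟩
        · exact ⟨⟨3, by simp⟩, rfl⟩
        · exact ⟨⟨1, by simp⟩, rfl⟩
    · rintro ⟨i, hi⟩ ⟨j, hj⟩
      obtain ⟨_, _⟩ := id hi; obtain ⟨_, _⟩ := id hj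
      interval_cases i <;> interval_cases j <;>
        simp [f, graphAffE6, hadj, hzadj, hwadj, hzw, hzw.symm, Γ.adj_comm (c _) z,
          Γ.adj_comm w (c _)]
    · rintro ⟨i, hi⟩
      obtain ⟨_, _⟩ := id hi
      interval_cases i <;> simp [f, flipE6, labelPerm, hp, gw, hz]
  · left
    push Not at hw
    have hT : ∀ v, v = z ∨ ∃ i : ℤ, -2 ≤ i ∧ i ≤ 2 ∧ v = c i := by
      refine P.conn.mem_of_closed
        (T := {v | v = z ∨ ∃ i : ℤ, -2 ≤ i ∧ i ≤ 2 ∧ v = c i}) (Or.inl rfl) ?_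
      intro u hu v huv
      by_contra hv
      change ¬ (_ ∨ _) at hv
      push Not at hv
      rcases hu with rfl | ⟨i, h1, h2, rfl⟩
      · exact hw v hv.2 hv.1 huv
      · by_cases h0 : i = 0
        · rw [h0] at huv
          exact hv.1 (huniq v hv.2 huv)
        · exact hmax v hv.2 i h1 h2 h0 huv
    have hzN : ∀ v, Γ.Adj z v → v = c 0 := by
      intro v hv
      rcases hT v with rfl | ⟨i, h1, h2, rfl⟩
      · exact (hv.ne rfl).elim
      · rw [(hzadj i h1 h2).mp hv]
    have hgrp := P.eq_one_or_eq_of_fork hg hinv fx m1 hz hN (fun v hv p q r hp hq hr => by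
        rcases hT v with rfl | ⟨i, h1, h2, rfl⟩
        · exact Or.inl ((hzN p hp).trans (hzN q hq).symm)
        · exact hdegc i h1 h2 (by rintro rfl; exact hv rfl) p q r hp hq hr)
      (fun k hk k0 k1 k2 kz => by
        ext1 v
        rcases hT v with rfl | ⟨i, h1, h2, rfl⟩
        · exact kz
        · exact hfixc k hk k0 k1 k2 i h1 h2)
    let f : Icc 1 6 → S := fun i => if (i : ℕ) = 1 then c (-2) else
      if (i : ℕ) = 2 then z else if (i : ℕ) = 3 then c (-1) else if (i : ℕ) = 4 then c 0 else
      if (i : ℕ) = 5 then c 1 else c 2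
    have e1 : ∀ i : ℤ, -2 ≤ i → i ≤ 2 → ¬ z = c i := hoffz
    have e3 : ∀ i : ℤ, -2 ≤ i → i ≤ 2 → ¬ c i = z := fun i h1 h2 => Ne.symm (hoffz i h1 h2)
    refine pairIso_zpowers (f := f) ⟨?_, fun v => ?_⟩ ?_ hg hgrp ?_
    · rintro ⟨i, hi⟩ ⟨j, hj⟩ hij
      obtain ⟨_, _⟩ := id hi; obtain ⟨_, _⟩ := id hj
      interval_cases i <;> interval_cases j <;>
        first | rfl | (exfalso; simp [f, hinj, e1, e3] at hij)
    · rcases hT v with rfl | ⟨i, h1, h2, rfl⟩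
      · exact ⟨⟨2, by simp⟩, rfl⟩
      · have : i = 0 ∨ i = 1 ∨ i = 2 ∨ i = -1 ∨ i = -2 := by omega
        rcases this with rfl | rfl | rfl | rfl | rfl
        · exact ⟨⟨4, by simp⟩, rfl⟩
        · exact ⟨⟨5, by simp⟩, rfl⟩
        · exact ⟨⟨6, by simp⟩, rfl⟩
        · exact ⟨⟨3, by simp⟩, rfl⟩
        · exact ⟨⟨1, by simp⟩, rfl⟩
    · rintro ⟨i, hi⟩ ⟨j, hj⟩
      obtain ⟨_, _⟩ := id hi; obtain ⟨_, _⟩ := id hj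
      interval_cases i <;> interval_cases j <;>
        simp [f, graphE6, hadj, hzadj, Γ.adj_comm (c _) z]
    · rintro ⟨i, hi⟩
      obtain ⟨_, _⟩ := id hi
      interval_cases i <;> simp [f, flipE6, labelPerm, hp, hz]

end SymPath

end

noncomputable section

/-! ### The types `D` -/

open SimpleGraph CoxeterPairs Set

variable {S : Type*} {Γ : SimpleGraph S} {G : Subgroup (Equiv.Perm S)}

/-- Beside a moved vertex attached to the fixed root `η`, a fixed vertex has inner product at
least `-1` with `η`. -/
theorem IsOrthogonalPair.neg_one_le_bil_of_fixed (P : IsOrthogonalPair Γ G) {g : Equiv.Perm S}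
    (hg : g ∈ G) {η : S →₀ ℤ} (hη : FixedRoot Γ g η) {y v : S} (hy : g y ≠ y)
    (hηy : Γ.bil η (vert y) = -1) (hv : g v = v) : -1 ≤ Γ.bil η (vert v) := by
  by_contra! hlt
  obtain ⟨k, hk⟩ : ∃ k, Γ.bil η (vert v) = -k := ⟨_, (neg_neg _).symm⟩
  have r1 := hη.add_smul (fixedRoot_vert hv) hk
  -- if `⟨η, v⟩ = -k`, then `(k² - 1) η + k v` is a fixed root, with inner product at most `1 - k²`
  -- with `y`
  have r2 := r1.add_smul hη (n := k ^ 2 - 2) (by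
    rw [map_add, map_smul, LinearMap.add_apply, LinearMap.smul_apply, hη.bil_self,
      Γ.bil_symm (vert v) η, hk, smul_eq_mul]
    ring)
  have h1 := P.neg_one_le_bil hg r2 hy
  have h2 : Γ.cart v y ≤ 0 := cart_nonpos (by rintro rfl; exact hy hv)
  simp only [map_add, map_smul, LinearMap.add_apply, LinearMap.smul_apply, hηy, bil_vert_vert,
    smul_eq_mul] at h1
  nlinarith

/-- The vertices `a 0, …, a n` form an induced path fixed by `g`. The field `root` records that the
sum of the vertices of a path is a root. -/
structure FixedPath (Γ : SimpleGraph S) (g : Equiv.Perm S) (a : ℕ → S) (n : ℕ) : Prop where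
  fix : ∀ i ≤ n, g (a i) = a i
  inj : ∀ i ≤ n, ∀ j ≤ n, a i = a j → i = j
  adj : ∀ i ≤ n, ∀ j ≤ n, (Γ.Adj (a i) (a j) ↔ j = i + 1 ∨ i = j + 1)
  root : ∀ m ≤ n, FixedRoot Γ g (∑ i ∈ Finset.range (m + 1), vert (a i))

namespace FixedPath

variable {g : Equiv.Perm S} {a : ℕ → S} {n : ℕ}

theorem restrict (h : FixedPath Γ g a n) {m : ℕ} (hm : m ≤ n) : FixedPath Γ g a m where
  fix i hi := h.fix i (by omega)
  inj i hi j hj := h.inj i (by omega) j (by omega)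
  adj i hi j hj := h.adj i (by omega) j (by omega)
  root k hk := h.root k (by omega)

theorem congr (h : FixedPath Γ g a n) {b : ℕ → S} (hb : ∀ i ≤ n, b i = a i) :
    FixedPath Γ g b n where
  fix i hi := by rw [hb i hi, h.fix i hi]
  inj i hi j hj := by rw [hb i hi, hb j hj]; exact h.inj i hi j hj
  adj i hi j hj := by rw [hb i hi, hb j hj]; exact h.adj i hi j hj
  root k hk := by
    convert h.root k hk using 1
    refine Finset.sum_congr rfl fun i hi => ?_
    rw [Finset.mem_range] at hi
    rw [hb i (by omega)]

theorem single {x : S} (hx : g x = x) : FixedPath Γ g (fun _ => x) 0 where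
  fix _ _ := hx
  inj i hi j hj _ := by omega
  adj i hi j hj := by
    have : ¬ (j = i + 1 ∨ i = j + 1) := by omega
    simp [this]
  root m hm := by
    obtain rfl : m = 0 := by omega
    simpa using fixedRoot_vert (Γ := Γ) hx

section

variable (P : IsOrthogonalPair Γ G) (hg : g ∈ G) {y : S} (hy : g y ≠ y) (hgg : g (g y) = y)
  (hyN : ∀ v, Γ.Adj y v ↔ v = a 0)

include hyN in
theorem bil_leaf (h : FixedPath Γ g a n) (hy : g y ≠ y) :
    Γ.bil (∑ i ∈ Finset.range (n + 1), vert (a i)) (vert y) = -1 := by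
  rw [bil_sum_vert, Finset.sum_eq_single_of_mem 0 (by simp)]
  · exact Adj.cart_eq ((hyN _).mpr rfl).symm
  · intro i hi h0
    rw [Finset.mem_range] at hi
    refine cart_eq_zero (by rintro rfl; exact hy (h.fix i (by omega))) fun ha => ?_
    exact h0 (h.inj _ (by omega) _ (by omega) ((hyN _).mp ha.symm))

include P hg hgg hyN hy

/-- The vertices attached to a fixed path are fixed, except for the leaves at its origin. -/
theorem fixed_of_adj (h : FixedPath Γ g a n) {i : ℕ} (hi : i ≤ n) {v : S}
    (hv : Γ.Adj (a i) v) (hvy : v ≠ y) (hvy' : v ≠ g y) : g v = v := by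
  by_contra hgv
  have r := h.restrict hi
  have hoff : ∀ k ∈ Finset.range (i + 1), v ≠ a k := by
    rintro k hk rfl
    rw [Finset.mem_range] at hk
    exact hgv (h.fix k (by omega))
  have b1 := P.neg_one_le_bil hg (r.root i le_rfl) hgv
  have b2 := sum_cart_le (Γ := Γ) hoff (Finset.mem_range.mpr (Nat.lt_succ_self i))
  rw [hv.cart_eq] at b2
  rw [bil_sum_vert] at b1
  rcases P.eq_of_bil_eq_neg_one hg (r.root i le_rfl) hy hgv (r.bil_leaf hyN hy)
    (by rw [bil_sum_vert]; linarith) with e | e | e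
  · exact hvy e
  · exact hvy' e
  · exact hvy' (g.injective (by rw [hgg, ← e]))

omit hgg in
theorem not_adj_of_adj_end (h : FixedPath Γ g a n) {v : S} (hv : g v = v)
    (hoff : ∀ i ≤ n, v ≠ a i) (hadj : Γ.Adj (a n) v) {i : ℕ} (hi : i < n) : ¬ Γ.Adj (a i) v := by
  intro hiv
  have b1 := P.neg_one_le_bil_of_fixed hg (h.root n le_rfl) hy (h.bil_leaf hyN hy) hv
  rw [bil_sum_vert] at b1
  have b2 := sum_cart_le_neg_two (Γ := Γ) (s := Finset.range (n + 1)) (c := a) (v := v)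
    (fun k hk => hoff k (by rw [Finset.mem_range] at hk; omega)) (i := i) (j := n)
    (by rw [Finset.mem_range]; omega) (by simp) hi.ne hiv hadj
  linarith

omit hgg in
/-- A fixed path can be prolonged by a fixed neighbour `v` of its end. -/
theorem extend (h : FixedPath Γ g a n) {v : S} (hv : g v = v)
    (hoff : ∀ i ≤ n, v ≠ a i) (hadj : Γ.Adj (a n) v) :
    FixedPath Γ g (Function.update a (n + 1) v) (n + 1) := by
  have e1 : Function.update a (n + 1) v (n + 1) = v := Function.update_self ..
  have e2 : ∀ i ≤ n, Function.update a (n + 1) v i = a i :=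
    fun i hi => Function.update_of_ne (by omega) _ _
  have a1 : ∀ i ≤ n, (Γ.Adj (a i) v ↔ i = n) := by
    intro i hi
    constructor
    · intro hiv
      by_contra hin
      exact h.not_adj_of_adj_end P hg hy hyN hv hoff hadj (by omega) hiv
    · rintro rfl; exact hadj
  have hcases : ∀ i ≤ n + 1, i = n + 1 ∨ i ≤ n := fun i hi => by omega
  refine ⟨?_, ?_, ?_, ?_⟩
  · intro i hi
    rcases hcases i hi with rfl | hi
    · rw [e1, hv]
    · rw [e2 i hi, h.fix i hi]
  · intro i hi j hj e
    rcases hcases i hi with rfl | hi <;> rcases hcases j hj with rfl | hj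
    · rfl
    · rw [e1, e2 j hj] at e; exact (hoff j hj e).elim
    · rw [e1, e2 i hi] at e; exact (hoff i hi e.symm).elim
    · rw [e2 i hi, e2 j hj] at e; exact h.inj i hi j hj e
  · intro i hi j hj
    rcases hcases i hi with rfl | hi <;> rcases hcases j hj with rfl | hj
    · simp
    · rw [e1, e2 j hj, Γ.adj_comm, a1 j hj]; omega
    · rw [e1, e2 i hi, a1 i hi]; omega
    · rw [e2 i hi, e2 j hj]; exact h.adj i hi j hj
  · intro m hm
    have hsum : ∀ k ≤ n, ∑ i ∈ Finset.range (k + 1), vert (Function.update a (n + 1) v i) =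
        ∑ i ∈ Finset.range (k + 1), vert (a i) := fun k hk =>
      Finset.sum_congr rfl fun i hi => by
        rw [Finset.mem_range] at hi
        rw [e2 i (by omega)]
    rcases hcases m hm with rfl | hm
    · rw [Finset.sum_range_succ, hsum n le_rfl, e1]
      refine (h.root n le_rfl).add (fixedRoot_vert hv) ?_
      rw [bil_sum_vert, Finset.sum_eq_single_of_mem n (by simp), hadj.cart_eq]
      intro i hi hin
      rw [Finset.mem_range] at hi
      exact cart_eq_zero (hoff i (by omega)).symm (mt (a1 i (by omega)).mp hin)
    · rw [hsum m hm]; exact h.root m hm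

end

end FixedPath

namespace IsOrthogonalPair

variable (P : IsOrthogonalPair Γ G) {g : Equiv.Perm S} (hg : g ∈ G)
  (hinv : ∀ k ∈ G, ∀ x y, k x = x → Γ.Adj x y → k (k y) = y)

include P hg hinv in
/-- The group of symmetries of a finite or infinite path, whose vertices are indexed by the
initial segment `L`, with two further leaves at its origin. -/
theorem eq_one_or_eq_of_path {a : ℕ → S} {y : S} {L : ℕ → Prop} (hL0 : L 0) (hL1 : L 1)
    (hL : ∀ i, L (i + 1) → L i) (hfix : ∀ i, L i → g (a i) = a i)
    (hinj : ∀ i j, L i → L j → a i = a j → i = j)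
    (hadj : ∀ i j, L i → L j → (Γ.Adj (a i) (a j) ↔ j = i + 1 ∨ i = j + 1))
    (hy : g y ≠ y) (hyN : ∀ v, Γ.Adj y v ↔ v = a 0)
    (hT : ∀ v, v = y ∨ v = g y ∨ ∃ i, L i ∧ v = a i) : ∀ h ∈ G, h = 1 ∨ h = g := by
  have hgyN : ∀ v, Γ.Adj (g y) v ↔ v = a 0 := by
    intro v
    obtain ⟨v, rfl⟩ := g.surjective v
    rw [P.adj g hg, hyN, ← g.injective.eq_iff, hfix 0 hL0]
  have hN : ∀ v, Γ.Adj (a 0) v ↔ v = y ∨ v = g y ∨ v = a 1 := by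
    intro v
    constructor
    · intro hv
      rcases hT v with rfl | rfl | ⟨i, hi, rfl⟩
      · simp
      · simp
      · rw [hadj 0 i hL0 hi] at hv
        obtain rfl : i = 1 := by omega
        simp
    · rintro (rfl | rfl | rfl)
      · exact ((hyN _).mpr rfl).symm
      · exact ((hgyN _).mpr rfl).symm
      · rw [hadj 0 1 hL0 hL1]; simp
  have haN : ∀ i, L (i + 1) → ∀ v, Γ.Adj (a (i + 1)) v → v = a i ∨ v = a (i + 2) := by
    intro i hi v hv
    rcases hT v with rfl | rfl | ⟨j, hj, rfl⟩
    · have := hinj _ _ hi hL0 ((hyN _).mp hv.symm)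
      omega
    · have := hinj _ _ hi hL0 ((hgyN _).mp hv.symm)
      omega
    · rw [hadj _ j hi hj] at hv
      rcases hv with rfl | hv
      · exact Or.inr rfl
      · left; congr 1; omega
  refine P.eq_one_or_eq_of_fork hg hinv (hfix 0 hL0) hy (hfix 1 hL1) hN ?_ ?_
  · intro v hv p q r hp hq hr
    rcases hT v with rfl | rfl | ⟨i, hi, rfl⟩
    · exact Or.inl (((hyN p).mp hp).trans ((hyN q).mp hq).symm)
    · exact Or.inl (((hgyN p).mp hp).trans ((hgyN q).mp hq).symm)
    · obtain _ | i := i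
      · exact (hv rfl).elim
      rcases haN i hi p hp with rfl | rfl <;> rcases haN i hi q hq with rfl | rfl <;>
        rcases haN i hi r hr with rfl | rfl <;> simp
  · intro k hk k0 ky kgy k1
    have key : ∀ i, (L i → k (a i) = a i) ∧ (L (i + 1) → k (a (i + 1)) = a (i + 1)) := by
      intro i
      induction i with
      | zero => exact ⟨fun _ => k0, fun _ => k1⟩
      | succ i ih =>
        refine ⟨ih.2, fun hi => ?_⟩
        have hi1 := hL _ hi
        have ha := (hadj (i + 1) (i + 1 + 1) hi1 hi).mpr (Or.inl rfl)
        rw [← P.adj k hk, ih.2 hi1] at ha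
        refine (haN i hi1 _ ha).resolve_left fun e => ?_
        rw [← ih.1 (hL _ hi1)] at e
        have := hinj _ _ hi (hL _ hi1) (k.injective e)
        omega
    ext1 v
    rcases hT v with rfl | rfl | ⟨i, hi, rfl⟩
    · exact ky
    · exact kgy
    · exact (key i).1 hi

end IsOrthogonalPair

end

noncomputable section

open SimpleGraph CoxeterPairs Set

variable {S : Type*} {Γ : SimpleGraph S} {G : Subgroup (Equiv.Perm S)}

namespace FixedPath

variable (P : IsOrthogonalPair Γ G) {g : Equiv.Perm S} (hg : g ∈ G)
  (hinv : ∀ k ∈ G, ∀ x y, k x = x → Γ.Adj x y → k (k y) = y) {a : ℕ → S} {n : ℕ} {y : S}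
include P hg hinv

/-- A fixed path with two exchanged leaves at its origin, without further vertices, is of type
`D`. -/
theorem pairIso_graphD (h : FixedPath Γ g a n) (hn : 1 ≤ n) (hy : g y ≠ y)
    (hyN : ∀ v, Γ.Adj y v ↔ v = a 0)
    (hT : ∀ v, v = y ∨ v = g y ∨ ∃ i, i ≤ n ∧ v = a i) :
    PairIso Γ G (graphD (n + 3)) (Subgroup.zpowers (swapD 1 (n + 3) (by omega))) := by
  have hgrp := P.eq_one_or_eq_of_path hg hinv (L := (· ≤ n)) (Nat.zero_le n) hn
    (fun i hi => by omega) h.fix (fun i j hi hj => h.inj i hi j hj)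
    (fun i j hi hj => h.adj i hi j hj) hy hyN hT
  have hgg : g (g y) = y := hinv g hg (a 0) y (h.fix 0 (by omega)) ((hyN _).mpr rfl).symm
  have hgyN : ∀ v, Γ.Adj (g y) v ↔ v = a 0 := by
    intro v
    obtain ⟨v, rfl⟩ := g.surjective v
    rw [P.adj g hg, hyN, ← g.injective.eq_iff, h.fix 0 (by omega)]
  have hinj0 : ∀ i ≤ n, a i = a 0 ↔ i = 0 :=
    fun i hi => ⟨h.inj i hi 0 (by omega), fun e => by rw [e]⟩
  have ny : ∀ i ≤ n, a i ≠ y := fun i hi e => hy (e ▸ h.fix i hi)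
  have ngy : ∀ i ≤ n, a i ≠ g y := fun i hi e => ny i hi (g.injective ((h.fix i hi).trans e))
  let f : Icc 1 (n + 3) → S := fun i => if (i : ℕ) ≤ n + 1 then a (n + 1 - i) else
    if (i : ℕ) = n + 2 then y else g y
  have f1 : ∀ i (hi : i ∈ Icc 1 (n + 3)), i ≤ n + 1 → f ⟨i, hi⟩ = a (n + 1 - i) :=
    fun i hi hi' => if_pos hi'
  have f2 : ∀ hi, f ⟨n + 2, hi⟩ = y := fun hi =>
    (if_neg (by simp only; omega)).trans (if_pos rfl)
  have f3 : ∀ hi, f ⟨n + 3, hi⟩ = g y := fun hi =>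
    (if_neg (by simp only; omega)).trans (if_neg (by simp))
  have hcases : ∀ i, i ∈ Icc 1 (n + 3) → i = n + 2 ∨ i = n + 3 ∨ i ≤ n + 1 := by
    intro i hi
    have := hi.2
    omega
  refine pairIso_zpowers (f := f) ⟨?_, fun v => ?_⟩ ?_ hg hgrp ?_
  · rintro ⟨i, hi⟩ ⟨j, hj⟩ hij
    have i0 := hi.1
    have j0 := hj.1
    rw [Subtype.ext_iff]
    simp only
    rcases hcases i hi with rfl | rfl | i1 <;> rcases hcases j hj with rfl | rfl | j1
    · rfl
    · rw [f2, f3] at hij; exact (hy hij.symm).elim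
    · rw [f2, f1 j hj j1] at hij; exact (ny _ (by omega) hij.symm).elim
    · rw [f2, f3] at hij; exact (hy hij).elim
    · rfl
    · rw [f3, f1 j hj j1] at hij; exact (ngy _ (by omega) hij.symm).elim
    · rw [f2, f1 i hi i1] at hij; exact (ny _ (by omega) hij).elim
    · rw [f3, f1 i hi i1] at hij; exact (ngy _ (by omega) hij).elim
    · rw [f1 i hi i1, f1 j hj j1] at hij
      have := h.inj _ (by omega) _ (by omega) hij
      omega
  · rcases hT v with rfl | rfl | ⟨i, hi, rfl⟩
    · exact ⟨_, f2 (by rw [mem_Icc]; omega)⟩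
    · exact ⟨_, f3 (by rw [mem_Icc]; omega)⟩
    · refine ⟨_, (f1 (n + 1 - i) (by rw [mem_Icc]; omega) (by omega)).trans ?_⟩
      congr 1; omega
  · rintro ⟨i, hi⟩ ⟨j, hj⟩
    have i0 := hi.1
    have j0 := hj.1
    simp only [graphD, fromRel_adj, ne_eq, Subtype.ext_iff]
    rcases hcases i hi with rfl | rfl | i1 <;> rcases hcases j hj with rfl | rfl | j1
    · simp
    · rw [f2, f3, hyN]; simp only [Ne.symm (ngy 0 (by omega)), iff_false]; omega
    · rw [f2, f1 j hj j1, hyN, hinj0 _ (by omega)]; omega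
    · rw [f2, f3, hgyN]; simp only [Ne.symm (ny 0 (by omega)), iff_false]; omega
    · simp
    · rw [f3, f1 j hj j1, hgyN, hinj0 _ (by omega)]; omega
    · rw [f2, f1 i hi i1, Γ.adj_comm, hyN, hinj0 _ (by omega)]; omega
    · rw [f3, f1 i hi i1, Γ.adj_comm, hgyN, hinj0 _ (by omega)]; omega
    · rw [f1 i hi i1, f1 j hj j1, h.adj _ (by omega) _ (by omega)]; omega
  · rintro ⟨i, hi⟩
    have i0 := hi.1
    have es : ∀ hi hi', swapD 1 (n + 3) (by omega) ⟨n + 2, hi⟩ = ⟨n + 3, hi'⟩ :=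
      fun hi hi' => Equiv.swap_apply_left _ _
    have es' : ∀ hi hi', swapD 1 (n + 3) (by omega) ⟨n + 3, hi⟩ = ⟨n + 2, hi'⟩ :=
      fun hi hi' => Equiv.swap_apply_right _ _
    rcases hcases i hi with rfl | rfl | i1
    · rw [es hi (by rw [mem_Icc]; omega), f2, f3]
    · rw [es' hi (by rw [mem_Icc]; omega), f2, f3, hgg]
    · rw [swapD, Equiv.swap_apply_of_ne_of_ne (by rw [Ne, Subtype.ext_iff]; simp only; omega)
        (by rw [Ne, Subtype.ext_iff]; simp only; omega), f1 i hi i1, h.fix _ (by omega)]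

/-- An infinite fixed path with two exchanged leaves at its origin is of type `D_∞`. -/
theorem pairIso_graphDInf (h : ∀ n, FixedPath Γ g a n) (hy : g y ≠ y)
    (hyN : ∀ v, Γ.Adj y v ↔ v = a 0) (hT : ∀ v, v = y ∨ v = g y ∨ ∃ i, v = a i) :
    PairIso Γ G graphDInf (Subgroup.zpowers swapDInf) := by
  have hfix : ∀ i, g (a i) = a i := fun i => (h i).fix i le_rfl
  have hinj : ∀ i j, a i = a j ↔ i = j := fun i j =>
    ⟨(h (i + j)).inj i (by omega) j (by omega), fun e => by rw [e]⟩
  have hadj : ∀ i j, Γ.Adj (a i) (a j) ↔ j = i + 1 ∨ i = j + 1 := fun i j =>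
    (h (i + j)).adj i (by omega) j (by omega)
  have hgrp := P.eq_one_or_eq_of_path hg hinv (L := fun _ => True) trivial trivial
    (fun i hi => hi) (fun i _ => hfix i) (fun i j _ _ => (hinj i j).mp)
    (fun i j _ _ => hadj i j) hy hyN (by simpa using hT)
  have hgg : g (g y) = y := hinv g hg (a 0) y (hfix 0) ((hyN _).mpr rfl).symm
  have hgyN : ∀ v, Γ.Adj (g y) v ↔ v = a 0 := by
    intro v
    obtain ⟨v, rfl⟩ := g.surjective v
    rw [P.adj g hg, hyN, ← g.injective.eq_iff, hfix 0]
  have ny : ∀ i, a i ≠ y := fun i e => hy (e ▸ hfix i)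
  have ngy : ∀ i, a i ≠ g y := fun i e => ny i (g.injective ((hfix i).trans e))
  let f : Ici 1 → S := fun i => if (i : ℕ) = 1 then y else if (i : ℕ) = 2 then g y else
    a (i - 3)
  have f1 : ∀ hi, f ⟨1, hi⟩ = y := fun hi => if_pos rfl
  have f2 : ∀ hi, f ⟨2, hi⟩ = g y := fun hi =>
    (if_neg (by norm_num)).trans (if_pos rfl)
  have f3 : ∀ i (hi : i + 3 ∈ Ici 1), f ⟨i + 3, hi⟩ = a i := fun i hi =>
    (if_neg (by simp only; omega)).trans (if_neg (by simp only; omega))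
  have hcases : ∀ i, i ∈ Ici 1 → i = 1 ∨ i = 2 ∨ ∃ k, i = k + 3 := by
    intro i hi
    rw [mem_Ici] at hi
    have : i = 1 ∨ i = 2 ∨ i = (i - 3) + 3 := by omega
    exact this.imp id fun h => h.imp id fun h => ⟨_, h⟩
  refine pairIso_zpowers (f := f) ⟨?_, fun v => ?_⟩ ?_ hg hgrp ?_
  · rintro ⟨i, hi⟩ ⟨j, hj⟩ hij
    rw [Subtype.ext_iff]
    simp only
    rcases hcases i hi with rfl | rfl | ⟨i, rfl⟩ <;> rcases hcases j hj with rfl | rfl | ⟨j, rfl⟩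
    · rfl
    · rw [f1, f2] at hij; exact (hy hij.symm).elim
    · rw [f1, f3] at hij; exact (ny _ hij.symm).elim
    · rw [f1, f2] at hij; exact (hy hij).elim
    · rfl
    · rw [f2, f3] at hij; exact (ngy _ hij.symm).elim
    · rw [f1, f3] at hij; exact (ny _ hij).elim
    · rw [f2, f3] at hij; exact (ngy _ hij).elim
    · rw [f3, f3, hinj] at hij
      rw [hij]
  · rcases hT v with rfl | rfl | ⟨i, rfl⟩
    · exact ⟨_, f1 (by simp)⟩
    · exact ⟨_, f2 (by simp)⟩
    · exact ⟨_, f3 i (by simp)⟩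
  · rintro ⟨i, hi⟩ ⟨j, hj⟩
    simp only [graphDInf, fromRel_adj, ne_eq, Subtype.ext_iff]
    rcases hcases i hi with rfl | rfl | ⟨i, rfl⟩ <;> rcases hcases j hj with rfl | rfl | ⟨j, rfl⟩
    · simp
    · rw [f1, f2, hyN]; simp [Ne.symm (ngy 0)]
    · rw [f1, f3, hyN, hinj]; omega
    · rw [f1, f2, hgyN]; simp [Ne.symm (ny 0)]
    · simp
    · rw [f2, f3, hgyN, hinj]; omega
    · rw [f1, f3, Γ.adj_comm, hyN, hinj]; omega
    · rw [f2, f3, Γ.adj_comm, hgyN, hinj]; omega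
    · rw [f3, f3, hadj]; omega
  · rintro ⟨i, hi⟩
    have es : ∀ hi hi', swapDInf ⟨1, hi⟩ = ⟨2, hi'⟩ := fun hi hi' => Equiv.swap_apply_left _ _
    have es' : ∀ hi hi', swapDInf ⟨2, hi⟩ = ⟨1, hi'⟩ := fun hi hi' => Equiv.swap_apply_right _ _
    rcases hcases i hi with rfl | rfl | ⟨i, rfl⟩
    · rw [es hi (by simp), f1, f2]
    · rw [es' hi (by simp), f1, f2, hgg]
    · rw [swapDInf, Equiv.swap_apply_of_ne_of_ne (by rw [Ne, Subtype.ext_iff]; simp)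
        (by rw [Ne, Subtype.ext_iff]; simp), f3, hfix]

/-- A fixed path with two exchanged leaves at its origin that forks again is of type `D̃`. -/
theorem pairIso_graphAffD (h : FixedPath Γ g a n) (hy : g y ≠ y)
    (hyN : ∀ v, Γ.Adj y v ↔ v = a 0) {z z' : S} (hz : g z = z) (hz' : g z' = z') (hzz : z ≠ z')
    (hoff : ∀ i ≤ n, z ≠ a i) (hoff' : ∀ i ≤ n, z' ≠ a i) (haz : Γ.Adj (a n) z)
    (haz' : Γ.Adj (a n) z') :
    PairIso Γ G (graphAffD (n + 4)) (Subgroup.zpowers (swapD 0 (n + 4) (by omega))) := by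
  have hgg : g (g y) = y := hinv g hg (a 0) y (h.fix 0 (by omega)) ((hyN _).mpr rfl).symm
  have hgyN : ∀ v, Γ.Adj (g y) v ↔ v = a 0 := by
    intro v
    obtain ⟨v, rfl⟩ := g.surjective v
    rw [P.adj g hg, hyN, ← g.injective.eq_iff, h.fix 0 (by omega)]
  have hinj : ∀ i ≤ n, ∀ j ≤ n, a i = a j ↔ i = j :=
    fun i hi j hj => ⟨h.inj i hi j hj, fun e => by rw [e]⟩
  have ny : ∀ i ≤ n, a i ≠ y := fun i hi e => hy (e ▸ h.fix i hi)
  have ngy : ∀ i ≤ n, a i ≠ g y := fun i hi e => ny i hi (g.injective ((h.fix i hi).trans e))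
  have nzy : z ≠ y := by rintro rfl; exact hy hz
  have nzy' : z' ≠ y := by rintro rfl; exact hy hz'
  have nzgy : z ≠ g y := fun e => nzy (g.injective (hz.trans e))
  have nzgy' : z' ≠ g y := fun e => nzy' (g.injective (hz'.trans e))
  have hη := h.root n le_rfl
  have eηy := h.bil_leaf hyN hy
  have eηgy : Γ.bil (∑ i ∈ Finset.range (n + 1), vert (a i)) (vert (g y)) = -1 := by
    rw [P.bil_fixed_vert hg hη, eηy]
  have az : ∀ i ≤ n, (Γ.Adj (a i) z ↔ i = n) := fun i hi => by
    refine ⟨fun hi' => ?_, by rintro rfl; exact haz⟩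
    by_contra hin
    exact h.not_adj_of_adj_end P hg hy hyN hz hoff haz (by omega) hi'
  have az' : ∀ i ≤ n, (Γ.Adj (a i) z' ↔ i = n) := fun i hi => by
    refine ⟨fun hi' => ?_, by rintro rfl; exact haz'⟩
    by_contra hin
    exact h.not_adj_of_adj_end P hg hy hyN hz' hoff' haz' (by omega) hi'
  have eηz : Γ.bil (∑ i ∈ Finset.range (n + 1), vert (a i)) (vert z) = -1 := by
    rw [bil_sum_vert, Finset.sum_eq_single_of_mem n (by simp), haz.cart_eq]
    intro i hi hin
    rw [Finset.mem_range] at hi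
    exact cart_eq_zero (hoff i (by omega)).symm (mt (az i (by omega)).mp hin)
  have eηz' : Γ.bil (∑ i ∈ Finset.range (n + 1), vert (a i)) (vert z') = -1 := by
    rw [bil_sum_vert, Finset.sum_eq_single_of_mem n (by simp), haz'.cart_eq]
    intro i hi hin
    rw [Finset.mem_range] at hi
    exact cart_eq_zero (hoff' i (by omega)).symm (mt (az' i (by omega)).mp hin)
  have czz : Γ.cart z z' = 0 := cart_eq_zero hzz (P.not_adj_of_fixed hg hη hy hz hz' eηy eηz eηz')
  have cyz : Γ.cart y z = 0 := cart_eq_zero nzy.symm fun e => hoff 0 (by omega) ((hyN z).mp e)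
  have cyz' : Γ.cart y z' = 0 := cart_eq_zero nzy'.symm fun e => hoff' 0 (by omega) ((hyN z').mp e)
  have cgyz : Γ.cart (g y) z = 0 :=
    cart_eq_zero nzgy.symm fun e => hoff 0 (by omega) ((hgyN z).mp e)
  have cgyz' : Γ.cart (g y) z' = 0 :=
    cart_eq_zero nzgy'.symm fun e => hoff' 0 (by omega) ((hgyN z').mp e)
  have f1 := P.fixedRoot_add_pair hg hη hy hgg (n := 1) eηy
  simp only [one_smul] at f1
  have f2 := f1.add (fixedRoot_vert hz) (by
    simp only [map_add, LinearMap.add_apply, eηz, bil_vert_vert, cyz, cgyz]; norm_num)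
  have f3 := f2.add (fixedRoot_vert hz') (by
    simp only [map_add, LinearMap.add_apply, eηz', bil_vert_vert, cyz', cgyz', czz]; norm_num)
  have hT : ∀ v, (v = y ∨ v = g y ∨ v = z ∨ v = z') ∨ ∃ i ≤ n, v = a i := by
    refine P.conn.mem_of_closed
      (T := {v | (v = y ∨ v = g y ∨ v = z ∨ v = z') ∨ ∃ i ≤ n, v = a i}) (Or.inl (Or.inl rfl)) ?_
    intro u hu v huv
    by_contra hv
    change ¬ (_ ∨ _) at hv
    push Not at hv
    obtain ⟨⟨v1, v2, v3, v4⟩, v5⟩ := hv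
    have c1 := cart_nonpos (Γ := Γ) (Ne.symm v1)
    have c2 := cart_nonpos (Γ := Γ) (Ne.symm v2)
    have c3 := cart_nonpos (Γ := Γ) (Ne.symm v3)
    have c4 := cart_nonpos (Γ := Γ) (Ne.symm v4)
    have c5 : ∀ i ∈ Finset.range (n + 1), v ≠ a i := fun i hi => by
      rw [Finset.mem_range] at hi
      exact v5 i (by omega)
    have c6 : ∑ i ∈ Finset.range (n + 1), Γ.cart (a i) v ≤ 0 :=
      Finset.sum_nonpos fun i hi => cart_nonpos (c5 i hi).symm
    have := P.bil_eq_zero_of_isotropic hg hη f3 (by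
        simp only [map_add, hη.bil_self, eηy, eηgy, eηz, eηz']; norm_num) hy eηy (by
        simp only [map_add, LinearMap.add_apply, eηy, bil_vert_vert, cart_self, Γ.cart_symm _ y,
          cyz, cyz', P.cart_moved hg hy]
        norm_num) v1 (by rw [bil_sum_vert]; exact c6) (by
        simp only [map_add, LinearMap.add_apply, bil_vert_vert, bil_sum_vert]; linarith)
    simp only [map_add, LinearMap.add_apply, bil_vert_vert, bil_sum_vert] at this
    rcases hu with (rfl | rfl | rfl | rfl) | ⟨i, hi, rfl⟩
    · have := huv.cart_eq; omega
    · have := huv.cart_eq; omega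
    · have := huv.cart_eq; omega
    · have := huv.cart_eq; omega
    · have := sum_cart_le (Γ := Γ) c5 (i := i) (by rw [Finset.mem_range]; omega)
      rw [huv.cart_eq] at this; omega
  have hzN : ∀ v, Γ.Adj z v ↔ v = a n := by
    refine fun v => ⟨fun hv => ?_, by rintro rfl; exact haz.symm⟩
    rcases hT v with (rfl | rfl | rfl | rfl) | ⟨i, hi, rfl⟩
    · exact (hoff 0 (by omega) ((hyN z).mp hv.symm)).elim
    · exact (hoff 0 (by omega) ((hgyN z).mp hv.symm)).elim
    · exact (hv.ne rfl).elim
    · rw [hv.cart_eq] at czz; omega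
    · rw [(az i hi).mp hv.symm]
  have hzN' : ∀ v, Γ.Adj z' v ↔ v = a n := by
    refine fun v => ⟨fun hv => ?_, by rintro rfl; exact haz'.symm⟩
    rcases hT v with (rfl | rfl | rfl | rfl) | ⟨i, hi, rfl⟩
    · exact (hoff' 0 (by omega) ((hyN z').mp hv.symm)).elim
    · exact (hoff' 0 (by omega) ((hgyN z').mp hv.symm)).elim
    · rw [hv.symm.cart_eq] at czz; omega
    · exact (hv.ne rfl).elim
    · rw [(az' i hi).mp hv.symm]
  have haN : ∀ i ≤ n, ∀ v, Γ.Adj (a i) v → (∃ j ≤ n, (j = i + 1 ∨ i = j + 1) ∧ v = a j) ∨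
      (i = 0 ∧ (v = y ∨ v = g y)) ∨ (i = n ∧ (v = z ∨ v = z')) := by
    intro i hi v hv
    rcases hT v with (rfl | rfl | rfl | rfl) | ⟨j, hj, rfl⟩
    · exact Or.inr (Or.inl ⟨(hinj _ hi _ (by omega)).mp ((hyN _).mp hv.symm), Or.inl rfl⟩)
    · exact Or.inr (Or.inl ⟨(hinj _ hi _ (by omega)).mp ((hgyN _).mp hv.symm), Or.inr rfl⟩)
    · exact Or.inr (Or.inr ⟨(az i hi).mp hv, Or.inl rfl⟩)
    · exact Or.inr (Or.inr ⟨(az' i hi).mp hv, Or.inr rfl⟩)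
    · exact Or.inl ⟨j, hj, (h.adj i hi j hj).mp hv, rfl⟩
  -- no symmetry fixing the path exchanges `z` and `z'`
  have hswap : ∀ r ∈ G, (∀ i ≤ n, r (a i) = a i) → r z = z' → r z' = z →
      (r y = y ∧ r (g y) = g y ∨ r y = g y ∧ r (g y) = y) → False := by
    intro r hr ra rz rz' hry
    have hfr : ∀ k : Equiv.Perm S, (∀ i ≤ n, k (a i) = a i) →
        FixedRoot Γ k (∑ i ∈ Finset.range (n + 1), vert (a i)) := by
      intro k hk
      refine ⟨hη.root, ?_⟩
      rw [map_sum]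
      refine Finset.sum_congr rfl fun i hi => ?_
      rw [Finset.mem_range] at hi
      rw [latPerm_vert, hk i (by omega)]
    rcases hry with ⟨h1, h2⟩ | ⟨h1, h2⟩
    · refine P.not_four_moved (mul_mem hg hr) (hfr (g * r) fun i hi => ?_) eηy eηgy eηz eηz'
        hy.symm nzy.symm nzy'.symm nzgy.symm nzgy'.symm hzz ?_ ?_ ?_ ?_
      · rw [Equiv.Perm.mul_apply, ra i hi, h.fix i hi]
      · rw [Equiv.Perm.mul_apply, h1]; exact hy
      · rw [Equiv.Perm.mul_apply, h2, hgg]; exact hy.symm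
      · rw [Equiv.Perm.mul_apply, rz, hz']; exact hzz.symm
      · rw [Equiv.Perm.mul_apply, rz', hz]; exact hzz
    · refine P.not_four_moved hr (hfr r ra) eηy eηgy eηz eηz'
        hy.symm nzy.symm nzy'.symm nzgy.symm nzgy'.symm hzz ?_ ?_ ?_ ?_
      · rw [h1]; exact hy
      · rw [h2]; exact hy.symm
      · rw [rz]; exact hzz.symm
      · rw [rz']; exact hzz
  have hpair : ∀ r : Equiv.Perm S, ∀ u v : S, (r u = u ∨ r u = v) → (r v = u ∨ r v = v) → u ≠ v →
      (r u = u ∧ r v = v ∨ r u = v ∧ r v = u) := by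
    intro r u v h1 h2 huv
    have := r.injective.ne huv
    rcases h1 with h1 | h1 <;> rcases h2 with h2 | h2 <;> simp_all
  have hx : ∀ k ∈ G, k (a 0) = a 0 := by
    intro k hk
    by_contra hkx
    have b1 : Γ.Adj (k (a 0)) (k y) := (P.adj k hk _ _).mpr ((hyN _).mpr rfl).symm
    have b2 : Γ.Adj (k (a 0)) (k (g y)) := (P.adj k hk _ _).mpr ((hgyN _).mpr rfl).symm
    have nb : k y ≠ k (g y) := k.injective.ne hy.symm
    have kl : ∀ v, Γ.Adj (k y) v → v = k (a 0) := by
      intro v hv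
      obtain ⟨v, rfl⟩ := k.surjective v
      rw [P.adj k hk, hyN] at hv
      rw [hv]
    have kl' : ∀ v, Γ.Adj (k (g y)) v → v = k (a 0) := by
      intro v hv
      obtain ⟨v, rfl⟩ := k.surjective v
      rw [P.adj k hk, hgyN] at hv
      rw [hv]
    rcases hT (k (a 0)) with (e | e | e | e) | ⟨i, hi, e⟩
    · rw [e, hyN] at b1 b2; exact nb (b1.trans b2.symm)
    · rw [e, hgyN] at b1 b2; exact nb (b1.trans b2.symm)
    · rw [e, hzN] at b1 b2; exact nb (b1.trans b2.symm)
    · rw [e, hzN'] at b1 b2; exact nb (b1.trans b2.symm)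
    have hi0 : i ≠ 0 := by rintro rfl; exact hkx e
    -- a vertex of the path is not a leaf attached to `a i`
    have hnl : ∀ j ≤ n, ∃ v, Γ.Adj (a j) v ∧ v ≠ a i := by
      intro j hj
      by_cases hj0 : j = 0
      · subst hj0
        exact ⟨y, ((hyN _).mpr rfl).symm, (ny i hi).symm⟩
      · by_cases hij : j = i + 1
        · by_cases hjn : j = n
          · subst hjn
            exact ⟨z, haz, hoff i hi⟩
          · refine ⟨a (j + 1), (h.adj _ hj _ (by omega)).mpr (Or.inl rfl), ?_⟩
            rw [Ne, hinj _ (by omega) _ hi]; omega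
        · refine ⟨a (j - 1), (h.adj _ hj _ (by omega)).mpr (by omega), ?_⟩
          rw [Ne, hinj _ (by omega) _ hi]; omega
    have hnot : ∀ j ≤ n, k y ≠ a j ∧ k (g y) ≠ a j := by
      intro j hj
      obtain ⟨v, v1, v2⟩ := hnl j hj
      constructor
      · intro e'
        rw [← e'] at v1
        exact v2 ((kl v v1).trans e)
      · intro e'
        rw [← e'] at v1
        exact v2 ((kl' v v1).trans e)
    rw [e] at b1 b2
    have c1 : i = n ∧ (k y = z ∨ k y = z') := by
      rcases haN i hi _ b1 with ⟨j, hj, -, e'⟩ | h' | h'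
      · exact ((hnot j hj).1 e').elim
      · exact (hi0 h'.1).elim
      · exact h'
    have c2 : k (g y) = z ∨ k (g y) = z' := by
      rcases haN i hi _ b2 with ⟨j, hj, -, e'⟩ | h' | h'
      · exact ((hnot j hj).2 e').elim
      · exact (hi0 h'.1).elim
      · exact h'.2
    obtain ⟨rfl, c1⟩ := c1
    -- the conjugate of `g` by `k` exchanges `z` and `z'`, and fixes the path
    let r := k * g * k⁻¹
    have hr : r ∈ G := mul_mem (mul_mem hk hg) (inv_mem hk)
    have rk : ∀ v, r (k v) = k (g v) := fun v => by simp [r]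
    have rzz : r z = z' ∧ r z' = z := by
      have r1 := rk y
      have r2 := rk (g y)
      rw [hgg] at r2
      rcases c1 with c1 | c1 <;> rcases c2 with c2 | c2
      · exact (nb (c1.trans c2.symm)).elim
      · rw [c1, c2] at r1 r2; exact ⟨r1, r2⟩
      · rw [c1, c2] at r1 r2; exact ⟨r2, r1⟩
      · exact (nb (c1.trans c2.symm)).elim
    have ran : r (a i) = a i := by rw [← e, rk, h.fix 0 (by omega)]
    have ra : ∀ m, m ≤ i → r (a (i - m)) = a (i - m) ∧
        (m + 1 ≤ i → r (a (i - (m + 1))) = a (i - (m + 1))) := by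
      intro m
      induction m with
      | zero =>
        intro _
        refine ⟨ran, fun hm => ?_⟩
        have ha : Γ.Adj (a i) (a (i - 1)) := (h.adj _ hi _ (by omega)).mpr (by omega)
        rw [← P.adj r hr, ran] at ha
        rcases haN i hi _ ha with ⟨j, hj, hj', e'⟩ | h' | ⟨-, e' | e'⟩
        · rw [zero_add, e']; congr 1; omega
        · exact (hi0 h'.1).elim
        · rw [← rzz.2] at e'; exact (hoff' _ (by omega) (r.injective e').symm).elim
        · rw [← rzz.1] at e'; exact (hoff _ (by omega) (r.injective e').symm).elim
      | succ m ih =>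
        intro hm
        obtain ⟨i1, i2⟩ := ih (by omega)
        refine ⟨i2 hm, fun hm' => ?_⟩
        have ha : Γ.Adj (a (i - (m + 1))) (a (i - (m + 1 + 1))) :=
          (h.adj _ (by omega) _ (by omega)).mpr (by omega)
        rw [← P.adj r hr, i2 hm] at ha
        rcases haN _ (by omega) _ ha with ⟨j, hj, hj' | hj', e'⟩ | h' | h'
        · rw [show j = i - m by omega, ← i1] at e'
          have := (hinj _ (by omega) _ (by omega)).mp (r.injective e')
          omega
        · rw [e']; congr 1; omega
        · omega
        · omega
    have ra' : ∀ j ≤ i, r (a j) = a j := fun j hj => by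
      have := (ra (i - j) (by omega)).1
      rwa [show i - (i - j) = j by omega] at this
    have rN : ∀ v, v = y ∨ v = g y → r v = y ∨ r v = g y := by
      intro v hv
      have ha : Γ.Adj (a 0) v := by
        rcases hv with rfl | rfl
        · exact ((hyN _).mpr rfl).symm
        · exact ((hgyN _).mpr rfl).symm
      rw [← P.adj r hr, ra' 0 (by omega)] at ha
      rcases haN 0 (by omega) _ ha with ⟨j, hj, -, e'⟩ | h' | h'
      · rw [← ra' j hj] at e'
        have := r.injective e'
        rcases hv with rfl | rfl
        · exact (ny j hj this.symm).elim
        · exact (ngy j hj this.symm).elim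
      · exact h'.2
      · omega
    exact hswap r hr ra' rzz.1 rzz.2 (hpair r y (g y) (rN y (Or.inl rfl)) (rN _ (Or.inr rfl))
      hy.symm)
  have hpath : ∀ k ∈ G, ∀ i, (i ≤ n → k (a i) = a i) ∧ (i + 1 ≤ n → k (a (i + 1)) = a (i + 1)) := by
    intro k hk i
    induction i with
    | zero =>
      refine ⟨fun _ => hx k hk, fun hn => ?_⟩
      have ha : Γ.Adj (a 0) (a 1) := (h.adj _ (by omega) _ hn).mpr (Or.inl rfl)
      have hf := IsOrthogonalPair.perm_fixed_neighbour hg hinv (h.fix 0 (by omega)) (h.fix 1 hn) ha hk (hx k hk)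
      rw [← P.adj k hk, hx k hk] at ha
      rcases haN 0 (by omega) _ ha with ⟨j, hj, hj', e'⟩ | ⟨-, e' | e'⟩ | h'
      · obtain rfl : j = 1 := by omega
        exact e'
      · rw [e'] at hf; exact (hy hf).elim
      · rw [e'] at hf; exact (hy (g.injective hf)).elim
      · omega
    | succ i ih =>
      refine ⟨ih.2, fun hn => ?_⟩
      have ha : Γ.Adj (a (i + 1)) (a (i + 1 + 1)) := (h.adj _ (by omega) _ hn).mpr (Or.inl rfl)
      rw [← P.adj k hk, ih.2 (by omega)] at ha
      rcases haN _ (by omega) _ ha with ⟨j, hj, rfl | hj', e'⟩ | h' | h'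
      · exact e'
      · rw [show j = i by omega, ← ih.1 (by omega)] at e'
        have := (hinj _ (by omega) _ (by omega)).mp (k.injective e')
        omega
      · omega
      · omega
  have hpath' : ∀ k ∈ G, ∀ i ≤ n, k (a i) = a i := fun k hk i hi => (hpath k hk i).1 hi
  have hzs : ∀ k ∈ G, ∀ v, v = z ∨ v = z' → k v = z ∨ k v = z' := by
    intro k hk v hv
    have ha : Γ.Adj (a n) v := by rcases hv with rfl | rfl <;> assumption
    have gv : g v = v := by rcases hv with rfl | rfl <;> assumption
    have hva : ∀ j ≤ n, v ≠ a j := by rcases hv with rfl | rfl <;> assumption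
    have hf := IsOrthogonalPair.perm_fixed_neighbour hg hinv (h.fix n le_rfl) gv ha hk (hpath' k hk n le_rfl)
    rw [← P.adj k hk, hpath' k hk n le_rfl] at ha
    rcases haN n le_rfl _ ha with ⟨j, hj, -, e'⟩ | ⟨-, e' | e'⟩ | h'
    · rw [← hpath' k hk j hj] at e'
      exact (hva j hj (k.injective e')).elim
    · rw [e'] at hf; exact (hy hf).elim
    · rw [e'] at hf; exact (hy (g.injective hf)).elim
    · exact h'.2
  have hys : ∀ k ∈ G, ∀ v, v = y ∨ v = g y → k v = y ∨ k v = g y := by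
    intro k hk v hv
    have hvT : ∀ w, (w = z ∨ w = z') → k v ≠ w := by
      intro w hw e'
      have hki := hzs k⁻¹ (inv_mem hk) w hw
      rw [← e', show k⁻¹ (k v) = v by simp] at hki
      rcases hv with rfl | rfl <;> rcases hki with e | e
      · exact nzy e.symm
      · exact nzy' e.symm
      · exact nzgy e.symm
      · exact nzgy' e.symm
    rcases hT (k v) with (e | e | e | e) | ⟨j, hj, e'⟩
    · exact Or.inl e
    · exact Or.inr e
    · exact (hvT z (Or.inl rfl) e).elim
    · exact (hvT z' (Or.inr rfl) e).elim
    · rw [← hpath' k hk j hj] at e'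
      have := k.injective e'
      rcases hv with rfl | rfl
      · exact (ny j hj this.symm).elim
      · exact (ngy j hj this.symm).elim
  have hgrp := eq_one_or_eq_of_fixes hg hgg (fun k hk hky => by
      have h1 := hpair k y (g y) (hys k hk y (Or.inl rfl)) (hys k hk _ (Or.inr rfl)) hy.symm
      have h2 := hpair k z z' (hzs k hk z (Or.inl rfl)) (hzs k hk _ (Or.inr rfl)) hzz
      rcases h2 with ⟨kz, kz'⟩ | ⟨kz, kz'⟩
      · have kgy : k (g y) = g y := by
          rcases h1 with h1 | h1
          · exact h1.2
          · exact (hy (h1.1.symm.trans hky)).elim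
        ext1 v
        rcases hT v with (rfl | rfl | rfl | rfl) | ⟨j, hj, rfl⟩
        · exact hky
        · exact kgy
        · exact kz
        · exact kz'
        · exact hpath' k hk j hj
      · exact (hswap k hk (hpath' k hk) kz kz' h1).elim) (fun k hk => hys k hk y (Or.inl rfl))
  let f : Icc 0 (n + 4) → S := fun i => if (i : ℕ) = 0 then z' else if (i : ℕ) = 1 then z else
    if (i : ℕ) ≤ n + 2 then a (n + 2 - i) else if (i : ℕ) = n + 3 then y else g y
  have f0 : ∀ hi, f ⟨0, hi⟩ = z' := fun hi => if_pos rfl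
  have f1 : ∀ hi, f ⟨1, hi⟩ = z := fun hi => (if_neg (by norm_num)).trans (if_pos rfl)
  have f2 : ∀ i (hi : i ∈ Icc 0 (n + 4)), 2 ≤ i → i ≤ n + 2 → f ⟨i, hi⟩ = a (n + 2 - i) :=
    fun i hi hi' hi'' => by
      simp only [f]
      rw [if_neg (by omega), if_neg (by omega), if_pos hi'']
  have f3 : ∀ hi, f ⟨n + 3, hi⟩ = y := fun hi => by
    simp only [f]
    rw [if_neg (by omega), if_neg (by omega), if_neg (by omega)]
    simp
  have f4 : ∀ hi, f ⟨n + 4, hi⟩ = g y := fun hi => by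
    simp only [f]
    rw [if_neg (by omega), if_neg (by omega), if_neg (by omega), if_neg (by omega)]
  have hcases : ∀ i, i ∈ Icc 0 (n + 4) → i = 0 ∨ i = 1 ∨ i = n + 3 ∨ i = n + 4 ∨
      (2 ≤ i ∧ i ≤ n + 2) := by
    intro i hi
    have := hi.2
    omega
  refine pairIso_zpowers (f := f) ⟨?_, fun v => ?_⟩ ?_ hg hgrp ?_
  · have key : ∀ i (hi : i ∈ Icc 0 (n + 4)) j (hj : j ∈ Icc 0 (n + 4)), i < j →
        f ⟨i, hi⟩ ≠ f ⟨j, hj⟩ := by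
      intro i hi j hj hij
      rcases hcases i hi with rfl | rfl | rfl | rfl | ⟨i1, i2⟩ <;>
        rcases hcases j hj with rfl | rfl | rfl | rfl | ⟨j1, j2⟩ <;>
        first
        | omega
        | simp only [f0, f1, f3, f4]
        | skip
      · exact hzz.symm
      · exact nzy'
      · exact nzgy'
      · rw [f2 j hj j1 j2]; exact hoff' _ (by omega)
      · exact nzy
      · exact nzgy
      · rw [f2 j hj j1 j2]; exact hoff _ (by omega)
      · exact hy.symm
      · rw [f2 i hi i1 i2]; exact ny _ (by omega)
      · rw [f2 i hi i1 i2]; exact ngy _ (by omega)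
      · rw [f2 i hi i1 i2, f2 j hj j1 j2, Ne, hinj _ (by omega) _ (by omega)]; omega
    rintro ⟨i, hi⟩ ⟨j, hj⟩ hij
    rw [Subtype.ext_iff]
    by_contra hne
    rcases lt_or_gt_of_ne hne with h' | h'
    · exact key i hi j hj h' hij
    · exact key j hj i hi h' hij.symm
  · rcases hT v with (rfl | rfl | rfl | rfl) | ⟨i, hi, rfl⟩
    · exact ⟨_, f3 (by rw [mem_Icc]; omega)⟩
    · exact ⟨_, f4 (by rw [mem_Icc]; omega)⟩
    · exact ⟨_, f1 (by rw [mem_Icc]; omega)⟩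
    · exact ⟨_, f0 (by rw [mem_Icc]; omega)⟩
    · refine ⟨_, (f2 (n + 2 - i) (by rw [mem_Icc]; omega) (by omega) (by omega)).trans ?_⟩
      congr 1; omega
  · have key : ∀ i (hi : i ∈ Icc 0 (n + 4)) j (hj : j ∈ Icc 0 (n + 4)), i < j →
        ((graphAffD (n + 4)).Adj ⟨i, hi⟩ ⟨j, hj⟩ ↔ Γ.Adj (f ⟨i, hi⟩) (f ⟨j, hj⟩)) := by
      intro i hi j hj hij
      simp only [graphAffD, fromRel_adj, ne_eq, Subtype.ext_iff]
      rcases hcases i hi with rfl | rfl | rfl | rfl | ⟨i1, i2⟩ <;>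
        rcases hcases j hj with rfl | rfl | rfl | rfl | ⟨j1, j2⟩ <;>
        first
        | (exfalso; omega)
        | skip
      · rw [f0, f1, hzN', eq_false (hoff n le_rfl), iff_false]; omega
      · rw [f0, f3, hzN', eq_false (ny n le_rfl).symm, iff_false]; omega
      · rw [f0, f4, hzN', eq_false (ngy n le_rfl).symm, iff_false]; omega
      · rw [f0, f2 j hj j1 j2, hzN', hinj _ (by omega) _ le_rfl]; omega
      · rw [f1, f3, hzN, eq_false (ny n le_rfl).symm, iff_false]; omega
      · rw [f1, f4, hzN, eq_false (ngy n le_rfl).symm, iff_false]; omega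
      · rw [f1, f2 j hj j1 j2, hzN, hinj _ (by omega) _ le_rfl]; omega
      · rw [f3, f4, hyN, eq_false (ngy 0 (by omega)).symm, iff_false]; omega
      · rw [f3, f2 i hi i1 i2, Γ.adj_comm, hyN, hinj _ (by omega) _ (by omega)]; omega
      · rw [f4, f2 i hi i1 i2, Γ.adj_comm, hgyN, hinj _ (by omega) _ (by omega)]; omega
      · rw [f2 i hi i1 i2, f2 j hj j1 j2, h.adj _ (by omega) _ (by omega)]; omega
    rintro ⟨i, hi⟩ ⟨j, hj⟩
    rcases lt_trichotomy i j with h' | rfl | h'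
    · exact key i hi j hj h'
    · simp
    · rw [Γ.adj_comm, adj_comm]; exact key j hj i hi h'
  · rintro ⟨i, hi⟩
    have es : ∀ hi hi', swapD 0 (n + 4) (by omega) ⟨n + 3, hi⟩ = ⟨n + 4, hi'⟩ :=
      fun hi hi' => Equiv.swap_apply_left _ _
    have es' : ∀ hi hi', swapD 0 (n + 4) (by omega) ⟨n + 4, hi⟩ = ⟨n + 3, hi'⟩ :=
      fun hi hi' => Equiv.swap_apply_right _ _
    have es'' : ∀ i (hi : i ∈ Icc 0 (n + 4)), i ≤ n + 2 →
        swapD 0 (n + 4) (by omega) ⟨i, hi⟩ = ⟨i, hi⟩ := fun i hi hi' =>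
      Equiv.swap_apply_of_ne_of_ne (by rw [Ne, Subtype.ext_iff]; simp only; omega)
        (by rw [Ne, Subtype.ext_iff]; simp only; omega)
    rcases hcases i hi with rfl | rfl | rfl | rfl | ⟨i1, i2⟩
    · rw [es'' _ _ (by omega), f0, hz']
    · rw [es'' _ _ (by omega), f1, hz]
    · rw [es hi (by rw [mem_Icc]; omega), f3, f4]
    · rw [es' hi (by rw [mem_Icc]; omega), f3, f4, hgg]
    · rw [es'' _ _ (by omega), f2 i hi i1 i2, h.fix _ (by omega)]

end FixedPath

end

noncomputable section

/-! ### The classification -/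

open SimpleGraph CoxeterPairs Set

variable {S : Type*} {Γ : SimpleGraph S} {G : Subgroup (Equiv.Perm S)}

/-- `(Γ, G)` is isomorphic to one of the pairs of the list. -/
def ListedPair (Γ : SimpleGraph S) (G : Subgroup (Equiv.Perm S)) : Prop :=
  (∃ m : ℕ, 1 ≤ m ∧ PairIso Γ G (graphA (2 * m + 1)) (Subgroup.zpowers (flipA m))) ∨
  (∃ (m : ℕ) (hm : 4 ≤ m), PairIso Γ G (graphD m) (Subgroup.zpowers (swapD 1 m (by omega)))) ∨
  (∃ H : Subgroup (Equiv.Perm (Icc 1 4)), Subgroup.zpowers (trialityD4 1 le_rfl) ≤ H ∧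
    H ≤ Subgroup.closure {trialityD4 1 le_rfl, swapD 1 4 (by omega)} ∧
    PairIso Γ G (graphD 4) H) ∨
  PairIso Γ G graphE6 (Subgroup.zpowers (flipE6 1 le_rfl)) ∨
  (∃ m : ℕ, 1 ≤ m ∧ PairIso Γ G (graphAffA (2 * m + 1)) (Subgroup.zpowers (flipAffA m))) ∨
  (∃ (m : ℕ) (hm : 4 ≤ m), PairIso Γ G (graphAffD m) (Subgroup.zpowers (swapD 0 m (by omega)))) ∨
  (∃ H : Subgroup (Equiv.Perm (Icc 0 4)), Subgroup.zpowers (trialityD4 0 zero_le_one) ≤ H ∧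
    H ≤ Subgroup.closure {trialityD4 0 zero_le_one, swapD 0 4 (by omega)} ∧
    PairIso Γ G (graphAffD 4) H) ∨
  PairIso Γ G graphAffE6 (Subgroup.zpowers (flipE6 0 zero_le_one)) ∨
  PairIso Γ G graphInfAInf (Subgroup.zpowers (Equiv.neg ℤ)) ∨
  PairIso Γ G graphDInf (Subgroup.zpowers swapDInf)

theorem ListedPair.isListed {M : CoxeterMatrix S} (hM : M.IsSimplyLaced)
    {G : Subgroup M.symmetryGroup}
    (h : ListedPair M.coxeterGraph (G.map M.symmetryGroup.subtype)) : IsListed M G := by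
  rcases h with ⟨m, hm, h⟩ | ⟨m, hm, h⟩ | ⟨H, h1, h2, h⟩ | h | ⟨m, hm, h⟩ | ⟨m, hm, h⟩ |
    ⟨H, h1, h2, h⟩ | h | h | h
  · exact Or.inl ⟨m, hm, h.isoPair hM⟩
  · exact Or.inr (Or.inl ⟨m, hm, h.isoPair hM⟩)
  · exact Or.inr (Or.inr (Or.inl ⟨H, h1, h2, h.isoPair hM⟩))
  · exact Or.inr (Or.inr (Or.inr (Or.inl (h.isoPair hM))))
  · exact Or.inr (Or.inr (Or.inr (Or.inr (Or.inl ⟨m, hm, h.isoPair hM⟩))))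
  · exact Or.inr (Or.inr (Or.inr (Or.inr (Or.inr (Or.inl ⟨m, hm, h.isoPair hM⟩)))))
  · exact Or.inr (Or.inr (Or.inr (Or.inr (Or.inr (Or.inr (Or.inl
      ⟨H, h1, h2, h.isoPair hM⟩))))))
  · exact Or.inr (Or.inr (Or.inr (Or.inr (Or.inr (Or.inr (Or.inr (Or.inl (h.isoPair hM))))))))
  · exact Or.inr (Or.inr (Or.inr (Or.inr (Or.inr (Or.inr (Or.inr (Or.inr
      (Or.inl (h.isoPair hM)))))))))
  · exact Or.inr (Or.inr (Or.inr (Or.inr (Or.inr (Or.inr (Or.inr (Or.inr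
      (Or.inr (h.isoPair hM)))))))))

namespace IsOrthogonalPair

variable (P : IsOrthogonalPair Γ G) {g : Equiv.Perm S} (hg : g ∈ G)
  (hinv : ∀ k ∈ G, ∀ x y, k x = x → Γ.Adj x y → k (k y) = y)
include P hg hinv

/-- The pairs for which the moved vertices `y` and `g y` next to a fixed vertex are leaves and
there is a further vertex are those of types `D` and `D̃`. -/
theorem listedPair_of_leaf {x y z : S} (hx : g x = x) (hy : g y ≠ y)
    (hyN : ∀ v, Γ.Adj y v ↔ v = x) (hz : g z = z) (hxz : Γ.Adj x z) : ListedPair Γ G := by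
  have hgg : g (g y) = y := hinv g hg x y hx ((hyN _).mpr rfl).symm
  have hgyN : ∀ v, Γ.Adj (g y) v ↔ v = x := by
    intro v
    obtain ⟨v, rfl⟩ := g.surjective v
    rw [P.adj g hg, hyN, ← g.injective.eq_iff, hx]
  by_cases hD : ∃ (a : ℕ → S) (n : ℕ) (v v' : S), a 0 = x ∧ FixedPath Γ g a n ∧ g v = v ∧
      g v' = v' ∧ v ≠ v' ∧ (∀ i ≤ n, v ≠ a i) ∧ (∀ i ≤ n, v' ≠ a i) ∧ Γ.Adj (a n) v ∧
      Γ.Adj (a n) v'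
  · obtain ⟨a, n, v, v', a0, h, hv, hv', hvv, o, o', e, e'⟩ := hD
    subst a0
    exact Or.inr (Or.inr (Or.inr (Or.inr (Or.inr (Or.inl
      ⟨n + 4, by omega, h.pairIso_graphAffD P hg hinv hy hyN hv hv' hvv o o' e e'⟩)))))
  push Not at hD
  have ny : ∀ v, g v = v → v ≠ y := by rintro v hv rfl; exact hy hv
  have ngy : ∀ v, g v = v → v ≠ g y := fun v hv e => ny v hv (g.injective (hv.trans e))
  -- an attached vertex beyond the leaves is attached to the end of the path
  have hstep : ∀ (a : ℕ → S) (n : ℕ), a 0 = x → FixedPath Γ g a n → ∀ i ≤ n, ∀ v,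
      Γ.Adj (a i) v → v ≠ y → v ≠ g y → (∀ j ≤ n, v ≠ a j) → g v = v ∧ i = n := by
    intro a n a0 h i hi v hv vy vgy hoff
    subst a0
    have gv := h.fixed_of_adj P hg hy hgg hyN hi hv vy vgy
    refine ⟨gv, ?_⟩
    by_contra hin
    refine hD a i v (a (i + 1)) rfl (h.restrict hi) gv (h.fix _ (by omega))
      (hoff _ (by omega)) (fun j hj => hoff j (by omega)) (fun j hj e => ?_) hv
      ((h.adj _ hi _ (by omega)).mpr (Or.inl rfl))
    have := h.inj _ (by omega) _ (by omega) e
    omega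
  by_cases hall : ∀ n, ∃ a : ℕ → S, a 0 = x ∧ FixedPath Γ g a n
  · choose A hA0 hA using hall
    have huniq : ∀ n m, n ≤ m → ∀ i ≤ n, ∀ k ≤ i, A m k = A n k := by
      intro n m hnm i
      induction i with
      | zero =>
        intro _ k hk
        obtain rfl : k = 0 := by omega
        rw [hA0, hA0]
      | succ i ih =>
        intro hi
        have ih' := ih (by omega)
        suffices hne : A m (i + 1) = A n (i + 1) by
          intro k hk
          rcases Nat.lt_or_ge k (i + 1) with h | h
          · exact ih' k (by omega)
          · obtain rfl : k = i + 1 := by omega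
            exact hne
        by_contra hne
        have e2 := ((hA m).adj i (by omega) (i + 1) (by omega)).mpr (Or.inl rfl)
        have f2 := (hA m).fix (i + 1) (by omega)
        rw [ih' i le_rfl] at e2
        obtain ⟨f3, f4⟩ := hstep (A n) n (hA0 n) (hA n) i (by omega) (A m (i + 1))
          e2 (ny _ f2) (ngy _ f2) (fun j hj e => by
            rw [e, (hA n).adj i (by omega) j hj] at e2
            rcases e2 with e2 | e2
            · exact hne (e2 ▸ e)
            · rw [← ih' j (by omega)] at e
              have := (hA m).inj _ (by omega) _ (by omega) e
              omega)
        omega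
    let a : ℕ → S := fun i => A i i
    have ha : ∀ n, FixedPath Γ g a n := fun n =>
      (hA n).congr fun i hi => (huniq i n hi i le_rfl i le_rfl).symm
    have a0 : a 0 = x := hA0 0
    have hT : ∀ v, v = y ∨ v = g y ∨ ∃ i, v = a i := by
      refine P.conn.mem_of_closed (T := {v | v = y ∨ v = g y ∨ ∃ i, v = a i}) (Or.inl rfl) ?_
      intro u hu v huv
      rcases hu with rfl | rfl | ⟨i, rfl⟩
      · exact Or.inr (Or.inr ⟨0, by rw [a0]; exact (hyN _).mp huv⟩)
      · exact Or.inr (Or.inr ⟨0, by rw [a0]; exact (hgyN _).mp huv⟩)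
      · by_contra hv
        change ¬ (_ ∨ _ ∨ _) at hv
        push Not at hv
        have := (hstep a (i + 1) a0 (ha _) i (by omega) v huv hv.1 hv.2.1
          (fun j _ => hv.2.2 j)).2
        omega
    exact Or.inr (Or.inr (Or.inr (Or.inr (Or.inr (Or.inr (Or.inr (Or.inr (Or.inr
      (FixedPath.pairIso_graphDInf P hg hinv ha hy (by rwa [a0]) hT)))))))))
  · classical
    push Not at hall
    obtain ⟨hk, hmin⟩ := Nat.find_spec hall, fun m => @Nat.find_min _ _ hall m
    generalize Nat.find hall = n at hk hmin
    obtain _ | n := n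
    · exact (hk _ rfl (.single hx)).elim
    have := hmin n (by omega)
    push Not at this
    obtain ⟨a, a0, h⟩ := this
    subst a0
    have hT : ∀ v, v = y ∨ v = g y ∨ ∃ i, i ≤ n ∧ v = a i := by
      refine P.conn.mem_of_closed (T := {v | v = y ∨ v = g y ∨ ∃ i, i ≤ n ∧ v = a i})
        (Or.inl rfl) ?_
      intro u hu v huv
      rcases hu with rfl | rfl | ⟨i, hi, rfl⟩
      · exact Or.inr (Or.inr ⟨0, by omega, (hyN _).mp huv⟩)
      · exact Or.inr (Or.inr ⟨0, by omega, (hgyN _).mp huv⟩)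
      · by_contra hv
        change ¬ (_ ∨ _ ∨ _) at hv
        push Not at hv
        obtain ⟨gv, rfl⟩ := hstep a n rfl h i hi v huv hv.1 hv.2.1 hv.2.2
        exact hk _ (Function.update_of_ne (by omega) _ _)
          (h.extend P hg hy hyN gv hv.2.2 huv)
    have hn : 1 ≤ n := by
      rcases hT z with e | e | ⟨i, hi, e⟩
      · exact (ny z hz e).elim
      · exact (ngy z hz e).elim
      · by_contra hn
        obtain rfl : i = 0 := by omega
        exact hxz.ne e.symm
    exact Or.inr (Or.inl ⟨n + 3, by omega, h.pairIso_graphD P hg hinv hn hy hyN hT⟩)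

end IsOrthogonalPair

theorem SymPath.congr {g : Equiv.Perm S} {c c' : ℤ → S} {n : ℕ} (h : SymPath Γ g c n)
    (hc : ∀ i : ℤ, -n ≤ i → i ≤ n → c' i = c i) : SymPath Γ g c' n where
  perm i h1 h2 := by rw [hc i h1 h2, hc _ (by omega) (by omega), h.perm i h1 h2]
  inj i j h1 h2 h3 h4 := by rw [hc i h1 h2, hc j h3 h4]; exact h.inj i j h1 h2 h3 h4
  adj i j h1 h2 h3 h4 := by rw [hc i h1 h2, hc j h3 h4]; exact h.adj i j h1 h2 h3 h4
  root m hm := by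
    convert h.root m hm using 1
    refine Finset.sum_congr rfl fun i hi => ?_
    rw [Finset.mem_Icc] at hi
    rw [hc i (by omega) (by omega)]

/-- The classification of the pairs with orthogonal orbits of roots. -/
theorem IsOrthogonalPair.listedPair (P : IsOrthogonalPair Γ G) (hG : ∃ g ∈ G, g ≠ 1) :
    ListedPair Γ G := by
  by_cases hinv : ∀ k ∈ G, ∀ x y, k x = x → Γ.Adj x y → k (k y) = y
  swap
  · push Not at hinv
    obtain ⟨k, hk, x, y, hx, hxy, hyy⟩ := hinv
    have hy : k y ≠ y := fun e => hyy (by rw [e, e])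
    rcases P.pairIso_triality hk hx hy hxy hyy with h | h
    · exact Or.inr (Or.inr (Or.inl h))
    · exact Or.inr (Or.inr (Or.inr (Or.inr (Or.inr (Or.inr (Or.inl h))))))
  obtain ⟨g, hg, hg1⟩ := hG
  obtain ⟨x, y, hx, hy, hxy⟩ := P.exists_fixed_adj_moved hg hg1
  have hgg := hinv g hg x y hx hxy
  by_cases hcyc : ∃ (n : ℕ) (c : ℤ → S) (z : S), 1 ≤ n ∧ SymPath Γ g c n ∧ g z = z ∧
      SymPath.Off c n z ∧ Γ.Adj z (c n)
  · obtain ⟨n, c, z, hn, h, hz, hoff, hzc⟩ := hcyc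
    exact Or.inr (Or.inr (Or.inr (Or.inr (Or.inl
      ⟨n, hn, h.pairIso_graphAffA P hg hn hz hoff hzc⟩))))
  push Not at hcyc
  have hfixed : ∀ (n : ℕ) (c : ℤ → S), SymPath Γ g c n → ∀ v, SymPath.Off c n v → g v = v →
      ∀ i : ℤ, -n ≤ i → i ≤ n → i ≠ 0 → ¬ Γ.Adj (c i) v := by
    intro n c h v hv gv i h1 h2 h0 hadj
    obtain ⟨m, rfl | rfl⟩ := i.eq_nat_or_neg
    · exact hcyc m c v (by omega) (h.restrict (by omega)) gv
        (fun i h1 h2 => hv i (by omega) (by omega)) hadj.symm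
    · rw [← P.adj g hg, h.perm _ h1 h2, neg_neg, gv] at hadj
      exact hcyc m c v (by omega) (h.restrict (by omega)) gv
        (fun i h1 h2 => hv i (by omega) (by omega)) hadj.symm
  -- a further vertex attached to an arm prolongs it
  have hstep : ∀ (n : ℕ) (c : ℤ → S), 1 ≤ n → SymPath Γ g c n → ∀ v, SymPath.Off c n v →
      ∀ i : ℤ, -n ≤ i → i ≤ n → i ≠ 0 → Γ.Adj (c i) v →
      ∃ c', SymPath Γ g c' (n + 1) ∧ c' 0 = c 0 ∧ c' 1 = c 1 := by
    intro n c hn h v hv i h1 h2 h0 hadj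
    have gv : g v ≠ v := fun gv => hfixed n c h v hv gv i h1 h2 h0 hadj
    have key : ∀ v, SymPath.Off c n v → g v ≠ v → Γ.Adj (c n) v →
        ∃ c', SymPath Γ g c' (n + 1) ∧ c' 0 = c 0 ∧ c' 1 = c 1 := by
      intro v hv gv hadj
      obtain ⟨c', h', e, -⟩ := h.extend P hg hv gv (h.sq_eq_of_adj_end P hg hn hv gv hadj) hadj
      exact ⟨c', h', e 0 (by omega) (by omega), e 1 (by omega) (by omega)⟩
    have hi : i = n ∨ i = -n := by
      by_contra hi
      exact gv (h.fixed_of_adj_inner P hg hv (by omega) (by omega) hadj)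
    rcases hi with rfl | rfl
    · exact key v hv gv hadj
    · rw [← P.adj g hg, h.perm _ h1 h2, neg_neg] at hadj
      exact key (g v) (hv.perm h) (fun e => gv (g.injective e)) hadj
  have hone : ∃ c : ℤ → S, SymPath Γ g c 1 ∧ c 0 = x ∧ c 1 = y := by
    obtain ⟨c', h', e, e'⟩ := (SymPath.single (Γ := Γ) hx).extend P hg (v := y)
      (fun i _ _ e => hy (e ▸ hx)) hy hgg hxy
    exact ⟨c', h', e 0 (by omega) (by omega), by simpa using e'⟩
  by_cases hall : ∀ n, ∃ c : ℤ → S, SymPath Γ g c n ∧ c 0 = x ∧ (1 ≤ n → c 1 = y)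
  · choose A hA hA0 hA1 using hall
    have huniq : ∀ n m : ℕ, n ≤ m → ∀ i : ℤ, -n ≤ i → i ≤ n → A m i = A n i := fun n m hnm =>
      ((hA m).restrict hnm).unique P hg (hA n) ((hA0 m).trans (hA0 n).symm)
        (fun hn => (hA1 m (by omega)).trans (hA1 n hn).symm)
    let c : ℤ → S := fun i => A i.natAbs i
    have hc : ∀ n, SymPath Γ g c n := fun n =>
      (hA n).congr fun i h1 h2 => (huniq i.natAbs n (by omega) i (by omega) (by omega)).symm
    have hT : ∀ v, ∃ i, c i = v := by
      refine P.conn.mem_of_closed (T := {v | ∃ i, c i = v}) (x := c 0) ⟨0, rfl⟩ ?_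
      rintro _ ⟨i, rfl⟩ v huv
      by_contra hv
      have hoff : ∀ n, SymPath.Off c n v := fun n j _ _ e => hv ⟨j, e.symm⟩
      have gv : g v = v := (hc (i.natAbs + 1)).fixed_of_adj_inner P hg (hoff _) (by omega)
        (by omega) huv
      by_cases h0 : i = 0
      · subst h0
        exact (hc 3).false_of_three P hg gv huv.symm
      · exact hfixed i.natAbs c (hc _) v (hoff _) gv i (by omega) (by omega) h0 huv
    exact Or.inr (Or.inr (Or.inr (Or.inr (Or.inr (Or.inr (Or.inr (Or.inr (Or.inl
      (P.pairIso_graphInfAInf hg hc hT)))))))))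
  · classical
    push Not at hall
    obtain ⟨hk, hmin⟩ := Nat.find_spec hall, fun m => @Nat.find_min _ _ hall m
    generalize Nat.find hall = n at hk hmin
    obtain _ | _ | n := n
    · have := (hk _ (.single hx) rfl).1
      omega
    · obtain ⟨c, h, c0, c1⟩ := hone
      exact ((hk c h c0).2 c1).elim
    have := hmin (n + 1) (by omega)
    push Not at this
    obtain ⟨c, h, c0, c1⟩ := this
    have c1 := c1 (by omega)
    subst c0 c1
    have hmax : ∀ v, SymPath.Off c (n + 1) v → ∀ i : ℤ, -(n + 1 : ℕ) ≤ i → i ≤ (n + 1 : ℕ) →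
        i ≠ 0 → ¬ Γ.Adj (c i) v := by
      intro v hv i h1 h2 h0 hadj
      obtain ⟨c', h', e0, e1⟩ := hstep (n + 1) c (by omega) h v hv i h1 h2 h0 hadj
      exact (hk c' h' e0).2 e1
    by_cases hz : ∃ z, SymPath.Off c (n + 1) z ∧ Γ.Adj (c 0) z
    · obtain ⟨z, hoff, hxz⟩ := hz
      have gz : g z = z := h.fixed_of_adj_inner P hg hoff (by omega) (by omega) hxz
      obtain _ | _ | n := n
      · refine P.listedPair_of_leaf hg hinv hx hy (fun v => ?_) gz hxz
        refine ⟨fun hv => ?_, by rintro rfl; exact hxy.symm⟩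
        by_cases ho : SymPath.Off c 1 v
        · exact (hmax v ho 1 (by omega) (by omega) (by omega) hv).elim
        · unfold SymPath.Off at ho
          push Not at ho
          obtain ⟨j, j1, j2, rfl⟩ := ho
          rw [h.adj 1 j (by omega) (by omega) j1 j2] at hv
          congr 1
          omega
      · rcases h.pairIso_graphE6 P hg hinv gz hxz.symm hmax with e | e
        · exact Or.inr (Or.inr (Or.inr (Or.inl e)))
        · exact Or.inr (Or.inr (Or.inr (Or.inr (Or.inr (Or.inr (Or.inr (Or.inl e)))))))
      · exact ((h.restrict (m := 3) (by omega)).false_of_three P hg gz hxz.symm).elim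
    · push Not at hz
      refine Or.inl ⟨n + 1, by omega, h.pairIso_graphA P hg (by omega) ?_⟩
      refine P.conn.mem_of_closed (T := {v | ∃ i : ℤ, -(n + 1 : ℕ) ≤ i ∧ i ≤ (n + 1 : ℕ) ∧ v = c i})
        (x := c 0) ⟨0, by omega, by omega, rfl⟩ ?_
      rintro _ ⟨i, h1, h2, rfl⟩ v huv
      by_contra hv
      have hoff : SymPath.Off c (n + 1) v := fun j j1 j2 e => hv ⟨j, j1, j2, e⟩
      by_cases h0 : i = 0
      · subst h0; exact hz v hoff huv
      · exact hmax v hoff i h1 h2 h0 huv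

end

noncomputable section

/-! ### Positive semidefinite graphs -/

open SimpleGraph

namespace SimpleGraph

variable {S : Type*} {Γ : SimpleGraph S}

open Classical in
/-- `f` is a positive superharmonic function on the graph: twice each value bounds the sum of the
values at any finitely many neighbours. -/
structure IsSuperharmonic (Γ : SimpleGraph S) (f : S → ℤ) : Prop where
  pos : ∀ s, 0 < f s
  le : ∀ s (T : Finset S), ∑ t ∈ T with Γ.Adj s t, f t ≤ 2 * f s

theorem eq_sum_smul_vert {u : S →₀ ℤ} {T : Finset S} (hT : u.support ⊆ T) :
    u = ∑ s ∈ T, u s • vert s := by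
  conv_lhs => rw [← u.sum_single]
  rw [Finsupp.sum_of_support_subset u hT _ (by simp)]
  simp [vert]

theorem bil_eq_sum {u v : S →₀ ℤ} {T : Finset S} (hu : u.support ⊆ T) (hv : v.support ⊆ T) :
    Γ.bil u v = ∑ s ∈ T, ∑ t ∈ T, u s * v t * Γ.cart s t := by
  conv_lhs => rw [eq_sum_smul_vert hu, eq_sum_smul_vert hv]
  simp only [map_sum, map_smul, LinearMap.sum_apply, LinearMap.smul_apply, bil_vert_vert,
    smul_eq_mul]
  simp only [Finset.mul_sum]
  rw [Finset.sum_comm]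
  refine Finset.sum_congr rfl fun s _ => Finset.sum_congr rfl fun t _ => ?_
  ring

open Classical in
/-- The form as a sum of squares. -/
theorem two_mul_bil_self (f : S → ℤ) (hf : ∀ s, 0 < f s) {u : S →₀ ℤ} {T : Finset S}
    (hu : u.support ⊆ T) :
    2 * (Γ.bil u u : ℚ) =
      ∑ s ∈ T, ∑ t ∈ T, (if Γ.Adj s t then (1 : ℚ) else 0) * (f s * f t) *
        ((u s : ℚ) / f s - u t / f t) ^ 2 +
      2 * ∑ s ∈ T, ((u s : ℚ) / f s) ^ 2 * f s *
        (2 * f s - ∑ t ∈ T, (if Γ.Adj s t then (1 : ℚ) else 0) * f t) := by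
  set a : S → S → ℚ := fun s t => if Γ.Adj s t then 1 else 0 with ha
  have hasymm : ∀ s t, a s t = a t s := fun s t => by simp only [ha, Γ.adj_comm]
  set v : S → ℚ := fun s => (u s : ℚ) / f s with hv
  have huv : ∀ s, (u s : ℚ) = f s * v s := fun s => by
    have : (f s : ℚ) ≠ 0 := by exact_mod_cast (hf s).ne'
    simp only [hv]; field_simp
  have hcart : ∀ s t, (Γ.cart s t : ℚ) = (if s = t then 2 else 0) - a s t := by
    intro s t
    by_cases h : s = t
    · subst h; simp [cart_self, ha]
    · by_cases h' : Γ.Adj s t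
      · simp [h'.cart_eq, ha, h', h]
      · simp [cart_eq_zero h h', ha, h', h]
  have e1 : (Γ.bil u u : ℚ) = 2 * ∑ s ∈ T, (f s * v s) ^ 2 -
      ∑ s ∈ T, ∑ t ∈ T, a s t * (f s * v s) * (f t * v t) := by
    rw [bil_eq_sum hu hu]
    push_cast
    rw [Finset.mul_sum, ← Finset.sum_sub_distrib]
    refine Finset.sum_congr rfl fun s hs => ?_
    have : ∀ t, (u s : ℚ) * u t * Γ.cart s t =
        (if s = t then 2 * (f s * v s) * (f t * v t) else 0) - a s t * (f s * v s) * (f t * v t) := by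
      intro t
      rw [hcart, huv, huv]
      split_ifs <;> ring
    simp only [this]
    rw [Finset.sum_sub_distrib, Finset.sum_ite_eq, if_pos hs]
    ring
  have e2 : ∑ s ∈ T, ∑ t ∈ T, a s t * (f s * f t) * (v s - v t) ^ 2 =
      2 * ∑ s ∈ T, ∑ t ∈ T, v s ^ 2 * f s * (a s t * f t) -
      2 * ∑ s ∈ T, ∑ t ∈ T, a s t * (f s * v s) * (f t * v t) := by
    have h1 : ∑ s ∈ T, ∑ t ∈ T, v t ^ 2 * f t * (a s t * f s) =
        ∑ s ∈ T, ∑ t ∈ T, v s ^ 2 * f s * (a s t * f t) := by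
      rw [Finset.sum_comm]
      refine Finset.sum_congr rfl fun s _ => Finset.sum_congr rfl fun t _ => ?_
      rw [hasymm]
    have h2 : ∑ s ∈ T, ∑ t ∈ T, a s t * (f s * f t) * (v s - v t) ^ 2 =
        ∑ s ∈ T, ∑ t ∈ T, v s ^ 2 * f s * (a s t * f t) +
        ∑ s ∈ T, ∑ t ∈ T, v t ^ 2 * f t * (a s t * f s) -
        2 * ∑ s ∈ T, ∑ t ∈ T, a s t * (f s * v s) * (f t * v t) := by
      simp only [Finset.mul_sum, ← Finset.sum_add_distrib, ← Finset.sum_sub_distrib]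
      refine Finset.sum_congr rfl fun s _ => Finset.sum_congr rfl fun t _ => ?_
      ring
    rw [h2, h1]
    ring
  have e3 : ∑ s ∈ T, v s ^ 2 * f s * (2 * f s - ∑ t ∈ T, a s t * f t) =
      2 * ∑ s ∈ T, (f s * v s) ^ 2 - ∑ s ∈ T, ∑ t ∈ T, v s ^ 2 * f s * (a s t * f t) := by
    rw [Finset.mul_sum, ← Finset.sum_sub_distrib]
    refine Finset.sum_congr rfl fun s _ => ?_
    rw [mul_sub, Finset.mul_sum]
    ring
  change _ = ∑ s ∈ T, ∑ t ∈ T, a s t * (f s * f t) * (v s - v t) ^ 2 +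
    2 * ∑ s ∈ T, v s ^ 2 * f s * (2 * f s - ∑ t ∈ T, a s t * f t)
  rw [e1, e2, e3]
  ring

namespace IsSuperharmonic

variable {f : S → ℤ} (hf : IsSuperharmonic Γ f)
include hf

open Classical in
theorem le' (s : S) (T : Finset S) :
    (0 : ℚ) ≤ 2 * f s - ∑ t ∈ T, (if Γ.Adj s t then (1 : ℚ) else 0) * f t := by
  have := hf.le s T
  rw [Finset.sum_filter] at this
  have h : ∑ t ∈ T, (if Γ.Adj s t then (1 : ℚ) else 0) * f t =
      ((∑ t ∈ T, if Γ.Adj s t then f t else 0 : ℤ) : ℚ) := by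
    push_cast
    refine Finset.sum_congr rfl fun t _ => ?_
    split_ifs <;> simp
  rw [h, sub_nonneg]
  exact_mod_cast this

open Classical in
theorem terms_nonneg (u : S →₀ ℤ) (T : Finset S) :
    (∀ s t, 0 ≤ (if Γ.Adj s t then (1 : ℚ) else 0) * (f s * f t) *
        ((u s : ℚ) / f s - u t / f t) ^ 2) ∧
    ∀ s, 0 ≤ ((u s : ℚ) / f s) ^ 2 * f s *
        (2 * f s - ∑ t ∈ T, (if Γ.Adj s t then (1 : ℚ) else 0) * f t) := by
  have hp : ∀ s, (0 : ℚ) < f s := fun s => by exact_mod_cast hf.pos s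
  refine ⟨fun s t => ?_, fun s => ?_⟩
  · have := hp s; have := hp t
    split_ifs <;> positivity
  · have := hp s
    have := hf.le' s T
    positivity

theorem bil_self_nonneg (u : S →₀ ℤ) : 0 ≤ Γ.bil u u := by
  have h := two_mul_bil_self (Γ := Γ) f hf.pos (subset_refl u.support)
  obtain ⟨h1, h2⟩ := hf.terms_nonneg u u.support
  have : (0 : ℚ) ≤ 2 * (Γ.bil u u : ℚ) := by
    rw [h]
    have := Finset.sum_nonneg fun s (_ : s ∈ u.support) =>
      Finset.sum_nonneg fun t (_ : t ∈ u.support) => h1 s t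
    have := Finset.sum_nonneg fun s (_ : s ∈ u.support) => h2 s
    linarith
  have : (0 : ℚ) ≤ (Γ.bil u u : ℚ) := by linarith
  exact_mod_cast this

open Classical in
/-- The isotropic vectors of a connected graph are proportional to `f`; they vanish if `f` is
strictly superharmonic somewhere or if the graph is infinite. -/
theorem null_vector (hconn : Γ.Connected) {u : S →₀ ℤ} (hu : Γ.bil u u = 0) :
    (∀ s t, u s * f t = u t * f s) ∧
    ((∃ s, ∀ T : Finset S, ∑ t ∈ T with Γ.Adj s t, f t < 2 * f s) ∨ Infinite S → u = 0) := by
  have hz : ∀ T : Finset S, u.support ⊆ T →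
      (∀ s ∈ T, ∀ t ∈ T, (if Γ.Adj s t then (1 : ℚ) else 0) * (f s * f t) *
        ((u s : ℚ) / f s - u t / f t) ^ 2 = 0) ∧
      ∀ s ∈ T, ((u s : ℚ) / f s) ^ 2 * f s *
        (2 * f s - ∑ t ∈ T, (if Γ.Adj s t then (1 : ℚ) else 0) * f t) = 0 := by
    intro T hT
    have h := two_mul_bil_self (Γ := Γ) f hf.pos hT
    obtain ⟨h1, h2⟩ := hf.terms_nonneg u T
    have h3 := fun s (_ : s ∈ T) => Finset.sum_nonneg fun t (_ : t ∈ T) => h1 s t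
    have h4 := Finset.sum_nonneg h3
    have h5 := Finset.sum_nonneg fun s (_ : s ∈ T) => h2 s
    rw [hu] at h
    have h6 : _ = (0 : ℚ) := le_antisymm (by push_cast at h; linarith) h4
    have h7 : _ = (0 : ℚ) := le_antisymm (by push_cast at h; linarith) h5
    rw [Finset.sum_eq_zero_iff_of_nonneg h3] at h6
    rw [Finset.sum_eq_zero_iff_of_nonneg fun s _ => h2 s] at h7
    refine ⟨fun s hs => ?_, h7⟩
    exact (Finset.sum_eq_zero_iff_of_nonneg fun t _ => h1 s t).mp (h6 s hs)
  have hp : ∀ s, (0 : ℚ) < f s := fun s => by exact_mod_cast hf.pos s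
  have hadj : ∀ s t, Γ.Adj s t → (u s : ℚ) / f s = u t / f t := by
    intro s t hst
    have := (hz (u.support ∪ {s, t}) Finset.subset_union_left).1 s (by simp) t (by simp)
    rw [if_pos hst, one_mul, mul_eq_zero, mul_eq_zero, sq_eq_zero_iff, sub_eq_zero] at this
    rcases this with (h | h) | h
    · exact ((hp s).ne' h).elim
    · exact ((hp t).ne' h).elim
    · exact h
  have hall : ∀ s t, (u s : ℚ) / f s = u t / f t := fun s t =>
    (hconn.mem_of_closed (T := {v | (u v : ℚ) / f v = u t / f t}) rfl
      (fun v hv w hvw => (hadj v w hvw).symm.trans hv) s)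
  constructor
  · intro s t
    have := hall s t
    rw [div_eq_div_iff (hp s).ne' (hp t).ne'] at this
    exact_mod_cast this
  · intro h
    have hex : ∃ s, u s = 0 := by
      rcases h with ⟨s, hs⟩ | h
      · refine ⟨s, ?_⟩
        have := (hz (u.support ∪ {s}) Finset.subset_union_left).2 s (by simp)
        rw [mul_eq_zero, mul_eq_zero, sq_eq_zero_iff, div_eq_zero_iff] at this
        rcases this with ((h | h) | h) | h
        · exact_mod_cast h
        · exact ((hp s).ne' h).elim
        · exact ((hp s).ne' h).elim
        · exfalso
          have hlt := hs (u.support ∪ {s})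
          rw [Finset.sum_filter] at hlt
          have e : ∑ t ∈ u.support ∪ {s}, (if Γ.Adj s t then (1 : ℚ) else 0) * f t =
              ((∑ t ∈ u.support ∪ {s}, if Γ.Adj s t then f t else 0 : ℤ) : ℚ) := by
            push_cast
            refine Finset.sum_congr rfl fun t _ => ?_
            split_ifs <;> simp
          rw [e, sub_eq_zero] at h
          have : 2 * f s = ∑ t ∈ u.support ∪ {s}, if Γ.Adj s t then f t else 0 := by
            exact_mod_cast h
          omega
      · obtain ⟨s, hs⟩ := Infinite.exists_notMem_finset u.support
        exact ⟨s, by simpa using hs⟩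
    obtain ⟨s, hs⟩ := hex
    ext t
    have := hall t s
    rw [hs, Int.cast_zero, zero_div, div_eq_zero_iff] at this
    have := this.resolve_right (hp t).ne'
    simpa using this

end IsSuperharmonic

end SimpleGraph

end

noncomputable section

/-! ### Orthogonality of the orbits of roots -/

open SimpleGraph

variable {S : Type*} {Γ : SimpleGraph S}

open Classical in
/-- Elementary conditions on a graph with a group of automorphisms ensuring that the roots of each
orbit are pairwise orthogonal: the form is positive semidefinite, its isotropic vectors are
controlled by a fixed vertex, and the automorphisms have order at most `3`. -/
structure IsSemidefinitePair (Γ : SimpleGraph S) (G : Subgroup (Equiv.Perm S)) : Prop where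
  conn : Γ.Connected
  adj : ∀ g ∈ G, ∀ s t, Γ.Adj (g s) (g t) ↔ Γ.Adj s t
  not_adj : ∀ g ∈ G, ∀ s, ¬ Γ.Adj s (g s)
  adj_symm : ∀ g ∈ G, ∀ s t, Γ.Adj s (g t) → Γ.Adj t (g s)
  order : ∀ g ∈ G, (∀ s, g (g s) = s) ∨ ∀ s, g (g (g s)) = s
  superharmonic : ∃ f, IsSuperharmonic Γ f ∧ ((∃ o, f o = 1 ∧ ∀ g ∈ G, g o = o) ∨
    (∃ s, ∀ T : Finset S, ∑ t ∈ T with Γ.Adj s t, f t < 2 * f s) ∨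
      Infinite S)

theorem latPerm_mul {S : Type*} (g h : Equiv.Perm S) (v : S →₀ ℤ) :
    latPerm (g * h) v = latPerm g (latPerm h v) := by
  ext s
  obtain ⟨t, rfl⟩ := (g * h).surjective s
  rw [latPerm_apply, Equiv.Perm.mul_apply, latPerm_apply, latPerm_apply]

namespace IsSemidefinitePair

variable {G : Subgroup (Equiv.Perm S)} (P : IsSemidefinitePair Γ G)
include P

/-- Each vector pairs evenly with its images, since `⟨α_s, g α_t⟩ ≡ ⟨α_t, g α_s⟩` modulo `2` and
`⟨α_s, g α_s⟩` is even. -/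
theorem even_bil {g : Equiv.Perm S} (hg : g ∈ G) (u : S →₀ ℤ) : 2 ∣ Γ.bil u (latPerm g u) := by
  have hsym : ∀ s t, 2 ∣ Γ.cart s (g t) + Γ.cart t (g s) := by
    intro s t
    by_cases h1 : Γ.Adj s (g t)
    · rw [h1.cart_eq, (P.adj_symm g hg s t h1).cart_eq]; norm_num
    · have h2 : ¬ Γ.Adj t (g s) := fun h => h1 (P.adj_symm g hg t s h)
      simp only [cart, if_neg h1, if_neg h2]
      split_ifs <;> norm_num
  have hsymm : ∀ u v, 2 ∣ Γ.bil u (latPerm g v) + Γ.bil v (latPerm g u) := by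
    intro u v
    induction u using vert_induction with
    | zero => simp
    | add u u' h h' =>
      simp only [map_add, LinearMap.add_apply]
      omega
    | smul n s =>
      induction v using vert_induction with
      | zero => simp
      | add v v' h h' =>
        simp only [map_add, LinearMap.add_apply]
        omega
      | smul m t =>
        have := (hsym s t).mul_left (n * m)
        simp only [map_smul, LinearMap.smul_apply, latPerm_vert, bil_vert_vert, smul_eq_mul]
        rw [show m * (n * Γ.cart s (g t)) + n * (m * Γ.cart t (g s)) =
          n * m * (Γ.cart s (g t) + Γ.cart t (g s)) by ring]
        exact this
  induction u using vert_induction with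
  | zero => simp
  | add u u' h h' =>
    have := hsymm u u'
    simp only [map_add, LinearMap.add_apply]
    omega
  | smul n s =>
    have : 2 ∣ Γ.cart s (g s) := by
      simp only [cart, if_neg (P.not_adj g hg s)]
      split_ifs <;> norm_num
    simp only [map_smul, LinearMap.smul_apply, latPerm_vert, bil_vert_vert, smul_eq_mul]
    exact (this.mul_left n).mul_left n

theorem bil_self_nonneg (u : S →₀ ℤ) : 0 ≤ Γ.bil u u := by
  obtain ⟨f, hf, -⟩ := P.superharmonic
  exact hf.bil_self_nonneg u

/-- An isotropic vector vanishes as soon as it vanishes at the fixed vertices, and it is divisible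
by `2` as soon as its values at the fixed vertices are even. -/
theorem isotropic {u : S →₀ ℤ} (hu : Γ.bil u u = 0) :
    ((∀ o, (∀ g ∈ G, g o = o) → u o = 0) → u = 0) ∧
    ((∀ o, (∀ g ∈ G, g o = o) → 2 ∣ u o) → ∀ s, 2 ∣ u s) := by
  obtain ⟨f, hf, h⟩ := P.superharmonic
  obtain ⟨h1, h2⟩ := hf.null_vector P.conn hu
  rcases h with ⟨o, ho, hG⟩ | h
  · have e : ∀ t, u t = u o * f t := fun t => by rw [h1, ho, mul_one]
    refine ⟨fun h => ?_, fun h s => ?_⟩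
    · ext t
      rw [e, h o hG, zero_mul]; rfl
    · rw [e]; exact (h o hG).mul_right _
  · have e := h2 h
    exact ⟨fun _ => e, fun _ s => by rw [e]; simp⟩

/-- A vector that an involution negates has the form `c - g c`, so its norm is divisible
by `4`. -/
theorem four_dvd_of_negated {g : Equiv.Perm S} (hg : g ∈ G) (hgg : ∀ s, g (g s) = s)
    {b : S →₀ ℤ} (hb : latPerm g b = -b) : 4 ∣ Γ.bil b b := by
  classical
  let _ : LinearOrder S := linearOrderOfSTO (WellOrderingRel (α := S))
  let c : S →₀ ℤ := b.filter fun s => s < g s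
  have hbs : ∀ s, b (g s) = -b s := by
    intro s
    have := DFunLike.congr_fun hb (g s)
    rw [latPerm_apply, Finsupp.neg_apply] at this
    omega
  have hc : b = c - latPerm g c := by
    ext s
    have e : latPerm g c s = c (g s) := by
      conv_lhs => rw [← hgg s]
      exact latPerm_apply g c (g s)
    have := hbs s
    rw [Finsupp.sub_apply, e]
    simp only [c, Finsupp.filter_apply, hgg]
    rcases lt_trichotomy s (g s) with h | h | h
    · rw [if_pos h, if_neg h.not_gt, sub_zero]
    · rw [← h] at this ⊢
      rw [if_neg (lt_irrefl _)]; omega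
    · rw [if_pos h, if_neg h.not_gt]; omega
  have h1 := P.even_bil hg c
  have h2 : 2 ∣ Γ.bil c c := by
    have := P.even_bil (one_mem G) c
    rwa [show latPerm (1 : Equiv.Perm S) c = c by ext s; exact latPerm_apply 1 c s] at this
  rw [hc]
  simp only [map_sub, LinearMap.sub_apply, bil_latPerm (P.adj g hg), Γ.bil_symm (latPerm g c) c]
  omega

/-- The orbits of roots consist of pairwise orthogonal roots. -/
theorem ortho {β : S →₀ ℤ} (hβ : Γ.LatRoot β) {g : Equiv.Perm S} (hg : g ∈ G) :
    latPerm g β = β ∨ Γ.bil β (latPerm g β) = 0 := by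
  have h0 := hβ.bil_self
  have h1 : Γ.bil (latPerm g β) (latPerm g β) = 2 := by rw [bil_latPerm (P.adj g hg), h0]
  have hev := P.even_bil hg β
  have hs := Γ.bil_symm (latPerm g β) β
  have eplus : Γ.bil (β + latPerm g β) (β + latPerm g β) = 4 + 2 * Γ.bil β (latPerm g β) := by
    simp only [map_add, LinearMap.add_apply]
    omega
  have eminus : Γ.bil (β - latPerm g β) (β - latPerm g β) = 4 - 2 * Γ.bil β (latPerm g β) := by
    simp only [map_sub, LinearMap.sub_apply]
    omega
  have hplus := P.bil_self_nonneg (β + latPerm g β)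
  have hminus := P.bil_self_nonneg (β - latPerm g β)
  have hfix : ∀ o, (∀ g ∈ G, g o = o) → latPerm g β o = β o := fun o ho => by
    conv_lhs => rw [← ho g hg]
    exact latPerm_apply g β o
  have hcases : Γ.bil β (latPerm g β) = 0 ∨ Γ.bil β (latPerm g β) = 2 ∨
      Γ.bil β (latPerm g β) = -2 := by omega
  rcases hcases with h | h | h
  · exact Or.inr h
  · left
    have := (P.isotropic (u := β - latPerm g β) (by omega)).1 fun o ho => by
      rw [Finsupp.sub_apply, hfix o ho, sub_self]
    exact (sub_eq_zero.mp this).symm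
  exfalso
  -- an involution negates `β - w`, where `2 w = β + g β` is isotropic, and `β - w` has norm `2`
  rcases P.order g hg with hgg | hggg
  · have hdvd := (P.isotropic (u := β + latPerm g β) (by omega)).2 fun o ho => by
      rw [Finsupp.add_apply, hfix o ho, ← two_mul]; exact dvd_mul_right _ _
    set w : S →₀ ℤ := (β + latPerm g β).mapRange (· / 2) rfl with hw
    have h2w : β + latPerm g β = (2 : ℤ) • w := by
      ext s
      rw [Finsupp.smul_apply, hw, Finsupp.mapRange_apply, smul_eq_mul, Int.mul_ediv_cancel' (hdvd s)]
    have hgβ : latPerm g (latPerm g β) = β := by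
      rw [← latPerm_mul]
      ext s
      conv_lhs => rw [← hgg s]
      exact latPerm_apply (g * g) β s
    have hgw : latPerm g w = w := by
      have : (2 : ℤ) • latPerm g w = (2 : ℤ) • w := by
        rw [← map_smul, ← h2w, map_add, hgβ, add_comm]
      exact smul_right_injective _ (by norm_num : (2 : ℤ) ≠ 0) this
    have hww : Γ.bil w w = 0 := by
      have : 4 * Γ.bil w w = Γ.bil (β + latPerm g β) (β + latPerm g β) := by
        rw [h2w]
        simp only [map_smul, LinearMap.smul_apply, smul_eq_mul]
        ring
      omega
    have hβw : Γ.bil β w = 0 := by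
      have : 2 * Γ.bil β w = Γ.bil β (β + latPerm g β) := by
        rw [h2w, map_smul, smul_eq_mul]
      rw [map_add] at this
      omega
    have hb : latPerm g (β - w) = -(β - w) := by
      have : latPerm g β = (2 : ℤ) • w - β := by rw [← h2w]; abel
      rw [map_sub, hgw, this]
      module
    have := P.four_dvd_of_negated hg hgg hb
    have e : Γ.bil (β - w) (β - w) = 2 := by
      simp only [map_sub, LinearMap.sub_apply, Γ.bil_symm w β]
      omega
    omega
  -- for `g` of order three the norm of `β + g β + g² β` is `6 - 12 < 0`
  · have e3 : latPerm g (latPerm g (latPerm g β)) = β := by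
      rw [← latPerm_mul, ← latPerm_mul]
      ext s
      conv_lhs => rw [← hggg s]
      exact latPerm_apply (g * g * g) β s
    have e1 := bil_latPerm (P.adj g hg) β (latPerm g β)
    have e2 := bil_latPerm (P.adj g hg) (latPerm g β) (latPerm g (latPerm g β))
    have e4 := bil_latPerm (P.adj g hg) (latPerm g β) (latPerm g β)
    rw [e3] at e2
    have := P.bil_self_nonneg (β + latPerm g β + latPerm g (latPerm g β))
    simp only [map_add, LinearMap.add_apply, Γ.bil_symm (latPerm g (latPerm g β)) β,
      Γ.bil_symm (latPerm g (latPerm g β)) (latPerm g β)] at this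
    have e5 := Γ.bil_symm (latPerm g (latPerm g β)) β
    omega

end IsSemidefinitePair

end

noncomputable section

/-! ### The listed pairs are semidefinite -/

open SimpleGraph

section

variable {I J : Type*} {A : SimpleGraph I}

open Classical in
theorem sum_neighbours_le {l : I → J} (hl : Function.Injective l) {F : J → ℤ}
    (hF : ∀ j, 0 < F j) {s : I} {L : List J} (hL : ∀ t, A.Adj s t → l t ∈ L) (T : Finset I) :
    ∑ t ∈ T with A.Adj s t, F (l t) ≤ (L.map F).sum := by
  have h1 : ∑ t ∈ T with A.Adj s t, F (l t) = ∑ j ∈ (T.filter (A.Adj s)).image l, F j := by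
    rw [Finset.sum_image fun a _ b _ h => hl h]
  have h2 : ∑ j ∈ (T.filter (A.Adj s)).image l, F j ≤ ∑ j ∈ L.toFinset, F j := by
    refine Finset.sum_le_sum_of_subset_of_nonneg (fun j hj => ?_) fun j _ _ => (hF j).le
    obtain ⟨t, ht, rfl⟩ := Finset.mem_image.mp hj
    exact List.mem_toFinset.mpr (hL t (Finset.mem_filter.mp ht).2)
  have h3 : ∑ j ∈ L.toFinset, F j ≤ (L.map F).sum := by
    clear h1 h2 hL
    induction L with
    | nil => simp
    | cons a L ih =>
      rw [List.toFinset_cons, List.map_cons, List.sum_cons]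
      by_cases h : a ∈ L.toFinset
      · rw [Finset.insert_eq_of_mem h]
        have := hF a
        omega
      · rw [Finset.sum_insert h]
        omega
  omega

theorem isSuperharmonic_of_label {l : I → J} (hl : Function.Injective l) {F : J → ℤ}
    (hF : ∀ j, 0 < F j)
    (h : ∀ s, ∃ L : List J, (∀ t, A.Adj s t → l t ∈ L) ∧ (L.map F).sum ≤ 2 * F (l s)) :
    IsSuperharmonic A fun i => F (l i) where
  pos s := hF _
  le s T := by
    obtain ⟨L, hL, hs⟩ := h s
    exact (sum_neighbours_le hl hF hL T).trans hs

theorem swap_swap_apply [DecidableEq I] (a b s : I) : Equiv.swap a b (Equiv.swap a b s) = s := by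
  rw [← Equiv.Perm.mul_apply, Equiv.swap_mul_self]; rfl

theorem eq_one_or_eq_of_mem_zpowers {h₀ h : Equiv.Perm I} (h2 : ∀ s, h₀ (h₀ s) = s)
    (hh : h ∈ Subgroup.zpowers h₀) : h = 1 ∨ h = h₀ := by
  obtain ⟨n, rfl⟩ := Subgroup.mem_zpowers_iff.mp hh
  have e : h₀ ^ (2 : ℤ) = 1 := by
    ext1 s
    rw [zpow_two, Equiv.Perm.mul_apply, h2]; rfl
  obtain ⟨k, rfl | rfl⟩ := Int.even_or_odd' n
  · left; rw [zpow_mul, e, one_zpow]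
  · right; rw [zpow_add, zpow_mul, e, one_zpow, one_mul, zpow_one]

open Classical in
theorem IsSemidefinitePair.of_involution (hA : A.Connected) {h₀ : Equiv.Perm I}
    (h2 : ∀ s, h₀ (h₀ s) = s) (hadj : ∀ s t, A.Adj s t → A.Adj (h₀ s) (h₀ t))
    (hnot : ∀ s, ¬ A.Adj s (h₀ s))
    (hf : ∃ f, IsSuperharmonic A f ∧ ((∃ o, f o = 1 ∧ h₀ o = o) ∨
      (∃ s, ∀ T : Finset I, ∑ t ∈ T with A.Adj s t, f t < 2 * f s) ∨ Infinite I)) :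
    IsSemidefinitePair A (Subgroup.zpowers h₀) where
  conn := hA
  adj h hh s t := by
    rcases eq_one_or_eq_of_mem_zpowers h2 hh with rfl | rfl
    · rfl
    · exact ⟨fun h => by simpa only [h2] using hadj _ _ h, hadj s t⟩
  not_adj h hh s := by
    rcases eq_one_or_eq_of_mem_zpowers h2 hh with rfl | rfl
    · exact A.irrefl
    · exact hnot s
  adj_symm h hh s t hst := by
    rcases eq_one_or_eq_of_mem_zpowers h2 hh with rfl | rfl
    · exact hst.symm
    · have := hadj _ _ hst
      rw [h2] at this
      exact this.symm
  order h hh := by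
    rcases eq_one_or_eq_of_mem_zpowers h2 hh with rfl | rfl
    · exact Or.inl fun _ => rfl
    · exact Or.inl h2
  superharmonic := by
    obtain ⟨f, hf, h⟩ := hf
    refine ⟨f, hf, h.imp_left ?_⟩
    rintro ⟨o, ho, ho'⟩
    refine ⟨o, ho, fun h hh => ?_⟩
    rcases eq_one_or_eq_of_mem_zpowers h2 hh with rfl | rfl
    · rfl
    · exact ho'

theorem PairIso.connected {S : Type*} {Γ : SimpleGraph S} {G : Subgroup (Equiv.Perm S)}
    {H : Subgroup (Equiv.Perm I)} (h : PairIso Γ G A H) (hΓ : Γ.Connected) : A.Connected := by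
  obtain ⟨e, he, -⟩ := h
  exact (Iso.connected_iff ⟨e, fun {s t} => he s t⟩).mp hΓ

/-- Semidefiniteness of a pair is invariant under isomorphism. -/
theorem PairIso.isSemidefinitePair {S : Type*} {Γ : SimpleGraph S} {G : Subgroup (Equiv.Perm S)}
    {H : Subgroup (Equiv.Perm I)} (h : PairIso Γ G A H) (hΓ : Γ.Connected)
    (P : IsSemidefinitePair A H) : IsSemidefinitePair Γ G := by
  classical
  obtain ⟨e, he, rfl⟩ := h
  have key : ∀ g ∈ G, ∃ h ∈ G.map e.permCongrHom.toMonoidHom, ∀ s, e (g s) = h (e s) := by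
    intro g hg
    refine ⟨_, ⟨g, hg, rfl⟩, fun s => ?_⟩
    change _ = e (g (e.symm (e s)))
    rw [e.symm_apply_apply]
  have hsum : ∀ (f : I → ℤ) s (T : Finset S), ∑ t ∈ T with Γ.Adj s t, f (e t) =
      ∑ t ∈ T.map e.toEmbedding with A.Adj (e s) t, f t := by
    intro f s T
    rw [Finset.sum_filter, Finset.sum_filter, Finset.sum_map]
    simp [he]
  constructor
  · exact hΓ
  · intro g hg s t
    obtain ⟨h, hh, e'⟩ := key g hg
    rw [← he, e', e', P.adj h hh, he]
  · intro g hg s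
    obtain ⟨h, hh, e'⟩ := key g hg
    rw [← he, e']
    exact P.not_adj h hh _
  · intro g hg s t
    obtain ⟨h, hh, e'⟩ := key g hg
    rw [← he, ← he, e', e']
    exact P.adj_symm h hh _ _
  · intro g hg
    obtain ⟨h, hh, e'⟩ := key g hg
    refine (P.order h hh).imp (fun k s => e.injective ?_) (fun k s => e.injective ?_)
    · rw [e', e', k]
    · rw [e', e', e', k]
  · obtain ⟨f, hf, hw⟩ := P.superharmonic
    refine ⟨fun s => f (e s), ⟨fun s => hf.pos _, fun s T => ?_⟩, ?_⟩
    · convert (hsum f s T).le.trans (by convert hf.le (e s) (T.map e.toEmbedding))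
    · rcases hw with ⟨o, ho, hG⟩ | ⟨s, hs⟩ | hI
      · refine Or.inl ⟨e.symm o, by simpa using ho, fun g hg => e.injective ?_⟩
        obtain ⟨h, hh, e'⟩ := key g hg
        rw [e', e.apply_symm_apply, hG h hh]
      · refine Or.inr (Or.inl ⟨e.symm s, fun T => ?_⟩)
        have h1 := hsum f (e.symm s) T
        have h2 := hs (T.map e.toEmbedding)
        simp only [e.apply_symm_apply] at h1 ⊢
        refine lt_of_le_of_lt (le_of_eq ?_) h2
        convert h1
      · exact Or.inr (Or.inr (Infinite.of_injective e.symm e.symm.injective))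

end

namespace CoxeterPairs

open Set

theorem isSemidefinitePair_graphA {m : ℕ} (hm : 1 ≤ m) (hA : (graphA (2 * m + 1)).Connected) :
    IsSemidefinitePair (graphA (2 * m + 1)) (Subgroup.zpowers (flipA m)) := by
  have hadj : ∀ i j, (graphA (2 * m + 1)).Adj i j ↔ (i : ℕ) + 1 = j ∨ (j : ℕ) + 1 = i := by
    intro i j
    simp only [graphA, fromRel_adj, ne_eq, Subtype.ext_iff]
    omega
  have hval : ∀ i, (flipA m i : ℕ) = 2 * m + 2 - i := fun i => rfl
  refine .of_involution hA (fun s => Subtype.ext ?_) (fun s t => ?_) (fun s => ?_)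
    ⟨fun s => 1, isSuperharmonic_of_label (l := Subtype.val) (F := fun _ => 1)
      Subtype.val_injective (fun _ => one_pos) (fun s => ?_), Or.inr (Or.inl ⟨⟨1, ?_⟩, fun T => ?_⟩)⟩
  · have := s.2
    rw [mem_Icc] at this
    rw [hval, hval]; omega
  · have := s.2; have := t.2
    rw [mem_Icc] at *
    rw [hadj, hadj, hval, hval]; omega
  · have := s.2
    rw [mem_Icc] at this
    rw [hadj, hval]; omega
  · refine ⟨[s + 1, s - 1], fun t ht => ?_, by simp⟩
    rw [hadj] at ht
    simp; omega
  · rw [mem_Icc]; omega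
  · refine lt_of_le_of_lt (sum_neighbours_le (l := Subtype.val) (F := fun _ => 1) (L := [2])
      Subtype.val_injective (fun _ => one_pos) (fun t ht => ?_) T) (by simp)
    have := t.2
    rw [mem_Icc] at this
    rw [hadj] at ht
    simp at ht ⊢; omega

theorem isSemidefinitePair_graphAffA {m : ℕ} (hm : 1 ≤ m)
    (hA : (graphAffA (2 * m + 1)).Connected) :
    IsSemidefinitePair (graphAffA (2 * m + 1)) (Subgroup.zpowers (flipAffA m)) := by
  have hadj : ∀ i j, (graphAffA (2 * m + 1)).Adj i j ↔ (i : ℕ) + 1 = j ∨ (j : ℕ) + 1 = i ∨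
      ((i : ℕ) = 0 ∧ (j : ℕ) = 2 * m + 1) ∨ ((j : ℕ) = 0 ∧ (i : ℕ) = 2 * m + 1) := by
    intro i j
    simp only [graphAffA, fromRel_adj, ne_eq, Subtype.ext_iff]
    omega
  have hval : ∀ i, (flipAffA m i : ℕ) =
      if (i : ℕ) = 0 then (0 : ℕ) else 2 * m + 2 - (i : ℕ) := fun i => rfl
  refine .of_involution hA (fun s => Subtype.ext ?_) (fun s t => ?_) (fun s => ?_)
    ⟨fun s => 1, isSuperharmonic_of_label (l := Subtype.val) (F := fun _ => 1)
      Subtype.val_injective (fun _ => one_pos) (fun s => ?_),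
      Or.inl ⟨⟨0, by simp⟩, rfl, rfl⟩⟩
  · have := s.2
    rw [mem_Icc] at this
    rw [hval, hval]; split_ifs <;> omega
  · have := s.2; have := t.2
    rw [mem_Icc] at *
    rw [hadj, hadj, hval, hval]; split_ifs <;> omega
  · have := s.2
    rw [mem_Icc] at this
    rw [hadj, hval]
    split_ifs
    · simp only [false_or, and_false, true_and]
      omega
    · omega
  · have := s.2
    rw [mem_Icc] at this
    refine ⟨[if (s : ℕ) = 2 * m + 1 then 0 else s + 1, if (s : ℕ) = 0 then 2 * m + 1 else s - 1],
      fun t ht => ?_, by simp⟩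
    have := t.2
    rw [mem_Icc] at this
    rw [hadj] at ht
    rw [List.mem_pair]
    split_ifs <;> omega

theorem isSemidefinitePair_graphInfAInf (hA : graphInfAInf.Connected) :
    IsSemidefinitePair graphInfAInf (Subgroup.zpowers (Equiv.neg ℤ)) := by
  have hadj : ∀ i j, graphInfAInf.Adj i j ↔ i + 1 = j ∨ j + 1 = i := by
    intro i j
    simp only [graphInfAInf, fromRel_adj, ne_eq]
    omega
  refine .of_involution hA neg_neg (fun s t => ?_) (fun s => ?_)
    ⟨fun s => 1, isSuperharmonic_of_label (l := id) (F := fun _ => 1)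
      Function.injective_id (fun _ => one_pos) (fun s => ?_), Or.inr (Or.inr inferInstance)⟩
  · simp only [hadj, Equiv.neg_apply]; omega
  · simp only [hadj, Equiv.neg_apply]; omega
  · refine ⟨[s + 1, s - 1], fun t ht => ?_, by simp⟩
    rw [hadj] at ht
    rw [List.mem_pair, id]
    omega

theorem isSemidefinitePair_graphDInf (hA : graphDInf.Connected) :
    IsSemidefinitePair graphDInf (Subgroup.zpowers swapDInf) := by
  have hadj : ∀ i j, graphDInf.Adj i j ↔ (2 ≤ (i : ℕ) ∧ (i : ℕ) + 1 = j) ∨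
      (2 ≤ (j : ℕ) ∧ (j : ℕ) + 1 = i) ∨ ((i : ℕ) = 1 ∧ (j : ℕ) = 3) ∨
      ((j : ℕ) = 1 ∧ (i : ℕ) = 3) := by
    intro i j
    simp only [graphDInf, fromRel_adj, ne_eq, Subtype.ext_iff]
    omega
  have hval : ∀ i, (swapDInf i : ℕ) =
      if (i : ℕ) = 1 then (2 : ℕ) else if (i : ℕ) = 2 then (1 : ℕ) else (i : ℕ) := by
    intro i
    simp only [swapDInf, Equiv.swap_apply_def, Subtype.ext_iff]
    split_ifs <;> rfl
  refine .of_involution hA (fun s => swap_swap_apply _ _ s) (fun s t => ?_) (fun s => ?_)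
    ⟨_, isSuperharmonic_of_label (l := Subtype.val) (F := fun i => if i ≤ 2 then 1 else 2)
      Subtype.val_injective (fun _ => by split_ifs <;> norm_num) (fun s => ?_),
      Or.inr (Or.inr inferInstance)⟩
  · rw [hadj, hadj, hval, hval]; split_ifs <;> omega
  · rw [hadj, hval]; split_ifs <;> omega
  · have := mem_Ici.mp s.2
    rcases Nat.lt_or_ge s 4 with h4 | h4
    · have h3 : (s : ℕ) ≤ 2 ∨ (s : ℕ) = 3 := by omega
      rcases h3 with h3 | h3
      · refine ⟨[3], fun t ht => ?_, by simp [h3]⟩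
        rw [hadj] at ht
        rw [List.mem_singleton]; omega
      · refine ⟨[1, 2, 4], fun t ht => ?_, by simp [h3]⟩
        rw [hadj] at ht
        have := mem_Ici.mp t.2
        simp; omega
    · refine ⟨[s + 1, s - 1], fun t ht => ?_, ?_⟩
      · rw [hadj] at ht
        rw [List.mem_pair]; omega
      · simp only [List.map_cons, List.map_nil, List.sum_cons, List.sum_nil]
        split_ifs <;> omega

theorem swapD_val {a m : ℕ} (h : a + 1 ≤ m) (i : Icc a m) : (swapD a m h i : ℕ) =
    if (i : ℕ) = m - 1 then m else if (i : ℕ) = m then m - 1 else i := by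
  simp only [swapD, Equiv.swap_apply_def, Subtype.ext_iff]
  split_ifs <;> rfl

theorem graphD_adj {m : ℕ} (i j : Icc 1 m) : (graphD m).Adj i j ↔
    (i : ℕ) ≠ j ∧ (((i : ℕ) + 1 = j ∧ (j : ℕ) + 1 ≤ m) ∨ ((i : ℕ) + 2 = m ∧ (j : ℕ) = m) ∨
      ((j : ℕ) + 1 = i ∧ (i : ℕ) + 1 ≤ m) ∨ ((j : ℕ) + 2 = m ∧ (i : ℕ) = m)) := by
  simp only [graphD, fromRel_adj, ne_eq, Subtype.ext_iff]
  omega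

theorem graphAffD_adj {m : ℕ} (i j : Icc 0 m) : (graphAffD m).Adj i j ↔
    (i : ℕ) ≠ j ∧ ((1 ≤ (i : ℕ) ∧ (i : ℕ) + 1 = j ∧ (j : ℕ) + 1 ≤ m) ∨
      ((i : ℕ) + 2 = m ∧ (j : ℕ) = m) ∨ ((i : ℕ) = 0 ∧ (j : ℕ) = 2) ∨
      (1 ≤ (j : ℕ) ∧ (j : ℕ) + 1 = i ∧ (i : ℕ) + 1 ≤ m) ∨
      ((j : ℕ) + 2 = m ∧ (i : ℕ) = m) ∨ ((j : ℕ) = 0 ∧ (i : ℕ) = 2)) := by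
  simp only [graphAffD, fromRel_adj, ne_eq, Subtype.ext_iff]
  omega

/-- The values `1` at the leaves and `2` elsewhere, on the graphs `D_m` and `D̃_m`. -/
def weightD (m i : ℕ) : ℤ := if i ≤ 1 ∨ m ≤ i + 1 then 1 else 2

theorem weightD_pos (m i : ℕ) : 0 < weightD m i := by
  unfold weightD; split_ifs <;> norm_num

theorem isSuperharmonic_graphD {m : ℕ} (hm : 4 ≤ m) :
    IsSuperharmonic (graphD m) fun i => weightD m i := by
  refine isSuperharmonic_of_label (l := Subtype.val) Subtype.val_injective (weightD_pos m)
    fun s => ?_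
  have h1 := mem_Icc.mp s.2
  by_cases hs : (s : ℕ) + 2 = m
  · refine ⟨[m - 3, m - 1, m], fun t ht => ?_, ?_⟩
    · rw [graphD_adj] at ht
      simp; omega
    · simp only [List.map_cons, List.map_nil, List.sum_cons, List.sum_nil, weightD]
      split_ifs <;> omega
  by_cases hs' : m ≤ (s : ℕ) + 1
  · refine ⟨[m - 2], fun t ht => ?_, ?_⟩
    · rw [graphD_adj] at ht
      have := mem_Icc.mp t.2
      simp; omega
    · simp only [List.map_cons, List.map_nil, List.sum_cons, List.sum_nil, weightD]
      split_ifs <;> omega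
  by_cases hs1 : (s : ℕ) = 1
  · refine ⟨[2], fun t ht => ?_, ?_⟩
    · rw [graphD_adj] at ht
      have := mem_Icc.mp t.2
      simp; omega
    · simp only [List.map_cons, List.map_nil, List.sum_cons, List.sum_nil, weightD]
      split_ifs <;> omega
  · refine ⟨[s - 1, s + 1], fun t ht => ?_, ?_⟩
    · rw [graphD_adj] at ht
      simp; omega
    · simp only [List.map_cons, List.map_nil, List.sum_cons, List.sum_nil, weightD]
      split_ifs <;> omega

open Classical in
theorem strict_graphD {m : ℕ} (hm : 4 ≤ m) : ∃ s : Icc 1 m, ∀ T : Finset (Icc 1 m),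
    ∑ t ∈ T with (graphD m).Adj s t, weightD m t < 2 * weightD m s := by
  refine ⟨⟨2, by rw [mem_Icc]; omega⟩, fun T => ?_⟩
  have key : ∀ L : List ℕ, (∀ t : Icc 1 m, (graphD m).Adj ⟨2, by rw [mem_Icc]; omega⟩ t →
      (t : ℕ) ∈ L) → (L.map (weightD m)).sum < 2 * weightD m 2 →
      ∑ t ∈ T with (graphD m).Adj ⟨2, by rw [mem_Icc]; omega⟩ t, weightD m t < 2 * weightD m 2 :=
    fun L h1 h2 => lt_of_le_of_lt (sum_neighbours_le (l := Subtype.val) Subtype.val_injective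
      (weightD_pos m) h1 T) h2
  rcases hm.eq_or_lt with rfl | hm
  · refine key [1, 3, 4] (fun t ht => ?_) (by simp [weightD])
    rw [graphD_adj] at ht
    simp at ht ⊢; omega
  · refine key [1, 3] (fun t ht => ?_) ?_
    · rw [graphD_adj] at ht
      simp at ht ⊢; omega
    · simp only [List.map_cons, List.map_nil, List.sum_cons, List.sum_nil, weightD]
      split_ifs <;> omega

theorem isSuperharmonic_graphAffD {m : ℕ} (hm : 4 ≤ m) :
    IsSuperharmonic (graphAffD m) fun i => weightD m i := by
  refine isSuperharmonic_of_label (l := Subtype.val) Subtype.val_injective (weightD_pos m)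
    fun s => ?_
  have h1 := mem_Icc.mp s.2
  have key : ∀ L : List ℕ, (∀ t : Icc 0 m, (graphAffD m).Adj s t → (t : ℕ) ∈ L) →
      (L.map (weightD m)).sum ≤ 2 * weightD m s → ∃ L : List ℕ,
      (∀ t : Icc 0 m, (graphAffD m).Adj s t → (t : ℕ) ∈ L) ∧
      (L.map (weightD m)).sum ≤ 2 * weightD m s := fun L h1 h2 => ⟨L, h1, h2⟩
  simp only [graphAffD_adj] at key ⊢
  by_cases hs : (s : ℕ) ≤ 1
  · refine key [2] (fun t ht => ?_) ?_
    · have := mem_Icc.mp t.2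
      simp; omega
    · simp only [List.map_cons, List.map_nil, List.sum_cons, List.sum_nil, weightD]
      split_ifs <;> omega
  by_cases hs' : m ≤ (s : ℕ) + 1
  · refine key [m - 2] (fun t ht => ?_) ?_
    · have := mem_Icc.mp t.2
      simp; omega
    · simp only [List.map_cons, List.map_nil, List.sum_cons, List.sum_nil, weightD]
      split_ifs <;> omega
  have h2 : ∀ i, weightD m i ≤ 2 := fun i => by unfold weightD; split_ifs <;> norm_num
  have hs2 : weightD m s = 2 := by unfold weightD; rw [if_neg (by omega)]
  have w0 : weightD m 0 = 1 := by simp [weightD]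
  have w1 : weightD m 1 = 1 := by simp [weightD]
  have w3 : weightD m (m - 1) = 1 := by unfold weightD; rw [if_pos (by omega)]
  have w4 : weightD m m = 1 := by unfold weightD; rw [if_pos (by omega)]
  have := h2 (s - 1)
  have := h2 (s + 1)
  by_cases hs2 : (s : ℕ) = 2
  · by_cases hm4 : m = 4
    · refine key [0, 1, m - 1, m] (fun t ht => ?_) ?_
      · simp; omega
      · simp only [List.map_cons, List.map_nil, List.sum_cons, List.sum_nil]; omega
    · refine key [0, 1, s + 1] (fun t ht => ?_) ?_
      · simp; omega
      · simp only [List.map_cons, List.map_nil, List.sum_cons, List.sum_nil]; omega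
  by_cases hsm : (s : ℕ) + 2 = m
  · refine key [s - 1, m - 1, m] (fun t ht => ?_) ?_
    · simp; omega
    · simp only [List.map_cons, List.map_nil, List.sum_cons, List.sum_nil]; omega
  · refine key [s - 1, s + 1] (fun t ht => ?_) ?_
    · simp; omega
    · simp only [List.map_cons, List.map_nil, List.sum_cons, List.sum_nil]; omega

theorem isSemidefinitePair_graphD {m : ℕ} (hm : 4 ≤ m) (hA : (graphD m).Connected) :
    IsSemidefinitePair (graphD m) (Subgroup.zpowers (swapD 1 m (by omega))) := by
  refine .of_involution hA (fun s => swap_swap_apply _ _ s) (fun s t => ?_) (fun s => ?_)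
    ⟨_, isSuperharmonic_graphD hm, Or.inr (Or.inl (strict_graphD hm))⟩
  · have := mem_Icc.mp s.2
    have := mem_Icc.mp t.2
    rw [graphD_adj, graphD_adj, swapD_val, swapD_val]; split_ifs <;> omega
  · have := mem_Icc.mp s.2
    rw [graphD_adj, swapD_val]; split_ifs <;> omega

theorem isSemidefinitePair_graphAffD {m : ℕ} (hm : 4 ≤ m) (hA : (graphAffD m).Connected) :
    IsSemidefinitePair (graphAffD m) (Subgroup.zpowers (swapD 0 m (by omega))) := by
  refine .of_involution hA (fun s => swap_swap_apply _ _ s) (fun s t => ?_) (fun s => ?_)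
    ⟨_, isSuperharmonic_graphAffD hm, Or.inl ⟨⟨0, by simp⟩, by simp [weightD], Subtype.ext ?_⟩⟩
  · have := mem_Icc.mp s.2
    have := mem_Icc.mp t.2
    rw [graphAffD_adj, graphAffD_adj, swapD_val, swapD_val]; split_ifs <;> omega
  · have := mem_Icc.mp s.2
    rw [graphAffD_adj, swapD_val]; split_ifs <;> omega
  · rw [swapD_val]; simp only; split_ifs <;> omega

open Classical in
theorem sum_neighbours_le_univ {I : Type*} [Fintype I] {A : SimpleGraph I} {r : I → I → Prop}
    [DecidableRel r] (hr : ∀ s t, A.Adj s t ↔ r s t) {f : I → ℤ} (hf : ∀ i, 0 < f i) (s : I)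
    (T : Finset I) : ∑ t ∈ T with A.Adj s t, f t ≤ ∑ t with r s t, f t := by
  refine Finset.sum_le_sum_of_subset_of_nonneg (fun t ht => ?_) fun t _ _ => (hf t).le
  rw [Finset.mem_filter] at ht
  rw [Finset.mem_filter]
  exact ⟨Finset.mem_univ _, (hr s t).mp ht.2⟩

/-- The coefficients of the highest root of `E_6`, extended by `1` to `Ẽ_6`. -/
def weightE6 (i : ℕ) : ℤ := if i = 4 then 3 else if i = 2 ∨ i = 3 ∨ i = 5 then 2 else 1

theorem weightE6_pos (i : ℕ) : 0 < weightE6 i := by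
  unfold weightE6; split_ifs <;> norm_num

theorem isSemidefinitePair_graphE6 (hA : graphE6.Connected) :
    IsSemidefinitePair graphE6 (Subgroup.zpowers (flipE6 1 le_rfl)) := by
  have hr : ∀ s t, graphE6.Adj s t ↔ _ := fun s t => fromRel_adj _ s t
  refine .of_involution hA (by decide) ?_ ?_
    ⟨fun i => weightE6 i, ⟨fun _ => weightE6_pos _, fun s T =>
      (sum_neighbours_le_univ hr (fun _ => weightE6_pos _) s T).trans ?_⟩,
      Or.inr (Or.inl ⟨⟨2, by simp⟩, fun T => lt_of_le_of_lt
        (sum_neighbours_le_univ hr (fun _ => weightE6_pos _) _ T) ?_⟩)⟩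
  · simp only [hr]; decide
  · simp only [hr]; decide
  · revert s; decide
  · decide

theorem isSemidefinitePair_graphAffE6 (hA : graphAffE6.Connected) :
    IsSemidefinitePair graphAffE6 (Subgroup.zpowers (flipE6 0 zero_le_one)) := by
  have hr : ∀ s t, graphAffE6.Adj s t ↔ _ := fun s t => fromRel_adj _ s t
  refine .of_involution hA (by decide) ?_ ?_
    ⟨fun i => weightE6 i, ⟨fun _ => weightE6_pos _, fun s T =>
      (sum_neighbours_le_univ hr (fun _ => weightE6_pos _) s T).trans ?_⟩,
      Or.inl ⟨⟨0, by simp⟩, by simp [weightE6], by decide⟩⟩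
  · simp only [hr]; decide
  · simp only [hr]; decide
  · revert s; decide

/-- The elements of the groups between `⟨g₁⟩` and `⟨g₁, g₂⟩` fix the vertices that are not
leaves exchanged by `g₁`. -/
theorem fixes_of_mem_closure {a : ℕ} (ha : a ≤ 1) {h : Equiv.Perm (Icc a 4)}
    (hh : h ∈ Subgroup.closure {trialityD4 a ha, swapD a 4 (by omega)}) :
    ∀ i : Icc a 4, (i : ℕ) = 0 ∨ (i : ℕ) = 2 → h i = i := by
  induction hh using Subgroup.closure_induction with
  | mem x hx =>
    intro i hi
    rcases hx with rfl | rfl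
    · exact Subtype.ext (by rcases i with ⟨i, _⟩; rcases hi with rfl | rfl <;> rfl)
    · exact Subtype.ext (by rw [swapD_val]; split_ifs <;> omega)
  | one => exact fun _ _ => rfl
  | mul x y _ _ hx hy => exact fun i hi => by rw [Equiv.Perm.mul_apply, hy i hi, hx i hi]
  | inv x _ hx => exact fun i hi => by rw [Equiv.Perm.inv_eq_iff_eq, hx i hi]

theorem isSemidefinitePair_graphD4 (hA : (graphD 4).Connected) {H : Subgroup (Equiv.Perm (Icc 1 4))}
    (hH : H ≤ Subgroup.closure {trialityD4 1 le_rfl, swapD 1 4 (by omega)}) :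
    IsSemidefinitePair (graphD 4) H := by
  have hr : ∀ s t, (graphD 4).Adj s t ↔ _ := fun s t => fromRel_adj _ s t
  have hcases := fun h (hh : h ∈ H) => leafPerm_cases 1 le_rfl h
    (fixes_of_mem_closure le_rfl (hH hh)) rfl rfl
  refine ⟨hA, fun h hh => ?_, fun h hh => ?_, fun h hh => ?_, fun h hh => ?_,
    ⟨_, isSuperharmonic_graphD le_rfl, Or.inr (Or.inl (strict_graphD le_rfl))⟩⟩
  · simp only [hr]
    rcases hcases h hh with rfl | rfl | rfl | rfl | rfl | rfl <;> decide
  · simp only [hr]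
    rcases hcases h hh with rfl | rfl | rfl | rfl | rfl | rfl <;> decide
  · simp only [hr]
    rcases hcases h hh with rfl | rfl | rfl | rfl | rfl | rfl <;> decide
  · rcases hcases h hh with rfl | rfl | rfl | rfl | rfl | rfl <;> decide

theorem isSemidefinitePair_graphAffD4 (hA : (graphAffD 4).Connected)
    {H : Subgroup (Equiv.Perm (Icc 0 4))}
    (hH : H ≤ Subgroup.closure {trialityD4 0 zero_le_one, swapD 0 4 (by omega)}) :
    IsSemidefinitePair (graphAffD 4) H := by
  have hr : ∀ s t, (graphAffD 4).Adj s t ↔ _ := fun s t => fromRel_adj _ s t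
  have hfix := fun h (hh : h ∈ H) => fixes_of_mem_closure zero_le_one (hH hh)
  have hcases := fun h (hh : h ∈ H) => leafPerm_cases 0 zero_le_one h (hfix h hh) rfl rfl
  refine ⟨hA, fun h hh => ?_, fun h hh => ?_, fun h hh => ?_, fun h hh => ?_,
    ⟨_, isSuperharmonic_graphAffD le_rfl, Or.inl ⟨⟨0, by simp⟩, by simp [weightD],
      fun h hh => hfix h hh _ (Or.inl rfl)⟩⟩⟩
  · simp only [hr]
    rcases hcases h hh with rfl | rfl | rfl | rfl | rfl | rfl <;> decide
  · simp only [hr]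
    rcases hcases h hh with rfl | rfl | rfl | rfl | rfl | rfl <;> decide
  · simp only [hr]
    rcases hcases h hh with rfl | rfl | rfl | rfl | rfl | rfl <;> decide
  · rcases hcases h hh with rfl | rfl | rfl | rfl | rfl | rfl <;> decide

end CoxeterPairs

open CoxeterPairs in
theorem ListedPair.isSemidefinitePair {S : Type*} {Γ : SimpleGraph S} {G : Subgroup (Equiv.Perm S)}
    (h : ListedPair Γ G) (hΓ : Γ.Connected) : IsSemidefinitePair Γ G := by
  rcases h with ⟨m, hm, h⟩ | ⟨m, hm, h⟩ | ⟨H, h1, h2, h⟩ | h | ⟨m, hm, h⟩ | ⟨m, hm, h⟩ |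
    ⟨H, h1, h2, h⟩ | h | h | h
  · exact h.isSemidefinitePair hΓ (isSemidefinitePair_graphA hm (h.connected hΓ))
  · exact h.isSemidefinitePair hΓ (isSemidefinitePair_graphD hm (h.connected hΓ))
  · exact h.isSemidefinitePair hΓ (isSemidefinitePair_graphD4 (h.connected hΓ) h2)
  · exact h.isSemidefinitePair hΓ (isSemidefinitePair_graphE6 (h.connected hΓ))
  · exact h.isSemidefinitePair hΓ (isSemidefinitePair_graphAffA hm (h.connected hΓ))
  · exact h.isSemidefinitePair hΓ (isSemidefinitePair_graphAffD hm (h.connected hΓ))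
  · exact h.isSemidefinitePair hΓ (isSemidefinitePair_graphAffD4 (h.connected hΓ) h2)
  · exact h.isSemidefinitePair hΓ (isSemidefinitePair_graphAffE6 (h.connected hΓ))
  · exact h.isSemidefinitePair hΓ (isSemidefinitePair_graphInfAInf (h.connected hΓ))
  · exact h.isSemidefinitePair hΓ (isSemidefinitePair_graphDInf (h.connected hΓ))

end

noncomputable section

/-! ### Longest elements of edge-free parabolic subgroups -/

namespace RootPrebasis

variable {S : Type*} {M : CoxeterMatrix S} (B : RootPrebasis M)

/-- The product of the reflections `σ_x`, `x ∈ X`, when these commute. -/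
def multiRefl (X : Finset S) (v : S →₀ ℝ) : S →₀ ℝ :=
  v - ∑ x ∈ X, B.form x v • Finsupp.single x 1

/-- The simple roots of `X` are pairwise orthogonal. -/
def IsEdgeFree (X : Set S) : Prop :=
  ∀ x ∈ X, ∀ y ∈ X, x ≠ y → B.form x (Finsupp.single y 1) = 0

variable {B}

theorem IsEdgeFree.mono {X Y : Set S} (h : B.IsEdgeFree X) (hY : Y ⊆ X) : B.IsEdgeFree Y :=
  fun x hx y hy => h x (hY hx) y (hY hy)

theorem IsEdgeFree.form_multiRefl_of_notMem {X : Finset S} {s : S}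
    (h : ∀ y ∈ X, B.form s (Finsupp.single y 1) = 0) (v : S →₀ ℝ) :
    B.form s (B.multiRefl X v) = B.form s v := by
  rw [multiRefl, map_sub, map_sum, Finset.sum_eq_zero, sub_zero]
  intro y hy
  rw [map_smul, h y hy, smul_zero]

theorem multiRefl_single {X : Finset S} (h : B.IsEdgeFree X) {s : S} (hs : s ∈ X) :
    B.multiRefl X (Finsupp.single s 1) = -Finsupp.single s 1 := by
  rw [multiRefl, Finset.sum_eq_single_of_mem s hs, B.form_self]
  · module
  · intro y hy hys
    rw [h y hy s hs hys, zero_smul]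

theorem IsEdgeFree.refl_multiRefl_insert [DecidableEq S] {X : Finset S} {s : S} (hs : s ∉ X)
    (h : B.IsEdgeFree (insert s X : Finset S)) (v : S →₀ ℝ) :
    B.refl s (B.multiRefl X v) = B.multiRefl (insert s X) v := by
  rw [refl_apply, form_multiRefl_of_notMem, multiRefl, multiRefl, Finset.sum_insert hs]
  · abel
  · intro y hy
    exact h s (by simp) y (by simp [hy]) fun e => hs (e ▸ hy)

theorem refl_refl (s : S) (v : S →₀ ℝ) : B.refl s (B.refl s v) = v :=
  Module.involutive_reflection (B.form_self s) v

/-- The elements of an edge-free parabolic subgroup act by partial products. -/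
theorem IsEdgeFree.exists_subset {X : Finset S} (h : B.IsEdgeFree X) {w : M.Group}
    (hw : w ∈ M.parabolic X) : ∃ Y ⊆ X, ∀ v, B.rep w v = B.multiRefl Y v := by
  classical
  have key : ∀ s ∈ X, ∀ y : M.Group, (∃ Y ⊆ X, ∀ v, B.rep y v = B.multiRefl Y v) →
      ∃ Y ⊆ X, ∀ v, B.rep (M.gen s * y) v = B.multiRefl Y v := by
    rintro s hs y ⟨Y, hY, e⟩
    have hmono : ∀ Z ⊆ X, B.IsEdgeFree (Z : Finset S) := fun Z hZ =>
      h.mono (Finset.coe_subset.mpr hZ)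
    by_cases hsY : s ∈ Y
    · have hsub : Y.erase s ⊆ X := (Finset.erase_subset s Y).trans hY
      refine ⟨Y.erase s, hsub, fun v => ?_⟩
      have := refl_multiRefl_insert (Finset.notMem_erase s Y)
        (by rw [Finset.insert_erase hsY]; exact hmono Y hY) v (B := B)
      rw [Finset.insert_erase hsY] at this
      rw [rep_mul_apply, e, rep_gen, ← this, refl_refl]
    · have hsub : insert s Y ⊆ X := Finset.insert_subset hs hY
      exact ⟨insert s Y, hsub, fun v => by
        rw [rep_mul_apply, e, rep_gen, refl_multiRefl_insert hsY (hmono _ hsub)]⟩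
  induction hw using Subgroup.closure_induction_left with
  | one => exact ⟨∅, by simp, fun v => by simp [multiRefl]⟩
  | mul_left x hx y _ ih =>
    obtain ⟨s, hs, rfl⟩ := hx
    exact key s hs y ih
  | inv_mul_cancel x hx y _ ih =>
    obtain ⟨s, hs, rfl⟩ := hx
    rw [gen_inv]
    exact key s hs y ih

theorem IsEdgeFree.exists_rep_eq {X : Finset S} (h : B.IsEdgeFree X) :
    ∃ u ∈ M.parabolic X, ∀ v, B.rep u v = B.multiRefl X v := by
  classical
  induction X using Finset.induction_on with
  | empty => exact ⟨1, one_mem _, fun v => by simp [multiRefl]⟩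
  | insert s X hs ih =>
    obtain ⟨u, hu, e⟩ := ih (h.mono (by simp))
    refine ⟨M.gen s * u, mul_mem (Subgroup.subset_closure ⟨s, by simp, rfl⟩) ?_, fun v => ?_⟩
    · exact Subgroup.closure_mono (Set.image_mono (by simp)) hu
    · rw [rep_mul_apply, e, rep_gen, refl_multiRefl_insert hs h]

end RootPrebasis

namespace CoxeterMatrix

open RootPrebasis

variable {S : Type*} {M : CoxeterMatrix S}

theorem finite_parabolic {X : Finset S} (h : M.canonicalRootBasis.IsEdgeFree X) :
    (M.parabolic X : Set M.Group).Finite := by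
  refine Set.Finite.subset (s := ⋃ Y ∈ X.powerset,
    {w : M.Group | ∀ v, M.canonicalRootBasis.rep w v = M.canonicalRootBasis.multiRefl Y v})
    (Set.Finite.biUnion (Finset.finite_toSet _) fun Y _ => Set.Subsingleton.finite ?_) ?_
  · intro w hw w' hw'
    exact M.canonical_rep_injective (LinearEquiv.ext fun v => (hw v).trans (hw' v).symm)
  · intro w hw
    obtain ⟨Y, hY, e⟩ := h.exists_subset hw
    simp only [Set.mem_iUnion]
    exact ⟨Y, Finset.mem_powerset.mpr hY, e⟩

/-- The product of the commuting generators of an edge-free set is the longest element. -/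
theorem isLongest_of_rep_eq {X : Finset S} (h : M.canonicalRootBasis.IsEdgeFree X) {u : M.Group}
    (hu : u ∈ M.parabolic X)
    (e : ∀ v, M.canonicalRootBasis.rep u v = M.canonicalRootBasis.multiRefl X v) :
    M.IsLongest X u := by
  refine ⟨hu, fun s hs => ?_⟩
  change M.toCoxeterSystem.IsLeftDescent u s
  rw [← CoxeterSystem.isRightDescent_inv_iff]
  by_contra hd
  have h1 := M.canonical_nonneg_of_not_isRightDescent _ _ hd s
  have h2 : M.canonicalRootBasis.rep u⁻¹ (Finsupp.single s 1) = -Finsupp.single s 1 := by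
    have h3 : M.canonicalRootBasis.rep u (-Finsupp.single s 1) = Finsupp.single s 1 := by
      rw [map_neg, e, multiRefl_single h hs, neg_neg]
    have h4 := M.canonicalRootBasis.rep_inv_rep u (-Finsupp.single s 1)
    rwa [h3] at h4
  rw [h2] at h1
  simp at h1
  linarith

theorem mem_fixedSubgroup_of_rep_eq {G : Subgroup M.symmetryGroup} {X : Finset S}
    (hX : ∀ g ∈ G, ∀ x, (g : Equiv.Perm S) x ∈ X ↔ x ∈ X) {u : M.Group}
    (e : ∀ v, M.canonicalRootBasis.rep u v = M.canonicalRootBasis.multiRefl X v) :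
    u ∈ M.fixedSubgroup G := by
  intro g hg
  have hsym := M.canonical_isSymmetric G
  refine M.canonical_rep_injective (LinearEquiv.ext fun v => ?_)
  obtain ⟨v, rfl⟩ := (permOnV (g : Equiv.Perm S)).surjective v
  rw [hsym.rep_symmHom hg, e, e, multiRefl, multiRefl, map_sub, map_sum]
  congr 1
  refine Finset.sum_bijective _ g.1.bijective (fun x => (hX g hg x).symm) fun x _ => ?_
  rw [hsym.form_apply hg, map_smul, permOnV_single]

end CoxeterMatrix

end

noncomputable section

/-! ### Roots are obtained from simple roots by the longest elements -/

open RootPrebasis SimpleGraph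

namespace IsSemidefinitePair

variable {S : Type*} {Γ : SimpleGraph S} {G : Subgroup (Equiv.Perm S)}
  (P : IsSemidefinitePair Γ G)
include P

/-- For a root with nonnegative coefficients, the orbit of some vertex pairs positively with it:
the sum over the orbit of the root has positive pairing with the root. -/
theorem exists_orbit_pos {b : S →₀ ℤ} (hb : Γ.LatRoot b) (hpos : ∀ s, 0 ≤ b s) {O : Finset (S →₀ ℤ)}
    (hO : ∀ c, c ∈ O ↔ ∃ g ∈ G, c = latPerm g b)
    {X : S → Finset S} (hX : ∀ s x, x ∈ X s ↔ ∃ g ∈ G, x = g s) :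
    ∃ s, 0 < ∑ x ∈ X s, Γ.bil b (vert x) := by
  have hbO : b ∈ O := (hO b).mpr ⟨1, one_mem _, by ext s; exact (latPerm_apply 1 b s).symm⟩
  have hsum : 0 < Γ.bil b (∑ c ∈ O, c) := by
    rw [map_sum, Finset.sum_eq_single_of_mem b hbO, hb.bil_self]
    · norm_num
    · intro c hc hcb
      obtain ⟨g, hg, rfl⟩ := (hO c).mp hc
      exact (P.ortho hb hg).resolve_left hcb
  have hex : ∃ s, 0 < Γ.bil (vert s) (∑ c ∈ O, c) := by
    by_contra! hall
    have e : Γ.bil b (∑ c ∈ O, c) = ∑ s ∈ b.support, b s * Γ.bil (vert s) (∑ c ∈ O, c) := by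
      generalize ∑ c ∈ O, c = ρ
      conv_lhs => rw [eq_sum_smul_vert (subset_refl b.support)]
      simp
    rw [e] at hsum
    refine absurd hsum (not_lt.mpr (Finset.sum_nonpos fun s _ => ?_))
    exact mul_nonpos_of_nonneg_of_nonpos (hpos s) (hall s)
  obtain ⟨s, hs⟩ := hex
  refine ⟨s, ?_⟩
  -- both sums are constant along the orbits, so they agree up to positive factors
  have h1 : ∀ x ∈ X s, ∑ c ∈ O, Γ.bil (vert x) c = ∑ c ∈ O, Γ.bil (vert s) c := by
    intro x hx
    obtain ⟨g, hg, rfl⟩ := (hX s x).mp hx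
    symm
    refine Finset.sum_bijective (latPerm g) (latPerm g).bijective (fun c => ?_) fun c _ => ?_
    · rw [hO, hO]
      constructor
      · rintro ⟨h, hh, rfl⟩
        exact ⟨g * h, mul_mem hg hh, by rw [latPerm_mul]⟩
      · rintro ⟨h, hh, e⟩
        exact ⟨g⁻¹ * h, mul_mem (inv_mem hg) hh, (latPerm g).injective (by
          rw [← latPerm_mul, mul_inv_cancel_left, e])⟩
    · rw [← latPerm_vert, bil_latPerm (P.adj g hg)]
  have h2 : ∀ c ∈ O, ∑ x ∈ X s, Γ.bil c (vert x) = ∑ x ∈ X s, Γ.bil b (vert x) := by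
    intro c hc
    obtain ⟨g, hg, rfl⟩ := (hO c).mp hc
    symm
    refine Finset.sum_bijective g g.bijective (fun x => ?_) fun x _ => ?_
    · rw [hX, hX]
      constructor
      · rintro ⟨h, hh, rfl⟩
        exact ⟨g * h, mul_mem hg hh, rfl⟩
      · rintro ⟨h, hh, e⟩
        exact ⟨g⁻¹ * h, mul_mem (inv_mem hg) hh, g.injective (by
          rw [e, ← Equiv.Perm.mul_apply, mul_inv_cancel_left])⟩
    · rw [← latPerm_vert, bil_latPerm (P.adj g hg)]
  have h3 : ∑ x ∈ X s, ∑ c ∈ O, Γ.bil (vert x) c = ∑ c ∈ O, ∑ x ∈ X s, Γ.bil c (vert x) := by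
    rw [Finset.sum_comm]
    exact Finset.sum_congr rfl fun c _ => Finset.sum_congr rfl fun x _ => Γ.bil_symm _ _
  rw [Finset.sum_congr rfl h1, Finset.sum_congr rfl h2, Finset.sum_const, Finset.sum_const,
    nsmul_eq_mul, nsmul_eq_mul, ← map_sum] at h3
  have hXs : 0 < (X s).card := Finset.card_pos.mpr ⟨s, (hX s s).mpr ⟨1, one_mem _, rfl⟩⟩
  have h4 : (0 : ℤ) < (X s).card * Γ.bil (vert s) (∑ c ∈ O, c) :=
    mul_pos (by exact_mod_cast hXs) hs
  rw [h3] at h4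
  exact pos_of_mul_pos_right h4 (Int.natCast_nonneg _)

omit P in
/-- A root supported on an edge-free set with nonnegative coefficients is simple. -/
theorem eq_vert_of_supported {b : S →₀ ℤ} (hb : Γ.bil b b = 2) (hpos : ∀ s, 0 ≤ b s) {X : Finset S}
    (hX : ∀ x ∈ X, ∀ y ∈ X, ¬ Γ.Adj x y) (hs : b.support ⊆ X) : ∃ s, b = vert s := by
  have h1 : ∑ s ∈ X, b s * b s = 1 := by
    have : Γ.bil b b = 2 * ∑ s ∈ X, b s * b s := by
      rw [bil_eq_sum hs hs, Finset.mul_sum]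
      refine Finset.sum_congr rfl fun s hs => ?_
      rw [Finset.sum_eq_single_of_mem s hs, cart_self]
      · ring
      · intro t ht hts
        rw [cart_eq_zero hts.symm (hX s hs t ht), mul_zero]
    omega
  have hne : ∃ s ∈ X, b s ≠ 0 := by
    by_contra! h
    rw [Finset.sum_eq_zero fun s hs => by rw [h s hs, mul_zero]] at h1
    exact zero_ne_one h1
  obtain ⟨s, hsX, hbs⟩ := hne
  have hbs' : 1 ≤ b s := by have := hpos s; omega
  classical
  rw [← Finset.add_sum_erase X _ hsX] at h1
  have h2 := Finset.sum_nonneg fun t (_ : t ∈ X.erase s) => mul_self_nonneg (b t)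
  have hone : b s = 1 := by nlinarith
  have h3 : ∑ t ∈ X.erase s, b t * b t = 0 := by nlinarith
  rw [Finset.sum_eq_zero_iff_of_nonneg fun t _ => mul_self_nonneg _] at h3
  refine ⟨s, ?_⟩
  ext t
  by_cases hts : t = s
  · rw [hts, hone, vert_apply_self]
  rw [vert_apply_ne hts]
  by_cases htX : t ∈ X
  · exact mul_self_eq_zero.mp (h3 t (Finset.mem_erase.mpr ⟨hts, htX⟩))
  · exact Finsupp.notMem_support_iff.mp fun h => htX (hs h)

end IsSemidefinitePair

namespace CoxeterMatrix

variable {S : Type*} {M : CoxeterMatrix S} {G : Subgroup M.symmetryGroup}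

/-- The conditions on a listed pair that are used to prove the basis property. -/
structure IsSemidefinite (M : CoxeterMatrix S) (G : Subgroup M.symmetryGroup) : Prop where
  simplyLaced : M.IsSimplyLaced
  pair : IsSemidefinitePair M.coxeterGraph (G.map M.symmetryGroup.subtype)
  finite : ∀ s : S, (MulAction.orbit G s).Finite

namespace IsSemidefinite

variable (P : M.IsSemidefinite G)
include P

/-- The orbit of a vertex as a finset. -/
def orbit (s : S) : Finset S := (P.finite s).toFinset

theorem coe_orbit (s : S) : (P.orbit s : Set S) = MulAction.orbit G s := by
  simp [orbit]

theorem mem_orbit_iff (s x : S) :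
    x ∈ P.orbit s ↔ ∃ g ∈ G.map M.symmetryGroup.subtype, x = g s := by
  rw [orbit, Set.Finite.mem_toFinset]
  constructor
  · rintro ⟨g, rfl⟩
    exact ⟨_, ⟨g.1, g.2, rfl⟩, rfl⟩
  · rintro ⟨_, ⟨g, hg, rfl⟩, rfl⟩
    exact ⟨⟨g, hg⟩, rfl⟩

theorem perm_mem_orbit_iff {g : M.symmetryGroup} (hg : g ∈ G) (s x : S) :
    (g : Equiv.Perm S) x ∈ P.orbit s ↔ x ∈ P.orbit s := by
  have hg' : (g : Equiv.Perm S) ∈ G.map M.symmetryGroup.subtype := ⟨g, hg, rfl⟩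
  rw [mem_orbit_iff, mem_orbit_iff]
  constructor
  · rintro ⟨h, hh, e⟩
    exact ⟨g.1⁻¹ * h, mul_mem (inv_mem hg') hh, g.1.injective (by
      rw [e, ← Equiv.Perm.mul_apply, mul_inv_cancel_left])⟩
  · rintro ⟨h, hh, rfl⟩
    exact ⟨g * h, mul_mem hg' hh, rfl⟩

theorem not_adj_of_mem_orbit {s x y : S} (hx : x ∈ P.orbit s) (hy : y ∈ P.orbit s) :
    ¬ M.coxeterGraph.Adj x y := by
  rw [mem_orbit_iff] at hx hy
  obtain ⟨g, hg, rfl⟩ := hx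
  obtain ⟨h, hh, rfl⟩ := hy
  have := P.pair.not_adj _ (mul_mem hh (inv_mem hg)) (g s)
  rwa [← Equiv.Perm.mul_apply, inv_mul_cancel_right] at this

theorem isEdgeFree_orbit (s : S) : M.canonicalRootBasis.IsEdgeFree (P.orbit s) := by
  intro x hx y hy hxy
  change M.canonicalForm x _ = 0
  rw [canonicalForm_single, canonicalEntry_eq_cart P.simplyLaced,
    cart_eq_zero hxy (P.not_adj_of_mem_orbit hx hy), Int.cast_zero]

theorem orbit_mem_sphericalOrbits (s : S) : (P.orbit s : Set S) ∈ M.sphericalOrbits G :=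
  ⟨⟨s, P.coe_orbit s⟩, Finset.finite_toSet _, finite_parabolic (P.isEdgeFree_orbit s)⟩

/-- The longest element of an orbit. -/
theorem exists_longest (s : S) : ∃ u ∈ M.hatGroup G ⊓ M.fixedSubgroup G,
    ∀ v, M.canonicalRootBasis.rep u v = M.canonicalRootBasis.multiRefl (P.orbit s) v := by
  obtain ⟨u, hu, e⟩ := (P.isEdgeFree_orbit s).exists_rep_eq
  refine ⟨u, ⟨Subgroup.subset_closure ⟨_, P.orbit_mem_sphericalOrbits s,
    isLongest_of_rep_eq (P.isEdgeFree_orbit s) hu e⟩, ?_⟩, e⟩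
  exact mem_fixedSubgroup_of_rep_eq (fun g hg x => P.perm_mem_orbit_iff hg s x) e

/-- Every root with nonnegative coefficients is the image of a simple root under a product of
longest elements of orbits: such an element lowers the height of every other root. -/
theorem exists_rep_of_latRoot {b : S →₀ ℤ} (hb : M.coxeterGraph.LatRoot b) (hpos : ∀ s, 0 ≤ b s) :
    ∃ w ∈ M.hatGroup G ⊓ M.fixedSubgroup G, ∃ s,
      latEmb S b = M.canonicalRootBasis.rep w (Finsupp.single s 1) := by
  classical
  induction hn : (b.sum fun _ n => n).toNat using Nat.strong_induction_on generalizing b with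
  | _ n ih =>
  have hO : {c | ∃ g ∈ G.map M.symmetryGroup.subtype, c = latPerm g b}.Finite := by
    refine Set.Finite.of_finite_image ((vecOrbit_finite P.finite (latEmb S b)).subset ?_)
      (latEmb_injective.injOn)
    rintro _ ⟨_, ⟨_, ⟨g, hg, rfl⟩, rfl⟩, rfl⟩
    exact ⟨g, hg, latEmb_latPerm _ _⟩
  obtain ⟨s, hs⟩ := P.pair.exists_orbit_pos hb hpos (O := hO.toFinset) (fun c => by simp)
    P.mem_orbit_iff
  obtain ⟨u, hu, e⟩ := P.exists_longest s
  set b' : S →₀ ℤ := b - ∑ x ∈ P.orbit s, M.coxeterGraph.bil b (vert x) • vert x with hb'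
  have hub : M.canonicalRootBasis.rep u (latEmb S b) = latEmb S b' := by
    rw [e, multiRefl, hb', map_sub, map_sum]
    congr 1
    refine Finset.sum_congr rfl fun x _ => ?_
    rw [map_zsmul, latEmb_vert, M.coxeterGraph.bil_symm]
    change M.canonicalForm x _ • _ = _
    rw [canonicalForm_latEmb P.simplyLaced, Int.cast_smul_eq_zsmul]
  have hroot' : latEmb S b' ∈ M.canonicalRootBasis.roots := by
    rw [← hub]
    exact rep_mem_roots ((latRoot_iff P.simplyLaced _).mpr ⟨b, hb, rfl⟩) u
  have hlat : M.coxeterGraph.LatRoot b' := by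
    obtain ⟨c, hc, e⟩ := (latRoot_iff P.simplyLaced _).mp hroot'
    rwa [latEmb_injective e]
  have hheight : (b'.sum fun _ n => n) < b.sum fun _ n => n := by
    have hadd : ∀ c d : S →₀ ℤ, ((c - d).sum fun _ n => n) = (c.sum fun _ n => n) -
        d.sum fun _ n => n := fun c d => Finsupp.sum_sub_index fun _ _ _ => rfl
    rw [hb', hadd, ← Finsupp.sum_finsetSum_index (fun _ => rfl) fun _ _ _ => rfl]
    have : ∑ x ∈ P.orbit s, ((M.coxeterGraph.bil b (vert x) • vert x).sum fun _ n => n) =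
        ∑ x ∈ P.orbit s, M.coxeterGraph.bil b (vert x) :=
      Finset.sum_congr rfl fun x _ => by simp [vert]
    omega
  rcases M.canonical_isReducedRootBasis.nonneg_or_nonpos hroot' with h | h
  · have hpos' : ∀ s, 0 ≤ b' s := fun s => by
      have := h s
      rw [latEmb_apply] at this
      exact_mod_cast this
    have hnn : 0 ≤ b'.sum fun _ n => n := Finset.sum_nonneg fun x _ => hpos' x
    obtain ⟨w, hw, t, e'⟩ := ih _ (by omega) hlat hpos' rfl
    refine ⟨u⁻¹ * w, mul_mem (inv_mem hu) hw, t, ?_⟩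
    rw [rep_mul_apply, ← e', ← hub, rep_inv_rep]
  · have hsupp : b.support ⊆ P.orbit s := by
      intro x hx
      by_contra hxs
      have h1 : b' x = b x := by
        rw [hb', Finsupp.sub_apply, Finsupp.finsetSum_apply, Finset.sum_eq_zero, sub_zero]
        intro y hy
        rw [Finsupp.smul_apply, vert_apply_ne (fun e : x = y => hxs (by rw [e]; exact hy)), smul_zero]
      have h2 := h x
      rw [latEmb_apply, h1] at h2
      have h3 : b x ≤ 0 := by exact_mod_cast h2
      exact Finsupp.mem_support_iff.mp hx (le_antisymm h3 (hpos x))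
    obtain ⟨t, rfl⟩ := IsSemidefinitePair.eq_vert_of_supported hb.bil_self hpos
      (fun x hx y hy => P.not_adj_of_mem_orbit hx hy) hsupp
    exact ⟨1, one_mem _, t, by rw [latEmb_vert, rep_one_apply]⟩

theorem exists_rep {β : S →₀ ℝ} (hβ : β ∈ M.canonicalRootBasis.posRoots) :
    ∃ w ∈ M.hatGroup G ⊓ M.fixedSubgroup G, ∃ s,
      β = M.canonicalRootBasis.rep w (Finsupp.single s 1) := by
  obtain ⟨hβ, hpos⟩ := hβ
  obtain ⟨b, hb, rfl⟩ := (latRoot_iff P.simplyLaced _).mp hβ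
  refine P.exists_rep_of_latRoot hb fun s => ?_
  have := hpos s
  rw [latEmb_apply] at this
  exact_mod_cast this

end IsSemidefinite

end CoxeterMatrix

end

noncomputable section

/-! ### The basis of orbit sums -/

open RootPrebasis

namespace CoxeterMatrix

variable {S : Type*} {M : CoxeterMatrix S} {G : Subgroup M.symmetryGroup}

theorem hatSimple_apply {X : Set S} (hX : X.Finite) (y : S) [Decidable (y ∈ X)] :
    hatSimple X y = if y ∈ X then 1 else 0 := by
  rw [hatSimple, finsum_single_apply hX]

theorem permOnV_hatSimple {s : S} (hs : (MulAction.orbit G s).Finite) {g : M.symmetryGroup}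
    (hg : g ∈ G) : permOnV (g : Equiv.Perm S) (hatSimple (MulAction.orbit G s)) =
      hatSimple (MulAction.orbit G s) := by
  classical
  ext y
  obtain ⟨z, rfl⟩ := g.1.surjective y
  rw [permOnV_apply, hatSimple_apply hs, hatSimple_apply hs]
  have : g.1 z ∈ MulAction.orbit G s ↔ z ∈ MulAction.orbit G s := by
    rw [← MulAction.orbit_eq_iff, ← MulAction.orbit_eq_iff]
    change MulAction.orbit G ((⟨g, hg⟩ : G) • z) = _ ↔ _
    rw [MulAction.orbit_smul]
  simp only [this]

theorem simpleSet_orbit (s : S) :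
    simpleSet (MulAction.orbit G s) = vecOrbit G (Finsupp.single s 1) := by
  ext v
  constructor
  · rintro ⟨_, ⟨g, rfl⟩, rfl⟩
    exact ⟨g.1, g.2, by rw [permOnV_single]; rfl⟩
  · rintro ⟨g, hg, rfl⟩
    exact ⟨_, ⟨⟨g, hg⟩, rfl⟩, by rw [permOnV_single]; rfl⟩

theorem image_vecOrbit {B : RootPrebasis M} (hB : B.IsSymmetric G) {w : M.Group}
    (hw : w ∈ M.fixedSubgroup G) (v : S →₀ ℝ) :
    B.rep w '' vecOrbit G v = vecOrbit G (B.rep w v) := by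
  ext u
  constructor
  · rintro ⟨_, ⟨g, hg, rfl⟩, rfl⟩
    exact ⟨g, hg, hB.rep_fixed hg hw v⟩
  · rintro ⟨g, hg, rfl⟩
    exact ⟨_, ⟨g, hg, rfl⟩, hB.rep_fixed hg hw v⟩

/-- `α̂_X` is the sum of the vectors of `ω_X`, and `w` maps it to the sum of those of `w(ω_X)`. -/
theorem rep_hatSimple_apply {B : RootPrebasis M} {X : Set S} (hX : X.Finite) (w : M.Group) (y : S) :
    B.rep w (hatSimple X) y = ∑ x ∈ hX.toFinset, B.rep w (Finsupp.single x 1) y := by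
  rw [hatSimple, finsum_mem_eq_finite_toFinset_sum _ hX, map_sum, Finsupp.finsetSum_apply]

theorem vecOrbit_eq_of_mem {u v : S →₀ ℝ} (h : u ∈ vecOrbit G v) : vecOrbit G u = vecOrbit G v := by
  obtain ⟨g, hg, rfl⟩ := h
  ext x
  constructor
  · rintro ⟨k, hk, rfl⟩
    rw [perm_mem_vecOrbit_iff hk, perm_mem_vecOrbit_iff hg]
    exact mem_vecOrbit_self G v
  · rintro ⟨k, hk, rfl⟩
    rw [perm_mem_vecOrbit_iff hk]
    exact ⟨g⁻¹, inv_mem hg, by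
      rw [← permOnV_mul, Subgroup.coe_inv, inv_mul_cancel, permOnV_one]⟩

namespace IsSemidefinite

variable (P : M.IsSemidefinite G)
include P

/-- The invariant vectors with nonnegative coefficients are nonnegative combinations of the
`α̂_X`. -/
theorem exists_sum_hatSimple (v : S →₀ ℝ) (hpos : ∀ s, 0 ≤ v s)
    (hinv : ∀ g ∈ G, ∀ s, v ((g : Equiv.Perm S) s) = v s) :
    ∃ c : M.sphericalOrbits G →₀ ℝ, (∀ X, 0 ≤ c X) ∧
      v = c.sum fun X r => r • hatSimple (X : Set S) := by
  classical
  induction hn : v.support.card using Nat.strong_induction_on generalizing v with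
  | _ n ih =>
  by_cases h0 : v = 0
  · exact ⟨0, fun _ => le_rfl, by simp [h0]⟩
  obtain ⟨y, hy⟩ := Finsupp.support_nonempty_iff.mpr h0
  have hsph : MulAction.orbit G y ∈ M.sphericalOrbits G := by
    rw [← P.coe_orbit]; exact P.orbit_mem_sphericalOrbits y
  set v' : S →₀ ℝ := v - v y • hatSimple (MulAction.orbit G y) with hv'
  have hval : ∀ s, v' s = if s ∈ MulAction.orbit G y then 0 else v s := by
    intro s
    rw [hv', Finsupp.sub_apply, Finsupp.smul_apply, hatSimple_apply (P.finite y)]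
    split_ifs with h
    · obtain ⟨g, rfl⟩ := h
      have : v (g • y) = v y := hinv g.1 g.2 y
      simp [this]
    · simp
  have hlt : v'.support.card < n := by
    rw [← hn]
    refine Finset.card_lt_card ⟨fun s hs => ?_, fun h => ?_⟩
    · rw [Finsupp.mem_support_iff, hval] at hs
      rw [Finsupp.mem_support_iff]
      split_ifs at hs with h
      · exact (hs rfl).elim
      · exact hs
    · have := h hy
      rw [Finsupp.mem_support_iff, hval, if_pos (MulAction.mem_orbit_self y)] at this
      exact this rfl
  obtain ⟨c, hc, e⟩ := ih _ hlt v' (fun s => by rw [hval]; split_ifs; exacts [le_rfl, hpos s])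
    (fun g hg s => by
      rw [hv', Finsupp.sub_apply, Finsupp.sub_apply, hinv g hg, Finsupp.smul_apply,
        Finsupp.smul_apply]
      conv_lhs => rw [← permOnV_hatSimple (P.finite y) hg]
      rw [permOnV_apply]) rfl
  refine ⟨c + Finsupp.single ⟨_, hsph⟩ (v y), fun X => ?_, ?_⟩
  · rw [Finsupp.add_apply, Finsupp.single_apply]
    have := hpos y
    have := hc X
    split_ifs <;> linarith
  · rw [Finsupp.sum_add_index (by simp) (by intros; rw [add_smul]), ← e,
      Finsupp.sum_single_index (by simp), hv']
    abel

/-- The elements of `ℬ̂` are the sums over the orbits of the positive roots. -/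
theorem mem_hatFamily_iff (K : Type*) [Field K] (x : (S →₀ ℝ) →₀ K) :
    x ∈ M.canonicalRootBasis.hatFamily G K ↔ ∃ β ∈ M.canonicalRootBasis.posRoots,
      x = ∑ᶠ α ∈ vecOrbit G β, Finsupp.single α 1 := by
  classical
  have hsym := M.canonical_isSymmetric G
  constructor
  · rintro ⟨v, ⟨-, c, hc, hv⟩, ω, ⟨w, hw, X, ⟨⟨s, rfl⟩, hX⟩, hvw, rfl⟩, rfl⟩
    refine ⟨M.canonicalRootBasis.rep w (Finsupp.single s 1), ⟨⟨w, s, rfl⟩, ?_⟩, by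
      rw [simpleSet_orbit, image_vecOrbit hsym hw]⟩
    refine (M.canonical_isReducedRootBasis.nonneg_or_nonpos ⟨w, s, rfl⟩).resolve_right fun hneg => ?_
    have hv0 : ∀ y, 0 ≤ v y := by
      intro y
      rw [hv, Finsupp.sum, Finsupp.finsetSum_apply]
      refine Finset.sum_nonneg fun X _ => ?_
      rw [Finsupp.smul_apply, hatSimple_apply X.2.2.1]
      have := hc X
      split_ifs <;> simp [this]
    have hterm : ∀ x ∈ hX.1.toFinset, ∀ y,
        M.canonicalRootBasis.rep w (Finsupp.single x 1) y ≤ 0 := by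
      intro x hx y
      rw [Set.Finite.mem_toFinset] at hx
      obtain ⟨g, rfl⟩ := hx
      obtain ⟨z, rfl⟩ := g.1.1.surjective y
      have := hsym.rep_fixed g.2 hw (Finsupp.single s 1)
      rw [permOnV_single] at this
      change M.canonicalRootBasis.rep w (Finsupp.single (g.1.1 s) 1) _ ≤ 0
      rw [this, permOnV_apply]
      exact hneg z
    refine ne_zero_of_mem_roots (B := M.canonicalRootBasis) ⟨w, s, rfl⟩ ?_
    ext y
    have h1 := hv0 y
    rw [hvw, rep_hatSimple_apply hX.1] at h1
    have h2 := (Finset.sum_eq_zero_iff_of_nonpos fun x hx => hterm x hx y).mp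
      (le_antisymm (Finset.sum_nonpos fun x hx => hterm x hx y) h1)
    exact h2 s (by simp)
  · rintro ⟨β, hβ, rfl⟩
    obtain ⟨w, ⟨hw, hw'⟩, s, e⟩ := P.exists_rep hβ
    have hsph : MulAction.orbit G s ∈ M.sphericalOrbits G := by
      rw [← P.coe_orbit]; exact P.orbit_mem_sphericalOrbits s
    refine ⟨M.canonicalRootBasis.rep w (hatSimple (MulAction.orbit G s)),
      ⟨⟨w, hw, _, hsph, rfl⟩, P.exists_sum_hatSimple _ (fun y => ?_) fun g hg y => ?_⟩,
      vecOrbit G β, ⟨w, hw', _, hsph, rfl, ?_⟩, rfl⟩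
    · rw [rep_hatSimple_apply (P.finite s)]
      refine Finset.sum_nonneg fun x hx => ?_
      rw [Set.Finite.mem_toFinset] at hx
      obtain ⟨g, rfl⟩ := hx
      have := hsym.rep_fixed g.2 hw' (Finsupp.single s 1)
      rw [permOnV_single, ← e] at this
      change 0 ≤ M.canonicalRootBasis.rep w (Finsupp.single (g.1.1 s) 1) _
      rw [this]
      exact (permOnV_mem_posRoots hsym g.2 hβ).2 y
    · conv_lhs => rw [← permOnV_hatSimple (P.finite s) hg, hsym.rep_fixed hg hw', permOnV_apply]
    · rw [simpleSet_orbit, image_vecOrbit hsym hw', e]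

theorem hasBasisProperty (K : Type*) [Field K] : M.canonicalRootBasis.HasBasisProperty G K := by
  classical
  have hsym := M.canonical_isSymmetric G
  have happ : ∀ β γ : S →₀ ℝ, (∑ᶠ α ∈ vecOrbit G β, Finsupp.single α (1 : K)) γ =
      if γ ∈ vecOrbit G β then 1 else 0 :=
    fun β γ => finsum_single_apply (vecOrbit_finite P.finite β) γ
  constructor
  · rw [LinearIndepOn, linearIndependent_iff']
    intro T c hc i hi
    obtain ⟨β, -, hβ⟩ := (P.mem_hatFamily_iff K _).mp i.2
    have h := DFunLike.congr_fun hc β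
    rw [Finsupp.finsetSum_apply, Finset.sum_eq_single_of_mem i hi, Finsupp.smul_apply] at h
    · change c i * i.1 β = 0 at h
      rwa [hβ, happ, if_pos (mem_vecOrbit_self G β), mul_one] at h
    · intro j _ hji
      obtain ⟨γ, -, hγ⟩ := (P.mem_hatFamily_iff K _).mp j.2
      change c j * j.1 β = 0
      rw [hγ, happ, if_neg, mul_zero]
      intro hmem
      refine hji (Subtype.ext ?_)
      rw [hγ, hβ, vecOrbit_eq_of_mem hmem]
  · refine le_antisymm (Submodule.span_le.mpr fun x hx => ?_) fun x hx => ?_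
    · obtain ⟨β, hβ, rfl⟩ := (P.mem_hatFamily_iff K _).mp hx
      exact orbitSum_mem_EG hsym P.finite K hβ
    · induction hn : x.support.card using Nat.strong_induction_on generalizing x with
      | _ n ih =>
      by_cases h0 : x = 0
      · rw [h0]; exact zero_mem _
      obtain ⟨β, hβ⟩ := Finsupp.support_nonempty_iff.mpr h0
      have hx' := mem_EG_iff.mp hx
      have hβpos : β ∈ M.canonicalRootBasis.posRoots := hx'.1 β (Finsupp.mem_support_iff.mp hβ)
      set b : (S →₀ ℝ) →₀ K := ∑ᶠ α ∈ vecOrbit G β, Finsupp.single α 1 with hb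
      have hval : ∀ γ, (x - x β • b) γ = if γ ∈ vecOrbit G β then 0 else x γ := by
        intro γ
        rw [Finsupp.sub_apply, Finsupp.smul_apply, hb, happ]
        split_ifs with h
        · obtain ⟨g, hg, rfl⟩ := h
          rw [hx'.2 g hg]
          simp
        · simp
      have hlt : (x - x β • b).support.card < n := by
        rw [← hn]
        refine Finset.card_lt_card ⟨fun s hs => ?_, fun h => ?_⟩
        · rw [Finsupp.mem_support_iff, hval] at hs
          rw [Finsupp.mem_support_iff]
          split_ifs at hs with h
          · exact (hs rfl).elim
          · exact hs
        · have := h hβ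
          rw [Finsupp.mem_support_iff, hval, if_pos (mem_vecOrbit_self G β)] at this
          exact this rfl
      have hmem := ih _ hlt _ (Submodule.sub_mem _ hx
        (Submodule.smul_mem _ _ (orbitSum_mem_EG hsym P.finite K hβpos))) rfl
      have hbmem : b ∈ Submodule.span K (M.canonicalRootBasis.hatFamily G K) :=
        Submodule.subset_span ((P.mem_hatFamily_iff K _).mpr ⟨β, hβpos, rfl⟩)
      rw [← sub_add_cancel x (x β • b)]
      exact add_mem hmem (Submodule.smul_mem _ _ hbmem)

end IsSemidefinite

end CoxeterMatrix

namespace CoxeterPairs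

variable {S : Type*} {M : CoxeterMatrix S} {G : Subgroup M.symmetryGroup}

theorem _root_.CoxeterMatrix.IsoPair.isSimplyLaced_and_pairIso {I : Type*} {A : SimpleGraph I}
    {H : Subgroup (Equiv.Perm I)} (h : M.IsoPair G A H) :
    M.IsSimplyLaced ∧ PairIso M.coxeterGraph (G.map M.symmetryGroup.subtype) A H := by
  classical
  obtain ⟨e, he, hH⟩ := h
  have hval : ∀ s t, M s t = if e s = e t then 1 else if A.Adj (e s) (e t) then 3 else 2 := by
    intro s t
    rw [← he]
    change Matrix.of _ _ _ = _
    rw [Matrix.of_apply]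
  have hadj : ∀ s t, M.coxeterGraph.Adj s t ↔ A.Adj (e s) (e t) := by
    intro s t
    constructor
    · rintro ⟨hne, h2⟩
      by_contra hA
      exact h2 (by rw [hval, if_neg (e.injective.ne hne), if_neg hA])
    · intro hA
      refine ⟨fun h => A.irrefl (h ▸ hA), ?_⟩
      rw [hval, if_neg hA.ne, if_pos hA]
      norm_num
  refine ⟨fun s t hst => ?_, e, fun s t => (hadj s t).symm, hH⟩
  have hA := (hadj s t).mp hst
  rw [hval, if_neg hA.ne, if_pos hA]

theorem IsListed.isSimplyLaced_and_listedPair (h : IsListed M G) :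
    M.IsSimplyLaced ∧ ListedPair M.coxeterGraph (G.map M.symmetryGroup.subtype) := by
  rcases h with ⟨m, hm, h⟩ | ⟨m, hm, h⟩ | ⟨H, h1, h2, h⟩ | h | ⟨m, hm, h⟩ | ⟨m, hm, h⟩ |
    ⟨H, h1, h2, h⟩ | h | h | h <;> refine h.isSimplyLaced_and_pairIso.imp_right fun h => ?_
  · exact Or.inl ⟨m, hm, h⟩
  · exact Or.inr (Or.inl ⟨m, hm, h⟩)
  · exact Or.inr (Or.inr (Or.inl ⟨H, h1, h2, h⟩))
  · exact Or.inr (Or.inr (Or.inr (Or.inl h)))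
  · exact Or.inr (Or.inr (Or.inr (Or.inr (Or.inl ⟨m, hm, h⟩))))
  · exact Or.inr (Or.inr (Or.inr (Or.inr (Or.inr (Or.inl ⟨m, hm, h⟩)))))
  · exact Or.inr (Or.inr (Or.inr (Or.inr (Or.inr (Or.inr (Or.inl ⟨H, h1, h2, h⟩))))))
  · exact Or.inr (Or.inr (Or.inr (Or.inr (Or.inr (Or.inr (Or.inr (Or.inl h)))))))
  · exact Or.inr (Or.inr (Or.inr (Or.inr (Or.inr (Or.inr (Or.inr (Or.inr (Or.inl h))))))))
  · exact Or.inr (Or.inr (Or.inr (Or.inr (Or.inr (Or.inr (Or.inr (Or.inr (Or.inr h))))))))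

end CoxeterPairs

theorem RootPrebasis.hasBasisProperty_iff_isListed {S : Type*} {M : CoxeterMatrix S}
    {G : Subgroup M.symmetryGroup} (hconn : M.coxeterGraph.Connected) (hG : G ≠ ⊥)
    (hfin : ∀ s : S, (MulAction.orbit G s).Finite) (K : Type*) [Field K] {B : RootPrebasis M}
    (hB : B.IsReducedRootBasis) (hsym : B.IsSymmetric G) :
    B.HasBasisProperty G K ↔ CoxeterPairs.IsListed M G := by
  constructor
  · intro h
    have hO := (h.rootsFromFixed hsym hfin).orthogonalOrbits hB hsym
    have hM := hO.isSimplyLaced hB hsym hconn hG hfin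
    obtain rfl := eq_canonical_of_isSimplyLaced hB hM
    obtain ⟨g, hg, hg1⟩ := G.bot_or_exists_ne_one.resolve_left hG
    exact ((hO.isOrthogonalPair hM hconn).listedPair ⟨g, ⟨g, hg, rfl⟩,
      fun e => hg1 (Subtype.ext e)⟩).isListed hM
  · intro h
    obtain ⟨hM, hL⟩ := h.isSimplyLaced_and_listedPair
    obtain rfl := eq_canonical_of_isSimplyLaced hB hM
    exact CoxeterMatrix.IsSemidefinite.hasBasisProperty
      ⟨hM, hL.isSemidefinitePair hconn, hfin⟩ K

end

theorem theorem2p12 {S : Type*} (M : CoxeterMatrix S) (G : Subgroup M.symmetryGroup)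
    (hconn : M.coxeterGraph.Connected) (hG : G ≠ ⊥)
    (hfin : ∀ s : S, (MulAction.orbit G s).Finite)
    (K : Type*) [Field K] :
    (M.canonicalRootBasis.HasBasisProperty G K ↔ CoxeterPairs.IsListed M G) ∧
    ∀ B : RootPrebasis M, B.IsReducedRootBasis → B.IsSymmetric G →
      (B.HasBasisProperty G K ↔ CoxeterPairs.IsListed M G) :=
  ⟨RootPrebasis.hasBasisProperty_iff_isListed hconn hG hfin K M.canonical_isReducedRootBasis
    (M.canonical_isSymmetric G),
    fun _ hB hsym => RootPrebasis.hasBasisProperty_iff_isListed hconn hG hfin K hB hsym⟩
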